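/- **Setting.** Write $\langle\xi\rangle=(1+|\xi|^2)^{1/2}$, $\widehat f$ for the Fourier transform on $\mathbb R$ in the angular frequency $\xi$ (so $\partial_x$ has symbol $i\xi$), and $\|f\|_{H^\sigma}=\|\langle\partial_x\rangle^\sigma f\|_{L^2(\mathbb R)}$, where $\langle\partial_x\rangle^\sigma$ is the Fourier multiplier with symbol $\langle\xi\rangle^\sigma$. Let $p\in[0,\infty)$ and let $K=\mathcal F^{-1}[k(\xi)\mathcal F]$ be a Fourier multiplier whose (measurable) symbol $k:\mathbb R\to\mathbb C$ satisfies, for some constant $M$ and all $\xi,\eta\in\mathbb R$, $$\Re k(\xi)\le 0,\qquad k(-\xi)=\overline{k(\xi)},\qquad |k(\xi)|\le M\langle\xi\rangle^p,$$ $$|(\xi+\eta)k(\xi+\eta)-\eta k(\eta)-\xi k(\xi)|\le M\big(|\xi|\langle\eta\rangle^p+|\eta|\langle\xi\rangle^p\big).$$ For $\Delta t>0$ put $t_r=r\Delta t$, let $N$ be the largest integer with $N\Delta t\le T$, and let $$\Sigma_1=\bigcup_{l=1}^N\Big((t_{l-1},t_{l-1/2}]\times\{t_{l-1}\}\ \cup\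 (t_{l-1/2},t_l]\times[t_{l-1/2},t_l]\Big),$$ $$\Sigma_2=\bigcup_{l=1}^N\Big([t_{l-1},t_{l-1/2}]\times(t_{l-1},t_{l-1/2}]\ \cup\ \{t_{l-1/2}\}\times(t_{l-1/2},t_l]\Big),$$ and $\Pi=\{(0,0)\}\cup\Sigma_1\cup\Sigma_2$. **Theorem 1.3.** Let $T>0$, $s>\tfrac32+3\max\{1,p\}$ and $C_0>0$. There exist $\overline{\Delta t}>0$ and $C>0$, depending only on $C_0,s,p,T$ and the constant $M$, such that the following holds. Let $u\in C([0,T]:H^s(\mathbb R))$ be a real-valued solution of $$\partial_t u+uu_x-Ku=0\ \text{ on }[0,T],\qquad u(0)=u_0,$$ with $\sup_{t\in[0,T]}\|u(t)\|_{H^s}\le C_0$. Then for every $\Delta t\in(0,\overline{\Delta t}]$ there exists a unique real-valued $v\in C(\Pi:H^s(\mathbb R))$, $v=v(t,\tau)$, solving the Strang splitting problem $$\partial_t v+vv_x=0\ \text{ for }(t,\tau)\in\Sigma_1,\qquad \partial_\tau v-Kv=0\ \text{ for }(t,\tau)\in\Sigma_2,\qquad v(0,0)=u_0,$$ and $$\sup_{t\in[0,N\Delta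 t]}\|v(t,t)-u(t)\|_{H^{s-3\max\{1,p\}}}\le C(\Delta t)^2 .$$ The same statement (existence, uniqueness and error bound) holds with the two substeps exchanged, that is, for the problem $$\partial_t v-Kv=0\ \text{ for }(t,\tau)\in\Sigma_1,\qquad \partial_\tau v+vv_x=0\ \text{ for }(t,\tau)\in\Sigma_2,\qquad v(0,0)=u_0 .$$ Time derivatives are taken in $L^2(\mathbb R)$, at end points within the domain. -/

import Mathlib

noncomputable section

open MeasureTheory FourierTransform Set

namespace Splitting

/-- `L²(ℝ)`, with complex values. -/
abbrev L2 : Type := Lp ℂ 2 (volume : Measure ℝ)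

/-- `f` is `ℝ`-valued (almost everywhere). -/
def IsRealValued (f : L2) : Prop := ∀ᵐ x, (f x).im = 0

/-- The Japanese bracket `⟨ξ⟩ = (1 + |ξ|²)^{1/2}`. -/
def bracket (ξ : ℝ) : ℝ := Real.sqrt (1 + |ξ| ^ 2)

theorem bracket_pos (ξ : ℝ) : 0 < bracket ξ := Real.sqrt_pos.2 (by positivity)

/-- The function `ξ ↦ ⟨2πξ⟩^σ (𝓕 f)(ξ)`. Here `𝓕` is Mathlib's Fourier transform, with kernel
`e^{-2πixξ}`, so that the angular frequency (the variable dual to `-i∂ₓ`) is `2πξ`. -/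
def weightedFourier (σ : ℝ) (f : L2) (ξ : ℝ) : ℂ :=
  ((bracket (2 * Real.pi * ξ) ^ σ : ℝ) : ℂ) * (𝓕 f : L2) ξ

theorem weightedFourier_add (σ : ℝ) (f g : L2) :
    weightedFourier σ (f + g) =ᵐ[volume] weightedFourier σ f + weightedFourier σ g := by
  have h : (𝓕 (f + g) : L2) = 𝓕 f + 𝓕 g := FourierAdd.fourier_add f g
  filter_upwards [Lp.coeFn_add (𝓕 f : L2) (𝓕 g : L2)] with ξ hξ
  simp only [weightedFourier, Pi.add_apply, h, hξ, mul_add]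

theorem weightedFourier_smul (σ : ℝ) (c : ℂ) (f : L2) :
    weightedFourier σ (c • f) =ᵐ[volume] c • weightedFourier σ f := by
  have h : (𝓕 (c • f) : L2) = c • 𝓕 f := FourierSMul.fourier_smul c f
  filter_upwards [Lp.coeFn_smul c (𝓕 f : L2)] with ξ hξ
  simp only [weightedFourier, Pi.smul_apply, h, hξ, smul_eq_mul]
  ring

/-- The functions `f ∈ L²(ℝ)` with `⟨ξ⟩^σ f̂ ∈ L²(ℝ)`. For `σ ≥ 0`, the only case used, this is
the set of all elements of `H^σ(ℝ)`. -/
def sobolevSubmodule (σ : ℝ) : Submodule ℂ L2 where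
  carrier := {f | MemLp (weightedFourier σ f) 2 volume}
  add_mem' {f g} hf hg := (memLp_congr_ae (weightedFourier_add σ f g)).2 (hf.add hg)
  zero_mem' := by
    have h := weightedFourier_smul σ 0 0
    rw [zero_smul, zero_smul] at h
    exact (memLp_congr_ae h).2 MemLp.zero
  smul_mem' c f hf := (memLp_congr_ae (weightedFourier_smul σ c f)).2 (hf.const_smul c)

/-- The Sobolev space `H^σ(ℝ)`, `σ ≥ 0`. -/
def Sobolev (σ : ℝ) : Type := sobolevSubmodule σ

namespace Sobolev

variable {σ : ℝ}

instance : AddCommGroup (Sobolev σ) := inferInstanceAs (AddCommGroup (sobolevSubmodule σ))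

/-- An element of `H^σ(ℝ)` as a function in `L²(ℝ)`. -/
def toL2 (f : Sobolev σ) : L2 := f.1

/-- `f ↦ ⟨2πξ⟩^σ 𝓕 f`, as a map from `H^σ(ℝ)` to `L²(ℝ)`. -/
def toWeighted : Sobolev σ →+ L2 :=
  let J : sobolevSubmodule σ →+ L2 :=
    AddMonoidHom.mk' (fun f => MemLp.toLp (weightedFourier σ f.1) f.2) fun f g =>
      (MemLp.toLp_congr (f + g).2 (f.2.add g.2) (weightedFourier_add σ f.1 g.1)).trans
        (MemLp.toLp_add f.2 g.2)
  J

theorem toWeighted_injective : Function.Injective (toWeighted (σ := σ)) := by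
  rw [injective_iff_map_eq_zero]
  intro f hf
  have h0 : weightedFourier σ f.1 =ᵐ[volume] 0 := by
    have h : (MemLp.toLp (weightedFourier σ f.1) f.2 : L2) = 0 := hf
    exact (MemLp.coeFn_toLp f.2).symm.trans ((Lp.eq_zero_iff_ae_eq_zero).1 h)
  have h1 : (𝓕 f.1 : L2) = 0 := by
    rw [Lp.eq_zero_iff_ae_eq_zero]
    filter_upwards [h0] with ξ hξ
    have hw : ((bracket (2 * Real.pi * ξ) ^ σ : ℝ) : ℂ) ≠ 0 :=
      Complex.ofReal_ne_zero.2 (Real.rpow_pos_of_pos (bracket_pos _) σ).ne'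
    exact (mul_eq_zero.1 hξ).resolve_left hw
  have h2 : ‖f.1‖ = 0 := by rw [← Lp.norm_fourier_eq, h1, norm_zero]
  exact Subtype.ext (norm_eq_zero.1 h2)

/-- The norm of `H^σ(ℝ)` is `‖f‖_{H^σ} = ‖⟨2πξ⟩^σ 𝓕 f‖_{L²} = ‖⟨∂ₓ⟩^σ f‖_{L²}`. -/
instance : NormedAddCommGroup (Sobolev σ) :=
  NormedAddCommGroup.induced (Sobolev σ) L2 toWeighted toWeighted_injective

theorem norm_eq (f : Sobolev σ) : ‖f‖ = (eLpNorm (weightedFourier σ f.toL2) 2 volume).toReal :=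
  Lp.norm_toLp _ f.2

end Sobolev

/-- `g` is the image of `f` under the Fourier multiplier with symbol `m`, where `m` is a function
of the angular frequency; that is, `ĝ(ξ) = m(ξ) f̂(ξ)`. -/
def IsFourierMultiplier (m : ℝ → ℂ) (f g : L2) : Prop :=
  ∀ᵐ ξ, (𝓕 g : L2) ξ = m (2 * Real.pi * ξ) * (𝓕 f : L2) ξ

/-- `g = Kf`, where `K` is the Fourier multiplier with symbol `k`. -/
def dispersion (k : ℝ → ℂ) (f g : L2) : Prop := IsFourierMultiplier k f g

/-- `g = -f fₓ`, where the derivative `fₓ ∈ L²(ℝ)` is the Fourier multiplier with symbol `iξ`. -/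
def burgers (f g : L2) : Prop :=
  ∃ fx : L2, IsFourierMultiplier (fun ξ => Complex.I * ξ) f fx ∧ ∀ᵐ x, g x = -(f x * fx x)

/-- `g = Kf - f fₓ`. -/
def fullOperator (k : ℝ → ℂ) (f g : L2) : Prop :=
  ∃ a b : L2, dispersion k f a ∧ burgers f b ∧ g = a + b

/-- The equation `y'(t) = A(y(t))` holds at the time `t`, for a curve `y` given on the set `S` of
times; the derivative is taken in `L²(ℝ)` and along `S` (so it is one-sided at the end points of
an interval). The relation `A f g` stands for `g = A(f)`. -/
def EvolvesAt (A : L2 → L2 → Prop) (y : ℝ → L2) (S : Set ℝ) (t : ℝ) : Prop :=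
  ∃ g : L2, A (y t) g ∧ HasDerivWithinAt y g S t

/-- The standing assumptions on the symbol `k`, with `M` the constant in the inequalities. -/
structure IsAdmissibleSymbol (p M : ℝ) (k : ℝ → ℂ) : Prop where
  measurable : Measurable k
  re_nonpos : ∀ ξ, (k ξ).re ≤ 0
  neg : ∀ ξ, k (-ξ) = (starRingEnd ℂ) (k ξ)
  growth : ∀ ξ, ‖k ξ‖ ≤ M * bracket ξ ^ p
  commutator : ∀ ξ η : ℝ, ‖((ξ + η : ℝ) : ℂ) * k (ξ + η) - (η : ℂ) * k η - (ξ : ℂ) * k ξ‖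
    ≤ M * (|ξ| * bracket η ^ p + |η| * bracket ξ ^ p)

/-- `u ∈ C([0,T] : H^s(ℝ))` is a real-valued solution of `∂ₜu + u uₓ - Ku = 0` on `[0,T]` with
`u(0) = u₀`. -/
structure IsSolution (k : ℝ → ℂ) (s T : ℝ) (u₀ : Sobolev s) (u : ℝ → Sobolev s) : Prop where
  continuousOn : ContinuousOn u (Icc 0 T)
  real : ∀ t ∈ Icc 0 T, IsRealValued (u t).toL2
  init : u 0 = u₀
  eqn : ∀ t ∈ Icc 0 T, EvolvesAt (fullOperator k) (fun r => (u r).toL2) (Icc 0 T) t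

/-- `Σ_{S,1}^{(n)}`: the union over `1 ≤ l ≤ n` of `(t_{l-1}, t_{l-1/2}] × {t_{l-1}}` and
`(t_{l-1/2}, t_l] × [t_{l-1/2}, t_l]`, where `t_r = rΔt`. -/
def strangSigma₁ (Δt : ℝ) (n : ℕ) : Set (ℝ × ℝ) :=
  ⋃ l ∈ Icc 1 n,
    (Ioc (((l : ℝ) - 1) * Δt) (((l : ℝ) - 1 / 2) * Δt) ×ˢ {((l : ℝ) - 1) * Δt}) ∪
    (Ioc (((l : ℝ) - 1 / 2) * Δt) ((l : ℝ) * Δt) ×ˢ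
      Icc (((l : ℝ) - 1 / 2) * Δt) ((l : ℝ) * Δt))

/-- `Σ_{S,2}^{(n)}`: the union over `1 ≤ l ≤ n` of `[t_{l-1}, t_{l-1/2}] × (t_{l-1}, t_{l-1/2}]`
and `{t_{l-1/2}} × (t_{l-1/2}, t_l]`, where `t_r = rΔt`. -/
def strangSigma₂ (Δt : ℝ) (n : ℕ) : Set (ℝ × ℝ) :=
  ⋃ l ∈ Icc 1 n,
    (Icc (((l : ℝ) - 1) * Δt) (((l : ℝ) - 1 / 2) * Δt) ×ˢ
      Ioc (((l : ℝ) - 1) * Δt) (((l : ℝ) - 1 / 2) * Δt)) ∪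
    ({((l : ℝ) - 1 / 2) * Δt} ×ˢ Ioc (((l : ℝ) - 1 / 2) * Δt) ((l : ℝ) * Δt))

/-- `Π_S^{(n)} = Σ_{S,1}^{(n)} ∪ Σ_{S,2}^{(n)}`, together with the initial point `(0,0)`. -/
def strangPi (Δt : ℝ) (n : ℕ) : Set (ℝ × ℝ) :=
  insert (0, 0) (strangSigma₁ Δt n ∪ strangSigma₂ Δt n)

/-- `v ∈ C(Π_S^{(n)} : H^s(ℝ))` is a real-valued solution of `∂ₜv = A(v)` on `Σ_{S,1}^{(n)}`,
`∂_τ v = B(v)` on `Σ_{S,2}^{(n)}`, `v(0,0) = u₀`. -/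
structure IsStrangSolution (A B : L2 → L2 → Prop) (s Δt : ℝ) (n : ℕ) (u₀ : Sobolev s)
    (v : ℝ × ℝ → Sobolev s) : Prop where
  continuousOn : ContinuousOn v (strangPi Δt n)
  real : ∀ q ∈ strangPi Δt n, IsRealValued (v q).toL2
  init : v (0, 0) = u₀
  eqn₁ : ∀ t τ : ℝ, (t, τ) ∈ strangSigma₁ Δt n →
    EvolvesAt A (fun r => (v (r, τ)).toL2) {r | (r, τ) ∈ strangPi Δt n} t
  eqn₂ : ∀ t τ : ℝ, (t, τ) ∈ strangSigma₂ Δt n →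
    EvolvesAt B (fun r => (v (t, r)).toL2) {r | (t, r) ∈ strangPi Δt n} τ

/-- For `T, Δt > 0`, the largest integer `N` with `N Δt ≤ T`. -/
def numSteps (Δt T : ℝ) : ℕ := ⌊T / Δt⌋₊

theorem isGreatest_numSteps {Δt T : ℝ} (hΔt : 0 < Δt) (hT : 0 < T) :
    IsGreatest {n : ℕ | (n : ℝ) * Δt ≤ T} (numSteps Δt T) := by
  refine ⟨?_, fun n hn => ?_⟩
  · exact (le_div_iff₀ hΔt).1 (Nat.floor_le (by positivity))
  · exact Nat.le_floor ((le_div_iff₀ hΔt).2 hn)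

end Splitting

end

/-! Put m = max(1, p), s = r + 3m and h = Δt/2, so that r > 3/2 and errors are measured in H^r. A
half step runs the Burgers flow Φ and the semigroup e^{tK} for time h each, and consecutive half
steps use opposite orders. Let C(w,w) be the commutator of K with the Burgers nonlinearity. The
curve e^{tK}Φ_t(w) solves the full equation up to a forcing t C(w,w) + O(t²), so its error is (t²/2)
C(w,w) + O(t³) (`norm_semi_flow_sub_le`). Exchanging the two flows changes the result by t² C(w,w) +
O(t³) (`norm_semi_flow_sub_flow_semi_le`), so the other order has error -(t²/2) C(w,w) + O(t³).
During one half step the solution moves by O(h) in H^{r+2m}, so over two half steps the leading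
terms cancel and leave O(h³) (`norm_second_step_le`). Adding these errors over the O(1/h) steps
gives O(h²).

The hypothesis on (ξ+η)k(ξ+η) - ηk(η) - ξk(ξ) is what bounds C: its kernel costs m derivatives on
each factor (`norm_commutator_le`), so C maps H^s to H^{r+m}, with room for one further application
of K.

All comparisons rest on one energy estimate in H^r (`stability`) for the difference of two curves
minus an explicit corrector, which here is the expected leading error. Dispersion contributes
nothing positive because Re k ≤ 0. The transport term is integrated by parts on the Fourier side
(`re_inner_transport_le`).

The constants close by a bootstrap (`exists_scheme_error`). The lifespan of the Burgers flow and the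
growth rate of its H^s norm depend only on the H^r norm. The H^r norm stays below C₀ + 1 because the
H^r error is at most 1 for small h, so the H^s norm stays below e^{cT}C₀.

The Burgers flow is constructed by Galerkin approximation (`exists_burgersCurve`). Energy estimates
with the weights ⟨ξ⟩^{σ+1}/(R+⟨ξ⟩), uniform in R, show that high-frequency tails grow at most
exponentially. Small tails together with convergence in H^r give convergence in H^s, and the same
argument gives continuity of the flow in its datum.

Throughout, an element f of H^σ is represented by the L² function ⟨2πξ⟩^σ f̂, a change of Sobolev
index is multiplication by a power of ⟨2πξ⟩ (`lower`), and bilinear maps are twisted convolutions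
with explicit kernels (`bil`). A kernel dominated by ⟨x⟩^{-a} + ⟨y⟩^{-a} with a > 1/2 is bounded on
L² (`Adm.norm_bil_le`). The last sections translate the equations and the domain Π to this setting.
-/

noncomputable section

open MeasureTheory FourierTransform Set

namespace Splitting

/-! ### The angular bracket -/

/-- The Japanese bracket of the angular frequency `2πξ`. -/
def jap (ξ : ℝ) : ℝ := bracket (2 * Real.pi * ξ)

theorem jap_eq (ξ : ℝ) : jap ξ = Real.sqrt (1 + (2 * Real.pi * ξ) ^ 2) := by
  rw [jap, bracket, sq_abs]

theorem jap_sq (ξ : ℝ) : jap ξ ^ 2 = 1 + (2 * Real.pi * ξ) ^ 2 := by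
  rw [jap_eq, Real.sq_sqrt (by positivity)]

theorem jap_pos (ξ : ℝ) : 0 < jap ξ := bracket_pos _

theorem one_le_jap (ξ : ℝ) : 1 ≤ jap ξ := by
  rw [jap_eq]; exact Real.one_le_sqrt.2 (by nlinarith [sq_nonneg (2 * Real.pi * ξ)])

theorem jap_neg (ξ : ℝ) : jap (-ξ) = jap ξ := by simp [jap_eq]

theorem abs_le_jap (ξ : ℝ) : |2 * Real.pi * ξ| ≤ jap ξ :=
  abs_le_of_sq_le_sq (by rw [jap_sq]; linarith) (jap_pos ξ).le

/-- After squaring, the claim becomes 1 + ab ≤ ⟨a⟩⟨b⟩ for a = 2πξ and b = 2πη, which is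
Cauchy–Schwarz. -/
theorem abs_jap_sub_le (ξ η : ℝ) : |jap ξ - jap η| ≤ |2 * Real.pi * (ξ - η)| := by
  have h1 := jap_sq ξ
  have h2 := jap_sq η
  have p1 := jap_pos ξ
  have p2 := jap_pos η
  apply abs_le_abs_of_sq_le_sq
  have : (1 + (2 * Real.pi * ξ) * (2 * Real.pi * η)) ≤ jap ξ * jap η := by
    apply le_of_sq_le_sq _ (by positivity)
    rw [mul_pow, h1, h2]
    nlinarith [sq_nonneg (2 * Real.pi * ξ - 2 * Real.pi * η)]
  nlinarith
where
  abs_le_abs_of_sq_le_sq {a b : ℝ} (h : a ^ 2 ≤ b ^ 2) : |a| ≤ |b| := sq_le_sq.1 h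
  le_of_sq_le_sq {a b : ℝ} (h : a ^ 2 ≤ b ^ 2) (hb : 0 ≤ b) : a ≤ b := le_of_abs_le (by
    have := sq_le_sq.1 h; rwa [abs_of_nonneg hb] at this)

theorem jap_add_le (x y : ℝ) : jap (x + y) ≤ jap x + jap y := by
  have h := abs_jap_sub_le (x + y) y
  rw [add_sub_cancel_right] at h
  linarith [le_abs_self (jap (x + y) - jap y), abs_le_jap x]

theorem abs_jap_add_sub_le (x y : ℝ) : |jap (x + y) - jap y| ≤ |2 * Real.pi * x| := by
  simpa using abs_jap_sub_le (x + y) y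

theorem continuous_jap : Continuous jap := by
  have : jap = fun ξ => Real.sqrt (1 + (2 * Real.pi * ξ) ^ 2) := funext jap_eq
  rw [this]; fun_prop

@[fun_prop]
theorem measurable_jap : Measurable jap := continuous_jap.measurable

theorem jap_rpow_pos (ξ σ : ℝ) : 0 < jap ξ ^ σ := Real.rpow_pos_of_pos (jap_pos ξ) σ

theorem jap_rpow_le_one {σ : ℝ} (hσ : σ ≤ 0) (ξ : ℝ) : jap ξ ^ σ ≤ 1 :=
  Real.rpow_le_one_of_one_le_of_nonpos (one_le_jap ξ) hσ

theorem jap_rpow_mono {σ τ : ℝ} (h : σ ≤ τ) (ξ : ℝ) : jap ξ ^ σ ≤ jap ξ ^ τ :=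
  Real.rpow_le_rpow_of_exponent_le (one_le_jap ξ) h

theorem integrable_jap_rpow {a : ℝ} (ha : 1 / 2 < a) : Integrable fun ξ => (jap ξ ^ (-a)) ^ 2 := by
  have h := (integrable_rpow_neg_one_add_norm_sq (E := ℝ) (μ := volume) (r := 2 * a)
    (by simp; linarith)).comp_mul_left' (R := 2 * Real.pi) (by positivity)
  refine h.congr (Filter.Eventually.of_forall fun ξ => ?_)
  simp only [Real.norm_eq_abs, sq_abs]
  rw [jap_eq, Real.sqrt_eq_rpow, ← Real.rpow_mul (by positivity), ← Real.rpow_mul_natCast (by positivity)]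
  congr 1; push_cast; ring

/-- The `L²` norm of `⟨2πξ⟩^{-a}`. -/
def japNorm (a : ℝ) : ℝ := Real.sqrt (∫ ξ, (jap ξ ^ (-a)) ^ 2)

theorem japNorm_nonneg (a : ℝ) : 0 ≤ japNorm a := Real.sqrt_nonneg _

theorem lintegral_jap {a : ℝ} (ha : 1 / 2 < a) :
    ∫⁻ ξ, ENNReal.ofReal (jap ξ ^ (-a)) ^ 2 = ENNReal.ofReal (japNorm a) ^ 2 := by
  rw [← ENNReal.ofReal_pow (japNorm_nonneg a), japNorm, Real.sq_sqrt
    (integral_nonneg fun _ => by positivity),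
    ofReal_integral_eq_lintegral_ofReal (integrable_jap_rpow ha)
      (Filter.Eventually.of_forall fun _ => by positivity)]
  refine lintegral_congr fun ξ => ?_
  rw [ENNReal.ofReal_pow (jap_rpow_pos ξ _).le]

/-! ### Squares of norms in `L²` -/

theorem eLpNorm_two_sq (f : ℝ → ℂ) : eLpNorm f 2 volume ^ 2 = ∫⁻ x, ‖f x‖ₑ ^ 2 := by
  have h := eLpNorm_nnreal_pow_eq_lintegral (f := f) (μ := volume) (p := 2) (by norm_num)
  simpa using h

theorem lintegral_enorm_sq (F : L2) : ∫⁻ x, ‖F x‖ₑ ^ 2 = ENNReal.ofReal ‖F‖ ^ 2 := by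
  rw [← eLpNorm_two_sq, Lp.norm_def, ENNReal.ofReal_toReal (Lp.eLpNorm_ne_top F)]

/-! ### Multiplication operators -/

/-- The symbol `m` is measurable and bounded by `C`. -/
structure BddSymbol (m : ℝ → ℂ) (C : ℝ) : Prop where
  meas : Measurable m
  bound : ∀ ξ, ‖m ξ‖ ≤ C

namespace BddSymbol
variable {m m' : ℝ → ℂ} {C C' : ℝ}

theorem nonneg (h : BddSymbol m C) : 0 ≤ C := (norm_nonneg _).trans (h.bound 0)

theorem mono (h : BddSymbol m C) (hC : C ≤ C') : BddSymbol m C' :=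
  ⟨h.meas, fun ξ => (h.bound ξ).trans hC⟩

theorem memLp (h : BddSymbol m C) (F : L2) : MemLp (fun ξ => m ξ * F ξ) 2 volume := by
  refine MemLp.of_le_mul (c := C) (Lp.memLp F)
    (h.meas.aestronglyMeasurable.mul (Lp.aestronglyMeasurable F)) ?_
  filter_upwards with ξ
  rw [norm_mul]
  exact mul_le_mul_of_nonneg_right (h.bound ξ) (norm_nonneg _)

theorem mul (h : BddSymbol m C) (h' : BddSymbol m' C') :
    BddSymbol (fun ξ => m ξ * m' ξ) (C * C') :=
  ⟨h.meas.mul h'.meas, fun ξ => by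
    rw [norm_mul]; exact mul_le_mul (h.bound ξ) (h'.bound ξ) (norm_nonneg _) h.nonneg⟩

end BddSymbol

open Classical in
/-- Multiplication by `m`, for bounded `m`, as an operator on `L²(ℝ)`. -/
def mulOp (m : ℝ → ℂ) : L2 →L[ℂ] L2 :=
  if h : ∃ C, BddSymbol m C then
    LinearMap.mkContinuous
      { toFun := fun F => (h.choose_spec.memLp F).toLp
        map_add' := fun F G => by
          rw [← MemLp.toLp_add]
          refine MemLp.toLp_congr _ _ ?_
          filter_upwards [Lp.coeFn_add F G] with ξ hξ
          simp only [hξ, Pi.add_apply, mul_add]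
        map_smul' := fun c F => by
          rw [RingHom.id_apply, ← MemLp.toLp_const_smul]
          refine MemLp.toLp_congr _ _ ?_
          filter_upwards [Lp.coeFn_smul c F] with ξ hξ
          simp only [hξ, Pi.smul_apply, smul_eq_mul]; ring } h.choose
      (fun F => by
        refine Lp.norm_le_mul_norm_of_ae_le_mul ?_
        filter_upwards [MemLp.coeFn_toLp (h.choose_spec.memLp F)] with ξ hξ
        simp only [LinearMap.coe_mk, AddHom.coe_mk, hξ, norm_mul]
        exact mul_le_mul_of_nonneg_right (h.choose_spec.bound ξ) (norm_nonneg _))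
  -- The default value makes the operator total in the symbol, so that later formulas need no
  -- boundedness proof inside their terms.
  else 0

section mulOp
variable {m m' : ℝ → ℂ} {C C' : ℝ}

theorem coeFn_mulOp (h : BddSymbol m C) (F : L2) : mulOp m F =ᵐ[volume] fun ξ => m ξ * F ξ := by
  have h' : ∃ C, BddSymbol m C := ⟨C, h⟩
  rw [mulOp, dif_pos h']
  exact MemLp.coeFn_toLp (h'.choose_spec.memLp F)

theorem eq_mulOp (h : BddSymbol m C) {F G : L2} (hG : ∀ᵐ ξ, G ξ = m ξ * F ξ) : G = mulOp m F :=
  Lp.ext (Filter.EventuallyEq.trans hG (coeFn_mulOp h F).symm)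

theorem norm_mulOp_le (h : BddSymbol m C) (F : L2) : ‖mulOp m F‖ ≤ C * ‖F‖ := by
  refine Lp.norm_le_mul_norm_of_ae_le_mul ?_
  filter_upwards [coeFn_mulOp h F] with ξ hξ
  rw [hξ, norm_mul]
  exact mul_le_mul_of_nonneg_right (h.bound ξ) (norm_nonneg _)

theorem norm_mulOp_le_norm_mulOp (h : BddSymbol m C) (h' : BddSymbol m' C') {c : ℝ}
    (hc : ∀ ξ, ‖m ξ‖ ≤ c * ‖m' ξ‖) (F : L2) : ‖mulOp m F‖ ≤ c * ‖mulOp m' F‖ := by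
  refine Lp.norm_le_mul_norm_of_ae_le_mul ?_
  filter_upwards [coeFn_mulOp h F, coeFn_mulOp h' F] with ξ hξ hξ'
  rw [hξ, hξ', norm_mul, norm_mul, ← mul_assoc]
  exact mul_le_mul_of_nonneg_right (hc ξ) (norm_nonneg _)

theorem mulOp_mulOp (h : BddSymbol m C) (h' : BddSymbol m' C') (F : L2) :
    mulOp m (mulOp m' F) = mulOp (fun ξ => m ξ * m' ξ) F := by
  refine eq_mulOp (h.mul h') ?_
  filter_upwards [coeFn_mulOp h (mulOp m' F), coeFn_mulOp h' F] with ξ h1 h2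
  rw [h1, h2, mul_assoc]

theorem mulOp_comm (h : BddSymbol m C) (h' : BddSymbol m' C') (F : L2) :
    mulOp m (mulOp m' F) = mulOp m' (mulOp m F) := by
  rw [mulOp_mulOp h h', mulOp_mulOp h' h]; simp only [mul_comm]

theorem bddSymbol_one : BddSymbol (fun _ => 1) 1 := ⟨measurable_const, fun _ => by simp⟩

theorem mulOp_one (F : L2) : mulOp (fun _ => 1) F = F :=
  (eq_mulOp bddSymbol_one (Filter.Eventually.of_forall fun _ => by simp)).symm

theorem mulOp_injective (h : BddSymbol m C) (h0 : ∀ ξ, m ξ ≠ 0) :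
    Function.Injective (mulOp m) := by
  rw [injective_iff_map_eq_zero]
  intro F hF
  rw [Lp.eq_zero_iff_ae_eq_zero]
  have h1 := (Lp.eq_zero_iff_ae_eq_zero).1 hF
  filter_upwards [h1, coeFn_mulOp h F] with ξ h2 h3
  rw [h3] at h2
  exact (mul_eq_zero.1 h2).resolve_left (h0 ξ)

/-- Dominated convergence for multiplication operators. -/
theorem tendsto_mulOp {ι : Type*} {l : Filter ι} [l.IsCountablyGenerated] {m : ι → ℝ → ℂ}
    {m₀ : ℝ → ℂ} (h : ∀ᶠ i in l, BddSymbol (m i) C) (h₀ : BddSymbol m₀ C)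
    (hlim : ∀ ξ, Filter.Tendsto (fun i => m i ξ) l (nhds (m₀ ξ))) (F : L2) :
    Filter.Tendsto (fun i => mulOp (m i) F) l (nhds (mulOp m₀ F)) := by
  rw [tendsto_iff_norm_sub_tendsto_zero]
  have key : Filter.Tendsto (fun i => ∫⁻ ξ, ‖(m i ξ - m₀ ξ) * F ξ‖ₑ ^ 2) l (nhds 0) := by
    have h0 : ∫⁻ ξ, ‖(m₀ ξ - m₀ ξ) * F ξ‖ₑ ^ 2 = 0 := by simp
    rw [← h0]
    refine tendsto_lintegral_filter_of_dominated_convergence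
      (fun ξ => ENNReal.ofReal (2 * C) ^ 2 * ‖F ξ‖ₑ ^ 2) ?_ ?_ ?_ ?_
    · filter_upwards [h] with i hi
      exact (((hi.meas.sub h₀.meas).mul (Lp.stronglyMeasurable F).measurable).enorm.pow_const 2)
    · filter_upwards [h] with i hi
      filter_upwards with ξ
      rw [enorm_mul, mul_pow]
      gcongr
      rw [← ofReal_norm]
      apply ENNReal.ofReal_le_ofReal
      calc ‖m i ξ - m₀ ξ‖ ≤ ‖m i ξ‖ + ‖m₀ ξ‖ := norm_sub_le _ _
        _ ≤ 2 * C := by linarith [hi.bound ξ, h₀.bound ξ]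
    · rw [lintegral_const_mul _ ((Lp.stronglyMeasurable F).measurable.enorm.pow_const 2),
        lintegral_enorm_sq]
      exact ENNReal.mul_ne_top (by finiteness) (by simp)
    · filter_upwards with ξ
      have h1 : Filter.Tendsto (fun i => (m i ξ - m₀ ξ) * F ξ) l (nhds ((m₀ ξ - m₀ ξ) * F ξ)) :=
        ((hlim ξ).sub_const _).mul_const _
      exact ((ENNReal.continuous_pow 2).tendsto _).comp h1.enorm
  have hsq : Filter.Tendsto (fun i => ENNReal.ofReal ‖mulOp (m i) F - mulOp m₀ F‖ ^ 2) l
      (nhds 0) := by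
    refine key.congr' ?_
    filter_upwards [h] with i hi
    rw [← lintegral_enorm_sq]
    refine lintegral_congr_ae ?_
    filter_upwards [Lp.coeFn_sub (mulOp (m i) F) (mulOp m₀ F), coeFn_mulOp hi F,
      coeFn_mulOp h₀ F] with ξ h1 h2 h3
    rw [h1, Pi.sub_apply, h2, h3, sub_mul]
  have h2 : Filter.Tendsto (fun i => ‖mulOp (m i) F - mulOp m₀ F‖ ^ 2) l (nhds 0) := by
    have := (ENNReal.tendsto_toReal (a := 0) (by simp)).comp hsq
    refine (this.congr fun i => ?_)
    simp
  have h3 := (Real.continuous_sqrt.tendsto 0).comp h2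
  simpa [Function.comp_def, Real.sqrt_sq] using h3

end mulOp

/-- A real symbol, as a complex one. -/
abbrev ofRealSymbol (w : ℝ → ℝ) : ℝ → ℂ := fun ξ => ((w ξ : ℝ) : ℂ)

theorem bddSymbol_ofReal {w : ℝ → ℝ} {C : ℝ} (hm : Measurable w) (h : ∀ ξ, |w ξ| ≤ C) :
    BddSymbol (ofRealSymbol w) C :=
  ⟨Complex.measurable_ofReal.comp hm, fun ξ => by simpa using h ξ⟩

/-- `Λ a` is multiplication by `⟨2πξ⟩^{-a}`: it takes the description of a function as an element
of `H^{σ+a}` to its description as an element of `H^σ`. -/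
def lower (a : ℝ) : L2 →L[ℂ] L2 := mulOp (ofRealSymbol fun ξ => jap ξ ^ (-a))

theorem bddSymbol_lower {a : ℝ} (ha : 0 ≤ a) :
    BddSymbol (ofRealSymbol fun ξ => jap ξ ^ (-a)) 1 :=
  bddSymbol_ofReal (by fun_prop) fun ξ => by
    rw [abs_of_pos (jap_rpow_pos _ _)]; exact jap_rpow_le_one (by linarith) ξ

theorem norm_lower_le {a : ℝ} (ha : 0 ≤ a) (F : L2) : ‖lower a F‖ ≤ ‖F‖ :=
  (norm_mulOp_le (bddSymbol_lower ha) F).trans_eq (one_mul _)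

theorem lower_lower {a b : ℝ} (ha : 0 ≤ a) (hb : 0 ≤ b) (F : L2) :
    lower a (lower b F) = lower (a + b) F := by
  rw [lower, lower, mulOp_mulOp (bddSymbol_lower ha) (bddSymbol_lower hb), lower]
  congr 2
  funext ξ
  simp only [ofRealSymbol]
  rw [← Complex.ofReal_mul, ← Real.rpow_add (jap_pos ξ)]
  ring_nf

theorem lower_injective {a : ℝ} (ha : 0 ≤ a) : Function.Injective (lower a) :=
  mulOp_injective (bddSymbol_lower ha) fun ξ => by
    simpa using (jap_rpow_pos ξ (-a)).ne'

/-! ### Young's inequality -/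

open scoped ENNReal in
theorem sq_lintegral_mul_le {f g : ℝ → ℝ≥0∞} (hf : Measurable f) (hg : Measurable g) :
    (∫⁻ x, f x * g x) ^ 2 ≤ (∫⁻ x, f x ^ 2) * ∫⁻ x, g x ^ 2 := by
  have h := ENNReal.lintegral_mul_le_Lp_mul_Lq volume Real.HolderConjugate.two_two
    hf.aemeasurable hg.aemeasurable
  calc (∫⁻ x, f x * g x) ^ 2
      ≤ ((∫⁻ a, f a ^ (2 : ℝ)) ^ (1 / 2 : ℝ) * (∫⁻ a, g a ^ (2 : ℝ)) ^ (1 / 2 : ℝ)) ^ 2 := by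
        gcongr; exact h
    _ = _ := by
      rw [mul_pow, ← ENNReal.rpow_mul_natCast, ← ENNReal.rpow_mul_natCast]
      norm_num

-- Cauchy–Schwarz applied to φ^{1/2} · (φ^{1/2} ψ), followed by Tonelli and translation invariance.
open scoped ENNReal in
theorem lintegral_young {φ ψ : ℝ → ℝ≥0∞} (hφ : Measurable φ) (hψ : Measurable ψ) :
    ∫⁻ ξ, (∫⁻ η, φ (ξ - η) * ψ η) ^ 2 ≤ (∫⁻ ξ, φ ξ) ^ 2 * ∫⁻ ξ, ψ ξ ^ 2 := by
  have hle : ∀ ξ, (∫⁻ η, φ (ξ - η) * ψ η) ^ 2 ≤ (∫⁻ x, φ x) * ∫⁻ η, φ (ξ - η) * ψ η ^ 2 := by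
    intro ξ
    have h := sq_lintegral_mul_le (f := fun η => φ (ξ - η) ^ (1 / 2 : ℝ))
      (g := fun η => φ (ξ - η) ^ (1 / 2 : ℝ) * ψ η) (by fun_prop) (by fun_prop)
    have e : ∀ t : ℝ≥0∞, (t ^ (1 / 2 : ℝ)) ^ 2 = t := fun t => by
      rw [← ENNReal.rpow_mul_natCast]; norm_num
    simp only [mul_pow, e, ← mul_assoc, ← sq] at h
    rwa [lintegral_sub_left_eq_self (fun x => φ x) ξ] at h
  calc ∫⁻ ξ, (∫⁻ η, φ (ξ - η) * ψ η) ^ 2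
      ≤ ∫⁻ ξ, (∫⁻ x, φ x) * ∫⁻ η, φ (ξ - η) * ψ η ^ 2 := lintegral_mono hle
    _ = (∫⁻ x, φ x) * ∫⁻ ξ, ∫⁻ η, φ (ξ - η) * ψ η ^ 2 := by
        refine lintegral_const_mul _ (Measurable.lintegral_prod_right ?_)
        fun_prop
    _ = (∫⁻ x, φ x) * ∫⁻ η, ∫⁻ ξ, φ (ξ - η) * ψ η ^ 2 := by
        rw [lintegral_lintegral_swap]
        exact Measurable.aemeasurable (by fun_prop)
    _ = (∫⁻ x, φ x) * ∫⁻ η, (∫⁻ ξ, φ ξ) * ψ η ^ 2 := by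
        congr 1
        refine lintegral_congr fun η => ?_
        rw [lintegral_mul_const _ (by fun_prop), lintegral_sub_right_eq_self (fun x => φ x) η]
    _ = _ := by
        rw [lintegral_const_mul _ (by fun_prop), ← mul_assoc, sq]

/-! ### Bilinear operators given by kernels on the Fourier side -/

/-- The kernel `κ` is measurable and `‖κ x y‖ ≤ C (⟨x⟩^{-a} + ⟨y⟩^{-a})`. -/
structure Adm (a : ℝ) (κ : ℝ → ℝ → ℂ) (C : ℝ) : Prop where
  meas : Measurable (Function.uncurry κ)
  bound : ∀ x y, ‖κ x y‖ ≤ C * (jap x ^ (-a) + jap y ^ (-a))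

/-- The twisted convolution of `f` and `g`, with kernel `κ`. -/
def bilInt (κ : ℝ → ℝ → ℂ) (f g : ℝ → ℂ) (ξ : ℝ) : ℂ := ∫ η, κ (ξ - η) η * (f (ξ - η) * g η)

open Classical in
/-- The twisted convolution, on `L²(ℝ)`. -/
def bil (κ : ℝ → ℝ → ℂ) (F G : L2) : L2 :=
  if h : MemLp (bilInt κ F G) 2 volume then h.toLp else 0

/-- The constant in the bound for `bil`. -/
def bilConst (a : ℝ) : ℝ := 2 * japNorm a

theorem bilConst_nonneg (a : ℝ) : 0 ≤ bilConst a := by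
  have := japNorm_nonneg a; unfold bilConst; positivity

theorem measurable_L2 (F : L2) : Measurable F := (Lp.stronglyMeasurable F).measurable

theorem real_smul_eq (c : ℝ) (F : L2) : c • F = (c : ℂ) • F := by
  refine Lp.ext ?_
  filter_upwards [Lp.coeFn_smul c F, Lp.coeFn_smul (c : ℂ) F] with ξ h1 h2
  rw [h1, h2]
  simp

theorem bilInt_congr (κ : ℝ → ℝ → ℂ) {f f' g g' : ℝ → ℂ} (hf : f =ᵐ[volume] f')
    (hg : g =ᵐ[volume] g') : bilInt κ f g = bilInt κ f' g' := by
  funext ξ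
  refine integral_congr_ae ?_
  have h1 := (quasiMeasurePreserving_sub_left volume ξ).ae hf
  filter_upwards [h1, hg] with η h2 h3
  rw [h2, h3]

/-- Needs no admissibility, since both sides take the default value together. This lets kernels be
rewritten freely in `bil_swap` and `bil_mulOp`. -/
theorem bil_congr {κ κ' : ℝ → ℝ → ℂ} {F G F' G' : L2} (h : bilInt κ F G = bilInt κ' F' G') :
    bil κ F G = bil κ' F' G' := by
  unfold bil
  generalize bilInt κ F G = A at h ⊢
  subst h
  rfl

theorem bilInt_swap (κ : ℝ → ℝ → ℂ) (f g : ℝ → ℂ) :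
    bilInt κ f g = bilInt (fun x y => κ y x) g f := by
  funext ξ
  unfold bilInt
  rw [← integral_sub_left_eq_self _ volume ξ]
  refine integral_congr_ae (Filter.Eventually.of_forall fun η => ?_)
  simp [mul_comm]

theorem bil_swap (κ : ℝ → ℝ → ℂ) (F G : L2) : bil κ F G = bil (fun x y => κ y x) G F :=
  bil_congr (bilInt_swap κ F G)

theorem bil_mulOp (κ : ℝ → ℝ → ℂ) {m m' : ℝ → ℂ} {C C' : ℝ} (h : BddSymbol m C)
    (h' : BddSymbol m' C') (F G : L2) :
    bil κ (mulOp m F) (mulOp m' G) = bil (fun x y => κ x y * (m x * m' y)) F G := by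
  refine bil_congr ?_
  rw [bilInt_congr κ (coeFn_mulOp h F) (coeFn_mulOp h' G)]
  funext ξ
  refine integral_congr_ae (Filter.Eventually.of_forall fun η => ?_)
  simp only; ring

theorem bil_mulOp_left (κ : ℝ → ℝ → ℂ) {m : ℝ → ℂ} {C : ℝ} (h : BddSymbol m C) (F G : L2) :
    bil κ (mulOp m F) G = bil (fun x y => κ x y * m x) F G := by
  have := bil_mulOp κ h bddSymbol_one F G
  simpa [mulOp_one] using this

theorem bil_mulOp_right (κ : ℝ → ℝ → ℂ) {m : ℝ → ℂ} {C : ℝ} (h : BddSymbol m C) (F G : L2) :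
    bil κ F (mulOp m G) = bil (fun x y => κ x y * m y) F G := by
  have := bil_mulOp κ bddSymbol_one h F G
  simpa [mulOp_one] using this

namespace Adm
variable {a C C' : ℝ} {κ κ' : ℝ → ℝ → ℂ}

theorem nonneg (h : Adm a κ C) : 0 ≤ C := by
  have h1 := (norm_nonneg _).trans (h.bound 0 0)
  have := jap_rpow_pos 0 (-a)
  exact nonneg_of_mul_nonneg_left h1 (by positivity)

theorem add (h : Adm a κ C) (h' : Adm a κ' C') : Adm a (fun x y => κ x y + κ' x y) (C + C') :=
  ⟨h.meas.add h'.meas, fun x y => by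
    rw [add_mul]; exact (norm_add_le _ _).trans (add_le_add (h.bound x y) (h'.bound x y))⟩

theorem neg (h : Adm a κ C) : Adm a (fun x y => -κ x y) C :=
  ⟨h.meas.neg, fun x y => by rw [norm_neg]; exact h.bound x y⟩

theorem sub (h : Adm a κ C) (h' : Adm a κ' C') : Adm a (fun x y => κ x y - κ' x y) (C + C') := by
  simpa [sub_eq_add_neg] using h.add h'.neg

theorem of_le (h : Adm a κ C) (hm : Measurable (Function.uncurry κ'))
    (hle : ∀ x y, ‖κ' x y‖ ≤ C' * ‖κ x y‖) (hC' : 0 ≤ C') : Adm a κ' (C' * C) :=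
  ⟨hm, fun x y => (hle x y).trans (by
    rw [mul_assoc]; exact mul_le_mul_of_nonneg_left (h.bound x y) hC')⟩

theorem measurable_comp (h : Adm a κ C) : Measurable fun p : ℝ × ℝ => κ (p.1 - p.2) p.2 :=
  h.meas.comp (f := fun p : ℝ × ℝ => (p.1 - p.2, p.2)) (by fun_prop)

theorem measurable_integrand (h : Adm a κ C) (F G : L2) :
    Measurable fun p : ℝ × ℝ => κ (p.1 - p.2) p.2 * (F (p.1 - p.2) * G p.2) := by
  have h1 := h.measurable_comp
  have h2 := (measurable_L2 F).comp (g := F) (f := fun p : ℝ × ℝ => p.1 - p.2) (by fun_prop)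
  have h3 := (measurable_L2 G).comp (g := G) (f := fun p : ℝ × ℝ => p.2) (by fun_prop)
  exact h1.mul (h2.mul h3)

-- The two terms of the kernel bound give two convolutions, with the weight ⟨·⟩^{-a} attached to F
-- or to G. The weight lies in L² because a > 1/2, so the weighted factor lies in L¹ by
-- Cauchy–Schwarz, and Young's inequality L¹ ∗ L² ⊂ L² applies. The factor 2 in `bilConst` comes
-- from (s+t)² ≤ 2(s²+t²) and the presence of two terms.
open scoped ENNReal in
theorem lintegral_sq_le (h : Adm a κ C) (ha : 1 / 2 < a) (F G : L2) :
    ∫⁻ ξ, (∫⁻ η, ‖κ (ξ - η) η * (F (ξ - η) * G η)‖ₑ) ^ 2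
      ≤ ENNReal.ofReal (C * bilConst a * ‖F‖ * ‖G‖) ^ 2 := by
  have mF := (measurable_L2 F).enorm
  have mG := (measurable_L2 G).enorm
  set w : ℝ → ℝ≥0∞ := fun x => ENNReal.ofReal (jap x ^ (-a)) with hw
  have mw : Measurable w := by fun_prop
  have hC := h.nonneg
  have hpt : ∀ ξ, (∫⁻ η, ‖κ (ξ - η) η * (F (ξ - η) * G η)‖ₑ) ≤ ENNReal.ofReal C *
      ((∫⁻ η, (w (ξ - η) * ‖F (ξ - η)‖ₑ) * ‖G η‖ₑ) +
        ∫⁻ η, ‖F (ξ - η)‖ₑ * (w η * ‖G η‖ₑ)) := by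
    intro ξ
    rw [← lintegral_add_left (by fun_prop), ← lintegral_const_mul _ (by fun_prop)]
    refine lintegral_mono fun η => ?_
    rw [enorm_mul, enorm_mul]
    have : ‖κ (ξ - η) η‖ₑ ≤ ENNReal.ofReal C * (w (ξ - η) + w η) := by
      rw [hw]; simp only
      rw [← ENNReal.ofReal_add (jap_rpow_pos _ _).le (jap_rpow_pos _ _).le,
        ← ENNReal.ofReal_mul hC, ← ofReal_norm]
      exact ENNReal.ofReal_le_ofReal (h.bound _ _)
    calc _ ≤ ENNReal.ofReal C * (w (ξ - η) + w η) * (‖F (ξ - η)‖ₑ * ‖G η‖ₑ) := by gcongr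
      _ = _ := by ring
  have hL1 : ∀ H : L2, (∫⁻ x, w x * ‖H x‖ₑ) ^ 2
      ≤ ENNReal.ofReal (japNorm a) ^ 2 * ENNReal.ofReal ‖H‖ ^ 2 := fun H => by
    refine (sq_lintegral_mul_le mw (measurable_L2 H).enorm).trans_eq ?_
    rw [lintegral_enorm_sq, lintegral_jap ha]
  have hY1 : ∫⁻ ξ, (∫⁻ η, (w (ξ - η) * ‖F (ξ - η)‖ₑ) * ‖G η‖ₑ) ^ 2
      ≤ ENNReal.ofReal (japNorm a) ^ 2 * ENNReal.ofReal ‖F‖ ^ 2 * ENNReal.ofReal ‖G‖ ^ 2 := by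
    refine (lintegral_young (φ := fun x => w x * ‖F x‖ₑ) (by fun_prop) mG).trans ?_
    rw [lintegral_enorm_sq]
    gcongr
    exact hL1 F
  have hY2 : ∫⁻ ξ, (∫⁻ η, ‖F (ξ - η)‖ₑ * (w η * ‖G η‖ₑ)) ^ 2
      ≤ ENNReal.ofReal (japNorm a) ^ 2 * ENNReal.ofReal ‖F‖ ^ 2 * ENNReal.ofReal ‖G‖ ^ 2 := by
    have : ∀ ξ, ∫⁻ η, ‖F (ξ - η)‖ₑ * (w η * ‖G η‖ₑ)
        = ∫⁻ η, (w (ξ - η) * ‖G (ξ - η)‖ₑ) * ‖F η‖ₑ := fun ξ => by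
      rw [← lintegral_sub_left_eq_self _ ξ]
      simp [mul_comm]
    simp only [this]
    refine (lintegral_young (φ := fun x => w x * ‖G x‖ₑ) (by fun_prop) mF).trans ?_
    rw [lintegral_enorm_sq, mul_right_comm]
    gcongr
    exact hL1 G
  have two : ∀ s t : ℝ≥0∞, (s + t) ^ 2 ≤ 2 * (s ^ 2 + t ^ 2) := fun s t => by
    have := ENNReal.rpow_add_le_mul_rpow_add_rpow s t (p := 2) (by norm_num)
    norm_num at this
    exact_mod_cast this
  calc _ ≤ ∫⁻ ξ, ENNReal.ofReal C ^ 2 * (2 *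
        ((∫⁻ η, (w (ξ - η) * ‖F (ξ - η)‖ₑ) * ‖G η‖ₑ) ^ 2 +
        (∫⁻ η, ‖F (ξ - η)‖ₑ * (w η * ‖G η‖ₑ)) ^ 2)) := by
        refine lintegral_mono fun ξ => ?_
        calc _ ≤ _ := pow_le_pow_left' (hpt ξ) 2
          _ ≤ _ := by rw [mul_pow]; gcongr; exact two _ _
    _ = ENNReal.ofReal C ^ 2 * (2 *
        ((∫⁻ ξ, (∫⁻ η, (w (ξ - η) * ‖F (ξ - η)‖ₑ) * ‖G η‖ₑ) ^ 2) +
        ∫⁻ ξ, (∫⁻ η, ‖F (ξ - η)‖ₑ * (w η * ‖G η‖ₑ)) ^ 2)) := by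
        rw [← lintegral_add_left, lintegral_const_mul, lintegral_const_mul]
        all_goals fun_prop
    _ ≤ ENNReal.ofReal C ^ 2 * (2 * (
        ENNReal.ofReal (japNorm a) ^ 2 * ENNReal.ofReal ‖F‖ ^ 2 * ENNReal.ofReal ‖G‖ ^ 2 +
        ENNReal.ofReal (japNorm a) ^ 2 * ENNReal.ofReal ‖F‖ ^ 2 * ENNReal.ofReal ‖G‖ ^ 2)) := by
        gcongr
    _ = _ := by
      have := japNorm_nonneg a
      rw [bilConst, ENNReal.ofReal_mul (by positivity), ENNReal.ofReal_mul (by positivity),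
        ENNReal.ofReal_mul (by positivity), ENNReal.ofReal_mul (by positivity)]
      norm_num
      ring

theorem integrable (h : Adm a κ C) (ha : 1 / 2 < a) (F G : L2) :
    ∀ᵐ ξ, Integrable fun η => κ (ξ - η) η * (F (ξ - η) * G η) := by
  have h1 := h.lintegral_sq_le ha F G
  have hm := h.measurable_integrand F G
  have h2 := ae_lt_top (Measurable.pow_const (hm.enorm.lintegral_prod_right') 2)
    (h1.trans_lt (by finiteness)).ne
  filter_upwards [h2] with ξ hξ
  refine ⟨(hm.comp (f := fun η => (ξ, η)) (by fun_prop)).aestronglyMeasurable, ?_⟩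
  by_contra hc
  simp only [HasFiniteIntegral, not_lt, top_le_iff] at hc
  refine hξ.ne ?_
  exact ENNReal.pow_eq_top_iff.2 ⟨hc, two_ne_zero⟩

theorem eLpNorm_bilInt_le (h : Adm a κ C) (ha : 1 / 2 < a) (F G : L2) :
    eLpNorm (bilInt κ F G) 2 volume ≤ ENNReal.ofReal (C * bilConst a * ‖F‖ * ‖G‖) := by
  have h1 : eLpNorm (bilInt κ F G) 2 volume ^ 2
      ≤ ENNReal.ofReal (C * bilConst a * ‖F‖ * ‖G‖) ^ 2 := by
    rw [eLpNorm_two_sq]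
    refine le_trans (lintegral_mono fun ξ => ?_) (h.lintegral_sq_le ha F G)
    gcongr
    exact enorm_integral_le_lintegral_enorm _
  exact (ENNReal.pow_le_pow_left_iff two_ne_zero).1 h1

theorem memLp (h : Adm a κ C) (ha : 1 / 2 < a) (F G : L2) : MemLp (bilInt κ F G) 2 volume :=
  ⟨(h.measurable_integrand F G).aestronglyMeasurable.integral_prod_right',
    (h.eLpNorm_bilInt_le ha F G).trans_lt (by finiteness)⟩

theorem coeFn_bil (h : Adm a κ C) (ha : 1 / 2 < a) (F G : L2) :
    bil κ F G =ᵐ[volume] bilInt κ F G := by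
  rw [bil, dif_pos (h.memLp ha F G)]
  exact MemLp.coeFn_toLp _

theorem norm_bil_le (h : Adm a κ C) (ha : 1 / 2 < a) (F G : L2) :
    ‖bil κ F G‖ ≤ C * bilConst a * ‖F‖ * ‖G‖ := by
  rw [bil, dif_pos (h.memLp ha F G), Lp.norm_toLp]
  have := h.nonneg
  have := bilConst_nonneg a
  exact ENNReal.toReal_le_of_le_ofReal (by positivity) (h.eLpNorm_bilInt_le ha F G)

theorem bil_add_left (h : Adm a κ C) (ha : 1 / 2 < a) (F F' G : L2) :
    bil κ (F + F') G = bil κ F G + bil κ F' G := by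
  refine Lp.ext ?_
  filter_upwards [h.coeFn_bil ha (F + F') G, h.coeFn_bil ha F G, h.coeFn_bil ha F' G,
    Lp.coeFn_add (bil κ F G) (bil κ F' G), h.integrable ha F G, h.integrable ha F' G]
    with ξ h1 h2 h3 h4 h5 h6
  rw [h1, h4, Pi.add_apply, h2, h3, bilInt_congr κ (Lp.coeFn_add F F') (Filter.EventuallyEq.refl _ G)]
  simp only [bilInt]
  rw [← integral_add h5 h6]
  refine integral_congr_ae (Filter.Eventually.of_forall fun η => ?_)
  simp only [Pi.add_apply]; ring

theorem swap (h : Adm a κ C) : Adm a (fun x y => κ y x) C :=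
  ⟨h.meas.comp measurable_swap, fun x y => by rw [add_comm]; exact h.bound y x⟩

theorem bil_add_right (h : Adm a κ C) (ha : 1 / 2 < a) (F G G' : L2) :
    bil κ F (G + G') = bil κ F G + bil κ F G' := by
  rw [bil_swap κ F, bil_swap κ F, bil_swap κ F, h.swap.bil_add_left ha]

theorem bil_smul_left (h : Adm a κ C) (ha : 1 / 2 < a) (c : ℂ) (F G : L2) :
    bil κ (c • F) G = c • bil κ F G := by
  refine Lp.ext ?_
  filter_upwards [h.coeFn_bil ha (c • F) G, h.coeFn_bil ha F G,
    Lp.coeFn_smul c (bil κ F G)] with ξ h1 h2 h4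
  rw [h1, h4, Pi.smul_apply, h2, bilInt_congr κ (Lp.coeFn_smul c F) (Filter.EventuallyEq.refl _ G)]
  simp only [bilInt]
  rw [← integral_smul]
  refine integral_congr_ae (Filter.Eventually.of_forall fun η => ?_)
  simp only [Pi.smul_apply, smul_eq_mul]; ring

theorem bil_smul_right (h : Adm a κ C) (ha : 1 / 2 < a) (c : ℂ) (F G : L2) :
    bil κ F (c • G) = c • bil κ F G := by
  rw [bil_swap κ F, bil_swap κ F, h.swap.bil_smul_left ha]

theorem bil_sub_left (h : Adm a κ C) (ha : 1 / 2 < a) (F F' G : L2) :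
    bil κ (F - F') G = bil κ F G - bil κ F' G := by
  rw [eq_sub_iff_add_eq, ← h.bil_add_left ha, sub_add_cancel]

theorem bil_sub_right (h : Adm a κ C) (ha : 1 / 2 < a) (F G G' : L2) :
    bil κ F (G - G') = bil κ F G - bil κ F G' := by
  rw [eq_sub_iff_add_eq, ← h.bil_add_right ha, sub_add_cancel]

theorem isBoundedBilinearMap (h : Adm a κ C) (ha : 1 / 2 < a) :
    IsBoundedBilinearMap ℝ fun p : L2 × L2 => bil κ p.1 p.2 where
  add_left := h.bil_add_left ha
  add_right := h.bil_add_right ha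
  smul_left c F G := by
    rw [real_smul_eq, real_smul_eq, h.bil_smul_left ha]
  smul_right c F G := by
    rw [real_smul_eq, real_smul_eq, h.bil_smul_right ha]
  bound := by
    -- The summand 1 is there because the constant has to be strictly positive.
    refine ⟨C * bilConst a + 1, ?_, fun F G => (h.norm_bil_le ha F G).trans ?_⟩
    · have := h.nonneg; have := bilConst_nonneg a; positivity
    · gcongr; linarith

theorem bil_kernel_add (h : Adm a κ C) (h' : Adm a κ' C') (ha : 1 / 2 < a) (F G : L2) :
    bil (fun x y => κ x y + κ' x y) F G = bil κ F G + bil κ' F G := by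
  refine Lp.ext ?_
  filter_upwards [(h.add h').coeFn_bil ha F G, h.coeFn_bil ha F G, h'.coeFn_bil ha F G,
    Lp.coeFn_add (bil κ F G) (bil κ' F G), h.integrable ha F G, h'.integrable ha F G]
    with ξ h1 h2 h3 h4 h5 h6
  rw [h1, h4, Pi.add_apply, h2, h3]
  simp only [bilInt]
  rw [← integral_add h5 h6]
  refine integral_congr_ae (Filter.Eventually.of_forall fun η => ?_)
  simp only; ring

theorem bil_kernel_smul (h : Adm a κ C) (ha : 1 / 2 < a) (c : ℂ) (F G : L2) :
    bil (fun x y => c * κ x y) F G = c • bil κ F G := by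
  have hm : Adm a (fun x y => c * κ x y) (‖c‖ * C) :=
    h.of_le (measurable_const.mul h.meas) (fun x y => (norm_mul _ _).le) (norm_nonneg c)
  refine Lp.ext ?_
  filter_upwards [hm.coeFn_bil ha F G, h.coeFn_bil ha F G,
    Lp.coeFn_smul c (bil κ F G)] with ξ h1 h2 h4
  rw [h1, h4, Pi.smul_apply, h2]
  simp only [bilInt]
  rw [← integral_smul]
  refine integral_congr_ae (Filter.Eventually.of_forall fun η => ?_)
  simp only [smul_eq_mul]; ring

/-- The output frequency is the sum of the two input frequencies, so a multiplier on the output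
enters the kernel as m(x + y). -/
theorem mulOp_bil (h : Adm a κ C) (ha : 1 / 2 < a) {m : ℝ → ℂ} {c : ℝ} (hm : BddSymbol m c)
    (F G : L2) : mulOp m (bil κ F G) = bil (fun x y => m (x + y) * κ x y) F G := by
  have h' : Adm a (fun x y => m (x + y) * κ x y) (c * C) :=
    h.of_le ((hm.meas.comp (f := fun p : ℝ × ℝ => p.1 + p.2) (by fun_prop)).mul h.meas)
      (fun x y => by rw [norm_mul]; gcongr; exact hm.bound _) hm.nonneg
  refine Lp.ext ?_
  filter_upwards [h'.coeFn_bil ha F G, h.coeFn_bil ha F G, coeFn_mulOp hm (bil κ F G)]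
    with ξ h1 h2 h3
  rw [h1, h3, h2]
  simp only [bilInt]
  rw [← integral_const_mul]
  refine integral_congr_ae (Filter.Eventually.of_forall fun η => ?_)
  simp only [sub_add_cancel]; ring

end Adm

/-! ### Hermitian symmetry -/

theorem memLp_conjRefl (F : L2) : MemLp (fun ξ => (starRingEnd ℂ) (F (-ξ))) 2 volume := by
  have h : MemLp (fun ξ => F (-ξ)) 2 volume :=
    (Lp.memLp F).comp_measurePreserving (Measure.measurePreserving_neg volume)
  exact h.star

/-- The map taking `F` to `conj (F (-ξ))`. -/
def conjRefl (F : L2) : L2 := (memLp_conjRefl F).toLp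

theorem coeFn_conjRefl (F : L2) : conjRefl F =ᵐ[volume] fun ξ => (starRingEnd ℂ) (F (-ξ)) :=
  MemLp.coeFn_toLp _

theorem ae_comp_neg {P : ℝ → Prop} (h : ∀ᵐ ξ, P ξ) : ∀ᵐ ξ, P (-ξ) :=
  (Measure.measurePreserving_neg volume).quasiMeasurePreserving.ae h

theorem conjRefl_sub (F G : L2) : conjRefl (F - G) = conjRefl F - conjRefl G := by
  refine Lp.ext ?_
  filter_upwards [coeFn_conjRefl (F - G), coeFn_conjRefl F, coeFn_conjRefl G,
    Lp.coeFn_sub (conjRefl F) (conjRefl G), ae_comp_neg (Lp.coeFn_sub F G)] with ξ h1 h2 h3 h4 h5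
  rw [h1, h4, Pi.sub_apply, h2, h3, h5, Pi.sub_apply, map_sub]

theorem norm_conjRefl (F : L2) : ‖conjRefl F‖ = ‖F‖ := by
  rw [conjRefl, Lp.norm_toLp, Lp.norm_def]
  congr 1
  have h := eLpNorm_comp_measurePreserving (p := 2) (Lp.aestronglyMeasurable F)
    (Measure.measurePreserving_neg (volume : Measure ℝ))
  rw [← h]
  refine eLpNorm_congr_norm_ae (Filter.Eventually.of_forall fun ξ => ?_)
  simp

theorem conjRefl_smul (c : ℝ) (F : L2) : conjRefl (c • F) = c • conjRefl F := by
  refine Lp.ext ?_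
  filter_upwards [coeFn_conjRefl (c • F), coeFn_conjRefl F,
    Lp.coeFn_smul c (conjRefl F), ae_comp_neg (Lp.coeFn_smul c F)] with ξ h1 h2 h4 h5
  rw [h1, h4, Pi.smul_apply, h2, h5, Pi.smul_apply]
  simp

theorem conjRefl_add (F G : L2) : conjRefl (F + G) = conjRefl F + conjRefl G := by
  have h := conjRefl_sub (F + G) G
  rw [add_sub_cancel_right] at h
  rw [h, sub_add_cancel]

/-- `conjRefl` as a continuous real-linear map. -/
def conjReflL : L2 →L[ℝ] L2 :=
  LinearMap.mkContinuous ⟨⟨conjRefl, conjRefl_add⟩, conjRefl_smul⟩ 1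
    fun F => by rw [one_mul]; exact (norm_conjRefl F).le

/-- `F` is the Fourier transform of a real-valued function. -/
def IsHerm (F : L2) : Prop := ∀ᵐ ξ, F (-ξ) = (starRingEnd ℂ) (F ξ)

theorem isHerm_iff (F : L2) : IsHerm F ↔ conjRefl F = F := by
  constructor
  · intro h
    refine Lp.ext ?_
    filter_upwards [coeFn_conjRefl F, h] with ξ h1 h2
    rw [h1, h2, Complex.conj_conj]
  · intro h
    have := coeFn_conjRefl F
    rw [h] at this
    filter_upwards [this] with ξ h1
    rw [h1, Complex.conj_conj]

theorem isClosed_isHerm : IsClosed {F : L2 | IsHerm F} := by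
  have : {F : L2 | IsHerm F} = {F | conjReflL F = F} := by
    ext F; exact isHerm_iff F
  rw [this]
  exact isClosed_eq conjReflL.continuous continuous_id

theorem conjRefl_mulOp {m : ℝ → ℂ} {C : ℝ} (h : BddSymbol m C)
    (hm : ∀ ξ, m (-ξ) = (starRingEnd ℂ) (m ξ)) (F : L2) :
    conjRefl (mulOp m F) = mulOp m (conjRefl F) := by
  refine Lp.ext ?_
  filter_upwards [coeFn_conjRefl (mulOp m F), coeFn_mulOp h (conjRefl F), coeFn_conjRefl F,
    ae_comp_neg (coeFn_mulOp h F)] with ξ h1 h2 h3 h4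
  rw [h1, h2, h3, h4, map_mul, hm, Complex.conj_conj]

theorem IsHerm.mulOp {m : ℝ → ℂ} {C : ℝ} (h : BddSymbol m C)
    (hm : ∀ ξ, m (-ξ) = (starRingEnd ℂ) (m ξ)) {F : L2} (hF : IsHerm F) :
    IsHerm (mulOp m F) := by
  rw [isHerm_iff] at *
  rw [conjRefl_mulOp h hm, hF]

theorem IsHerm.lower {F : L2} (hF : IsHerm F) {a : ℝ} (ha : 0 ≤ a) : IsHerm (lower a F) :=
  hF.mulOp (bddSymbol_lower ha) fun ξ => by simp [jap_neg]

theorem IsHerm.of_lower {F : L2} {a : ℝ} (ha : 0 ≤ a) (hF : IsHerm (Splitting.lower a F)) :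
    IsHerm F := by
  rw [isHerm_iff] at *
  apply lower_injective ha
  rwa [Splitting.lower, ← conjRefl_mulOp (bddSymbol_lower ha) fun ξ => by simp [jap_neg]]

theorem Adm.conjRefl_bil {a C : ℝ} {κ : ℝ → ℝ → ℂ} (h : Adm a κ C) (ha : 1 / 2 < a)
    (hκ : ∀ x y, κ (-x) (-y) = (starRingEnd ℂ) (κ x y)) (F G : L2) :
    conjRefl (bil κ F G) = bil κ (conjRefl F) (conjRefl G) := by
  refine Lp.ext ?_
  filter_upwards [coeFn_conjRefl (bil κ F G), h.coeFn_bil ha (conjRefl F) (conjRefl G),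
    ae_comp_neg (h.coeFn_bil ha F G)] with ξ h1 h2 h3
  rw [h1, h2, h3, bilInt_congr κ (coeFn_conjRefl F) (coeFn_conjRefl G)]
  simp only [bilInt]
  rw [← integral_conj, ← integral_neg_eq_self]
  refine integral_congr_ae (Filter.Eventually.of_forall fun η => ?_)
  simp only [map_mul, ← hκ]
  congr 3 <;> ring_nf

/-- The energy identity behind integration by parts: for a Hermitian `F`, the adjoint of
`bil κ F` has the kernel `conj (κ (-x) (x + y))`. -/
theorem re_inner_bil {a C C' : ℝ} {κ : ℝ → ℝ → ℂ} (h : Adm a κ C) (ha : 1 / 2 < a)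
    (h' : Adm a (fun x y => (starRingEnd ℂ) (κ (-x) (x + y))) C') {F : L2} (hF : IsHerm F)
    (G : L2) :
    (inner ℂ G (bil κ F G)).re =
      (inner ℂ G (bil (fun x y => (starRingEnd ℂ) (κ (-x) (x + y))) F G)).re := by
  set κ' : ℝ → ℝ → ℂ := fun x y => (starRingEnd ℂ) (κ (-x) (x + y)) with hκ'
  have expand : ∀ {κ : ℝ → ℝ → ℂ} {C : ℝ}, Adm a κ C → inner ℂ G (bil κ F G) =
      ∫ ξ, ∫ η, (starRingEnd ℂ) (G ξ) * (κ (ξ - η) η * (F (ξ - η) * G η)) := by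
    intro κ C h
    rw [L2.inner_def]
    refine integral_congr_ae ?_
    filter_upwards [h.coeFn_bil ha F G] with ξ h1
    rw [h1, bilInt, integral_const_mul, RCLike.inner_apply, mul_comm]
  -- Absolute integrability of the double integral, needed for Fubini: Cauchy–Schwarz in ξ reduces
  -- it to the L² bound for the inner integral of absolute values.
  have hint : Integrable (Function.uncurry fun ξ η =>
      (starRingEnd ℂ) (G ξ) * (κ (ξ - η) η * (F (ξ - η) * G η))) (volume.prod volume) := by
    have hm := h.measurable_integrand F G
    have hG1 : Measurable fun p : ℝ × ℝ => (starRingEnd ℂ) (G p.1) :=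
      Complex.continuous_conj.measurable.comp
        ((measurable_L2 G).comp (f := fun p : ℝ × ℝ => p.1) (by fun_prop))
    refine ⟨(hG1.mul hm).aestronglyMeasurable, ?_⟩
    have e : ∫⁻ p : ℝ × ℝ, ‖(starRingEnd ℂ) (G p.1) *
        (κ (p.1 - p.2) p.2 * (F (p.1 - p.2) * G p.2))‖ₑ ∂(volume.prod volume) =
        ∫⁻ ξ, ‖G ξ‖ₑ * ∫⁻ η, ‖κ (ξ - η) η * (F (ξ - η) * G η)‖ₑ := by
      have hmm := (hG1.mul hm).enorm.aemeasurable (μ := (volume : Measure ℝ).prod volume)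
      simp only [Pi.mul_apply] at hmm
      rw [lintegral_prod _ hmm]
      refine lintegral_congr fun ξ => ?_
      have hm1 := (hm.comp (f := fun η => (ξ, η)) (by fun_prop)).enorm
      simp only [Function.comp_def] at hm1
      rw [← lintegral_const_mul _ hm1]
      refine lintegral_congr fun η => ?_
      rw [enorm_mul]
      congr 1
      rw [← ofReal_norm, ← ofReal_norm, RCLike.norm_conj]
    have b := sq_lintegral_mul_le (measurable_L2 G).enorm
      (hm.enorm.lintegral_prod_right' (ν := (volume : Measure ℝ)))
    refine lt_of_le_of_lt e.le ?_
    by_contra hc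
    rw [not_lt, top_le_iff] at hc
    rw [hc] at b
    have b2 := b.trans (mul_le_mul_right (h.lintegral_sq_le ha F G) _)
    rw [lintegral_enorm_sq] at b2
    exact absurd b2 (not_le.2 (by simp only [ENNReal.top_pow two_ne_zero]; finiteness))
  -- Exchange ξ and η and conjugate, which does not change the real part. Hermitian symmetry then
  -- turns F(η - ξ) back into F(ξ - η), and the kernel becomes conj κ(-x, x+y).
  rw [expand h, expand h', integral_integral_swap hint, ← Complex.conj_re, ← integral_conj]
  congr 1
  refine integral_congr_ae (Filter.Eventually.of_forall fun ξ => ?_)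
  simp only
  rw [← integral_conj]
  refine integral_congr_ae ?_
  have h1 := (quasiMeasurePreserving_sub_left volume ξ).ae hF
  filter_upwards [h1] with η h2
  rw [neg_sub] at h2
  rw [h2]
  simp only [map_mul, Complex.conj_conj, hκ', neg_sub, sub_add_cancel]
  ring

/-! ### Power weights -/

theorem jap_add_rpow_le {c : ℝ} (hc : 0 ≤ c) (x y : ℝ) :
    jap (x + y) ^ c ≤ 2 ^ c * (jap x ^ c + jap y ^ c) := by
  have hx := jap_rpow_pos x c
  have hy := jap_rpow_pos y c
  have h2 : (0 : ℝ) < 2 ^ c := by positivity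
  rcases le_total (jap x) (jap y) with h | h
  · have : jap (x + y) ≤ 2 * jap y := (jap_add_le x y).trans (by linarith)
    calc jap (x + y) ^ c ≤ (2 * jap y) ^ c := Real.rpow_le_rpow (jap_pos _).le this hc
      _ = 2 ^ c * jap y ^ c := Real.mul_rpow (by norm_num) (jap_pos _).le
      _ ≤ _ := by gcongr; linarith
  · have : jap (x + y) ≤ 2 * jap x := (jap_add_le x y).trans (by linarith)
    calc jap (x + y) ^ c ≤ (2 * jap x) ^ c := Real.rpow_le_rpow (jap_pos _).le this hc
      _ = 2 ^ c * jap x ^ c := Real.mul_rpow (by norm_num) (jap_pos _).le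
      _ ≤ _ := by gcongr; linarith

theorem jap_mul_jap_le {a α β : ℝ} (h : (α ≤ 0 ∧ β ≤ -a) ∨ (α ≤ -a ∧ β ≤ 0)) (x y : ℝ) :
    jap x ^ α * jap y ^ β ≤ jap x ^ (-a) + jap y ^ (-a) := by
  have hx := jap_rpow_pos x (-a)
  have hy := jap_rpow_pos y (-a)
  rcases h with ⟨h1, h2⟩ | ⟨h1, h2⟩
  · calc jap x ^ α * jap y ^ β ≤ 1 * jap y ^ (-a) :=
          mul_le_mul (jap_rpow_le_one h1 x) (jap_rpow_mono h2 y) (jap_rpow_pos _ _).le zero_le_one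
      _ ≤ _ := by linarith
  · calc jap x ^ α * jap y ^ β ≤ jap x ^ (-a) * 1 :=
          mul_le_mul (jap_rpow_mono h1 x) (jap_rpow_le_one h2 y) (jap_rpow_pos _ _).le hx.le
      _ ≤ _ := by linarith

/-- The weight turning a kernel acting on functions in `L²` into one acting from
`H^i × H^j` to `H^o`. -/
def levelWeight (i j o x y : ℝ) : ℝ := jap (x + y) ^ o * jap x ^ (-i) * jap y ^ (-j)

theorem levelWeight_pos (i j o x y : ℝ) : 0 < levelWeight i j o x y :=
  mul_pos (mul_pos (jap_rpow_pos _ _) (jap_rpow_pos _ _)) (jap_rpow_pos _ _)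

/-- The kernel `κ`, acting from `H^i × H^j` to `H^o`. -/
def atLevel (κ : ℝ → ℝ → ℂ) (i j o : ℝ) (x y : ℝ) : ℂ := (levelWeight i j o x y : ℂ) * κ x y

theorem measurable_atLevel {κ : ℝ → ℝ → ℂ} (h : Measurable (Function.uncurry κ)) (i j o : ℝ) :
    Measurable (Function.uncurry (atLevel κ i j o)) := by
  have h1 : Measurable fun p : ℝ × ℝ => ((levelWeight i j o p.1 p.2 : ℝ) : ℂ) :=
    Complex.measurable_ofReal.comp (by unfold levelWeight; fun_prop)
  exact h1.mul h

/-- Since ⟨x+y⟩^o ≤ 2^o (⟨x⟩^o + ⟨y⟩^o), the output derivatives fall entirely on one factor. The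
hypothesis `h1` treats the case of x and `h2` the case of y. In each case no positive power may
remain, and one of the two factors must decay at least like ⟨·⟩^{-a}. -/
theorem levelWeight_mul_le {a b c i j o : ℝ} (ho : 0 ≤ o)
    (h1 : (o + b - i ≤ 0 ∧ c - j ≤ -a) ∨ (o + b - i ≤ -a ∧ c - j ≤ 0))
    (h2 : (b - i ≤ 0 ∧ o + c - j ≤ -a) ∨ (b - i ≤ -a ∧ o + c - j ≤ 0)) (x y : ℝ) :
    levelWeight i j o x y * (jap x ^ b * jap y ^ c)
      ≤ 2 ^ (o + 1) * (jap x ^ (-a) + jap y ^ (-a)) := by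
  have e1 := jap_mul_jap_le h1 x y
  have e2 := jap_mul_jap_le h2 x y
  have hx := jap_pos x
  have hy := jap_pos y
  rw [Real.rpow_sub hx, Real.rpow_sub hy, Real.rpow_add hx] at e1
  rw [Real.rpow_sub hx, Real.rpow_sub hy, Real.rpow_add hy] at e2
  unfold levelWeight
  rw [Real.rpow_neg hx.le i, Real.rpow_neg hy.le j]
  have px := Real.rpow_pos_of_pos hx i
  have py := Real.rpow_pos_of_pos hy j
  have pb := Real.rpow_pos_of_pos hx b
  have pc := Real.rpow_pos_of_pos hy c
  calc _ = jap (x + y) ^ o * (jap x ^ b / jap x ^ i * (jap y ^ c / jap y ^ j)) := by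
        field_simp
    _ ≤ 2 ^ o * (jap x ^ o + jap y ^ o) * (jap x ^ b / jap x ^ i * (jap y ^ c / jap y ^ j)) := by
        gcongr; exact jap_add_rpow_le ho x y
    _ = 2 ^ o * (jap x ^ o * jap x ^ b / jap x ^ i * (jap y ^ c / jap y ^ j) +
        jap x ^ b / jap x ^ i * (jap y ^ o * jap y ^ c / jap y ^ j)) := by ring
    _ ≤ 2 ^ o * ((jap x ^ (-a) + jap y ^ (-a)) + (jap x ^ (-a) + jap y ^ (-a))) := by gcongr
    _ = _ := by rw [Real.rpow_add two_pos, Real.rpow_one]; ring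

theorem adm_atLevel {κ : ℝ → ℝ → ℂ} (hm : Measurable (Function.uncurry κ)) {C a b c i j o : ℝ}
    (hκ : ∀ x y, ‖κ x y‖ ≤ C * (jap x ^ b * jap y ^ c)) (hC : 0 ≤ C) (ho : 0 ≤ o)
    (h1 : (o + b - i ≤ 0 ∧ c - j ≤ -a) ∨ (o + b - i ≤ -a ∧ c - j ≤ 0))
    (h2 : (b - i ≤ 0 ∧ o + c - j ≤ -a) ∨ (b - i ≤ -a ∧ o + c - j ≤ 0)) :
    Adm a (atLevel κ i j o) (C * 2 ^ (o + 1)) := by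
  refine ⟨measurable_atLevel hm i j o, fun x y => ?_⟩
  have hw := levelWeight_pos i j o x y
  rw [atLevel, norm_mul, Complex.norm_real, Real.norm_of_nonneg hw.le]
  calc _ ≤ levelWeight i j o x y * (C * (jap x ^ b * jap y ^ c)) := by gcongr; exact hκ x y
    _ = C * (levelWeight i j o x y * (jap x ^ b * jap y ^ c)) := by ring
    _ ≤ C * (2 ^ (o + 1) * (jap x ^ (-a) + jap y ^ (-a))) :=
      mul_le_mul_of_nonneg_left (levelWeight_mul_le ho h1 h2 x y) hC
    _ = _ := by ring

theorem adm_atLevel_symm {κ : ℝ → ℝ → ℂ} (hm : Measurable (Function.uncurry κ))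
    {C a b c i o : ℝ} (hκ : ∀ x y, ‖κ x y‖ ≤ C * (jap x ^ b * jap y ^ c + jap x ^ c * jap y ^ b))
    (hC : 0 ≤ C) (ho : 0 ≤ o)
    (h1 : (o + b - i ≤ 0 ∧ c - i ≤ -a) ∨ (o + b - i ≤ -a ∧ c - i ≤ 0))
    (h2 : (b - i ≤ 0 ∧ o + c - i ≤ -a) ∨ (b - i ≤ -a ∧ o + c - i ≤ 0)) :
    Adm a (atLevel κ i i o) (2 * C * 2 ^ (o + 1)) := by
  refine ⟨measurable_atLevel hm i i o, fun x y => ?_⟩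
  have hw := levelWeight_pos i i o x y
  rw [atLevel, norm_mul, Complex.norm_real, Real.norm_of_nonneg hw.le]
  calc _ ≤ levelWeight i i o x y * (C * (jap x ^ b * jap y ^ c + jap x ^ c * jap y ^ b)) := by
        gcongr; exact hκ x y
    _ = C * (levelWeight i i o x y * (jap x ^ b * jap y ^ c) +
          levelWeight i i o x y * (jap x ^ c * jap y ^ b)) := by ring
    _ ≤ C * (2 ^ (o + 1) * (jap x ^ (-a) + jap y ^ (-a)) +
          2 ^ (o + 1) * (jap x ^ (-a) + jap y ^ (-a))) := by
      refine mul_le_mul_of_nonneg_left (add_le_add (levelWeight_mul_le ho h1 h2 x y)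
        (levelWeight_mul_le ho ?_ ?_ x y)) hC
      · exact h2.symm.imp And.symm And.symm
      · exact h1.symm.imp And.symm And.symm
    _ = _ := by ring

section level
variable {κ : ℝ → ℝ → ℂ} {a C i j o d : ℝ}

/-- With this lemma and the next two, passing to a weaker norm, in the output or in an argument, is
a shift of the indices of a single kernel. Estimates between different Sobolev spaces thus become
identities followed by one bound. -/
theorem lower_bil (h : Adm a (atLevel κ i j o) C) (ha : 1 / 2 < a) (hd : 0 ≤ d) (F G : L2) :
    lower d (bil (atLevel κ i j o) F G) = bil (atLevel κ i j (o - d)) F G := by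
  rw [lower, h.mulOp_bil ha (bddSymbol_lower hd)]
  congr 1
  funext x y
  simp only [atLevel, levelWeight, ofRealSymbol]
  rw [sub_eq_add_neg, Real.rpow_add (jap_pos _)]
  push_cast
  ring

theorem bil_lower_left (hd : 0 ≤ d) (F G : L2) :
    bil (atLevel κ i j o) (lower d F) G = bil (atLevel κ (i + d) j o) F G := by
  rw [lower, bil_mulOp_left _ (bddSymbol_lower hd)]
  congr 1
  funext x y
  simp only [atLevel, levelWeight, ofRealSymbol]
  rw [neg_add, Real.rpow_add (jap_pos _)]
  push_cast
  ring

theorem bil_lower_right (hd : 0 ≤ d) (F G : L2) :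
    bil (atLevel κ i j o) F (lower d G) = bil (atLevel κ i (j + d) o) F G := by
  rw [lower, bil_mulOp_right _ (bddSymbol_lower hd)]
  congr 1
  funext x y
  simp only [atLevel, levelWeight, ofRealSymbol]
  rw [neg_add, Real.rpow_add (jap_pos _)]
  push_cast
  ring

end level

/-! ### The Burgers kernel -/

/-- The kernel of `(f, g) ↦ -f gₓ`. -/
def burgersKernel (_x y : ℝ) : ℂ := -(Complex.I * ((2 * Real.pi * y : ℝ) : ℂ))

theorem measurable_burgersKernel : Measurable (Function.uncurry burgersKernel) := by
  have : Measurable fun p : ℝ × ℝ => ((2 * Real.pi * p.2 : ℝ) : ℂ) :=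
    Complex.measurable_ofReal.comp (by fun_prop)
  exact (measurable_const.mul this).neg

theorem norm_burgersKernel (x y : ℝ) : ‖burgersKernel x y‖ = |2 * Real.pi * y| := by
  rw [burgersKernel, norm_neg, norm_mul, Complex.norm_I, one_mul, Complex.norm_real,
    Real.norm_eq_abs]

theorem norm_burgersKernel_le (x y : ℝ) : ‖burgersKernel x y‖ ≤ jap y := by
  rw [norm_burgersKernel]; exact abs_le_jap y

/-- If the output derivatives fall on the undifferentiated factor, `hoi` pays for them and the other
factor supplies the decay. If they fall on the differentiated factor, its index j must pay for o + 1
derivatives. -/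
theorem adm_burgers {r i j o : ℝ} (ho : 0 ≤ o) (h1 : o + 1 ≤ j) (hir : r ≤ i + 1) (hoi : o ≤ i)
    (hjr : r ≤ j) :
    Adm (r - 1) (atLevel burgersKernel i j o) (2 ^ (o + 1)) := by
  have := adm_atLevel (κ := burgersKernel) measurable_burgersKernel (C := 1) (a := r - 1) (b := 0)
    (c := 1) (i := i) (j := j) (o := o) (fun x y => by
      rw [Real.rpow_zero, Real.rpow_one, one_mul, one_mul]; exact norm_burgersKernel_le x y)
    zero_le_one ho (Or.inl ⟨by linarith, by linarith⟩) (Or.inr ⟨by linarith, by linarith⟩)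
  simpa using this

/-! ### Dispersive symbols -/

namespace IsAdmissibleSymbol
variable {p M : ℝ} {k : ℝ → ℂ}

theorem M_nonneg (hk : IsAdmissibleSymbol p M k) : 0 ≤ M := by
  have := (norm_nonneg _).trans (hk.growth 0)
  exact nonneg_of_mul_nonneg_left this (Real.rpow_pos_of_pos (bracket_pos 0) p)

/-- The case k = 0 makes the pure Burgers equation an instance of the full equation, so that
`stability` serves both. -/
theorem zero (p : ℝ) {M : ℝ} (hM : 0 ≤ M) : IsAdmissibleSymbol p M fun _ => 0 where
  measurable := measurable_const
  re_nonpos := by simp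
  neg := by simp
  growth ξ := by
    have := Real.rpow_pos_of_pos (bracket_pos ξ) p
    simp only [norm_zero]; positivity
  commutator ξ η := by
    have := Real.rpow_pos_of_pos (bracket_pos ξ) p
    have := Real.rpow_pos_of_pos (bracket_pos η) p
    simp only [mul_zero, sub_zero, norm_zero]; positivity

end IsAdmissibleSymbol

/-- The symbol `k`, as a function of the frequency. -/
def freqSymbol (k : ℝ → ℂ) (ξ : ℝ) : ℂ := k (2 * Real.pi * ξ)

/-- The kernel of the commutator of the dispersion and the Burgers nonlinearity. -/
def commKernel (k : ℝ → ℂ) (x y : ℝ) : ℂ :=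
  Complex.I / 2 * ((2 * Real.pi * (x + y) : ℝ) : ℂ) *
    (freqSymbol k x + freqSymbol k y - freqSymbol k (x + y))

/-- The kernel of the commutator of the dispersive flow at time `t` and the Burgers
nonlinearity. -/
def flowCommKernel (k : ℝ → ℂ) (t x y : ℝ) : ℂ :=
  Complex.I / 2 * ((2 * Real.pi * (x + y) : ℝ) : ℂ) *
    (Complex.exp (t * (freqSymbol k x + freqSymbol k y)) - Complex.exp (t * freqSymbol k (x + y)))

/-- Mean value inequality on the closed left half-plane, which is convex and on which exp has
modulus at most 1. -/
theorem norm_exp_sub_one_le {z : ℂ} (hz : z.re ≤ 0) : ‖Complex.exp z - 1‖ ≤ ‖z‖ := by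
  have h := Convex.norm_image_sub_le_of_norm_hasDerivWithin_le (f := Complex.exp)
    (f' := Complex.exp) (s := {w : ℂ | w.re ≤ 0}) (C := 1) (x := 0) (y := z)
    (fun w _ => (Complex.hasDerivAt_exp w).hasDerivWithinAt)
    (fun w hw => by rw [Complex.norm_exp]; exact Real.exp_le_one_iff.2 hw)
    (convex_halfSpace_re_le 0) (by simp) hz
  simpa using h

/-- The factor ‖b - a‖ is kept because in the application b - a is the commutator symbol, and the
cancellation it contains must survive in the second-order remainder. -/
theorem norm_exp_sub_exp_sub_le {a b : ℂ} (ha : a.re ≤ 0) (hb : b.re ≤ 0) :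
    ‖Complex.exp b - Complex.exp a - (b - a)‖ ≤ ‖b - a‖ * (‖a‖ + ‖b‖) := by
  have hconv : Convex ℝ ({w : ℂ | w.re ≤ 0} ∩ Metric.closedBall 0 (‖a‖ + ‖b‖)) :=
    (convex_halfSpace_re_le 0).inter (convex_closedBall _ _)
  have h := Convex.norm_image_sub_le_of_norm_hasDerivWithin_le
    (f := fun w => Complex.exp w - w)
    (f' := fun w => Complex.exp w - 1) (C := ‖a‖ + ‖b‖) (x := a) (y := b)
    (fun w _ => ((Complex.hasDerivAt_exp w).sub (hasDerivAt_id w)).hasDerivWithinAt)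
    (fun w hw => (norm_exp_sub_one_le hw.1).trans (by simpa using hw.2))
    hconv ⟨ha, by simp⟩ ⟨hb, by simp⟩
  have e : Complex.exp b - Complex.exp a - (b - a)
      = (Complex.exp b - b) - (Complex.exp a - a) := by ring
  rw [e, mul_comm]
  exact h

/-! ### Kernel bounds from the hypotheses on the symbol -/

section symbol
variable {p M m : ℝ} {k : ℝ → ℂ} (hk : IsAdmissibleSymbol p M k) (hpm : p ≤ m) (hm : 1 ≤ m)
include hk

theorem measurable_freqSymbol : Measurable (freqSymbol k) :=
  hk.measurable.comp (by fun_prop)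

theorem re_freqSymbol (ξ : ℝ) : (freqSymbol k ξ).re ≤ 0 := hk.re_nonpos _

theorem freqSymbol_neg (ξ : ℝ) : freqSymbol k (-ξ) = (starRingEnd ℂ) (freqSymbol k ξ) := by
  simp [freqSymbol, ← hk.neg]

theorem measurable_commKernel : Measurable (Function.uncurry (commKernel k)) := by
  have h1 : Measurable fun q : ℝ × ℝ => ((2 * Real.pi * (q.1 + q.2) : ℝ) : ℂ) :=
    Complex.measurable_ofReal.comp (by fun_prop)
  have h2 := measurable_freqSymbol hk
  exact (measurable_const.mul h1).mul (((h2.comp measurable_fst).add (h2.comp measurable_snd)).sub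
    (h2.comp (measurable_fst.add measurable_snd)))

theorem measurable_flowCommKernel (t : ℝ) :
    Measurable (Function.uncurry (flowCommKernel k t)) := by
  have h1 : Measurable fun q : ℝ × ℝ => ((2 * Real.pi * (q.1 + q.2) : ℝ) : ℂ) :=
    Complex.measurable_ofReal.comp (by fun_prop)
  have h2 := measurable_freqSymbol hk
  exact (measurable_const.mul h1).mul ((Complex.measurable_exp.comp (measurable_const.mul
    ((h2.comp measurable_fst).add (h2.comp measurable_snd)))).sub
    (Complex.measurable_exp.comp (measurable_const.mul
    (h2.comp (measurable_fst.add measurable_snd)))))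

include hpm

theorem norm_freqSymbol_le (ξ : ℝ) : ‖freqSymbol k ξ‖ ≤ M * jap ξ ^ m :=
  (hk.growth _).trans (mul_le_mul_of_nonneg_left (jap_rpow_mono hpm ξ) hk.M_nonneg)

include hm

/-- The product (x+y)(k(x) + k(y) - k(x+y)) is minus the expression bounded by hypothesis plus the
cross terms x k(y) + y k(x). None of these has more than m = max(1,p) derivatives on a single
factor, whereas the terms (x+y)k(x+y) and xk(x) taken alone may cost p + 1. -/
theorem norm_commutator_le (x y : ℝ) : ‖((2 * Real.pi * (x + y) : ℝ) : ℂ) *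
    (freqSymbol k x + freqSymbol k y - freqSymbol k (x + y))‖
      ≤ 4 * M * (jap x ^ m * jap y ^ m) := by
  have hM := hk.M_nonneg
  have h1 := hk.commutator (2 * Real.pi * x) (2 * Real.pi * y)
  have hx : |2 * Real.pi * x| ≤ jap x ^ m := (abs_le_jap x).trans
    (by simpa using jap_rpow_mono hm x)
  have hy : |2 * Real.pi * y| ≤ jap y ^ m := (abs_le_jap y).trans
    (by simpa using jap_rpow_mono hm y)
  have kx := norm_freqSymbol_le hk hpm x
  have ky := norm_freqSymbol_le hk hpm y
  have bx : bracket (2 * Real.pi * x) ^ p ≤ jap x ^ m := jap_rpow_mono hpm x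
  have bY : bracket (2 * Real.pi * y) ^ p ≤ jap y ^ m := jap_rpow_mono hpm y
  have e : ((2 * Real.pi * (x + y) : ℝ) : ℂ) *
      (freqSymbol k x + freqSymbol k y - freqSymbol k (x + y)) =
      -((((2 * Real.pi * x + 2 * Real.pi * y : ℝ)) : ℂ) * k (2 * Real.pi * x + 2 * Real.pi * y)
        - ((2 * Real.pi * y : ℝ) : ℂ) * k (2 * Real.pi * y)
        - ((2 * Real.pi * x : ℝ) : ℂ) * k (2 * Real.pi * x))
      + ((2 * Real.pi * x : ℝ) : ℂ) * freqSymbol k y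
      + ((2 * Real.pi * y : ℝ) : ℂ) * freqSymbol k x := by
    simp only [freqSymbol, mul_add]; push_cast; ring
  have px := jap_rpow_pos x m
  have py := jap_rpow_pos y m
  rw [e]
  calc _ ≤ M * (|2 * Real.pi * x| * bracket (2 * Real.pi * y) ^ p +
        |2 * Real.pi * y| * bracket (2 * Real.pi * x) ^ p)
        + |2 * Real.pi * x| * (M * jap y ^ m) + |2 * Real.pi * y| * (M * jap x ^ m) := by
        refine (norm_add_le _ _).trans (add_le_add ((norm_add_le _ _).trans (add_le_add ?_ ?_)) ?_)
        · rw [norm_neg]; exact h1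
        · rw [norm_mul, Complex.norm_real, Real.norm_eq_abs]; gcongr
        · rw [norm_mul, Complex.norm_real, Real.norm_eq_abs]; gcongr
    _ ≤ M * (jap x ^ m * jap y ^ m + jap y ^ m * jap x ^ m)
        + jap x ^ m * (M * jap y ^ m) + jap y ^ m * (M * jap x ^ m) := by
        gcongr
        · exact Real.rpow_nonneg (bracket_pos _).le _
        · exact Real.rpow_nonneg (bracket_pos _).le _
    _ = _ := by ring

theorem norm_commKernel_le (x y : ℝ) :
    ‖commKernel k x y‖ ≤ 2 * M * (jap x ^ m * jap y ^ m) := by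
  have h := norm_commutator_le hk hpm hm x y
  rw [commKernel, mul_assoc, norm_mul]
  have : ‖Complex.I / 2‖ = 1 / 2 := by simp
  rw [this]; linarith

/-- Second-order Taylor remainder of the exponential. One factor is the commutator symbol, costing m
derivatives on each argument. The other is of the size of the symbols k themselves and costs m more
on one argument, which gives the exponents 2m and m. -/
theorem norm_flowCommKernel_sub_le {t : ℝ} (ht : 0 ≤ t) (x y : ℝ) :
    ‖flowCommKernel k t x y - t * commKernel k x y‖ ≤
      2 * M ^ 2 * (2 ^ m + 1) * t ^ 2 *
        (jap x ^ (2 * m) * jap y ^ m + jap x ^ m * jap y ^ (2 * m)) := by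
  have hM := hk.M_nonneg
  set A := freqSymbol k (x + y)
  set B := freqSymbol k x + freqSymbol k y with hB
  have hAre : ((t : ℂ) * A).re ≤ 0 := by
    rw [Complex.re_ofReal_mul]; exact mul_nonpos_of_nonneg_of_nonpos ht (re_freqSymbol hk _)
  have hBre : ((t : ℂ) * B).re ≤ 0 := by
    rw [Complex.re_ofReal_mul, Complex.add_re]
    exact mul_nonpos_of_nonneg_of_nonpos ht
      (by linarith [re_freqSymbol hk x, re_freqSymbol hk y])
  have h1 := norm_exp_sub_exp_sub_le hAre hBre
  have hc := norm_commutator_le hk hpm hm x y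
  have e : flowCommKernel k t x y - t * commKernel k x y =
      Complex.I / 2 * ((2 * Real.pi * (x + y) : ℝ) : ℂ) *
        (Complex.exp (t * B) - Complex.exp (t * A) - (t * B - t * A)) := by
    simp only [flowCommKernel, commKernel, A, B]; ring
  have half : ‖Complex.I / 2‖ = 1 / 2 := by simp
  have px := jap_rpow_pos x m
  have py := jap_rpow_pos y m
  have e2 : ‖(t : ℂ) * B - t * A‖ = t * ‖B - A‖ := by
    rw [← mul_sub, norm_mul, Complex.norm_real, Real.norm_of_nonneg ht]
  have hAB : ‖(t : ℂ) * A‖ + ‖(t : ℂ) * B‖ ≤ t * (M * (2 ^ m + 1) * (jap x ^ m + jap y ^ m)) := by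
    rw [norm_mul, norm_mul, Complex.norm_real, Real.norm_of_nonneg ht, ← mul_add]
    gcongr
    have a1 : ‖A‖ ≤ M * (2 ^ m * (jap x ^ m + jap y ^ m)) :=
      (norm_freqSymbol_le hk hpm (x + y)).trans
        (mul_le_mul_of_nonneg_left (jap_add_rpow_le (by linarith) x y) hM)
    have b1 : ‖B‖ ≤ M * jap x ^ m + M * jap y ^ m :=
      (norm_add_le _ _).trans (add_le_add (norm_freqSymbol_le hk hpm x)
        (norm_freqSymbol_le hk hpm y))
    calc _ ≤ _ := add_le_add a1 b1
      _ = _ := by ring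
  rw [norm_mul] at hc
  rw [e, norm_mul, norm_mul, half]
  calc _ ≤ 1 / 2 * ‖((2 * Real.pi * (x + y) : ℝ) : ℂ)‖ * ((t * ‖B - A‖) *
        (t * (M * (2 ^ m + 1) * (jap x ^ m + jap y ^ m)))) := by
        gcongr
        refine h1.trans ?_
        rw [e2]
        gcongr
    _ = 1 / 2 * (‖((2 * Real.pi * (x + y) : ℝ) : ℂ)‖ * ‖B - A‖) * (t ^ 2 *
        (M * (2 ^ m + 1) * (jap x ^ m + jap y ^ m))) := by ring
    _ ≤ 1 / 2 * (4 * M * (jap x ^ m * jap y ^ m)) * (t ^ 2 *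
        (M * (2 ^ m + 1) * (jap x ^ m + jap y ^ m))) := by gcongr
    _ = _ := by
      rw [two_mul m, Real.rpow_add (jap_pos x), Real.rpow_add (jap_pos y)]; ring

end symbol

/-! ### Weights for the energy estimates -/

/-- The weight `⟨2πξ⟩^{σ+1} / (R + ⟨2πξ⟩)`. -/
def tailWeight (σ R ξ : ℝ) : ℝ := jap ξ ^ (σ + 1) / (R + jap ξ)

section tailWeight
variable {σ R : ℝ}

theorem tailWeight_pos (hR : 0 ≤ R) (ξ : ℝ) : 0 < tailWeight σ R ξ :=
  div_pos (jap_rpow_pos _ _) (by linarith [jap_pos ξ])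

theorem tailWeight_zero (σ ξ : ℝ) : tailWeight σ 0 ξ = jap ξ ^ σ := by
  rw [tailWeight, zero_add, Real.rpow_add (jap_pos ξ), Real.rpow_one,
    mul_div_assoc, div_self (jap_pos ξ).ne', mul_one]

theorem tailWeight_le (hR : 0 ≤ R) (ξ : ℝ) : tailWeight σ R ξ ≤ jap ξ ^ σ := by
  rw [← tailWeight_zero, tailWeight, tailWeight]
  have := jap_rpow_pos ξ (σ + 1)
  have := jap_pos ξ
  gcongr

@[fun_prop]
theorem measurable_tailWeight (σ R : ℝ) : Measurable (tailWeight σ R) := by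
  unfold tailWeight; fun_prop

/-- Bernoulli's inequality applied to B/A = 1 + (B-A)/A. -/
theorem rpow_sub_rpow_le {A B c : ℝ} (hB : 0 < B) (hAB : B ≤ A) (hc : 1 ≤ c) :
    A ^ c - B ^ c ≤ c * A ^ (c - 1) * (A - B) := by
  have hA : 0 < A := hB.trans_le hAB
  have h := one_add_mul_self_le_rpow_one_add (s := (B - A) / A) (by
    rw [le_div_iff₀ hA]; linarith) hc
  have e : 1 + (B - A) / A = B / A := by field_simp; ring
  rw [e, Real.div_rpow hB.le hA.le, le_div_iff₀ (Real.rpow_pos_of_pos hA c)] at h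
  have e2 : A ^ c = A ^ (c - 1) * A := by
    conv_rhs => rw [← Real.rpow_one A]
    rw [← Real.rpow_mul hA.le, one_mul, ← Real.rpow_add hA]; ring_nf
  have e3 : (1 + c * ((B - A) / A)) * A ^ c = A ^ c + c * (B - A) * A ^ (c - 1) := by
    rw [e2]; field_simp
  rw [e3] at h
  linarith

theorem tail_quotient_mono (hσ : 1 ≤ σ) (hR : 0 ≤ R) {A B : ℝ} (hA : 0 < A) (hAB : A ≤ B) :
    A ^ σ / (R + A) ≤ B ^ σ / (R + B) := by
  have hB : 0 < B := hA.trans_le hAB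
  have e : ∀ t : ℝ, 0 < t → t ^ σ / (R + t) = t ^ (σ - 1) * (t / (R + t)) := fun t ht => by
    rw [Real.rpow_sub ht, Real.rpow_one]; field_simp
  rw [e A hA, e B hB]
  have h1 : A ^ (σ - 1) ≤ B ^ (σ - 1) := Real.rpow_le_rpow hA.le hAB (by linarith)
  have h2 : A / (R + A) ≤ B / (R + B) := by
    rw [div_le_div_iff₀ (by linarith) (by linarith)]; nlinarith
  have : 0 ≤ A / (R + A) := by positivity
  have : 0 ≤ B ^ (σ - 1) := by positivity
  gcongr

/-- Replacing the denominator R + B by R + A makes the subtracted term smaller, and what is left is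
a difference of powers. The factor σ + 1 does not involve R, and the tail estimates depend on this.
-/
theorem tail_sub_le (hσ : 1 ≤ σ) (hR : 0 ≤ R) {A B : ℝ} (hB : 0 < B) (hAB : B ≤ A) :
    |A ^ (σ + 1) / (R + A) - B ^ (σ + 1) / (R + B)| ≤ (σ + 1) * (A - B) * (A ^ σ / (R + A)) := by
  have hA : 0 < A := hB.trans_le hAB
  have e : ∀ t : ℝ, 0 < t → t ^ (σ + 1) / (R + t) = t ^ σ / (R + t) * t := fun t ht => by
    rw [Real.rpow_add ht, Real.rpow_one]; ring
  have mono : B ^ (σ + 1) / (R + B) ≤ A ^ (σ + 1) / (R + A) := by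
    rw [e A hA, e B hB]
    have := tail_quotient_mono hσ hR hB hAB
    gcongr
  rw [abs_of_nonneg (by linarith)]
  have h1 : B ^ (σ + 1) / (R + A) ≤ B ^ (σ + 1) / (R + B) := by gcongr
  have h2 := rpow_sub_rpow_le hB hAB (c := σ + 1) (by linarith)
  rw [add_sub_cancel_right] at h2
  calc _ ≤ A ^ (σ + 1) / (R + A) - B ^ (σ + 1) / (R + A) := by linarith
    _ = (A ^ (σ + 1) - B ^ (σ + 1)) / (R + A) := by ring
    _ ≤ ((σ + 1) * A ^ σ * (A - B)) / (R + A) := by gcongr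
    _ = _ := by ring

/-- The constant in the commutator estimate for the weights. -/
def weightConst (σ : ℝ) : ℝ := (σ + 1) * 2 ^ σ

/-- Both arguments of the weight have bracket at most 2B, where t^σ/(R+t), which is increasing,
costs at most a factor 2^σ compared with its value at B. The brackets themselves differ by at most
⟨x⟩. -/
theorem abs_tailWeight_sub_le_max (hσ : 1 ≤ σ) (hR : 0 ≤ R) (x y : ℝ) {B : ℝ} (hx : jap x ≤ B)
    (hy : jap y ≤ B) : |tailWeight σ R (x + y) - tailWeight σ R y| ≤
      weightConst σ * jap x * (B ^ σ / (R + B)) := by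
  have hB : 0 < B := (jap_pos x).trans_le hx
  have hq : ∀ t, 0 < t → t ≤ 2 * B → t ^ σ / (R + t) ≤ 2 ^ σ * (B ^ σ / (R + B)) := by
    intro t ht htB
    refine (tail_quotient_mono hσ hR ht htB).trans ?_
    rw [Real.mul_rpow two_pos.le hB.le, mul_div_assoc]
    gcongr; linarith
  have h1 := abs_jap_add_sub_le x y
  have h2 := abs_le_jap x
  have hs := jap_add_le x y
  have px := jap_pos x
  have hB' : 0 ≤ B ^ σ / (R + B) := by positivity
  rcases le_total (jap y) (jap (x + y)) with h | h
  · refine (tail_sub_le hσ hR (jap_pos y) h).trans ?_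
    rw [abs_of_nonneg (by linarith)] at h1
    calc _ ≤ (σ + 1) * jap x * (2 ^ σ * (B ^ σ / (R + B))) := by
          have := hq _ (jap_pos (x + y)) (by linarith)
          have : 0 ≤ jap (x + y) ^ σ / (R + jap (x + y)) := by
            have := jap_pos (x + y); positivity
          gcongr; linarith
      _ = _ := by rw [weightConst]; ring
  · rw [abs_sub_comm]
    refine (tail_sub_le hσ hR (jap_pos (x + y)) h).trans ?_
    rw [abs_of_nonpos (by linarith)] at h1
    calc _ ≤ (σ + 1) * jap x * (2 ^ σ * (B ^ σ / (R + B))) := by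
          have := hq _ (jap_pos y) (by linarith)
          have : 0 ≤ jap y ^ σ / (R + jap y) := by
            have := jap_pos y; positivity
          gcongr; linarith
      _ = _ := by rw [weightConst]; ring

theorem tail_quotient_eq (ξ : ℝ) :
    jap ξ ^ σ / (R + jap ξ) = tailWeight σ R ξ / jap ξ := by
  rw [tailWeight, Real.rpow_add (jap_pos ξ), Real.rpow_one]
  have := jap_pos ξ
  field_simp

/-- When y is the high frequency, the difference of weights gains ⟨y⟩^{-1}, which pays for the
derivative in the transport term. -/
theorem abs_tailWeight_sub_le_right (hσ : 1 ≤ σ) (hR : 0 ≤ R) {x y : ℝ} (h : jap x ≤ jap y) :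
    |tailWeight σ R (x + y) - tailWeight σ R y| ≤
      weightConst σ * jap x * (tailWeight σ R y / jap y) := by
  rw [← tail_quotient_eq]
  exact abs_tailWeight_sub_le_max hσ hR x y h le_rfl

theorem abs_tailWeight_sub_le_left (hσ : 1 ≤ σ) (hR : 0 ≤ R) {x y : ℝ} (h : jap y ≤ jap x) :
    |tailWeight σ R (x + y) - tailWeight σ R y| ≤ weightConst σ * tailWeight σ R x := by
  have := abs_tailWeight_sub_le_max hσ hR x y le_rfl h
  rw [tail_quotient_eq] at this
  refine this.trans_eq ?_
  have := jap_pos x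
  field_simp

theorem weightConst_nonneg (hσ : 1 ≤ σ) : 0 ≤ weightConst σ := by
  unfold weightConst; positivity

end tailWeight

/-! ### Trilinear estimates -/

theorem inner_mulOp_ofReal {w : ℝ → ℝ} {C : ℝ} (h : BddSymbol (ofRealSymbol w) C) (F G : L2) :
    inner ℂ (mulOp (ofRealSymbol w) F) G = inner ℂ F (mulOp (ofRealSymbol w) G) := by
  rw [L2.inner_def, L2.inner_def]
  refine integral_congr_ae ?_
  filter_upwards [coeFn_mulOp h F, coeFn_mulOp h G] with ξ h1 h2
  rw [h1, h2]
  simp only [RCLike.inner_apply, map_mul, ofRealSymbol, Complex.conj_ofReal]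
  ring

/-- The pairing is the integral of m w |F|², so only the sign of its real part matters. This gives
dissipativity of K in every Sobolev norm, without using the size of the symbol. -/
theorem re_inner_mulOp_nonpos {m : ℝ → ℂ} {w : ℝ → ℝ} {C C' : ℝ} (hm : BddSymbol m C)
    (hw : BddSymbol (ofRealSymbol w) C') (hre : ∀ ξ, (m ξ).re * w ξ ≤ 0) (F : L2) :
    (inner ℂ (mulOp (ofRealSymbol w) F) (mulOp m F)).re ≤ 0 := by
  rw [L2.inner_def, ← RCLike.re_eq_complex_re, ← integral_re (L2.integrable_inner _ _)]
  refine integral_nonpos_of_ae ?_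
  filter_upwards [coeFn_mulOp hm F, coeFn_mulOp hw F] with ξ h1 h2
  rw [h1, h2]
  simp only [RCLike.inner_apply, map_mul, ofRealSymbol, Complex.conj_ofReal, Pi.zero_apply]
  have e : m ξ * F ξ * (((w ξ : ℝ) : ℂ) * (starRingEnd ℂ) (F ξ))
      = ((w ξ * Complex.normSq (F ξ) : ℝ) : ℂ) * m ξ := by
    rw [Complex.ofReal_mul, ← Complex.mul_conj]; ring
  rw [e, RCLike.re_eq_complex_re, Complex.re_ofReal_mul]
  nlinarith [hre ξ, Complex.normSq_nonneg (F ξ)]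

theorem re_inner_le_norm_mul (F G : L2) : (inner ℂ F G).re ≤ ‖F‖ * ‖G‖ :=
  (Complex.re_le_norm _).trans (norm_inner_le_norm F G)

/-- Integration by parts for the transport term `-g e_x`, with a real regularizing multiplier
`ℓ`. -/
theorem re_inner_transport_le {a C Cℓ : ℝ} (ha : 1 / 2 < a) {ℓ γ : ℝ → ℝ}
    (hℓ : BddSymbol (ofRealSymbol ℓ) Cℓ) (hdℓ : ∀ y, |2 * Real.pi * y| * |ℓ y| ≤ C)
    (hγm : Measurable γ) (hγe : ∀ x, γ (-x) = γ x) (hγ : ∀ x, jap x * |γ x| ≤ jap x ^ (-a))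
    {g : L2} (hg : IsHerm g) (e : L2) :
    (inner ℂ (mulOp (ofRealSymbol ℓ) e)
      (bil (fun x y => burgersKernel x y * ((ℓ y * γ x : ℝ) : ℂ)) g e)).re ≤
      bilConst a / 2 * ‖g‖ * ‖mulOp (ofRealSymbol ℓ) e‖ ^ 2 := by
  have hCℓ := hℓ.nonneg
  have hC : 0 ≤ C := (mul_nonneg (abs_nonneg _) (abs_nonneg _)).trans (hdℓ 0)
  have mℓ : Measurable ℓ := by
    have := Complex.measurable_re.comp hℓ.meas
    simpa [Function.comp_def, ofRealSymbol] using this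
  have bℓ : ∀ x, |ℓ x| ≤ Cℓ := fun x => by simpa [ofRealSymbol] using hℓ.bound x
  have bγ : ∀ x, |γ x| ≤ jap x ^ (-a) := fun x =>
    (le_mul_of_one_le_left (abs_nonneg _) (one_le_jap x)).trans (hγ x)
  have bdγ : ∀ x, |2 * Real.pi * x| * |γ x| ≤ jap x ^ (-a) := fun x =>
    (mul_le_mul_of_nonneg_right (abs_le_jap x) (abs_nonneg _)).trans (hγ x)
  have adm : ∀ {w : ℝ → ℝ → ℝ} {D : ℝ}, Measurable (Function.uncurry w) → 0 ≤ D →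
      (∀ x y, |w x y| ≤ D * jap x ^ (-a)) →
      Adm a (fun x y => Complex.I * ((w x y : ℝ) : ℂ)) D := by
    intro w D hw hD hb
    refine ⟨measurable_const.mul (Complex.measurable_ofReal.comp hw), fun x y => ?_⟩
    rw [norm_mul, Complex.norm_I, one_mul, Complex.norm_real, Real.norm_eq_abs]
    refine (hb x y).trans (mul_le_mul_of_nonneg_left ?_ hD)
    linarith [jap_rpow_pos y (-a)]
  have e0 : (fun x y => burgersKernel x y * ((ℓ y * γ x : ℝ) : ℂ)) =
      fun x y => Complex.I * ((-(2 * Real.pi * y) * ℓ y * γ x : ℝ) : ℂ) := by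
    funext x y; simp only [burgersKernel]; push_cast; ring
  set κ1 : ℝ → ℝ → ℂ := fun x y =>
    Complex.I * ((-(2 * Real.pi * y) * ℓ y * ℓ (x + y) * γ x : ℝ) : ℂ) with hκ1
  set κ2 : ℝ → ℝ → ℂ := fun x y => (starRingEnd ℂ) (κ1 (-x) (x + y)) with hκ2
  set κ3 : ℝ → ℝ → ℂ := fun x y => Complex.I * ((2 * Real.pi * x * γ x : ℝ) : ℂ) with hκ3
  -- The bounds C and Cℓ of the regularizing multiplier only make the pairings finite. The final
  -- constant uses the bound 1 for `κ3`, which does not involve ℓ.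
  have a0 : Adm a (fun x y => Complex.I * ((-(2 * Real.pi * y) * ℓ y * γ x : ℝ) : ℂ)) C :=
    adm (w := fun x y => -(2 * Real.pi * y) * ℓ y * γ x)
      (by unfold Function.uncurry; fun_prop) hC fun x y => by
      rw [abs_mul, abs_mul, abs_neg]
      exact mul_le_mul (hdℓ y) (bγ x) (abs_nonneg _) hC
  have a1 : Adm a κ1 (C * Cℓ) :=
    adm (w := fun x y => -(2 * Real.pi * y) * ℓ y * ℓ (x + y) * γ x)
      (by unfold Function.uncurry; fun_prop) (by positivity) fun x y => by
      rw [abs_mul, abs_mul, abs_mul, abs_neg]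
      have := jap_rpow_pos x (-a)
      gcongr
      · exact hdℓ y
      · exact bℓ _
      · exact bγ x
  have e2 : κ2 = fun x y =>
      Complex.I * (((2 * Real.pi * (x + y)) * ℓ (x + y) * ℓ y * γ x : ℝ) : ℂ) := by
    funext x y
    simp only [hκ2, hκ1, map_mul, Complex.conj_I, Complex.conj_ofReal, hγe]
    rw [neg_add_cancel_left]
    push_cast; ring
  have a2 : Adm a κ2 (C * Cℓ) := by
    rw [e2]
    refine adm (w := fun x y => (2 * Real.pi * (x + y)) * ℓ (x + y) * ℓ y * γ x)
      (by unfold Function.uncurry; fun_prop) (by positivity) fun x y => ?_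
    rw [abs_mul, abs_mul, abs_mul]
    have := jap_rpow_pos x (-a)
    gcongr
    · exact hdℓ _
    · exact bℓ _
    · exact bγ x
  have a3 : Adm a κ3 1 :=
    adm (w := fun x _ => 2 * Real.pi * x * γ x)
      (by unfold Function.uncurry; fun_prop) zero_le_one fun x y => by
      rw [abs_mul, one_mul]; exact bdγ x
  set z := mulOp (ofRealSymbol ℓ) e with hz
  have s1 : inner ℂ z (bil (fun x y => burgersKernel x y * ((ℓ y * γ x : ℝ) : ℂ)) g e)
      = inner ℂ e (bil κ1 g e) := by
    rw [hz, inner_mulOp_ofReal hℓ, e0, a0.mulOp_bil ha hℓ]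
    congr 2
    funext x y
    simp only [ofRealSymbol, hκ1]; push_cast; ring
  -- The integration by parts: the kernels of the operator and of its adjoint carry the factors -y
  -- and x + y, whose sum is x. The derivative has moved from e to g, and ℓ(y)ℓ(x+y) is absorbed
  -- into the two copies of z.
  have s2 : inner ℂ e (bil κ1 g e) + inner ℂ e (bil κ2 g e) = inner ℂ z (bil κ3 g z) := by
    rw [← inner_add_right, ← a1.bil_kernel_add a2 ha, hz, inner_mulOp_ofReal hℓ,
      bil_mulOp_right _ hℓ]
    have a4 : Adm a (fun x y => κ3 x y * ofRealSymbol ℓ y) (Cℓ * 1) :=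
      a3.of_le (a3.meas.mul (hℓ.meas.comp measurable_snd)) (fun x y => by
        rw [norm_mul, mul_comm]; gcongr; exact hℓ.bound y) hCℓ
    rw [a4.mulOp_bil ha hℓ]
    congr 2
    funext x y
    simp only [e2, hκ1, hκ3, ofRealSymbol]; push_cast; ring
  have s3 := re_inner_bil a1 ha a2 hg e
  have s4 := congrArg Complex.re s2
  rw [Complex.add_re] at s4
  have s5 := re_inner_le_norm_mul z (bil κ3 g z)
  have s6 := a3.norm_bil_le ha g z
  have s7 : ‖z‖ * ‖bil κ3 g z‖ ≤ ‖z‖ * (1 * bilConst a * ‖g‖ * ‖z‖) := by gcongr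
  rw [s1]
  have : bilConst a / 2 * ‖g‖ * ‖z‖ ^ 2 = (‖z‖ * (1 * bilConst a * ‖g‖ * ‖z‖)) / 2 := by ring
  rw [this]
  linarith

/-- The constant in the estimate for the transport term. -/
def transportConst (r : ℝ) : ℝ := (1 / 2 + weightConst r) * bilConst (r - 1)

theorem transportConst_nonneg {r : ℝ} (hr : 3 / 2 < r) : 0 ≤ transportConst r := by
  have := bilConst_nonneg (r - 1)
  have := weightConst_nonneg (σ := r) (by linarith)
  unfold transportConst; positivity

/-- The energy estimate for the transport term `-g e_x` in `H^r`. Here `g` and `e` are given as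
elements of `H^{r+m}`. -/
theorem re_inner_burgers_le {r m : ℝ} (hr : 3 / 2 < r) (hm : 1 ≤ m) {g : L2} (hg : IsHerm g)
    (e : L2) :
    (inner ℂ (lower m e) (bil (atLevel burgersKernel (r + m) (r + m) r) g e)).re ≤
      transportConst r * ‖g‖ * ‖lower m e‖ ^ 2 := by
  have ha : 1 / 2 < r - 1 := by linarith
  have hℓ := bddSymbol_lower (a := m) (by linarith)
  set ℓ : ℝ → ℝ := fun ξ => jap ξ ^ (-m) with hℓdef
  set γ : ℝ → ℝ := fun ξ => jap ξ ^ (-(r + m)) with hγdef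
  have hγ : ∀ x, jap x * |γ x| ≤ jap x ^ (-(r - 1)) := fun x => by
    rw [hγdef]; simp only
    rw [abs_of_pos (jap_rpow_pos _ _)]
    calc jap x * jap x ^ (-(r + m)) = jap x ^ (1 + -(r + m)) := by
          rw [Real.rpow_add (jap_pos x), Real.rpow_one]
      _ ≤ _ := jap_rpow_mono (by linarith) x
  have hdℓ : ∀ y, |2 * Real.pi * y| * |ℓ y| ≤ 1 := fun y => by
    rw [hℓdef]; simp only
    rw [abs_of_pos (jap_rpow_pos _ _)]
    calc _ ≤ jap y ^ (1 : ℝ) * jap y ^ (-m) := by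
          rw [Real.rpow_one]
          exact mul_le_mul_of_nonneg_right (abs_le_jap y) (jap_rpow_pos _ _).le
      _ = jap y ^ (1 + -m) := (Real.rpow_add (jap_pos y) _ _).symm
      _ ≤ 1 := jap_rpow_le_one (by linarith) y
  have hp := re_inner_transport_le ha hℓ hdℓ (by fun_prop) (fun x => by simp [hγdef, jap_neg]) hγ
    hg e
  -- Write ⟨x+y⟩^r = ⟨y⟩^r + (⟨x+y⟩^r - ⟨y⟩^r). The first part is the pure transport kernel `κ1`,
  -- covered by `re_inner_transport_le`. The difference gives the commutator kernel `κ2`, which is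
  -- bounded because the difference of weights absorbs the derivative.
  set κ1 : ℝ → ℝ → ℂ := fun x y => burgersKernel x y * ((ℓ y * γ x : ℝ) : ℂ) with hκ1
  set κ2 : ℝ → ℝ → ℂ := fun x y => burgersKernel x y *
    (((tailWeight r 0 (x + y) - tailWeight r 0 y) / tailWeight r 0 y * γ x : ℝ) : ℂ) with hκ2
  have mb := measurable_burgersKernel
  have a1 : Adm (r - 1) κ1 1 := by
    refine ⟨mb.mul (Complex.measurable_ofReal.comp
      (f := fun q : ℝ × ℝ => ℓ q.2 * γ q.1) (by fun_prop)), fun x y => ?_⟩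
    rw [hκ1]; simp only
    rw [norm_mul, norm_burgersKernel, Complex.norm_real, Real.norm_eq_abs, abs_mul (ℓ y), ← mul_assoc]
    have h2 : |γ x| ≤ jap x ^ (-(r - 1)) :=
      (le_mul_of_one_le_left (abs_nonneg _) (one_le_jap x)).trans (hγ x)
    have := jap_rpow_pos y (-(r - 1))
    calc _ ≤ 1 * jap x ^ (-(r - 1)) := mul_le_mul (hdℓ y) h2 (abs_nonneg _) zero_le_one
      _ ≤ _ := by linarith
  have hW := weightConst_nonneg (σ := r) (by linarith)
  have a2 : Adm (r - 1) κ2 (weightConst r) := by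
    refine ⟨mb.mul (Complex.measurable_ofReal.comp
      (f := fun q : ℝ × ℝ => (tailWeight r 0 (q.1 + q.2) - tailWeight r 0 q.2) /
        tailWeight r 0 q.2 * γ q.1) (by fun_prop)), fun x y => ?_⟩
    rw [hκ2]; simp only
    have px := jap_rpow_pos x (-(r - 1))
    have py := jap_rpow_pos y (-(r - 1))
    have jx := jap_pos x
    have jy := jap_pos y
    have tw := tailWeight_pos (σ := r) le_rfl y
    rw [norm_mul, Complex.norm_real, Real.norm_eq_abs, abs_mul, abs_div, abs_of_pos tw]
    have hb := norm_burgersKernel_le x y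
    rcases le_total (jap x) (jap y) with h | h
    · have h1 := abs_tailWeight_sub_le_right (σ := r) (R := 0) (by linarith) le_rfl h
      calc _ ≤ jap y * ((weightConst r * jap x * (tailWeight r 0 y / jap y)) /
            tailWeight r 0 y * |γ x|) := by gcongr
        _ = weightConst r * (jap x * |γ x|) := by field_simp
        _ ≤ weightConst r * jap x ^ (-(r - 1)) := by gcongr; exact hγ x
        _ ≤ _ := by gcongr; linarith
    · have h1 := abs_tailWeight_sub_le_left (σ := r) (R := 0) (by linarith) le_rfl h
      simp only [tailWeight_zero] at h1 tw ⊢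
      calc _ ≤ jap y * ((weightConst r * jap x ^ r) / jap y ^ r * |γ x|) := by gcongr
        _ = weightConst r * (jap x ^ r * |γ x|) * (jap y / jap y ^ r) := by field_simp
        _ ≤ weightConst r * 1 * jap y ^ (-(r - 1)) := by
          have e1 : jap x ^ r * |γ x| ≤ 1 := by
            rw [hγdef]; simp only
            rw [abs_of_pos (jap_rpow_pos _ _), ← Real.rpow_add jx]
            exact jap_rpow_le_one (by linarith) x
          have e2 : jap y / jap y ^ r = jap y ^ (-(r - 1)) := by
            rw [neg_sub, Real.rpow_sub jy, Real.rpow_one]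
          rw [e2]; gcongr
        _ ≤ _ := by rw [mul_one]; gcongr; linarith
  have split : bil (atLevel burgersKernel (r + m) (r + m) r) g e =
      bil κ1 g e + bil κ2 g (lower m e) := by
    have a3 : Adm (r - 1) (fun x y => κ2 x y * ofRealSymbol ℓ y) (1 * weightConst r) :=
      a2.of_le (a2.meas.mul (hℓ.meas.comp measurable_snd)) (fun x y => by
        rw [norm_mul, mul_comm]; gcongr; exact hℓ.bound y) zero_le_one
    rw [lower, bil_mulOp_right _ hℓ, ← a1.bil_kernel_add a3 ha]
    congr 1
    funext x y
    simp only [atLevel, levelWeight, hκ1, hκ2, tailWeight_zero, ofRealSymbol, hℓdef, hγdef]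
    have e1 : jap y ^ (-(r + m)) = jap y ^ (-m) / jap y ^ r := by
      rw [div_eq_mul_inv, ← Real.rpow_neg (jap_pos y).le, ← Real.rpow_add (jap_pos y)]
      ring_nf
    have := (jap_rpow_pos y r).ne'
    have e2 : jap (x + y) ^ r * jap x ^ (-(r + m)) * jap y ^ (-(r + m)) =
        jap y ^ (-m) * jap x ^ (-(r + m)) + (jap (x + y) ^ r - jap y ^ r) / jap y ^ r *
          jap x ^ (-(r + m)) * jap y ^ (-m) := by
      rw [e1]; field_simp; ring
    rw [e2]; push_cast; ring
  rw [split, inner_add_right, Complex.add_re]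
  have h2 : (inner ℂ (lower m e) (bil κ2 g (lower m e))).re ≤
      ‖lower m e‖ * (weightConst r * bilConst (r - 1) * ‖g‖ * ‖lower m e‖) :=
    (re_inner_le_norm_mul _ _).trans (by gcongr; exact a2.norm_bil_le ha g _)
  have h1 : (inner ℂ (lower m e) (bil κ1 g e)).re ≤
      bilConst (r - 1) / 2 * ‖g‖ * ‖lower m e‖ ^ 2 := hp
  rw [transportConst]
  linarith

/-! ### Grönwall -/

/-- Grönwall's inequality for the square root of `f`. -/
theorem sqrt_le_of_deriv_le {f f' : ℝ → ℝ} {a b C S : ℝ} (hC : 0 ≤ C) (hS : 0 ≤ S)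
    (hf0 : ∀ t ∈ Icc a b, 0 ≤ f t) (hfc : ContinuousOn f (Icc a b))
    (hf : ∀ t ∈ Ioo a b, HasDerivAt f (f' t) t)
    (hle : ∀ t ∈ Ioo a b, f' t ≤ 2 * C * f t + 2 * S * Real.sqrt (f t)) :
    ∀ t ∈ Icc a b, Real.sqrt (f t) ≤
      Real.exp (C * (t - a)) * (Real.sqrt (f a) + S * (t - a)) := by
  intro t ht
  -- The square root is not differentiable at 0, so f is replaced by f + ε and ε tends to 0 at the
  -- end.
  have key : ∀ ε : ℝ, 0 < ε → Real.sqrt (f t) ≤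
      Real.exp (C * (t - a)) * (Real.sqrt (f a + ε) + S * (t - a)) := by
    intro ε hε
    have pos : ∀ x ∈ Icc a b, 0 < f x + ε := fun x hx => by linarith [hf0 x hx]
    set G : ℝ → ℝ := fun x => Real.exp (-(C * (x - a))) * Real.sqrt (f x + ε) - S * (x - a)
    have anti : AntitoneOn G (Icc a b) := by
      apply antitoneOn_of_hasDerivWithinAt_nonpos (convex_Icc a b)
        (f' := fun x => (Real.exp (-(C * (x - a))) * (-(C * 1))) * Real.sqrt (f x + ε) +
          Real.exp (-(C * (x - a))) * (f' x / (2 * Real.sqrt (f x + ε))) - S * 1)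
      · have : ContinuousOn (fun x => Real.sqrt (f x + ε)) (Icc a b) :=
          (hfc.add continuousOn_const).sqrt
        exact ((by fun_prop : Continuous fun x => Real.exp (-(C * (x - a)))).continuousOn.mul
          this).sub (by fun_prop)
      · intro x hx
        rw [interior_Icc] at hx
        have h1 : HasDerivAt (fun x => Real.exp (-(C * (x - a))))
            (Real.exp (-(C * (x - a))) * (-(C * 1))) x :=
          ((((hasDerivAt_id x).sub_const a).const_mul C).neg).exp
        have h2 := (((hf x hx).add_const ε).sqrt (pos x (Ioo_subset_Icc_self hx)).ne')
        have h3 := ((hasDerivAt_id x).sub_const a).const_mul S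
        exact ((h1.mul h2).sub h3).hasDerivWithinAt
      · intro x hx
        rw [interior_Icc] at hx
        have px := pos x (Ioo_subset_Icc_self hx)
        have f0 := hf0 x (Ioo_subset_Icc_self hx)
        set q := Real.sqrt (f x + ε) with hq
        have hq0 : 0 < q := Real.sqrt_pos.2 px
        have hqq : q ^ 2 = f x + ε := Real.sq_sqrt px.le
        have hsq : Real.sqrt (f x) ≤ q := Real.sqrt_le_sqrt (by linarith)
        have hE : 0 < Real.exp (-(C * (x - a))) := Real.exp_pos _
        have hE1 : Real.exp (-(C * (x - a))) ≤ 1 :=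
          Real.exp_le_one_iff.2 (by have := hx.1; nlinarith)
        have hd : f' x / (2 * q) ≤ C * q + S := by
          rw [div_le_iff₀ (by positivity)]
          have := hle x hx
          nlinarith [mul_nonneg hS hq0.le, mul_le_mul_of_nonneg_left hsq hS,
            mul_nonneg hC hε.le]
        have := mul_le_mul_of_nonneg_left hd hE.le
        nlinarith
    have hGt := anti (left_mem_Icc.2 (ht.1.trans ht.2)) ht ht.1
    simp only [G, sub_self, mul_zero, neg_zero, Real.exp_zero, one_mul, sub_zero] at hGt
    have hE : Real.exp (C * (t - a)) * Real.exp (-(C * (t - a))) = 1 := by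
      rw [← Real.exp_add]; simp
    calc Real.sqrt (f t) ≤ Real.sqrt (f t + ε) := Real.sqrt_le_sqrt (by linarith)
      _ = Real.exp (C * (t - a)) * (Real.exp (-(C * (t - a))) * Real.sqrt (f t + ε)) := by
        rw [← mul_assoc, hE, one_mul]
      _ ≤ _ := by gcongr; linarith
  have hlim : Filter.Tendsto (fun ε : ℝ => Real.exp (C * (t - a)) *
      (Real.sqrt (f a + ε) + S * (t - a))) (nhdsWithin 0 (Ioi 0))
      (nhds (Real.exp (C * (t - a)) * (Real.sqrt (f a + 0) + S * (t - a)))) := by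
    refine Filter.Tendsto.mono_left ?_ nhdsWithin_le_nhds
    exact Continuous.tendsto (by fun_prop) 0
  rw [add_zero] at hlim
  exact ge_of_tendsto hlim (Filter.eventually_of_mem self_mem_nhdsWithin fun ε hε => key ε hε)

theorem hasDerivAt_norm_sq {y : ℝ → L2} {y' : L2} {t : ℝ} (h : HasDerivAt y y' t) :
    HasDerivAt (fun s => ‖y s‖ ^ 2) (2 * (inner ℂ (y t) y').re) t := by
  have h1 := h.inner ℂ h
  have h2 := (Complex.reCLM.hasFDerivAt.comp_hasDerivAt t h1)
  have e : (fun s => ‖y s‖ ^ 2) = Complex.reCLM ∘ fun s => inner ℂ (y s) (y s) := by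
    funext s
    simp only [Function.comp_apply, Complex.reCLM_apply]
    rw [← RCLike.re_eq_complex_re, ← norm_sq_eq_re_inner]
  rw [e]
  refine h2.congr_deriv ?_
  simp only [Complex.reCLM_apply, Complex.add_re]
  rw [← inner_conj_symm (𝕜 := ℂ) y' (y t)]
  simp only [Complex.conj_re]; ring

/-- The energy method in `L²`. -/
theorem norm_le_of_re_inner_le {y y' : ℝ → L2} {a b C S : ℝ} (hC : 0 ≤ C) (hS : 0 ≤ S)
    (hyc : ContinuousOn y (Icc a b)) (hy : ∀ t ∈ Ioo a b, HasDerivAt y (y' t) t)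
    (hle : ∀ t ∈ Ioo a b, (inner ℂ (y t) (y' t)).re ≤ C * ‖y t‖ ^ 2 + S * ‖y t‖) :
    ∀ t ∈ Icc a b, ‖y t‖ ≤ Real.exp (C * (t - a)) * (‖y a‖ + S * (t - a)) := by
  have h := sqrt_le_of_deriv_le (f := fun t => ‖y t‖ ^ 2) (a := a) (b := b) hC hS
    (fun t _ => by positivity) (hyc.norm.pow 2) (fun t ht => hasDerivAt_norm_sq (hy t ht))
    (fun t ht => by rw [Real.sqrt_sq (norm_nonneg _)]; linarith [hle t ht])
  simpa only [Real.sqrt_sq (norm_nonneg _)] using h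

/-! ### Stability of the full equation -/

/-- The symbol of the dispersion as a bounded operator from `H^{σ+m}` to `H^σ`. -/
def dispSymbol (k : ℝ → ℂ) (m : ℝ) (ξ : ℝ) : ℂ := ((jap ξ ^ (-m) : ℝ) : ℂ) * freqSymbol k ξ

theorem bddSymbol_dispSymbol {p M m : ℝ} {k : ℝ → ℂ} (hk : IsAdmissibleSymbol p M k)
    (hpm : p ≤ m) : BddSymbol (dispSymbol k m) M := by
  refine ⟨(Complex.measurable_ofReal.comp (by fun_prop)).mul (measurable_freqSymbol hk),
    fun ξ => ?_⟩
  rw [dispSymbol, norm_mul, Complex.norm_real, Real.norm_of_nonneg (jap_rpow_pos _ _).le]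
  calc _ ≤ jap ξ ^ (-m) * (M * jap ξ ^ m) := by
        have := jap_rpow_pos ξ (-m)
        gcongr; exact norm_freqSymbol_le hk hpm ξ
    _ = M * (jap ξ ^ (-m) * jap ξ ^ m) := by ring
    _ = M := by rw [← Real.rpow_add (jap_pos ξ)]; simp

/-- The constant in the stability estimate. -/
def stabConst (r M B : ℝ) : ℝ :=
  2 * B * (transportConst r + 2 ^ (r + 1) * bilConst (r - 1)) + M + 1

theorem stabConst_nonneg {r M B : ℝ} (hr : 3 / 2 < r) (hM : 0 ≤ M) (hB : 0 ≤ B) :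
    0 ≤ stabConst r M B := by
  have := transportConst_nonneg hr
  have := bilConst_nonneg (r - 1)
  unfold stabConst; positivity

/-- Stability: `f`, `g` and `j` are curves in `H^{r+m}`, and the difference `f - g - j`, in `H^r`,
satisfies the difference of the equations of `f` and `g` up to the error `ρ`. -/
theorem stability {r m p M B S : ℝ} {k : ℝ → ℂ} (hr : 3 / 2 < r) (hm : 1 ≤ m) (hpm : p ≤ m)
    (hk : IsAdmissibleSymbol p M k) {a b : ℝ} {f g j ρ : ℝ → L2} (hS : 0 ≤ S)
    (hB : 0 ≤ B) (hf : ∀ t ∈ Icc a b, ‖f t‖ ≤ B) (hg : ∀ t ∈ Icc a b, ‖g t‖ ≤ B)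
    (hgh : ∀ t ∈ Icc a b, IsHerm (g t)) (hj : ∀ t ∈ Ioo a b, ‖j t‖ ≤ S)
    (hρ : ∀ t ∈ Ioo a b, ‖ρ t‖ ≤ S)
    (hc : ContinuousOn (fun t => lower m (f t - g t - j t)) (Icc a b))
    (hd : ∀ t ∈ Ioo a b, HasDerivAt (fun t => lower m (f t - g t - j t))
      (mulOp (dispSymbol k m) (f t - g t - j t) +
        (bil (atLevel burgersKernel (r + m) (r + m) r) (f t) (f t) -
          bil (atLevel burgersKernel (r + m) (r + m) r) (g t) (g t)) + ρ t) t) :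
    ∀ t ∈ Icc a b, ‖lower m (f t - g t - j t)‖ ≤ Real.exp (stabConst r M B * (t - a)) *
      (‖lower m (f a - g a - j a)‖ + stabConst r M B * S * (t - a)) := by
  have ha : 1 / 2 < r - 1 := by linarith
  have hM := hk.M_nonneg
  have hK := stabConst_nonneg hr hM hB
  set κ := atLevel burgersKernel (r + m) (r + m) r with hκ
  have aκ : Adm (r - 1) κ (2 ^ (r + 1)) :=
    adm_burgers (by linarith) (by linarith) (by linarith) (by linarith) (by linarith)
  have aκ' : Adm (r - 1) (atLevel burgersKernel r (r + m) r) (2 ^ (r + 1)) :=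
    adm_burgers (by linarith) (by linarith) (by linarith) (by linarith) (by linarith)
  have hT := transportConst_nonneg hr
  have hb := bilConst_nonneg (r - 1)
  have h2 : (0 : ℝ) < 2 ^ (r + 1) := by positivity
  refine norm_le_of_re_inner_le hK (mul_nonneg hK hS) hc hd fun t ht => ?_
  have ht' := Ioo_subset_Icc_self ht
  set E := f t - g t - j t with hE
  have hfg : f t - g t = E + j t := by rw [hE]; abel
  -- Substituting f - g = E + j in the difference of squares gives three kinds of terms. In the
  -- first the undifferentiated factor is E, which is bounded in terms of the H^r norm. In the
  -- second E is transported by g, which needs the energy estimate. The terms with j are bounded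
  -- directly, since j is controlled in H^{r+m}.
  have split : bil κ (f t) (f t) - bil κ (g t) (g t) =
      bil (atLevel burgersKernel r (r + m) r) (lower m E) (f t) + bil κ (g t) E +
        (bil κ (j t) (f t) + bil κ (g t) (j t)) := by
    have e1 : bil κ (f t) (f t) - bil κ (g t) (g t) =
        bil κ (f t - g t) (f t) + bil κ (g t) (f t - g t) := by
      rw [aκ.bil_sub_left ha, aκ.bil_sub_right ha]; abel
    rw [e1, hfg, aκ.bil_add_left ha, aκ.bil_add_right ha, bil_lower_left (by linarith)]
    abel
  rw [split]
  simp only [inner_add_right, Complex.add_re]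
  have i1 : (inner ℂ (lower m E) (mulOp (dispSymbol k m) E)).re ≤ 0 :=
    re_inner_mulOp_nonpos (bddSymbol_dispSymbol hk hpm) (bddSymbol_lower (by linarith))
      (fun ξ => by
        rw [dispSymbol, Complex.re_ofReal_mul]
        have h1 := jap_rpow_pos ξ (-m)
        have h2 := re_freqSymbol hk ξ
        nlinarith [mul_pos h1 h1]) E
  have n := norm_nonneg (lower m E)
  have i2 : (inner ℂ (lower m E)
      (bil (atLevel burgersKernel r (r + m) r) (lower m E) (f t))).re ≤
      ‖lower m E‖ * (2 ^ (r + 1) * bilConst (r - 1) * ‖lower m E‖ * B) :=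
    (re_inner_le_norm_mul _ _).trans (by
      refine mul_le_mul_of_nonneg_left ((aκ'.norm_bil_le ha _ _).trans ?_) n
      gcongr; exact hf t ht')
  have i3 : (inner ℂ (lower m E) (bil κ (g t) E)).re ≤ transportConst r * B * ‖lower m E‖ ^ 2 :=
    (re_inner_burgers_le hr hm (hgh t ht') E).trans (by gcongr; exact hg t ht')
  have i4 : (inner ℂ (lower m E) (bil κ (j t) (f t))).re ≤
      ‖lower m E‖ * (2 ^ (r + 1) * bilConst (r - 1) * S * B) :=
    (re_inner_le_norm_mul _ _).trans (by
      refine mul_le_mul_of_nonneg_left ((aκ.norm_bil_le ha _ _).trans ?_) n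
      gcongr
      · exact hj t ht
      · exact hf t ht')
  have i5 : (inner ℂ (lower m E) (bil κ (g t) (j t))).re ≤
      ‖lower m E‖ * (2 ^ (r + 1) * bilConst (r - 1) * B * S) :=
    (re_inner_le_norm_mul _ _).trans (by
      refine mul_le_mul_of_nonneg_left ((aκ.norm_bil_le ha _ _).trans ?_) n
      gcongr
      · exact hg t ht'
      · exact hj t ht)
  have i6 : (inner ℂ (lower m E) (ρ t)).re ≤ ‖lower m E‖ * S :=
    (re_inner_le_norm_mul _ _).trans (by gcongr; exact hρ t ht)
  have k1 : ‖lower m E‖ * (2 ^ (r + 1) * bilConst (r - 1) * ‖lower m E‖ * B) +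
      transportConst r * B * ‖lower m E‖ ^ 2 ≤ stabConst r M B * ‖lower m E‖ ^ 2 := by
    have : 0 ≤ (B * (transportConst r + 2 ^ (r + 1) * bilConst (r - 1)) + M + 1) *
      ‖lower m E‖ ^ 2 := by positivity
    rw [stabConst]; linarith
  have k2 : ‖lower m E‖ * (2 ^ (r + 1) * bilConst (r - 1) * S * B) +
      ‖lower m E‖ * (2 ^ (r + 1) * bilConst (r - 1) * B * S) + ‖lower m E‖ * S ≤
      stabConst r M B * S * ‖lower m E‖ := by
    have : 0 ≤ (2 * B * transportConst r + M) * (S * ‖lower m E‖) := by positivity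
    rw [stabConst]; linarith
  linarith

/-! ### Calculus of curves in `L²` -/

/-- `mulOp m` as a real-linear operator. -/
def mulOpR (m : ℝ → ℂ) : L2 →L[ℝ] L2 :=
  LinearMap.mkContinuous
    { toFun := mulOp m
      map_add' := map_add _
      map_smul' := fun c F => by
        rw [RingHom.id_apply, real_smul_eq, real_smul_eq, map_smul] } ‖mulOp m‖
    (mulOp m).le_opNorm

theorem hasDerivWithinAt_mulOp (m : ℝ → ℂ) {y : ℝ → L2} {y' : L2} {s : Set ℝ} {t : ℝ}
    (h : HasDerivWithinAt y y' s t) :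
    HasDerivWithinAt (fun r => mulOp m (y r)) (mulOp m y') s t :=
  (mulOpR m).hasFDerivAt.comp_hasDerivWithinAt t h

theorem hasDerivAt_mulOp (m : ℝ → ℂ) {y : ℝ → L2} {y' : L2} {t : ℝ}
    (h : HasDerivAt y y' t) : HasDerivAt (fun r => mulOp m (y r)) (mulOp m y') t :=
  (mulOpR m).hasFDerivAt.comp_hasDerivAt t h

theorem mulOp_real_smul (m : ℝ → ℂ) (c : ℝ) (F : L2) : mulOp m (c • F) = c • mulOp m F :=
  (mulOpR m).map_smul c F

theorem eq_zero_of_hasDerivAt_zero {y : ℝ → L2} {a b : ℝ} (hyc : ContinuousOn y (Icc a b))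
    (hy : ∀ t ∈ Ioo a b, HasDerivAt y 0 t) (h0 : y a = 0) : ∀ t ∈ Icc a b, y t = 0 := by
  intro t ht
  have h := norm_le_of_re_inner_le (C := 0) (S := 0) le_rfl le_rfl hyc hy
    (fun t _ => by simp) t ht
  simpa [h0] using h

/-- A primitive of a curve which is continuous on an interval. -/
def primitive (a b : ℝ) (z : ℝ → L2) (t : ℝ) : L2 :=
  if h : a ≤ b then ∫ s in a..t, IccExtend h ((Icc a b).domRestrict z) s else 0

theorem hasDerivAt_primitive_aux {a b : ℝ} (h : a ≤ b) {z : ℝ → L2}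
    (hz : ContinuousOn z (Icc a b)) (t : ℝ) :
    HasDerivAt (primitive a b z) (IccExtend h ((Icc a b).domRestrict z) t) t := by
  have hc : Continuous (IccExtend h ((Icc a b).domRestrict z)) :=
    (continuousOn_iff_continuous_domRestrict.1 hz).Icc_extend'
  have e : primitive a b z = fun t => ∫ s in a..t, IccExtend h ((Icc a b).domRestrict z) s := by
    funext t; simp [primitive, h]
  rw [e]
  exact intervalIntegral.integral_hasDerivAt_right (hc.intervalIntegrable _ _)
    (hc.stronglyMeasurableAtFilter _ _) hc.continuousAt

theorem hasDerivAt_primitive {a b : ℝ} {z : ℝ → L2}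
    (hz : ContinuousOn z (Icc a b)) {t : ℝ} (ht : t ∈ Icc a b) :
    HasDerivAt (primitive a b z) (z t) t := by
  have h := hasDerivAt_primitive_aux (ht.1.trans ht.2) hz t
  rwa [IccExtend_of_mem _ _ ht] at h

theorem primitive_left (a b : ℝ) (z : ℝ → L2) : primitive a b z a = 0 := by
  unfold primitive; split_ifs <;> simp

/-- A curve which is differentiable in a weak norm, with a derivative which is continuous in a
strong norm, is differentiable in the strong norm. -/
theorem hasDerivWithinAt_of_mulOp {m : ℝ → ℂ} {C : ℝ} (hm : BddSymbol m C)
    (hm0 : ∀ ξ, m ξ ≠ 0) {x z : ℝ → L2} {a b : ℝ} (hx : ContinuousOn x (Icc a b))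
    (hz : ContinuousOn z (Icc a b))
    (hd : ∀ t ∈ Ioo a b, HasDerivAt (fun r => mulOp m (x r)) (mulOp m (z t)) t)
    {t : ℝ} (ht : t ∈ Icc a b) : HasDerivWithinAt x (z t) (Icc a b) t := by
  have hP : ContinuousOn (primitive a b z) (Icc a b) := fun t ht =>
    (hasDerivAt_primitive hz ht).continuousAt.continuousWithinAt
  -- The primitive of z is formed in the strong norm. In the weak norm it has the same derivative as
  -- x, so the two differ by a constant there, and injectivity of the multiplier carries the
  -- identity back.
  have key : ∀ t ∈ Icc a b, mulOp m (x t - x a - primitive a b z t) = 0 := by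
    refine eq_zero_of_hasDerivAt_zero
      (((mulOp m).continuous.comp_continuousOn ((hx.sub continuousOn_const).sub hP))) ?_ ?_
    · intro t ht
      have h1 := hasDerivAt_mulOp m (hasDerivAt_primitive hz (Ioo_subset_Icc_self ht))
      have h2 := ((hd t ht).sub_const (mulOp m (x a))).sub h1
      rw [sub_self] at h2
      refine h2.congr_of_eventuallyEq (Filter.Eventually.of_forall fun r => ?_)
      simp only [map_sub]
      rfl
    · simp [primitive_left]
  have e : ∀ t ∈ Icc a b, x t = x a + primitive a b z t := fun t ht => by
    have h1 := mulOp_injective hm hm0 ((key t ht).trans (map_zero _).symm)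
    rw [sub_sub, sub_eq_zero] at h1; exact h1
  exact ((hasDerivAt_primitive hz ht).hasDerivWithinAt.const_add (x a)).congr e (e t ht)

/-! ### Truncated ordinary differential equations -/

section truncated
variable {E : Type*} [NormedAddCommGroup E] [NormedSpace ℝ E]

/-- The cut-off `1` on `[0, 2B]` and `0` on `[3B, ∞)`. -/
def clampCutoff (B x : ℝ) : ℝ := max 0 (min 1 (3 - x / B))

theorem clampCutoff_nonneg (B x : ℝ) : 0 ≤ clampCutoff B x := le_max_left _ _

theorem clampCutoff_le_one (B x : ℝ) : clampCutoff B x ≤ 1 :=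
  max_le zero_le_one (min_le_left _ _)

theorem clampCutoff_eq_one {B x : ℝ} (hB : 0 < B) (hx : x ≤ 2 * B) : clampCutoff B x = 1 := by
  have : x / B ≤ 2 := by rw [div_le_iff₀ hB]; linarith
  unfold clampCutoff
  rw [min_eq_left (by linarith), max_eq_right zero_le_one]

theorem clampCutoff_eq_zero {B x : ℝ} (hB : 0 < B) (hx : 3 * B ≤ x) : clampCutoff B x = 0 := by
  have : 3 ≤ x / B := by rw [le_div_iff₀ hB]; linarith
  unfold clampCutoff
  exact max_eq_left ((min_le_right _ _).trans (by linarith))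

theorem abs_clampCutoff_sub_le {B : ℝ} (hB : 0 < B) (x y : ℝ) :
    |clampCutoff B x - clampCutoff B y| ≤ |x - y| / B := by
  unfold clampCutoff
  have h1 := abs_max_sub_max_le_max 0 (min 1 (3 - x / B)) 0 (min 1 (3 - y / B))
  have h2 := abs_min_sub_min_le_max 1 (3 - x / B) 1 (3 - y / B)
  have h3 : |3 - x / B - (3 - y / B)| = |x - y| / B := by
    rw [← abs_of_pos hB, ← abs_div, abs_of_pos hB, ← abs_neg]; congr 1; field_simp; ring
  simp only [sub_self, abs_zero] at h1 h2
  rw [h3] at h2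
  have h4 : 0 ≤ |x - y| / B := by positivity
  rw [max_eq_right (abs_nonneg (min 1 (3 - x / B) - min 1 (3 - y / B)))] at h1
  rw [max_eq_right h4] at h2
  exact h1.trans h2

/-- The vector field `f`, cut off outside a ball. -/
def truncField (B : ℝ) (f : E → E) (Z : E) : E := clampCutoff B ‖Z‖ • f Z

variable {B L K : ℝ} {f : E → E}

theorem norm_truncField_le (hB : 0 < B) (hL : 0 ≤ L) (hf : ∀ Z, ‖Z‖ ≤ 3 * B → ‖f Z‖ ≤ L) (Z : E) :
    ‖truncField B f Z‖ ≤ L := by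
  rw [truncField, norm_smul, Real.norm_of_nonneg (clampCutoff_nonneg _ _)]
  rcases le_total ‖Z‖ (3 * B) with h | h
  · exact (mul_le_of_le_one_left (norm_nonneg _) (clampCutoff_le_one _ _)).trans (hf Z h)
  · rw [clampCutoff_eq_zero hB h, zero_mul]; exact hL

/-- If W lies in the ball of radius 3B, write the difference as χ(Z)(f Z - f W) + (χ(Z) - χ(W)) f W,
which gives K and L/B. By symmetry one point in the ball suffices, and if both lie outside both
values vanish. -/
theorem norm_truncField_sub_le (hB : 0 < B) (hL : 0 ≤ L) (hK : 0 ≤ K)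
    (hf : ∀ Z, ‖Z‖ ≤ 3 * B → ‖f Z‖ ≤ L)
    (hfl : ∀ Z W, ‖Z‖ ≤ 3 * B → ‖W‖ ≤ 3 * B → ‖f Z - f W‖ ≤ K * ‖Z - W‖) (Z W : E) :
    ‖truncField B f Z - truncField B f W‖ ≤ (K + L / B) * ‖Z - W‖ := by
  have aux : ∀ Z W : E, ‖W‖ ≤ 3 * B →
      ‖truncField B f Z - truncField B f W‖ ≤ (K + L / B) * ‖Z - W‖ := by
    intro Z W hW
    have e : truncField B f Z - truncField B f W = clampCutoff B ‖Z‖ • (f Z - f W) +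
        (clampCutoff B ‖Z‖ - clampCutoff B ‖W‖) • f W := by
      simp only [truncField, smul_sub, sub_smul]; abel
    rw [e, add_mul]
    refine (norm_add_le _ _).trans (add_le_add ?_ ?_)
    · rw [norm_smul, Real.norm_of_nonneg (clampCutoff_nonneg _ _)]
      rcases le_total ‖Z‖ (3 * B) with h | h
      · exact (mul_le_of_le_one_left (norm_nonneg _) (clampCutoff_le_one _ _)).trans
          (hfl Z W h hW)
      · rw [clampCutoff_eq_zero hB h, zero_mul]; positivity
    · rw [norm_smul, Real.norm_eq_abs]
      calc _ ≤ |‖Z‖ - ‖W‖| / B * L :=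
            mul_le_mul (abs_clampCutoff_sub_le hB _ _) (hf W hW) (norm_nonneg _) (by positivity)
        _ ≤ ‖Z - W‖ / B * L := by gcongr; exact abs_norm_sub_norm_le Z W
        _ = _ := by ring
  rcases le_total ‖W‖ (3 * B) with h | h
  · exact aux Z W h
  rcases le_total ‖Z‖ (3 * B) with h' | h'
  · rw [norm_sub_rev, norm_sub_rev Z]; exact aux W Z h'
  · rw [truncField, truncField, clampCutoff_eq_zero hB h, clampCutoff_eq_zero hB h']
    simp only [zero_smul, sub_self, norm_zero]; positivity

/-- The truncated field is bounded by L and globally Lipschitz, so Picard–Lindelöf in a ball of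
radius LT reaches the whole interval in one application. -/
theorem exists_truncated_solution [CompleteSpace E] (hB : 0 < B) (hL : 0 ≤ L) (hK : 0 ≤ K)
    (hf : ∀ Z, ‖Z‖ ≤ 3 * B → ‖f Z‖ ≤ L)
    (hfl : ∀ Z W, ‖Z‖ ≤ 3 * B → ‖W‖ ≤ 3 * B → ‖f Z - f W‖ ≤ K * ‖Z - W‖) {T : ℝ} (hT : 0 ≤ T)
    (x₀ : E) : ∃ α : ℝ → E, α 0 = x₀ ∧
      ∀ t ∈ Icc 0 T, HasDerivWithinAt α (truncField B f (α t)) (Icc 0 T) t := by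
  have hKL : 0 ≤ K + L / B := by positivity
  have h : IsPicardLindelof (fun _ => truncField B f) (tmin := 0) (tmax := T) ⟨0, le_rfl, hT⟩ x₀
      (Real.toNNReal (L * T)) 0 (Real.toNNReal L) (Real.toNNReal (K + L / B)) :=
    { lipschitzOnWith := fun t _ => (LipschitzWith.of_dist_le_mul fun Z W => by
        rw [dist_eq_norm, dist_eq_norm, Real.coe_toNNReal _ hKL]
        exact norm_truncField_sub_le hB hL hK hf hfl Z W).lipschitzOnWith
      continuousOn := fun _ _ => continuousOn_const
      norm_le := fun _ _ Z _ => by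
        rw [Real.coe_toNNReal _ hL]; exact norm_truncField_le hB hL hf Z
      mul_max_le := by
        simp only [sub_zero, sub_self, NNReal.coe_zero]
        rw [Real.coe_toNNReal _ hL, Real.coe_toNNReal _ (by positivity), max_eq_left hT] }
  exact h.exists_eq_forall_mem_Icc_hasDerivWithinAt₀

end truncated

/-! ### The Galerkin approximation of the Burgers equation -/

/-- The indicator of the low frequencies. -/
def cutoff (n : ℕ) (ξ : ℝ) : ℝ := if jap ξ ≤ n then 1 else 0

theorem cutoff_nonneg (n : ℕ) (ξ : ℝ) : 0 ≤ cutoff n ξ := by unfold cutoff; split_ifs <;> norm_num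

theorem cutoff_le_one (n : ℕ) (ξ : ℝ) : cutoff n ξ ≤ 1 := by unfold cutoff; split_ifs <;> norm_num

theorem cutoff_mul_self (n : ℕ) (ξ : ℝ) : cutoff n ξ * cutoff n ξ = cutoff n ξ := by
  unfold cutoff; split_ifs <;> norm_num

theorem cutoff_neg (n : ℕ) (ξ : ℝ) : cutoff n (-ξ) = cutoff n ξ := by simp [cutoff, jap_neg]

@[fun_prop]
theorem measurable_cutoff (n : ℕ) : Measurable (cutoff n) :=
  Measurable.ite (measurableSet_le measurable_jap measurable_const) measurable_const
    measurable_const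

theorem bddSymbol_cutoff_mul {n : ℕ} {w : ℝ → ℝ} (hw : Measurable w) {C : ℝ}
    (h : ∀ ξ, jap ξ ≤ n → |w ξ| ≤ C) (hC : 0 ≤ C) :
    BddSymbol (ofRealSymbol fun ξ => cutoff n ξ * w ξ) C :=
  bddSymbol_ofReal (by fun_prop) fun ξ => by
    unfold cutoff; split_ifs with h1
    · simpa using h ξ h1
    · simpa using hC

theorem bddSymbol_cutoff (n : ℕ) : BddSymbol (ofRealSymbol (cutoff n)) 1 :=
  bddSymbol_ofReal (by fun_prop) fun ξ => by
    rw [abs_of_nonneg (cutoff_nonneg n ξ)]; exact cutoff_le_one n ξ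

/-- The projection onto the low frequencies. -/
def lowPass (n : ℕ) : L2 →L[ℂ] L2 := mulOp (ofRealSymbol (cutoff n))

theorem norm_lowPass_le (n : ℕ) (F : L2) : ‖lowPass n F‖ ≤ ‖F‖ :=
  (norm_mulOp_le (bddSymbol_cutoff n) F).trans_eq (one_mul _)

theorem IsHerm.lowPass {F : L2} (hF : IsHerm F) (n : ℕ) : IsHerm (lowPass n F) :=
  hF.mulOp (bddSymbol_cutoff n) fun ξ => by simp [cutoff_neg]

theorem lowPass_lowPass (n : ℕ) (F : L2) : lowPass n (lowPass n F) = lowPass n F := by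
  rw [lowPass, mulOp_mulOp (bddSymbol_cutoff n) (bddSymbol_cutoff n)]
  congr 2; funext ξ
  simp only [ofRealSymbol]
  rw [← Complex.ofReal_mul, cutoff_mul_self]

/-- The kernel of the Galerkin approximation, in `H^r`. -/
def galerkinKernel (n : ℕ) (r x y : ℝ) : ℂ :=
  ((cutoff n (x + y) * cutoff n x * cutoff n y : ℝ) : ℂ) * atLevel burgersKernel r r r x y

/-- The constant degenerates as n grows. It serves to solve the truncated equation and to justify
manipulations of kernels. The uniform bounds come from `galerkin_energy`. -/
theorem adm_galerkin (n : ℕ) {r : ℝ} (hr : 3 / 2 < r) :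
    Adm (r - 1) (galerkinKernel n r) ((n : ℝ) ^ r) := by
  refine ⟨(Complex.measurable_ofReal.comp (f := fun q : ℝ × ℝ =>
    cutoff n (q.1 + q.2) * cutoff n q.1 * cutoff n q.2) (by fun_prop)).mul
      (measurable_atLevel measurable_burgersKernel r r r), fun x y => ?_⟩
  have px := jap_rpow_pos x (-(r - 1))
  have py := jap_rpow_pos y (-(r - 1))
  have jy := jap_pos y
  rw [galerkinKernel, norm_mul, Complex.norm_real, Real.norm_eq_abs]
  by_cases h : jap (x + y) ≤ n
  · have h1 : |cutoff n (x + y) * cutoff n x * cutoff n y| ≤ 1 := by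
      have a1 := cutoff_nonneg n (x + y); have a2 := cutoff_nonneg n x
      have a3 := cutoff_nonneg n y
      rw [abs_of_nonneg (by positivity)]
      exact mul_le_one₀ (mul_le_one₀ (cutoff_le_one _ _) a2 (cutoff_le_one _ _)) a3
        (cutoff_le_one _ _)
    have hw := levelWeight_pos r r r x y
    rw [atLevel, norm_mul, Complex.norm_real, Real.norm_of_nonneg hw.le]
    have hx1 : jap x ^ (-r) ≤ 1 := jap_rpow_le_one (by linarith) x
    have hx0 := jap_rpow_pos x (-r)
    have hy0 := jap_rpow_pos y (-r)
    have hn : jap (x + y) ^ r ≤ (n : ℝ) ^ r := Real.rpow_le_rpow (jap_pos _).le h (by linarith)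
    have e : jap y ^ (-r) * jap y = jap y ^ (-(r - 1)) := by
      rw [neg_sub, sub_eq_add_neg, add_comm, Real.rpow_add jy, Real.rpow_one]
    calc _ ≤ 1 * (levelWeight r r r x y * jap y) := by
          gcongr; exact norm_burgersKernel_le x y
      _ = jap (x + y) ^ r * jap x ^ (-r) * (jap y ^ (-r) * jap y) := by
          rw [levelWeight]; ring
      _ ≤ (n : ℝ) ^ r * 1 * jap y ^ (-(r - 1)) := by rw [e]; gcongr
      _ ≤ _ := by rw [mul_one]; gcongr; linarith
  · have : cutoff n (x + y) = 0 := by unfold cutoff; rw [if_neg h]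
    rw [this]; simp only [zero_mul, abs_zero]
    positivity

/-- The symbol measuring Galerkin approximations, given in `H^r`, in the weighted norms. -/
def galerkinWeight (n : ℕ) (r σ R ξ : ℝ) : ℝ := cutoff n ξ * (tailWeight σ R ξ * jap ξ ^ (-r))

theorem bddSymbol_galerkinWeight (n : ℕ) {r σ R : ℝ} (hr : 0 ≤ r) (hσ : 0 ≤ σ) (hR : 0 ≤ R) :
    BddSymbol (ofRealSymbol (galerkinWeight n r σ R)) ((n : ℝ) ^ σ) :=
  bddSymbol_cutoff_mul (w := fun ξ => tailWeight σ R ξ * jap ξ ^ (-r)) (by fun_prop)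
    (fun ξ h => by
      have h1 := tailWeight_pos (σ := σ) hR ξ
      have h2 := jap_rpow_pos ξ (-r)
      rw [abs_of_pos (by positivity)]
      calc _ ≤ jap ξ ^ σ * 1 :=
            mul_le_mul (tailWeight_le hR ξ) (jap_rpow_le_one (by linarith) ξ) h2.le
              (jap_rpow_pos _ _).le
        _ ≤ _ := by rw [mul_one]; exact Real.rpow_le_rpow (jap_pos _).le h hσ) (by positivity)

/-- The growth rate of the Galerkin approximations. -/
def growthConst (r σ : ℝ) : ℝ := (1 / 2 + 2 * weightConst σ) * bilConst (r - 1)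

theorem growthConst_nonneg {r σ : ℝ} (hσ : 1 ≤ σ) : 0 ≤ growthConst r σ := by
  have := weightConst_nonneg hσ
  have := bilConst_nonneg (r - 1)
  unfold growthConst; positivity

/-- With z the weighted function, the output weight w(x+y) is compared with w(y). The part with w(y)
is transport of z by Z and is integrated by parts. The difference is put on the y-argument when ⟨x⟩
≤ ⟨y⟩ (`κ2`) and on the x-argument otherwise (`κ3`), so that in both cases the unweighted factor is
controlled in H^r. The constants do not depend on n or R. Powers of n appear only in qualitative
admissibility statements. -/
theorem galerkin_energy (n : ℕ) {r σ R : ℝ} (hr : 3 / 2 < r) (hσ : 1 ≤ σ) (hR : 0 ≤ R) {Z : L2}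
    (hZ : IsHerm Z) (hn : lowPass n Z = Z) :
    (inner ℂ (mulOp (ofRealSymbol (galerkinWeight n r σ R)) Z)
      (mulOp (ofRealSymbol (galerkinWeight n r σ R)) (bil (galerkinKernel n r) Z Z))).re ≤
      growthConst r σ * ‖Z‖ * ‖mulOp (ofRealSymbol (galerkinWeight n r σ R)) Z‖ ^ 2 := by
  have ha : 1 / 2 < r - 1 := by linarith
  have hw := bddSymbol_galerkinWeight n (r := r) (σ := σ) (R := R) (by linarith) (by linarith) hR
  have hW := weightConst_nonneg hσ
  set w := galerkinWeight n r σ R with hwdef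
  set z := mulOp (ofRealSymbol w) Z with hz
  have hc := bddSymbol_cutoff n
  have mb := measurable_burgersKernel
  have hnn : mulOp (ofRealSymbol (cutoff n)) z = z := by
    rw [hz, mulOp_comm hc hw]; congr 1
  -- the transport part
  set γ : ℝ → ℝ := fun ξ => cutoff n ξ * jap ξ ^ (-r) with hγdef
  have hγ : ∀ x, jap x * |γ x| ≤ jap x ^ (-(r - 1)) := fun x => by
    have h1 := cutoff_nonneg n x
    have h2 := jap_rpow_pos x (-r)
    have h3 := jap_pos x
    rw [hγdef]; simp only
    rw [abs_of_nonneg (by positivity)]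
    calc _ ≤ jap x * (1 * jap x ^ (-r)) := by gcongr; exact cutoff_le_one n x
      _ = jap x ^ (1 + -r) := by rw [one_mul, Real.rpow_add h3, Real.rpow_one]
      _ ≤ _ := jap_rpow_mono (by linarith) x
  have hdℓ : ∀ y, |2 * Real.pi * y| * |cutoff n y| ≤ n := fun y => by
    unfold cutoff
    split_ifs with h
    · rw [abs_one, mul_one]; exact (abs_le_jap y).trans h
    · simp
  have htr := re_inner_transport_le ha hc hdℓ (by fun_prop)
    (fun x => by simp [hγdef, jap_neg, cutoff_neg]) hγ hZ z
  rw [hnn] at htr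
  set κ1 : ℝ → ℝ → ℂ := fun x y => burgersKernel x y * ((cutoff n y * γ x : ℝ) : ℂ) with hκ1
  have a1 : Adm (r - 1) κ1 n := by
    refine ⟨mb.mul (Complex.measurable_ofReal.comp
      (f := fun q : ℝ × ℝ => cutoff n q.2 * γ q.1) (by fun_prop)), fun x y => ?_⟩
    rw [hκ1]; simp only
    rw [norm_mul, norm_burgersKernel, Complex.norm_real, Real.norm_eq_abs, abs_mul (cutoff n y),
      ← mul_assoc]
    have h2 : |γ x| ≤ jap x ^ (-(r - 1)) :=
      (le_mul_of_one_le_left (abs_nonneg _) (one_le_jap x)).trans (hγ x)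
    have := jap_rpow_pos y (-(r - 1))
    calc _ ≤ (n : ℝ) * jap x ^ (-(r - 1)) := mul_le_mul (hdℓ y) h2 (abs_nonneg _) (by positivity)
      _ ≤ _ := by gcongr; linarith
  -- the commutator
  set D : ℝ → ℝ → ℝ := fun x y => tailWeight σ R (x + y) - tailWeight σ R y with hD
  have mD : Measurable fun q : ℝ × ℝ => D q.1 q.2 := by simp only [hD]; fun_prop
  set ind : ℝ → ℝ → ℝ := fun x y => if jap x ≤ jap y then 1 else 0 with hind
  have mind : Measurable fun q : ℝ × ℝ => ind q.1 q.2 :=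
    Measurable.ite (measurableSet_le (by fun_prop) (by fun_prop)) measurable_const measurable_const
  set κ2 : ℝ → ℝ → ℂ := fun x y => burgersKernel x y *
    ((ind x y * (D x y / tailWeight σ R y) * (cutoff n y * γ x) : ℝ) : ℂ) with hκ2
  set κ3 : ℝ → ℝ → ℂ := fun x y => burgersKernel x y *
    (((1 - ind x y) * (D x y / tailWeight σ R x) * (cutoff n x * γ y) : ℝ) : ℂ) with hκ3
  have a2 : Adm (r - 1) κ2 (weightConst σ) := by
    refine ⟨mb.mul (Complex.measurable_ofReal.comp (f := fun q : ℝ × ℝ =>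
      ind q.1 q.2 * (D q.1 q.2 / tailWeight σ R q.2) * (cutoff n q.2 * γ q.1)) (by fun_prop)),
      fun x y => ?_⟩
    have px := jap_rpow_pos x (-(r - 1))
    have py := jap_rpow_pos y (-(r - 1))
    have jx := jap_pos x
    have jy := jap_pos y
    have tw := tailWeight_pos (σ := σ) hR y
    rw [hκ2]; simp only
    rw [norm_mul, Complex.norm_real, Real.norm_eq_abs, abs_mul, abs_mul, abs_mul, abs_div,
      abs_of_pos tw]
    by_cases h : jap x ≤ jap y
    · have h1 := abs_tailWeight_sub_le_right hσ hR h
      have h2 : |ind x y| = 1 := by simp [hind, h]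
      have h3 : |cutoff n y| ≤ 1 := by
        rw [abs_of_nonneg (cutoff_nonneg _ _)]; exact cutoff_le_one _ _
      rw [h2]
      calc _ ≤ jap y * (1 * ((weightConst σ * jap x * (tailWeight σ R y / jap y)) /
            tailWeight σ R y) * (1 * |γ x|)) := by
              gcongr
              exact norm_burgersKernel_le x y
        _ = weightConst σ * (jap x * |γ x|) := by field_simp
        _ ≤ weightConst σ * jap x ^ (-(r - 1)) := by gcongr; exact hγ x
        _ ≤ _ := by gcongr; linarith
    · have h2 : ind x y = 0 := by simp [hind, h]
      rw [h2]; simp only [abs_zero, zero_mul, mul_zero]; positivity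
  have a3 : Adm (r - 1) κ3 (weightConst σ) := by
    refine ⟨mb.mul (Complex.measurable_ofReal.comp (f := fun q : ℝ × ℝ =>
      (1 - ind q.1 q.2) * (D q.1 q.2 / tailWeight σ R q.1) * (cutoff n q.1 * γ q.2))
      (by fun_prop)), fun x y => ?_⟩
    have px := jap_rpow_pos x (-(r - 1))
    have py := jap_rpow_pos y (-(r - 1))
    have tw := tailWeight_pos (σ := σ) hR x
    rw [hκ3]; simp only
    rw [norm_mul, Complex.norm_real, Real.norm_eq_abs, abs_mul, abs_mul, abs_mul, abs_div,
      abs_of_pos tw]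
    by_cases h : jap x ≤ jap y
    · have h2 : 1 - ind x y = 0 := by simp [hind, h]
      rw [h2]; simp only [abs_zero, zero_mul, mul_zero]; positivity
    · have h1 := abs_tailWeight_sub_le_left (x := x) (y := y) hσ hR (le_of_not_ge h)
      have h2 : |1 - ind x y| = 1 := by simp [hind, h]
      have h3 : |cutoff n x| ≤ 1 := by
        rw [abs_of_nonneg (cutoff_nonneg _ _)]; exact cutoff_le_one _ _
      have jy := jap_pos y
      rw [h2]
      calc _ ≤ jap y * (1 * ((weightConst σ * tailWeight σ R x) /
            tailWeight σ R x) * (1 * |γ y|)) := by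
              gcongr
              exact norm_burgersKernel_le x y
        _ = weightConst σ * (jap y * |γ y|) := by field_simp
        _ ≤ weightConst σ * jap y ^ (-(r - 1)) := by gcongr; exact hγ y
        _ ≤ _ := by gcongr; linarith
  have bc : ∀ {κ : ℝ → ℝ → ℂ} {C : ℝ}, Adm (r - 1) κ C → Adm (r - 1) (fun x y =>
      κ x y * ofRealSymbol w y) ((n : ℝ) ^ σ * C) := fun h =>
    h.of_le (h.meas.mul (hw.meas.comp measurable_snd)) (fun x y => by
      rw [norm_mul, mul_comm]; gcongr; exact hw.bound y) hw.nonneg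
  have bc' : ∀ {κ : ℝ → ℝ → ℂ} {C : ℝ}, Adm (r - 1) κ C → Adm (r - 1) (fun x y =>
      κ x y * ofRealSymbol w x) ((n : ℝ) ^ σ * C) := fun h =>
    h.of_le (h.meas.mul (hw.meas.comp measurable_fst)) (fun x y => by
      rw [norm_mul, mul_comm]; gcongr; exact hw.bound x) hw.nonneg
  have bc3 : ∀ {κ : ℝ → ℝ → ℂ} {C : ℝ}, Adm (r - 1) κ C → Adm (r - 1) (fun x y =>
      ofRealSymbol (cutoff n) (x + y) * κ x y) (1 * C) := fun h =>
    h.of_le ((hc.meas.comp (f := fun p : ℝ × ℝ => p.1 + p.2) (by fun_prop)).mul h.meas)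
      (fun x y => by rw [norm_mul]; gcongr; exact hc.bound _) zero_le_one
  have split : mulOp (ofRealSymbol w) (bil (galerkinKernel n r) Z Z) =
      mulOp (ofRealSymbol (cutoff n)) (bil κ1 Z z + (bil κ2 Z z + bil κ3 z Z)) := by
    rw [hz, bil_mulOp_right κ1 hw, bil_mulOp_right κ2 hw, bil_mulOp_left κ3 hw,
      (adm_galerkin n hr).mulOp_bil ha hw, ← (bc a2).bil_kernel_add (bc' a3) ha,
      ← (bc a1).bil_kernel_add ((bc a2).add (bc' a3)) ha,
      ((bc a1).add ((bc a2).add (bc' a3))).mulOp_bil ha hc]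
    congr 1
    funext x y
    have tx := (tailWeight_pos (σ := σ) hR x).ne'
    have ty := (tailWeight_pos (σ := σ) hR y).ne'
    have tj := (jap_rpow_pos (x + y) r).ne'
    simp only [hκ1, hκ2, hκ3, galerkinKernel, atLevel, levelWeight, ofRealSymbol, hwdef,
      galerkinWeight, hγdef]
    have e : cutoff n (x + y) * (tailWeight σ R (x + y) * jap (x + y) ^ (-r)) *
        (cutoff n (x + y) * cutoff n x * cutoff n y) *
        (jap (x + y) ^ r * jap x ^ (-r) * jap y ^ (-r)) =
        cutoff n (x + y) * (cutoff n y * (cutoff n x * jap x ^ (-r)) *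
            (cutoff n y * (tailWeight σ R y * jap y ^ (-r))) +
          (ind x y * (D x y / tailWeight σ R y) * (cutoff n y * (cutoff n x * jap x ^ (-r))) *
            (cutoff n y * (tailWeight σ R y * jap y ^ (-r))) +
          (1 - ind x y) * (D x y / tailWeight σ R x) * (cutoff n x * (cutoff n y * jap y ^ (-r))) *
            (cutoff n x * (tailWeight σ R x * jap x ^ (-r))))) := by
      have c1 := cutoff_mul_self n (x + y)
      have c2 := cutoff_mul_self n x
      have c3 := cutoff_mul_self n y
      have j1 : jap (x + y) ^ (-r) * jap (x + y) ^ r = 1 := by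
        rw [← Real.rpow_add (jap_pos _)]; simp
      calc _ = (cutoff n (x + y) * cutoff n (x + y)) * tailWeight σ R (x + y) *
            (jap (x + y) ^ (-r) * jap (x + y) ^ r) * cutoff n x * cutoff n y *
            jap x ^ (-r) * jap y ^ (-r) := by ring
        _ = cutoff n (x + y) * tailWeight σ R (x + y) * cutoff n x * cutoff n y *
            jap x ^ (-r) * jap y ^ (-r) := by rw [c1, j1]; ring
        _ = cutoff n (x + y) * (cutoff n x * (cutoff n y * cutoff n y) * tailWeight σ R y +
            (ind x y * D x y * (cutoff n x * (cutoff n y * cutoff n y)) +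
            (1 - ind x y) * D x y * (cutoff n y * (cutoff n x * cutoff n x)))) *
            jap x ^ (-r) * jap y ^ (-r) := by
              rw [c2, c3]; simp only [hD]; ring
        _ = _ := by field_simp
    have e' := congrArg (fun t : ℝ => (t : ℂ)) e
    push_cast at e' ⊢
    linear_combination burgersKernel x y * e'
  rw [split, ← inner_mulOp_ofReal hc, hnn, inner_add_right, inner_add_right, Complex.add_re,
    Complex.add_re]
  have n0 := norm_nonneg z
  have h2 : (inner ℂ z (bil κ2 Z z)).re ≤
      ‖z‖ * (weightConst σ * bilConst (r - 1) * ‖Z‖ * ‖z‖) :=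
    (re_inner_le_norm_mul _ _).trans (by gcongr; exact a2.norm_bil_le ha Z z)
  have h3 : (inner ℂ z (bil κ3 z Z)).re ≤
      ‖z‖ * (weightConst σ * bilConst (r - 1) * ‖z‖ * ‖Z‖) :=
    (re_inner_le_norm_mul _ _).trans (by gcongr; exact a3.norm_bil_le ha z Z)
  rw [growthConst]
  linarith

/-! ### Solutions of the Galerkin approximation -/

theorem galerkinKernel_neg (n : ℕ) (r x y : ℝ) :
    galerkinKernel n r (-x) (-y) = (starRingEnd ℂ) (galerkinKernel n r x y) := by
  simp only [galerkinKernel, atLevel, levelWeight, burgersKernel, ← neg_add, cutoff_neg, jap_neg,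
    map_mul, map_neg, Complex.conj_I, Complex.conj_ofReal]
  push_cast; ring

theorem lowPass_bil_galerkin (n : ℕ) {r : ℝ} (hr : 3 / 2 < r) (F G : L2) :
    lowPass n (bil (galerkinKernel n r) F G) = bil (galerkinKernel n r) F G := by
  rw [lowPass, (adm_galerkin n hr).mulOp_bil (by linarith) (bddSymbol_cutoff n)]
  congr 1; funext x y
  rw [ofRealSymbol, galerkinKernel, ← mul_assoc, ← Complex.ofReal_mul, ← mul_assoc, ← mul_assoc,
    cutoff_mul_self]

theorem clampCutoff_mul_le {B x : ℝ} (hB : 0 < B) : clampCutoff B x * x ≤ 3 * B := by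
  rcases le_total x (3 * B) with h | h
  · rcases le_total 0 x with h0 | h0
    · exact (mul_le_of_le_one_left h0 (clampCutoff_le_one B x)).trans h
    · exact (mul_nonpos_of_nonneg_of_nonpos (clampCutoff_nonneg B x) h0).trans (by positivity)
  · rw [clampCutoff_eq_zero hB h, zero_mul]; positivity

/-- `Z` solves the Galerkin approximation, with the nonlinearity cut off outside a ball. -/
structure IsGalerkin (n : ℕ) (r B T : ℝ) (Z : ℝ → L2) : Prop where
  deriv : ∀ t ∈ Icc 0 T, HasDerivWithinAt Z
    (clampCutoff B ‖Z t‖ • bil (galerkinKernel n r) (Z t) (Z t)) (Icc 0 T) t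
  herm : ∀ t ∈ Icc 0 T, IsHerm (Z t)
  low : ∀ t ∈ Icc 0 T, lowPass n (Z t) = Z t

/-- Both constraints on the datum propagate. The anti-Hermitian part Z - conjRefl Z satisfies a
homogeneous linear inequality with zero initial value and vanishes by Grönwall. The part of Z above
the frequency cut-off has zero derivative, because the vector field takes low-pass values. -/
theorem exists_isGalerkin (n : ℕ) {r B T : ℝ} (hr : 3 / 2 < r) (hB : 0 < B) (hT : 0 ≤ T) {Z₀ : L2}
    (hZ₀ : IsHerm Z₀) (hn : lowPass n Z₀ = Z₀) :
    ∃ Z : ℝ → L2, Z 0 = Z₀ ∧ IsGalerkin n r B T Z := by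
  have ha : 1 / 2 < r - 1 := by linarith
  set κ := galerkinKernel n r with hκ
  have aκ : Adm (r - 1) κ ((n : ℝ) ^ r) := adm_galerkin n hr
  set A := (n : ℝ) ^ r * bilConst (r - 1) with hA
  have hA0 : 0 ≤ A := mul_nonneg aκ.nonneg (bilConst_nonneg _)
  have hf : ∀ Z : L2, ‖Z‖ ≤ 3 * B → ‖bil κ Z Z‖ ≤ A * (3 * B) * (3 * B) := fun Z hZ =>
    (aκ.norm_bil_le ha Z Z).trans (by gcongr)
  have hfl : ∀ Z W : L2, ‖Z‖ ≤ 3 * B → ‖W‖ ≤ 3 * B →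
      ‖bil κ Z Z - bil κ W W‖ ≤ (2 * A * (3 * B)) * ‖Z - W‖ := fun Z W hZ hW => by
    have e : bil κ Z Z - bil κ W W = bil κ (Z - W) Z + bil κ W (Z - W) := by
      rw [aκ.bil_sub_left ha, aκ.bil_sub_right ha]; abel
    rw [e]
    have h1 := aκ.norm_bil_le ha (Z - W) Z
    have h2 := aκ.norm_bil_le ha W (Z - W)
    calc _ ≤ A * ‖Z - W‖ * ‖Z‖ + A * ‖W‖ * ‖Z - W‖ := (norm_add_le _ _).trans (add_le_add h1 h2)
      _ ≤ A * ‖Z - W‖ * (3 * B) + A * (3 * B) * ‖Z - W‖ := by gcongr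
      _ = _ := by ring
  obtain ⟨Z, hZ0, hZ⟩ := exists_truncated_solution (f := fun Z => bil κ Z Z) hB (by positivity)
    (by positivity) hf hfl hT Z₀
  have hZc : ContinuousOn Z (Icc 0 T) := fun t ht => (hZ t ht).continuousWithinAt
  have hZi : ∀ t ∈ Ioo 0 T, HasDerivAt Z (truncField B (fun Z => bil κ Z Z) (Z t)) t :=
    fun t ht => (hZ t (Ioo_subset_Icc_self ht)).hasDerivAt (Icc_mem_nhds ht.1 ht.2)
  refine ⟨Z, hZ0, hZ, fun t ht => ?_, fun t ht => ?_⟩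
  · have hcc : ContinuousOn (fun t => Z t - conjRefl (Z t)) (Icc 0 T) :=
      hZc.sub (conjReflL.continuous.comp_continuousOn hZc)
    have hd : ∀ t ∈ Ioo 0 T, HasDerivAt (fun t => Z t - conjRefl (Z t))
        (truncField B (fun Z => bil κ Z Z) (Z t) -
          conjRefl (truncField B (fun Z => bil κ Z Z) (Z t))) t := fun t ht =>
      (hZi t ht).sub (conjReflL.hasFDerivAt.comp_hasDerivAt t (hZi t ht))
    have hle := norm_le_of_re_inner_le (C := 2 * A * (3 * B)) (S := 0) (by positivity) le_rfl hcc hd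
      (fun t ht => by
        set W := Z t - conjRefl (Z t) with hW
        have e : truncField B (fun Z => bil κ Z Z) (Z t) -
            conjRefl (truncField B (fun Z => bil κ Z Z) (Z t)) =
            clampCutoff B ‖Z t‖ • (bil κ W (Z t) + bil κ (conjRefl (Z t)) W) := by
          simp only [truncField]
          rw [conjRefl_smul, aκ.conjRefl_bil ha (galerkinKernel_neg n r), ← smul_sub, hW,
            aκ.bil_sub_left ha, aκ.bil_sub_right ha]
          congr 1; abel
        rw [e, zero_mul, add_zero]
        refine (re_inner_le_norm_mul _ _).trans ?_
        have h1 := aκ.norm_bil_le ha W (Z t)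
        have h2 := aκ.norm_bil_le ha (conjRefl (Z t)) W
        rw [norm_conjRefl] at h2
        have h3 := clampCutoff_mul_le (B := B) (x := ‖Z t‖) hB
        rw [norm_smul, Real.norm_of_nonneg (clampCutoff_nonneg _ _)]
        have h0 := clampCutoff_nonneg B ‖Z t‖
        calc ‖W‖ * (clampCutoff B ‖Z t‖ * ‖bil κ W (Z t) + bil κ (conjRefl (Z t)) W‖)
            ≤ ‖W‖ * (clampCutoff B ‖Z t‖ * (A * ‖W‖ * ‖Z t‖ + A * ‖Z t‖ * ‖W‖)) := by
              gcongr; exact (norm_add_le _ _).trans (add_le_add h1 h2)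
          _ = 2 * A * (clampCutoff B ‖Z t‖ * ‖Z t‖) * ‖W‖ ^ 2 := by ring
          _ ≤ _ := by gcongr) t ht
    rw [hZ0, (isHerm_iff Z₀).1 hZ₀, sub_self, norm_zero] at hle
    simp only [zero_mul, add_zero, mul_zero] at hle
    rw [isHerm_iff]
    exact (sub_eq_zero.1 (norm_le_zero_iff.1 hle)).symm
  · have h0 := eq_zero_of_hasDerivAt_zero (y := fun t => Z t - lowPass n (Z t))
      (hZc.sub ((lowPass n).continuous.comp_continuousOn hZc)) (fun t ht => by
        have h1 := (hZi t ht).sub (hasDerivAt_mulOp (ofRealSymbol (cutoff n)) (hZi t ht))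
        have e : mulOp (ofRealSymbol (cutoff n)) (truncField B (fun Z => bil κ Z Z) (Z t)) =
            truncField B (fun Z => bil κ Z Z) (Z t) := by
          simp only [truncField]
          rw [mulOp_real_smul]
          exact congrArg _ (lowPass_bil_galerkin n hr _ _)
        rw [e, sub_self] at h1
        exact h1) (by simp only [hZ0, hn, sub_self]) t ht
    exact (sub_eq_zero.1 h0).symm

namespace IsGalerkin
variable {n : ℕ} {r B T : ℝ} {Z : ℝ → L2}

theorem continuousOn (h : IsGalerkin n r B T Z) : ContinuousOn Z (Icc 0 T) :=
  fun t ht => (h.deriv t ht).continuousWithinAt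

theorem hasDerivAt (h : IsGalerkin n r B T Z) {t : ℝ} (ht : t ∈ Ioo 0 T) : HasDerivAt Z
    (clampCutoff B ‖Z t‖ • bil (galerkinKernel n r) (Z t) (Z t)) t :=
  (h.deriv t (Ioo_subset_Icc_self ht)).hasDerivAt (Icc_mem_nhds ht.1 ht.2)

/-- The cut-off vector field satisfies χ(‖Z‖)‖Z‖ ≤ 3B, so the energy inequality has a constant rate
without any a priori bound on Z. -/
theorem growth (h : IsGalerkin n r B T Z) (hr : 3 / 2 < r) (hB : 0 < B) {σ R : ℝ} (hσ : 1 ≤ σ)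
    (hR : 0 ≤ R) {t : ℝ} (ht : t ∈ Icc 0 T) :
    ‖mulOp (ofRealSymbol (galerkinWeight n r σ R)) (Z t)‖ ≤
      Real.exp (growthConst r σ * (3 * B) * t) *
        ‖mulOp (ofRealSymbol (galerkinWeight n r σ R)) (Z 0)‖ := by
  have hG := growthConst_nonneg (r := r) hσ
  have := norm_le_of_re_inner_le (C := growthConst r σ * (3 * B)) (S := 0) (by positivity) le_rfl
    ((mulOp (ofRealSymbol (galerkinWeight n r σ R))).continuous.comp_continuousOn h.continuousOn)
    (fun t ht => hasDerivAt_mulOp _ (h.hasDerivAt ht)) (fun t ht => by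
      have ht' := Ioo_subset_Icc_self ht
      have h1 := galerkin_energy n (R := R) hr hσ hR (h.herm t ht') (h.low t ht')
      have h0 := clampCutoff_nonneg B ‖Z t‖
      have h3 := clampCutoff_mul_le (B := B) (x := ‖Z t‖) hB
      rw [mulOp_real_smul, real_smul_eq, inner_smul_right, Complex.re_ofReal_mul, zero_mul,
        add_zero]
      calc _ ≤ clampCutoff B ‖Z t‖ * (growthConst r σ * ‖Z t‖ *
            ‖mulOp (ofRealSymbol (galerkinWeight n r σ R)) (Z t)‖ ^ 2) :=
            mul_le_mul_of_nonneg_left h1 h0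
        _ = growthConst r σ * (clampCutoff B ‖Z t‖ * ‖Z t‖) *
            ‖mulOp (ofRealSymbol (galerkinWeight n r σ R)) (Z t)‖ ^ 2 := by ring
        _ ≤ _ := by simp only [Function.comp_apply]; gcongr) t ht
  simpa using this

end IsGalerkin

/-! ### Changing levels -/

/-- The symbol cutting off the low frequencies `⟨2πξ⟩ ≪ R` smoothly. -/
def tailSymbol (R ξ : ℝ) : ℝ := jap ξ / (R + jap ξ)

theorem tailSymbol_pos {R : ℝ} (hR : 0 ≤ R) (ξ : ℝ) : 0 < tailSymbol R ξ := by
  have := jap_pos ξ; unfold tailSymbol; positivity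

theorem tailSymbol_le_one {R : ℝ} (hR : 0 ≤ R) (ξ : ℝ) : tailSymbol R ξ ≤ 1 := by
  have := jap_pos ξ
  unfold tailSymbol; rw [div_le_one (by positivity)]; linarith

theorem bddSymbol_tail {R : ℝ} (hR : 0 ≤ R) : BddSymbol (ofRealSymbol (tailSymbol R)) 1 :=
  bddSymbol_ofReal (by unfold tailSymbol; fun_prop) fun ξ => by
    rw [abs_of_pos (tailSymbol_pos hR ξ)]; exact tailSymbol_le_one hR ξ

/-- The high frequency part of `F`. -/
def tail (R : ℝ) : L2 →L[ℂ] L2 := mulOp (ofRealSymbol (tailSymbol R))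

theorem norm_tail_le {R : ℝ} (hR : 0 ≤ R) (F : L2) : ‖tail R F‖ ≤ ‖F‖ :=
  (norm_mulOp_le (bddSymbol_tail hR) F).trans_eq (one_mul _)

theorem tendsto_tail (F : L2) :
    Filter.Tendsto (fun R : ℝ => ‖tail R F‖) Filter.atTop (nhds 0) := by
  have h := (tendsto_mulOp (l := Filter.atTop) (m := fun R => ofRealSymbol (tailSymbol R))
    (m₀ := fun _ => 0) (C := 1)
    ((Filter.eventually_ge_atTop 0).mono fun R hR => bddSymbol_tail hR)
    ⟨measurable_const, fun _ => by simp⟩ (fun ξ => by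
      simp only [ofRealSymbol]
      rw [← Complex.ofReal_zero]
      refine (Complex.continuous_ofReal.tendsto 0).comp ?_
      unfold tailSymbol
      exact Filter.Tendsto.const_div_atTop (Filter.tendsto_atTop_add_const_right _ _
        Filter.tendsto_id) _) F).norm
  have e : mulOp (fun _ => (0 : ℂ)) F = 0 :=
    (eq_mulOp (C := 0) ⟨measurable_const, fun _ => by simp⟩ (by
      filter_upwards [Lp.coeFn_zero ℂ 2 (volume : Measure ℝ)] with ξ h; simp)).symm
  rwa [e, norm_zero] at h

/-- Where ⟨2πξ⟩ ≤ R the first symbol is at least 1, elsewhere the second is. This turns convergence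
in a weak norm plus uniformly small tails into strong convergence. -/
theorem norm_le_lower_add_tail {d R : ℝ} (hd : 0 ≤ d) (hR : 1 ≤ R) (F : L2) :
    ‖F‖ ≤ R ^ d * ‖lower d F‖ + 2 * ‖tail R F‖ := by
  have hR0 : 0 ≤ R := by linarith
  have hw : BddSymbol (ofRealSymbol fun ξ => R ^ d * jap ξ ^ (-d) + 2 * tailSymbol R ξ)
      (R ^ d * 1 + 2 * 1) :=
    bddSymbol_ofReal (by unfold tailSymbol; fun_prop) fun ξ => by
      have h1 := jap_rpow_pos ξ (-d); have h2 := tailSymbol_pos hR0 ξ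
      rw [abs_of_pos (by positivity)]
      gcongr
      · exact jap_rpow_le_one (by linarith) ξ
      · exact tailSymbol_le_one hR0 ξ
  have h1 := norm_mulOp_le_norm_mulOp bddSymbol_one hw (c := 1) (fun ξ => by
    have j := jap_pos ξ
    have h1 := jap_rpow_pos ξ (-d); have h2 := tailSymbol_pos hR0 ξ
    simp only [ofRealSymbol]
    rw [norm_one, one_mul, Complex.norm_real, Real.norm_of_nonneg (by positivity)]
    rcases le_total (jap ξ) R with h | h
    · have : 1 ≤ R ^ d * jap ξ ^ (-d) := by
        rw [Real.rpow_neg j.le, ← div_eq_mul_inv, one_le_div (jap_rpow_pos ξ d)]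
        exact Real.rpow_le_rpow j.le h hd
      linarith
    · have : 1 ≤ 2 * tailSymbol R ξ := by
        rw [tailSymbol, ← mul_div_assoc, one_le_div (by positivity)]; linarith
      have : 0 < R ^ d * jap ξ ^ (-d) := by positivity
      linarith) F
  rw [mulOp_one, one_mul] at h1
  refine h1.trans ?_
  have e : mulOp (ofRealSymbol fun ξ => R ^ d * jap ξ ^ (-d) + 2 * tailSymbol R ξ) F =
      ((R ^ d : ℝ) : ℂ) • lower d F + (2 : ℂ) • tail R F := by
    symm
    refine eq_mulOp hw ?_
    filter_upwards [Lp.coeFn_add (((R ^ d : ℝ) : ℂ) • lower d F) ((2 : ℂ) • tail R F),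
      Lp.coeFn_smul ((R ^ d : ℝ) : ℂ) (lower d F), Lp.coeFn_smul (2 : ℂ) (tail R F),
      coeFn_mulOp (bddSymbol_lower hd) F, coeFn_mulOp (bddSymbol_tail hR0) F] with ξ a1 a2 a3 a4 a5
    rw [a1, Pi.add_apply, a2, a3, Pi.smul_apply, Pi.smul_apply, lower, tail, a4, a5]
    simp only [ofRealSymbol, smul_eq_mul]
    push_cast; ring
  rw [e]
  refine (norm_add_le _ _).trans_eq ?_
  rw [norm_smul, norm_smul, Complex.norm_real, Real.norm_of_nonneg (by positivity)]
  simp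

/-- Discarding the frequencies above n costs 1/n as soon as one derivative is to spare. This is the
rate of convergence of the Galerkin scheme in the weak norm. -/
theorem norm_sub_lowPass_lower_le {n : ℕ} (hn : 1 ≤ n) {a : ℝ} (ha : 1 ≤ a) (F : L2) :
    ‖lower a F - lowPass n (lower a F)‖ ≤ ‖F‖ / n := by
  have hn0 : (0 : ℝ) < n := by exact_mod_cast hn
  have hl := bddSymbol_lower (a := a) (by linarith)
  have hw : BddSymbol (ofRealSymbol fun ξ => (1 - cutoff n ξ) * jap ξ ^ (-a)) (1 / n) :=
    bddSymbol_ofReal (by fun_prop) fun ξ => by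
      unfold cutoff
      split_ifs with h
      · simp
      · rw [sub_zero, one_mul, abs_of_pos (jap_rpow_pos _ _)]
        push Not at h
        calc _ ≤ jap ξ ^ (-(1 : ℝ)) := jap_rpow_mono (by linarith) ξ
          _ = 1 / jap ξ := by rw [Real.rpow_neg_one, one_div]
          _ ≤ _ := by gcongr
  have e : lower a F - lowPass n (lower a F) =
      mulOp (ofRealSymbol fun ξ => (1 - cutoff n ξ) * jap ξ ^ (-a)) F := by
    refine eq_mulOp hw ?_
    filter_upwards [Lp.coeFn_sub (lower a F) (lowPass n (lower a F)), coeFn_mulOp hl F,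
      coeFn_mulOp (bddSymbol_cutoff n) (lower a F)] with ξ h1 h2 h3
    rw [h1, Pi.sub_apply, lowPass, h3, lower, h2]
    simp only [ofRealSymbol]; push_cast; ring
  rw [e]
  exact (norm_mulOp_le hw F).trans_eq (by ring)

/-- The Burgers nonlinearity, from `H^s` to `H^o`. -/
abbrev burgersBil (s o : ℝ) : L2 → L2 → L2 := bil (atLevel burgersKernel s s o)

theorem adm_burgersBil {r s o : ℝ} (ho : 0 ≤ o) (h1 : o + 1 ≤ s) (h : r ≤ s) :
    Adm (r - 1) (atLevel burgersKernel s s o) (2 ^ (o + 1)) :=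
  adm_burgers ho h1 (by linarith) (by linarith) h

theorem burgersBil_lower {i s o d : ℝ} (hd : 0 ≤ d) (hs : s = i + d) (F G : L2) :
    burgersBil i o (lower d F) (lower d G) = burgersBil s o F G := by
  rw [burgersBil, bil_lower_left hd, bil_lower_right hd, hs]

theorem lower_burgersBil {r s o o' d : ℝ} (hr : 3 / 2 < r) (ho : 0 ≤ o) (h1 : o + 1 ≤ s)
    (h : r ≤ s) (hd : 0 ≤ d) (ho' : o' = o - d) (F G : L2) :
    lower d (burgersBil s o F G) = burgersBil s o' F G := by
  rw [burgersBil, lower_bil (adm_burgersBil ho h1 h) (by linarith) hd, ho']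

/-! ### The flow of the Burgers equation -/

theorem galerkinWeight_self (n : ℕ) (r : ℝ) : galerkinWeight n r r 0 = cutoff n := by
  funext ξ
  rw [galerkinWeight, tailWeight_zero, ← Real.rpow_add (jap_pos ξ)]; simp

theorem galerkinWeight_zero (n : ℕ) (r d ξ : ℝ) :
    galerkinWeight n r (r + d) 0 ξ = cutoff n ξ * jap ξ ^ d := by
  rw [galerkinWeight, tailWeight_zero, ← Real.rpow_add (jap_pos ξ)]; ring_nf

theorem tailSymbol_mul_galerkinWeight (n : ℕ) (r d R ξ : ℝ) :
    tailSymbol R ξ * galerkinWeight n r (r + d) 0 ξ = galerkinWeight n r (r + d) R ξ := by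
  have h := jap_pos ξ
  rw [galerkinWeight, galerkinWeight, tailWeight_zero, tailWeight, tailSymbol, Real.rpow_add_one h.ne']
  ring

theorem tail_zero (F : L2) : tail 0 F = F := by
  have : ofRealSymbol (tailSymbol 0) = fun _ => 1 := by
    funext ξ
    have := (jap_pos ξ).ne'
    simp [ofRealSymbol, tailSymbol, this]
  rw [tail, this, mulOp_one]

theorem mulOp_ofReal_mul {w w' : ℝ → ℝ} {C C' : ℝ} (h : BddSymbol (ofRealSymbol w) C)
    (h' : BddSymbol (ofRealSymbol w') C') (F : L2) :
    mulOp (ofRealSymbol w) (mulOp (ofRealSymbol w') F) =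
      mulOp (ofRealSymbol fun ξ => w ξ * w' ξ) F := by
  rw [mulOp_mulOp h h']; congr 2; funext ξ; simp [ofRealSymbol]

theorem mulOp_zero_symbol (F : L2) : mulOp (fun _ => 0) F = 0 :=
  (eq_mulOp (C := 0) ⟨measurable_const, fun _ => by simp⟩ (by
    filter_upwards [Lp.coeFn_zero ℂ 2 (volume : Measure ℝ)] with ξ h; simp)).symm

theorem mulOp_dispSymbol_zero (m : ℝ) (F : L2) : mulOp (dispSymbol (fun _ => 0) m) F = 0 := by
  have : dispSymbol (fun _ => 0) m = fun _ => 0 := by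
    funext ξ; simp [dispSymbol, freqSymbol]
  rw [this, mulOp_zero_symbol]

/-- The rate of growth of solutions of the Burgers equation which have size `B` in `H^r`. -/
def flowRate (r d B : ℝ) : ℝ := growthConst r (r + d) * (3 * B)

/-- The Galerkin equation is solved in the H^r representation, where both B and the lifespan are
measured, and lifted to the H^{r+d} representation by the frequency-localized multiplier `w`.
Applying `growth` with σ = r + d and every R ≥ 0 gives the tail bound uniformly in n. -/
theorem exists_approximate_flow (n : ℕ) {r d B T : ℝ} (hr : 3 / 2 < r) (hd1 : 1 ≤ d) (hB : 0 < B)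
    (hT : 0 ≤ T) (hTB : Real.exp (growthConst r r * (3 * B) * T) ≤ 2) {Y₀ : L2} (hY₀ : IsHerm Y₀)
    (hb : ‖lower d Y₀‖ ≤ B) :
    ∃ Y : ℝ → L2, ContinuousOn Y (Icc 0 T) ∧ Y 0 = lowPass n Y₀ ∧
      (∀ t ∈ Icc 0 T, IsHerm (Y t)) ∧
      (∀ t ∈ Icc 0 T, ∀ R, 0 ≤ R → ‖tail R (Y t)‖ ≤ Real.exp (flowRate r d B * t) * ‖tail R Y₀‖) ∧
      ∀ t ∈ Ioo 0 T, HasDerivAt (fun t => lower d (Y t))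
        (lowPass n (burgersBil (r + d) r (Y t) (Y t))) t := by
  have ha : 1 / 2 < r - 1 := by linarith
  have hd : 0 ≤ d := by linarith
  have hc := bddSymbol_cutoff n
  have hl := bddSymbol_lower hd
  have hw := fun {σ R : ℝ} (hσ : 0 ≤ σ) (hR : 0 ≤ R) =>
    bddSymbol_galerkinWeight n (r := r) (σ := σ) (R := R) (by linarith) hσ hR
  have hw0 := hw (σ := r + d) (by linarith) (le_refl 0)
  obtain ⟨Z, hZ0, hZ⟩ := exists_isGalerkin n hr hB hT ((hY₀.lower hd).lowPass n)
    (lowPass_lowPass n _)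
  set w := ofRealSymbol (galerkinWeight n r (r + d) 0) with hwdef
  have lower_lift : ∀ F, lower d (mulOp w F) = lowPass n F := fun F => by
    rw [lower, mulOp_ofReal_mul hl hw0, lowPass]
    congr 2; funext ξ
    simp only [ofRealSymbol, galerkinWeight_zero]
    congr 1
    rw [mul_comm, mul_assoc, ← Real.rpow_add (jap_pos ξ)]; simp
  have tail_lift : ∀ {R : ℝ}, 0 ≤ R → ∀ F, tail R (mulOp w F) =
      mulOp (ofRealSymbol (galerkinWeight n r (r + d) R)) F := fun {R} hR F => by
    rw [tail, mulOp_ofReal_mul (bddSymbol_tail hR) hw0]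
    congr 2; funext ξ
    exact congrArg _ <| tailSymbol_mul_galerkinWeight n r d R ξ
  have lift_start : mulOp w (lowPass n (lower d Y₀)) = lowPass n Y₀ := by
    apply lower_injective hd
    rw [lower_lift, lowPass_lowPass, lower, lowPass, mulOp_comm hl hc]
  -- The weight with σ = r and R = 0 is the plain H^r norm. On the given interval it at most
  -- doubles, so the truncation of the vector field is never active.
  have low : ∀ t ∈ Icc 0 T, ‖Z t‖ ≤ 2 * B := fun t ht => by
    have h := hZ.growth hr hB (σ := r) (by linarith) le_rfl ht
    rw [galerkinWeight_self] at h
    have e1 : mulOp (ofRealSymbol (cutoff n)) (Z t) = Z t := hZ.low t ht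
    rw [e1, hZ0] at h
    have h0 := growthConst_nonneg (r := r) (σ := r) (by linarith)
    calc _ ≤ _ := h
      _ ≤ 2 * B := by
        gcongr
        · exact (Real.exp_le_exp.2 (by gcongr; exact ht.2)).trans hTB
        · exact (norm_lowPass_le n _).trans ((norm_lowPass_le n _).trans hb)
  refine ⟨fun t => mulOp w (Z t), (mulOp w).continuous.comp_continuousOn hZ.continuousOn, ?_, ?_,
    ?_, ?_⟩
  · simp only [hZ0, lift_start]
  · intro t ht
    refine (hZ.herm t ht).mulOp hw0 fun ξ => ?_
    simp [hwdef, ofRealSymbol, galerkinWeight_zero, cutoff_neg, jap_neg]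
  · intro t ht R hR
    have h := hZ.growth hr hB (σ := r + d) (by linarith) hR ht
    rw [← tail_lift hR, ← tail_lift hR, hZ0, lift_start] at h
    refine h.trans ?_
    rw [flowRate]
    gcongr
    rw [tail, lowPass, mulOp_comm (bddSymbol_tail hR) hc]
    exact norm_lowPass_le n _
  · intro t ht
    have ht' := Ioo_subset_Icc_self ht
    have h1 := hZ.hasDerivAt ht
    rw [clampCutoff_eq_one hB (low t ht'), one_smul] at h1
    have e : bil (galerkinKernel n r) (Z t) (Z t) =
        lowPass n (burgersBil (r + d) r (mulOp w (Z t)) (mulOp w (Z t))) := by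
      have aB : Adm (r - 1) (atLevel burgersKernel (r + d) (r + d) r) (2 ^ (r + 1)) :=
        adm_burgersBil (by linarith) (by linarith) (by linarith)
      rw [lowPass, burgersBil, aB.mulOp_bil ha hc, bil_mulOp _ hw0 hw0]
      congr 1
      funext x y
      simp only [galerkinKernel, atLevel, levelWeight, ofRealSymbol, hwdef, galerkinWeight_zero]
      have hr1 : ∀ ξ, jap ξ ^ (-r) = jap ξ ^ (-(r + d)) * jap ξ ^ d := fun ξ => by
        rw [← Real.rpow_add (jap_pos ξ)]; ring_nf
      rw [hr1 x, hr1 y]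
      push_cast; ring
    rw [e] at h1
    refine h1.congr_of_eventuallyEq ?_
    filter_upwards [Icc_mem_nhds ht.1 ht.2] with x hx
    exact (lower_lift _).trans (hZ.low x hx)

theorem Adm.continuousOn_bil {a C : ℝ} {κ : ℝ → ℝ → ℂ} (h : Adm a κ C) (ha : 1 / 2 < a)
    {X : Type*} [TopologicalSpace X] {F G : X → L2} {S : Set X} (hF : ContinuousOn F S)
    (hG : ContinuousOn G S) : ContinuousOn (fun x => bil κ (F x) (G x)) S :=
  (h.isBoundedBilinearMap ha).continuous.comp_continuousOn (f := fun x => (F x, G x))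
    (hF.prodMk hG)

theorem burgersBil_sub {s o a C : ℝ} (h : Adm a (atLevel burgersKernel s s o) C) (ha : 1 / 2 < a)
    {F G : L2} {D : ℝ} (hF : ‖F‖ ≤ D) (hG : ‖G‖ ≤ D) :
    ‖burgersBil s o F F - burgersBil s o G G‖ ≤ 2 * C * bilConst a * D * ‖F - G‖ := by
  have e : burgersBil s o F F - burgersBil s o G G =
      burgersBil s o (F - G) F + burgersBil s o G (F - G) := by
    rw [burgersBil, h.bil_sub_left ha, h.bil_sub_right ha]; abel
  have hC := h.nonneg
  have hb := bilConst_nonneg a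
  rw [e]
  calc _ ≤ C * bilConst a * ‖F - G‖ * ‖F‖ + C * bilConst a * ‖G‖ * ‖F - G‖ :=
        (norm_add_le _ _).trans (add_le_add (h.norm_bil_le ha _ _) (h.norm_bil_le ha _ _))
    _ ≤ C * bilConst a * ‖F - G‖ * D + C * bilConst a * D * ‖F - G‖ := by gcongr
    _ = _ := by ring

/-- Two approximate flows are close to each other. -/
theorem norm_sub_approximate_flow_le {n n' : ℕ} (hn : 1 ≤ n) (hn' : 1 ≤ n') {r m d T D : ℝ}
    (hr : 3 / 2 < r) (hm : 1 ≤ m) (hd : m + 1 ≤ d) {Y Y' : ℝ → L2}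
    (hY : ContinuousOn Y (Icc 0 T)) (hY' : ContinuousOn Y' (Icc 0 T))
    (hD : ∀ t ∈ Icc 0 T, ‖Y t‖ ≤ D) (hD' : ∀ t ∈ Icc 0 T, ‖Y' t‖ ≤ D)
    (hH : ∀ t ∈ Icc 0 T, IsHerm (Y' t))
    (hd1 : ∀ t ∈ Ioo 0 T, HasDerivAt (fun t => lower d (Y t))
        (lowPass n (burgersBil (r + d) r (Y t) (Y t))) t)
    (hd2 : ∀ t ∈ Ioo 0 T, HasDerivAt (fun t => lower d (Y' t))
        (lowPass n' (burgersBil (r + d) r (Y' t) (Y' t))) t) {t : ℝ} (ht : t ∈ Icc 0 T) :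
    ‖lower d (Y t - Y' t)‖ ≤ Real.exp (stabConst r 0 D * t) * (‖lower d (Y 0 - Y' 0)‖ +
      stabConst r 0 D * (2 ^ (r + d - m + 1) * bilConst (r - 1) * D * D * (1 / n + 1 / n')) * t) := by
  have ha : 1 / 2 < r - 1 := by linarith
  have hD0 : 0 ≤ D := (norm_nonneg _).trans (hD t ht)
  have hdm : 0 ≤ d - m := by linarith
  have hb := bilConst_nonneg (r - 1)
  have aB : Adm (r - 1) (atLevel burgersKernel (r + d) (r + d) (r + d - m)) (2 ^ (r + d - m + 1)) :=
    adm_burgersBil (by linarith) (by linarith) (by linarith)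
  have conv : ∀ F : L2, burgersBil (r + m) r (lower (d - m) F) (lower (d - m) F) =
      burgersBil (r + d) r F F := fun F => burgersBil_lower hdm (by ring) _ _
  -- The nonlinearity already lies in H^{r+d-m}, and d - m ≥ 1 derivatives remain for the error of
  -- the low-pass projection.
  have err : ∀ {n : ℕ}, 1 ≤ n → ∀ F : L2, ‖F‖ ≤ D → ‖burgersBil (r + d) r F F -
      lowPass n (burgersBil (r + d) r F F)‖ ≤
        2 ^ (r + d - m + 1) * bilConst (r - 1) * D * D * (1 / n) := by
    intro n hn F hF
    rw [← lower_burgersBil (r := r) (o := r + d - m) (d := d - m) hr (by linarith) (by linarith)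
      (by linarith) hdm (by ring)]
    refine (norm_sub_lowPass_lower_le hn (by linarith) _).trans ?_
    rw [mul_one_div]
    gcongr
    refine (aB.norm_bil_le ha _ _).trans ?_
    gcongr
  have low2 : ∀ F : L2, lower m (lower (d - m) F) = lower d F := fun F => by
    rw [lower_lower (by linarith) hdm]; congr 1; ring_nf
  have hst := stability (r := r) (m := m) (p := m) (M := 0) (B := D)
    (S := 2 ^ (r + d - m + 1) * bilConst (r - 1) * D * D * (1 / n + 1 / n')) hr hm le_rfl
    (IsAdmissibleSymbol.zero m le_rfl) (a := 0) (b := T)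
    (f := fun t => lower (d - m) (Y t)) (g := fun t => lower (d - m) (Y' t)) (j := fun _ => 0)
    (ρ := fun t => -(burgersBil (r + d) r (Y t) (Y t) -
        lowPass n (burgersBil (r + d) r (Y t) (Y t))) + (burgersBil (r + d) r (Y' t) (Y' t) -
        lowPass n' (burgersBil (r + d) r (Y' t) (Y' t)))) (by positivity) hD0
    (fun t ht => (norm_lower_le hdm _).trans (hD t ht))
    (fun t ht => (norm_lower_le hdm _).trans (hD' t ht))
    (fun t ht => (hH t ht).lower hdm) (fun t _ => by rw [norm_zero]; positivity)
    (fun t ht => by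
      have ht' := Ioo_subset_Icc_self ht
      refine (norm_add_le _ _).trans ?_
      rw [norm_neg, mul_add]
      exact add_le_add (err hn _ (hD t ht')) (err hn' _ (hD' t ht'))) (by
      simp only [sub_zero, ← map_sub, low2]
      exact (lower d).continuous.comp_continuousOn (hY.sub hY')) (fun t ht => by
      have h := (hd1 t ht).sub (hd2 t ht)
      simp only [sub_zero, ← map_sub, low2]
      rw [mulOp_dispSymbol_zero, zero_add]
      change HasDerivAt _ ((burgersBil (r + m) r _ _ - burgersBil (r + m) r _ _) + _) t
      rw [conv, conv]
      refine (h.congr_of_eventuallyEq (Filter.Eventually.of_forall fun r => ?_)).congr_deriv ?_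
      · simp
      · abel) t ht
  simp only [sub_zero, ← map_sub, low2] at hst
  exact hst

/-- `Y` is a curve of real-valued functions in `H^s`, solving the Burgers equation in
`H^{s-m}`. -/
structure IsBurgersCurve (s m a b : ℝ) (Y : ℝ → L2) : Prop where
  cont : ContinuousOn Y (Icc a b)
  herm : ∀ t ∈ Icc a b, IsHerm (Y t)
  deriv : ∀ t ∈ Icc a b, HasDerivWithinAt (fun t => lower m (Y t))
    (burgersBil s (s - m) (Y t) (Y t)) (Icc a b) t

/-- The approximations are Cauchy in H^r by the stability estimate and have uniformly small tails in
H^{r+d}, hence converge uniformly in H^{r+d}. The existence time is governed by the H^r norm of the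
datum alone. -/
theorem exists_burgersCurve {r m d B T : ℝ} (hr : 3 / 2 < r) (hm : 1 ≤ m) (hd : m + 1 ≤ d)
    (hB : 0 < B) (hT : 0 ≤ T) (hTB : Real.exp (growthConst r r * (3 * B) * T) ≤ 2) {Y₀ : L2}
    (hY₀ : IsHerm Y₀) (hb : ‖lower d Y₀‖ ≤ B) :
    ∃ Y : ℝ → L2, Y 0 = Y₀ ∧ IsBurgersCurve (r + d) m 0 T Y ∧ ∀ t ∈ Icc 0 T, ∀ R, 0 ≤ R →
      ‖tail R (Y t)‖ ≤ Real.exp (flowRate r d B * t) * ‖tail R Y₀‖ := by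
  have ha : 1 / 2 < r - 1 := by linarith
  have hd0 : 0 ≤ d := by linarith
  have hdm : 0 ≤ d - m := by linarith
  choose Y hYc hY0 hYh hYt hYd using fun n => exists_approximate_flow n hr (by linarith) hB hT hTB
    hY₀ hb (d := d)
  have hc0 : 0 ≤ flowRate r d B := by
    have := growthConst_nonneg (r := r) (σ := r + d) (by linarith)
    unfold flowRate; positivity
  set c := Real.exp (flowRate r d B * T) with hc
  have hc1 : 0 < c := Real.exp_pos _
  set D := c * ‖Y₀‖ with hDdef
  have hD0 : 0 ≤ D := by positivity
  have hYt' : ∀ n, ∀ t ∈ Icc 0 T, ∀ R, 0 ≤ R → ‖tail R (Y n t)‖ ≤ c * ‖tail R Y₀‖ :=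
    fun n t ht R hR => (hYt n t ht R hR).trans (by rw [hc]; gcongr; exact ht.2)
  have hD : ∀ n, ∀ t ∈ Icc 0 T, ‖Y n t‖ ≤ D := fun n t ht => by
    simpa only [tail_zero] using hYt' n t ht 0 le_rfl
  set K := stabConst r 0 D with hK
  have hK0 : 0 ≤ K := stabConst_nonneg hr le_rfl hD0
  set A := 2 ^ (r + d - m + 1) * bilConst (r - 1) * D * D with hA
  have hA0 : 0 ≤ A := by have := bilConst_nonneg (r - 1); positivity
  set P := Real.exp (K * T) * (‖Y₀‖ + K * A * T) with hP
  have hP0 : 0 ≤ P := by positivity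
  have low : ∀ n n' : ℕ, 1 ≤ n → 1 ≤ n' → ∀ t ∈ Icc 0 T,
      ‖lower d (Y n t - Y n' t)‖ ≤ P * (1 / n + 1 / n') := by
    intro n n' hn hn' t ht
    have h := norm_sub_approximate_flow_le hn hn' hr hm hd (hYc n) (hYc n') (hD n) (hD n') (hYh n')
      (hYd n) (hYd n') ht
    have h0 : ‖lower d (Y n 0 - Y n' 0)‖ ≤ ‖Y₀‖ * (1 / n + 1 / n') := by
      rw [hY0, hY0]
      have e : lower d (lowPass n Y₀ - lowPass n' Y₀) =
          -(lower d Y₀ - lowPass n (lower d Y₀)) + (lower d Y₀ - lowPass n' (lower d Y₀)) := by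
        rw [map_sub, lower, lowPass, lowPass, mulOp_comm (bddSymbol_lower hd0) (bddSymbol_cutoff n),
          mulOp_comm (bddSymbol_lower hd0) (bddSymbol_cutoff n')]
        abel
      rw [e]
      refine (norm_add_le _ _).trans ?_
      rw [norm_neg, mul_add, mul_one_div, mul_one_div]
      exact add_le_add (norm_sub_lowPass_lower_le hn (by linarith) _)
        (norm_sub_lowPass_lower_le hn' (by linarith) _)
    rw [← hK, ← hA] at h
    refine h.trans ?_
    rw [hP]
    have ht0 := ht.1
    have hq : (0 : ℝ) ≤ 1 / n + 1 / n' := by positivity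
    calc _ ≤ Real.exp (K * T) * (‖Y₀‖ * (1 / n + 1 / n') + K * (A * (1 / n + 1 / n')) * T) := by
          refine mul_le_mul (Real.exp_le_exp.2 (mul_le_mul_of_nonneg_left ht.2 hK0))
            (add_le_add h0 (mul_le_mul_of_nonneg_left ht.2 (by positivity))) (by positivity)
            (Real.exp_pos _).le
      _ = _ := by ring
  -- First R is chosen so that each of the two tails is at most ε/8, and then N so that the
  -- weak-norm term is at most ε/2 for this R.
  have unif : ∀ ε : ℝ, 0 < ε → ∃ N : ℕ, 1 ≤ N ∧ ∀ n, N ≤ n → ∀ n', N ≤ n' → ∀ t ∈ Icc 0 T,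
      ‖Y n t - Y n' t‖ ≤ ε := by
    intro ε hε
    obtain ⟨R, hR1, hR⟩ : ∃ R : ℝ, 1 ≤ R ∧ ‖tail R Y₀‖ < ε / (8 * c) :=
      (((Filter.eventually_ge_atTop 1).and
        ((tendsto_tail Y₀).eventually (gt_mem_nhds (by positivity)))).exists)
    obtain ⟨N, hN⟩ := exists_nat_gt (4 * (R ^ d * P) / ε)
    have hRd : 0 ≤ R ^ d := by positivity
    refine ⟨N + 1, by omega, fun n hn n' hn' t ht => ?_⟩
    have h1 := norm_le_lower_add_tail hd0 hR1 (Y n t - Y n' t)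
    have h2 := low n n' (by omega) (by omega) t ht
    have h3 : ‖tail R (Y n t - Y n' t)‖ ≤ ε / 4 := by
      rw [map_sub]
      refine (norm_sub_le _ _).trans ?_
      have q1 := hYt' n t ht R (by linarith)
      have q2 := hYt' n' t ht R (by linarith)
      have q3 : c * ‖tail R Y₀‖ ≤ ε / 8 := by
        calc _ ≤ c * (ε / (8 * c)) := by gcongr
          _ = _ := by field_simp
      linarith
    have hNn : ∀ n : ℕ, N + 1 ≤ n → R ^ d * (P * (1 / n)) ≤ ε / 4 := by
      intro n hn
      have : (N : ℝ) < n := by exact_mod_cast hn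
      have hn0 : (0 : ℝ) < n := lt_of_le_of_lt (by positivity) this
      have : 4 * (R ^ d * P) / ε ≤ n := (hN.trans this).le
      rw [div_le_iff₀ hε] at this
      rw [← mul_assoc, mul_one_div, div_le_iff₀ hn0]; linarith
    have h4 := hNn n hn
    have h5 := hNn n' hn'
    calc _ ≤ R ^ d * (P * (1 / n + 1 / n')) + 2 * (ε / 4) := h1.trans (by gcongr)
      _ = R ^ d * (P * (1 / n)) + R ^ d * (P * (1 / n')) + 2 * (ε / 4) := by ring
      _ ≤ _ := by linarith
  have cau : UniformCauchySeqOn Y Filter.atTop (Icc 0 T) := by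
    rw [Metric.uniformCauchySeqOn_iff]
    intro ε hε
    obtain ⟨N, -, hN⟩ := unif (ε / 2) (by positivity)
    exact ⟨N, fun n hn n' hn' t ht => by
      rw [dist_eq_norm]; exact (hN n hn n' hn' t ht).trans_lt (by linarith)⟩
  have lim : ∀ t, ∃ y, t ∈ Icc 0 T → Filter.Tendsto (fun n => Y n t) Filter.atTop (nhds y) := by
    intro t
    by_cases ht : t ∈ Icc 0 T
    · obtain ⟨y, hy⟩ := cauchySeq_tendsto_of_complete (cau.cauchySeq ht)
      exact ⟨y, fun _ => hy⟩
    · exact ⟨0, fun h => absurd h ht⟩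
  choose X hX using lim
  have hu : TendstoUniformlyOn Y X Filter.atTop (Icc 0 T) :=
    cau.tendstoUniformlyOn_of_tendsto fun t ht => hX t ht
  have hXc : ContinuousOn X (Icc 0 T) :=
    hu.continuousOn (Filter.Eventually.of_forall fun n => hYc n).frequently
  have hXt : ∀ t ∈ Icc 0 T, ∀ R, 0 ≤ R →
      ‖tail R (X t)‖ ≤ Real.exp (flowRate r d B * t) * ‖tail R Y₀‖ := fun t ht R hR =>
    le_of_tendsto (((tail R).continuous.tendsto _).comp (hX t ht)).norm
      (Filter.Eventually.of_forall fun n => hYt n t ht R hR)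
  have hXD : ∀ t ∈ Icc 0 T, ‖X t‖ ≤ D := fun t ht =>
    le_of_tendsto (hX t ht).norm (Filter.Eventually.of_forall fun n => hD n t ht)
  have a1 : Adm (r - 1) (atLevel burgersKernel (r + d) (r + d) r) (2 ^ (r + 1)) :=
    adm_burgersBil (by linarith) (by linarith) (by linarith)
  have a2 : Adm (r - 1) (atLevel burgersKernel (r + d) (r + d) (r + d - m)) (2 ^ (r + d - m + 1)) :=
    adm_burgersBil (by linarith) (by linarith) (by linarith)
  have hconv : ∀ F : L2, lower (d - m) (burgersBil (r + d) (r + d - m) F F) =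
      burgersBil (r + d) r F F := fun F =>
    lower_burgersBil (r := r) hr (by linarith) (by linarith) (by linarith) hdm (by ring) _ _
  have hXd : ∀ t ∈ Ioo 0 T, HasDerivAt (fun t => lower d (X t))
      (burgersBil (r + d) r (X t) (X t)) t := by
    intro t ht
    refine hasDerivAt_of_tendstoUniformlyOn isOpen_Ioo (l := Filter.atTop)
      (f := fun n t => lower d (Y n t))
      (f' := fun n t => lowPass n (burgersBil (r + d) r (Y n t) (Y n t)))
      (g' := fun t => burgersBil (r + d) r (X t) (X t)) ?_
      (Filter.Eventually.of_forall fun n t ht => hYd n t ht)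
      (fun t ht => ((lower d).continuous.tendsto _).comp (hX t (Ioo_subset_Icc_self ht))) ht
    rw [Metric.tendstoUniformlyOn_iff]
    intro ε hε
    set Q := 2 * 2 ^ (r + 1) * bilConst (r - 1) * D with hQ
    have hQ0 : 0 ≤ Q := by have := bilConst_nonneg (r - 1); positivity
    have hu' := Metric.tendstoUniformlyOn_iff.1 hu (ε / (2 * (Q + 1))) (by positivity)
    obtain ⟨N, hN⟩ := exists_nat_gt (4 * A / ε)
    filter_upwards [hu', Filter.eventually_ge_atTop (N + 1)] with n hn hNn t ht
    have ht' := Ioo_subset_Icc_self ht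
    have hn1 := hn t ht'
    rw [dist_eq_norm] at hn1 ⊢
    have h1 := burgersBil_sub a1 ha (hXD t ht') (hD n t ht')
    have h2 : ‖burgersBil (r + d) r (X t) (X t) -
        lowPass n (burgersBil (r + d) r (X t) (X t))‖ ≤ A / n := by
      rw [← hconv]
      refine (norm_sub_lowPass_lower_le (by omega) (by linarith) _).trans ?_
      gcongr
      refine (a2.norm_bil_le ha _ _).trans ?_
      have := bilConst_nonneg (r - 1)
      rw [hA]
      have := hXD t ht'
      gcongr
    have h3 := norm_lowPass_le n (burgersBil (r + d) r (X t) (X t) -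
      burgersBil (r + d) r (Y n t) (Y n t))
    have h4 : A / n ≤ ε / 4 := by
      have : (N : ℝ) < n := by exact_mod_cast hNn
      have hn0 : (0 : ℝ) < n := lt_of_le_of_lt (by positivity) this
      have : 4 * A / ε ≤ n := (hN.trans this).le
      rw [div_le_iff₀ hε] at this
      rw [div_le_iff₀ hn0]; linarith
    have h5 : Q * ‖X t - Y n t‖ ≤ ε / 2 := by
      calc _ ≤ (Q + 1) * (ε / (2 * (Q + 1))) := by gcongr; linarith
        _ = _ := by field_simp
    have e : burgersBil (r + d) r (X t) (X t) - lowPass n (burgersBil (r + d) r (Y n t) (Y n t)) =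
        (burgersBil (r + d) r (X t) (X t) - lowPass n (burgersBil (r + d) r (X t) (X t))) +
        lowPass n (burgersBil (r + d) r (X t) (X t) - burgersBil (r + d) r (Y n t) (Y n t)) := by
      rw [map_sub]; abel
    rw [e]
    exact (norm_add_le _ _).trans_lt (by linarith)
  have h0T : (0 : ℝ) ∈ Icc 0 T := ⟨le_rfl, hT⟩
  refine ⟨X, ?_, ⟨hXc, fun t ht => ?_, fun t ht => ?_⟩, hXt⟩
  · refine tendsto_nhds_unique (hX 0 h0T) ?_
    have h := tendsto_mulOp (l := Filter.atTop) (m := fun n => ofRealSymbol (cutoff n))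
      (m₀ := fun _ => 1) (Filter.Eventually.of_forall fun n => bddSymbol_cutoff n) bddSymbol_one
      (fun ξ => by
        refine tendsto_const_nhds.congr' ?_
        obtain ⟨N, hN⟩ := exists_nat_gt (jap ξ)
        filter_upwards [Filter.eventually_ge_atTop N] with n hn
        have : jap ξ ≤ n := hN.le.trans (by exact_mod_cast hn)
        simp [ofRealSymbol, cutoff, this]) Y₀
    rw [mulOp_one] at h
    simp only [hY0]
    exact h
  · exact isClosed_isHerm.mem_of_tendsto (hX t ht) (Filter.Eventually.of_forall fun n => hYh n t ht)
  -- The derivative has been identified in H^r only. The right-hand side is continuous in H^{r+d-m},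
  -- so the equation holds there, end points included.
  · refine hasDerivWithinAt_of_mulOp (bddSymbol_lower hdm)
      (fun ξ => by simpa [ofRealSymbol] using (jap_rpow_pos ξ (-(d - m))).ne')
      (x := fun t => lower m (X t)) (z := fun t => burgersBil (r + d) (r + d - m) (X t) (X t))
      ((lower m).continuous.comp_continuousOn hXc)
      (a2.continuousOn_bil ha hXc hXc)
      (fun t ht => ?_) ht
    change HasDerivAt (fun t => lower (d - m) (lower m (X t)))
      (lower (d - m) (burgersBil (r + d) (r + d - m) (X t) (X t))) t
    simp only [hconv, lower_lower hdm (by linarith : 0 ≤ m), sub_add_cancel]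
    exact hXd t ht

namespace IsBurgersCurve
variable {r d m a b D : ℝ} {Y Y' : ℝ → L2}

theorem hasDerivWithinAt_lower (h : IsBurgersCurve (r + d) m a b Y) (hr : 3 / 2 < r) (hm : 1 ≤ m)
    (hd : m ≤ d) {t : ℝ} (ht : t ∈ Icc a b) : HasDerivWithinAt (fun t => lower d (Y t))
      (burgersBil (r + d) r (Y t) (Y t)) (Icc a b) t := by
  have h1 := hasDerivWithinAt_mulOp (ofRealSymbol fun ξ => jap ξ ^ (-(d - m))) (h.deriv t ht)
  have e : mulOp (ofRealSymbol fun ξ => jap ξ ^ (-(d - m)))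
      (burgersBil (r + d) (r + d - m) (Y t) (Y t)) = burgersBil (r + d) r (Y t) (Y t) :=
    lower_burgersBil (r := r) hr (by linarith) (by linarith) (by linarith) (by linarith)
      (by ring) _ _
  rw [e] at h1
  have e2 : ∀ F, mulOp (ofRealSymbol fun ξ => jap ξ ^ (-(d - m))) (lower m F) = lower d F :=
    fun F => (lower_lower (by linarith) (by linarith) F).trans (by rw [sub_add_cancel])
  simpa only [e2] using h1

theorem hasDerivAt_lower (h : IsBurgersCurve (r + d) m a b Y) (hr : 3 / 2 < r) (hm : 1 ≤ m)
    (hd : m ≤ d) {t : ℝ} (ht : t ∈ Ioo a b) : HasDerivAt (fun t => lower d (Y t))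
      (burgersBil (r + d) r (Y t) (Y t)) t :=
  (h.hasDerivWithinAt_lower hr hm hd (Ioo_subset_Icc_self ht)).hasDerivAt (Icc_mem_nhds ht.1 ht.2)

theorem norm_lower_sub_le (h : IsBurgersCurve (r + d) m a b Y)
    (h' : IsBurgersCurve (r + d) m a b Y') (hr : 3 / 2 < r) (hm : 1 ≤ m) (hd : m ≤ d)
    (hD : ∀ t ∈ Icc a b, ‖Y t‖ ≤ D) (hD' : ∀ t ∈ Icc a b, ‖Y' t‖ ≤ D) {t : ℝ} (ht : t ∈ Icc a b) :
    ‖lower d (Y t - Y' t)‖ ≤ Real.exp (stabConst r 0 D * (t - a)) * ‖lower d (Y a - Y' a)‖ := by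
  have hD0 : 0 ≤ D := (norm_nonneg _).trans (hD t ht)
  have hdm : 0 ≤ d - m := by linarith
  have conv : ∀ F : L2, burgersBil (r + m) r (lower (d - m) F) (lower (d - m) F) =
      burgersBil (r + d) r F F := fun F => burgersBil_lower hdm (by ring) _ _
  have low2 : ∀ F : L2, lower m (lower (d - m) F) = lower d F := fun F => by
    rw [lower_lower (by linarith) hdm]; congr 1; ring_nf
  have hst := stability (r := r) (m := m) (p := m) (M := 0) (B := D) (S := 0) hr hm le_rfl
    (IsAdmissibleSymbol.zero m le_rfl) (a := a) (b := b)
    (f := fun t => lower (d - m) (Y t)) (g := fun t => lower (d - m) (Y' t)) (j := fun _ => 0)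
    (ρ := fun _ => 0) le_rfl hD0
    (fun t ht => (norm_lower_le hdm _).trans (hD t ht))
    (fun t ht => (norm_lower_le hdm _).trans (hD' t ht))
    (fun t ht => (h'.herm t ht).lower hdm) (fun t _ => by rw [norm_zero])
    (fun t ht => by rw [norm_zero]) (by
      simp only [sub_zero, ← map_sub, low2]
      exact (lower d).continuous.comp_continuousOn (h.cont.sub h'.cont)) (fun t ht => by
      have h1 := (h.hasDerivAt_lower hr hm hd ht).sub (h'.hasDerivAt_lower hr hm hd ht)
      simp only [sub_zero, ← map_sub, low2]
      rw [mulOp_dispSymbol_zero, zero_add, add_zero]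
      change HasDerivAt _ (burgersBil (r + m) r _ _ - burgersBil (r + m) r _ _) t
      rw [conv, conv]
      refine h1.congr_of_eventuallyEq (Filter.Eventually.of_forall fun r => ?_)
      simp) t ht
  simp only [sub_zero, ← map_sub, low2, mul_zero, zero_mul, add_zero] at hst
  exact hst

theorem eqOn (h : IsBurgersCurve (r + d) m a b Y)
    (h' : IsBurgersCurve (r + d) m a b Y') (hr : 3 / 2 < r) (hm : 1 ≤ m) (hd : m ≤ d)
    (h0 : Y a = Y' a) : EqOn Y Y' (Icc a b) := by
  intro t ht
  obtain ⟨D1, hD1⟩ := isCompact_Icc.exists_bound_of_continuousOn h.cont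
  obtain ⟨D2, hD2⟩ := isCompact_Icc.exists_bound_of_continuousOn h'.cont
  have := h.norm_lower_sub_le h' hr hm hd (D := max D1 D2)
    (fun t ht => (hD1 t ht).trans (le_max_left _ _))
    (fun t ht => (hD2 t ht).trans (le_max_right _ _)) ht
  rw [h0, sub_self, map_zero, norm_zero, mul_zero] at this
  exact sub_eq_zero.1 (lower_injective (by linarith)
    ((norm_le_zero_iff.1 this).trans (map_zero _).symm))

/-- A curve in `H^s` which solves the Burgers equation in `L²` solves it in `H^{s-m}`. -/
theorem of_lower {s : ℝ} (hm : 1 ≤ m) (hsm : r ≤ s - m) (hr : 3 / 2 < r)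
    (hc : ContinuousOn Y (Icc a b)) (hH : ∀ t ∈ Icc a b, IsHerm (Y t))
    (hd : ∀ t ∈ Ioo a b, HasDerivAt (fun t => lower s (Y t)) (burgersBil s 0 (Y t) (Y t)) t) :
    IsBurgersCurve s m a b Y := by
  have a2 : Adm (r - 1) (atLevel burgersKernel s s (s - m)) (2 ^ (s - m + 1)) :=
    adm_burgersBil (by linarith) (by linarith) (by linarith)
  have hdm : 0 ≤ s - m := by linarith
  refine ⟨hc, hH, fun t ht => ?_⟩
  refine hasDerivWithinAt_of_mulOp (bddSymbol_lower hdm)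
    (fun ξ => by simpa [ofRealSymbol] using (jap_rpow_pos ξ (-(s - m))).ne')
    (x := fun t => lower m (Y t)) (z := fun t => burgersBil s (s - m) (Y t) (Y t))
    ((lower m).continuous.comp_continuousOn hc)
    (a2.continuousOn_bil (by linarith) hc hc) (fun t ht => ?_) ht
  change HasDerivAt (fun t => lower (s - m) (lower m (Y t)))
    (lower (s - m) (burgersBil s (s - m) (Y t) (Y t))) t
  rw [lower_burgersBil (r := r) (o' := 0) hr (by linarith) (by linarith) (by linarith) hdm (by ring)]
  simp only [lower_lower hdm (by linarith : 0 ≤ m), sub_add_cancel]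
  exact hd t ht

end IsBurgersCurve

/-- Joint continuity of the flow of the Burgers equation. -/
theorem continuousOn_flow {r m d D c T : ℝ} (hr : 3 / 2 < r) (hm : 1 ≤ m) (hd : m ≤ d)
    (hc : 0 ≤ c) {X : Type*} [TopologicalSpace X] {S : Set X} {y : X → L2} (hy : ContinuousOn y S)
    {Φ : X → ℝ → L2} (h0 : ∀ x ∈ S, Φ x 0 = y x)
    (hΦ : ∀ x ∈ S, IsBurgersCurve (r + d) m 0 T (Φ x))
    (hD : ∀ x ∈ S, ∀ t ∈ Icc 0 T, ‖Φ x t‖ ≤ D)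
    (htail : ∀ x ∈ S, ∀ t ∈ Icc 0 T, ∀ R, 0 ≤ R → ‖tail R (Φ x t)‖ ≤ c * ‖tail R (y x)‖) :
    ContinuousOn (fun q : ℝ × X => Φ q.2 q.1) (Icc 0 T ×ˢ S) := by
  rintro ⟨t₀, x₀⟩ ⟨ht₀, hx₀⟩
  have hd0 : 0 ≤ d := by linarith
  have hD0 : 0 ≤ D := (norm_nonneg _).trans (hD x₀ hx₀ t₀ ht₀)
  have hK := stabConst_nonneg hr le_rfl hD0
  have hT : 0 ≤ T := ht₀.1.trans ht₀.2
  set K := stabConst r 0 D with hKdef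
  have h1 : Filter.Tendsto (fun q : ℝ × X => Φ x₀ q.1) (nhdsWithin (t₀, x₀) (Icc 0 T ×ˢ S))
      (nhds (Φ x₀ t₀)) := by
    have := (hΦ x₀ hx₀).cont t₀ ht₀
    refine this.tendsto.comp ?_
    exact tendsto_nhdsWithin_of_tendsto_nhds_of_eventually_within _
      (continuous_fst.continuousWithinAt) (eventually_nhdsWithin_of_forall fun q hq => hq.1)
  have hy' : Filter.Tendsto (fun q : ℝ × X => y q.2) (nhdsWithin (t₀, x₀) (Icc 0 T ×ˢ S))
      (nhds (y x₀)) :=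
    (hy x₀ hx₀).tendsto.comp (tendsto_nhdsWithin_of_tendsto_nhds_of_eventually_within _
      (continuous_snd.continuousWithinAt) (eventually_nhdsWithin_of_forall fun q hq => hq.2))
  rw [ContinuousWithinAt, Metric.tendsto_nhds]
  intro ε hε
  -- R depends on the limit datum only. The tail of a nearby datum exceeds that of y x₀ by at most
  -- the distance of the data.
  obtain ⟨R, hR1, hR⟩ : ∃ R : ℝ, 1 ≤ R ∧ ‖tail R (y x₀)‖ < ε / (16 * (c + 1)) :=
    (((Filter.eventually_ge_atTop 1).and
      ((tendsto_tail (y x₀)).eventually (gt_mem_nhds (by positivity)))).exists)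
  have hRd : 0 ≤ R ^ d := by positivity
  set P := R ^ d * Real.exp (K * T) + 2 * c with hP
  have hP0 : 0 ≤ P := by positivity
  filter_upwards [Metric.tendsto_nhds.1 h1 (ε / 4) (by positivity),
    Metric.tendsto_nhds.1 hy' (ε / (4 * (P + 1))) (by positivity), self_mem_nhdsWithin]
    with q hq1 hq2 hq
  obtain ⟨hqt, hqx⟩ := hq
  rw [dist_eq_norm] at hq1 hq2 ⊢
  have a1 := norm_le_lower_add_tail hd0 hR1 (Φ q.2 q.1 - Φ x₀ q.1)
  have a2 := (hΦ q.2 hqx).norm_lower_sub_le (hΦ x₀ hx₀) hr hm hd (hD q.2 hqx) (hD x₀ hx₀) hqt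
  rw [h0 _ hqx, h0 _ hx₀, sub_zero] at a2
  have a3 : ‖lower d (Φ q.2 q.1 - Φ x₀ q.1)‖ ≤ Real.exp (K * T) * ‖y q.2 - y x₀‖ := by
    refine a2.trans (mul_le_mul (Real.exp_le_exp.2 ?_) (norm_lower_le hd0 _) (norm_nonneg _)
      (Real.exp_pos _).le)
    exact mul_le_mul_of_nonneg_left hqt.2 hK
  have hR0 : 0 ≤ R := by linarith
  have a4 : ‖tail R (Φ q.2 q.1 - Φ x₀ q.1)‖ ≤ c * ‖y q.2 - y x₀‖ + 2 * (c * ‖tail R (y x₀)‖) := by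
    rw [map_sub]
    have b1 := htail _ hqx _ hqt R hR0
    have b2 := htail _ hx₀ _ hqt R hR0
    have b3 : ‖tail R (y q.2)‖ ≤ ‖y q.2 - y x₀‖ + ‖tail R (y x₀)‖ := by
      have : tail R (y q.2) = tail R (y q.2 - y x₀) + tail R (y x₀) := by rw [map_sub]; abel
      rw [this]
      exact (norm_add_le _ _).trans (by gcongr; exact norm_tail_le hR0 _)
    have b4 := mul_le_mul_of_nonneg_left b3 hc
    refine (norm_sub_le _ _).trans ?_
    linarith
  have a5 : c * ‖tail R (y x₀)‖ ≤ ε / 16 := by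
    calc _ ≤ (c + 1) * (ε / (16 * (c + 1))) := by gcongr; linarith
      _ = _ := by field_simp
  have a6 : ‖Φ q.2 q.1 - Φ x₀ q.1‖ ≤ ε / 2 := by
    calc _ ≤ R ^ d * (Real.exp (K * T) * ‖y q.2 - y x₀‖) +
          2 * (c * ‖y q.2 - y x₀‖ + 2 * (ε / 16)) := a1.trans (by gcongr; linarith)
      _ = P * ‖y q.2 - y x₀‖ + ε / 4 := by rw [hP]; ring
      _ ≤ (P + 1) * (ε / (4 * (P + 1))) + ε / 4 := by gcongr; linarith
      _ = _ := by field_simp; ring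
  calc _ = ‖(Φ q.2 q.1 - Φ x₀ q.1) + (Φ x₀ q.1 - Φ x₀ t₀)‖ := by congr 1; abel
    _ ≤ _ := norm_add_le _ _
    _ < ε := by linarith

/-! ### The dispersive semigroup -/

/-- The symbol of the dispersive semigroup. -/
def semiSymbol (k : ℝ → ℂ) (t ξ : ℝ) : ℂ := Complex.exp (t * freqSymbol k ξ)

/-- The dispersive semigroup, `e^{tK}`. -/
def semi (k : ℝ → ℂ) (t : ℝ) : L2 →L[ℂ] L2 := mulOp (semiSymbol k t)

theorem norm_exp_sub_exp_le {a b : ℂ} (ha : a.re ≤ 0) (hb : b.re ≤ 0) :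
    ‖Complex.exp b - Complex.exp a‖ ≤ ‖b - a‖ := by
  have h := Convex.norm_image_sub_le_of_norm_hasDerivWithin_le (f := Complex.exp)
    (f' := Complex.exp) (s := {w : ℂ | w.re ≤ 0}) (C := 1) (x := a) (y := b)
    (fun w _ => (Complex.hasDerivAt_exp w).hasDerivWithinAt)
    (fun w hw => by rw [Complex.norm_exp]; exact Real.exp_le_one_iff.2 hw)
    (convex_halfSpace_re_le 0) ha hb
  simpa using h

theorem semi_zero (k : ℝ → ℂ) (F : L2) : semi k 0 F = F := by
  have : semiSymbol k 0 = fun _ => 1 := by funext ξ; simp [semiSymbol]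
  rw [semi, this, mulOp_one]

section semi
variable {p M m : ℝ} {k : ℝ → ℂ} (hk : IsAdmissibleSymbol p M k)
include hk

theorem re_mul_freqSymbol {t : ℝ} (ht : 0 ≤ t) (ξ : ℝ) : ((t : ℂ) * freqSymbol k ξ).re ≤ 0 := by
  rw [Complex.re_ofReal_mul]; exact mul_nonpos_of_nonneg_of_nonpos ht (re_freqSymbol hk ξ)

theorem bddSymbol_semi {t : ℝ} (ht : 0 ≤ t) : BddSymbol (semiSymbol k t) 1 :=
  ⟨Complex.measurable_exp.comp (measurable_const.mul (measurable_freqSymbol hk)), fun ξ => by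
    rw [semiSymbol, Complex.norm_exp]
    exact Real.exp_le_one_iff.2 (re_mul_freqSymbol hk ht ξ)⟩

theorem norm_semi_le {t : ℝ} (ht : 0 ≤ t) (F : L2) : ‖semi k t F‖ ≤ ‖F‖ :=
  (norm_mulOp_le (bddSymbol_semi hk ht) F).trans_eq (one_mul _)

theorem IsHerm.semi {F : L2} (hF : IsHerm F) {t : ℝ} (ht : 0 ≤ t) : IsHerm (semi k t F) :=
  hF.mulOp (bddSymbol_semi hk ht) fun ξ => by
    rw [semiSymbol, semiSymbol, freqSymbol_neg hk, ← Complex.exp_conj, map_mul, Complex.conj_ofReal]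

theorem lower_semi {t : ℝ} (ht : 0 ≤ t) {a : ℝ} (ha : 0 ≤ a) (F : L2) :
    lower a (semi k t F) = semi k t (lower a F) :=
  mulOp_comm (bddSymbol_lower ha) (bddSymbol_semi hk ht) F

theorem continuousOn_semi_const (F : L2) : ContinuousOn (fun t => semi k t F) (Ici 0) := by
  intro t ht
  exact tendsto_mulOp (l := nhdsWithin t (Ici 0)) (m := fun t => semiSymbol k t)
    (m₀ := semiSymbol k t) (C := 1)
    (eventually_nhdsWithin_of_forall fun t ht => bddSymbol_semi hk ht) (bddSymbol_semi hk ht)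
    (fun ξ => (Continuous.tendsto (f := fun t : ℝ => semiSymbol k t ξ)
      (by unfold semiSymbol; fun_prop) t).mono_left nhdsWithin_le_nhds) F

/-- Because the semigroup is contractive, strong continuity at the fixed element F₀ is enough. -/
theorem tendsto_semi {ι : Type*} {l : Filter ι} {τ : ι → ℝ} {F : ι → L2} {τ₀ : ℝ} {F₀ : L2}
    (hτ : Filter.Tendsto τ l (nhds τ₀)) (h0 : ∀ᶠ i in l, 0 ≤ τ i) (h₀ : 0 ≤ τ₀)
    (hF : Filter.Tendsto F l (nhds F₀)) :
    Filter.Tendsto (fun i => semi k (τ i) (F i)) l (nhds (semi k τ₀ F₀)) := by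
  have h1 : Filter.Tendsto (fun i => semi k (τ i) F₀) l (nhds (semi k τ₀ F₀)) :=
    (continuousOn_semi_const hk F₀ τ₀ h₀).tendsto.comp
      (tendsto_nhdsWithin_of_tendsto_nhds_of_eventually_within _ hτ h0)
  have h2 : Filter.Tendsto (fun i => semi k (τ i) (F i - F₀)) l (nhds (0 : L2)) := by
    have h3 : Filter.Tendsto (fun i => ‖F i - F₀‖) l (nhds 0) :=
      tendsto_iff_norm_sub_tendsto_zero.1 hF
    refine squeeze_zero_norm' (a := fun i => ‖F i - F₀‖) ?_ h3
    filter_upwards [h0] with i hi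
    exact norm_semi_le hk hi _
  have h3 := h2.add h1
  rw [zero_add (semi k τ₀ F₀)] at h3
  refine h3.congr fun i => ?_
  rw [map_sub]; abel

theorem continuousOn_semi {X : Type*} [TopologicalSpace X] {S : Set X} {τ : X → ℝ} {F : X → L2}
    (hτ : ContinuousOn τ S) (h0 : ∀ x ∈ S, 0 ≤ τ x) (hF : ContinuousOn F S) :
    ContinuousOn (fun x => semi k (τ x) (F x)) S := fun x hx =>
  tendsto_semi hk (hτ x hx) (eventually_nhdsWithin_of_forall h0) (h0 x hx) (hF x hx)

/-- After division by ⟨2πξ⟩^m the difference quotients of the symbol are bounded by M, since exp is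
1-Lipschitz on the left half-plane. Dominated convergence then passes to the limit. -/
theorem hasDerivWithinAt_semi (hm : 0 ≤ m) (hpm : p ≤ m) (F : L2) {t : ℝ} (ht : 0 ≤ t) :
    HasDerivWithinAt (fun t => lower m (semi k t F)) (mulOp (dispSymbol k m) (semi k t F))
      (Ici 0) t := by
  have hM := hk.M_nonneg
  have hdisp := bddSymbol_dispSymbol hk hpm
  have hlow := bddSymbol_lower hm
  rw [hasDerivWithinAt_iff_tendsto_slope]
  set q : ℝ → ℝ → ℂ := fun t' ξ => ((jap ξ ^ (-m) : ℝ) : ℂ) *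
    (((t' - t : ℝ) : ℂ)⁻¹ * (semiSymbol k t' ξ - semiSymbol k t ξ)) with hq
  have hqb : ∀ t' ∈ Ici (0 : ℝ) \ {t}, BddSymbol (q t') M := by
    intro t' ht'
    have h1 := bddSymbol_semi hk ht'.1
    have h2 := bddSymbol_semi hk ht
    refine ⟨hlow.meas.mul (measurable_const.mul (h1.meas.sub h2.meas)), fun ξ => ?_⟩
    refine le_trans ?_ (hdisp.bound ξ)
    rw [hq, dispSymbol, norm_mul, norm_mul _ (freqSymbol k ξ)]
    refine mul_le_mul_of_nonneg_left ?_ (norm_nonneg _)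
    have h3 := norm_exp_sub_exp_le (re_mul_freqSymbol hk ht ξ) (re_mul_freqSymbol hk ht'.1 ξ)
    rw [← sub_mul, ← Complex.ofReal_sub, norm_mul, Complex.norm_real] at h3
    have h4 : 0 < ‖t' - t‖ := norm_pos_iff.2 (sub_ne_zero.2 ht'.2)
    rw [norm_mul, norm_inv, Complex.norm_real, inv_mul_le_iff₀ h4]
    exact h3
  have hlim := tendsto_mulOp (l := nhdsWithin t (Ici 0 \ {t})) (m := q)
    (m₀ := fun ξ => dispSymbol k m ξ * semiSymbol k t ξ) (C := M)
    (eventually_nhdsWithin_of_forall hqb)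
    ((hdisp.mul (bddSymbol_semi hk ht)).mono (by rw [mul_one])) (fun ξ => by
      have h1 : HasDerivAt (fun t' : ℝ => semiSymbol k t' ξ)
          (semiSymbol k t ξ * freqSymbol k ξ) t := by
        have h2 : HasDerivAt (fun t' : ℝ => (t' : ℂ) * freqSymbol k ξ) (1 * freqSymbol k ξ) t :=
          (Complex.ofRealCLM.hasDerivAt (x := t)).mul_const _
        rw [one_mul] at h2
        exact h2.cexp
      have h3 := (hasDerivAt_iff_tendsto_slope.1 h1).mono_left
        (nhdsWithin_mono t (fun x hx => hx.2 : Ici (0 : ℝ) \ {t} ⊆ {t}ᶜ))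
      have h4 := h3.const_mul ((jap ξ ^ (-m) : ℝ) : ℂ)
      have e : dispSymbol k m ξ * semiSymbol k t ξ =
          ((jap ξ ^ (-m) : ℝ) : ℂ) * (semiSymbol k t ξ * freqSymbol k ξ) := by
        rw [dispSymbol]; ring
      rw [e]
      refine h4.congr fun t' => ?_
      simp only [hq, slope, vsub_eq_sub, Complex.real_smul, Complex.ofReal_inv]) F
  rw [← mulOp_mulOp hdisp (bddSymbol_semi hk ht)] at hlim
  refine hlim.congr' (eventually_nhdsWithin_of_forall fun t' ht' => ?_)
  symm
  refine eq_mulOp (hqb t' ht') ?_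
  rw [slope, vsub_eq_sub, ← map_sub, real_smul_eq, ← map_smul]
  set G := semi k t' F - semi k t F with hG
  filter_upwards [coeFn_mulOp hlow (((((t' - t)⁻¹ : ℝ)) : ℂ) • G), Lp.coeFn_smul (((t' - t)⁻¹ : ℝ) : ℂ) G,
    Lp.coeFn_sub (semi k t' F) (semi k t F), coeFn_mulOp (bddSymbol_semi hk ht'.1) F,
    coeFn_mulOp (bddSymbol_semi hk ht) F] with ξ b1 b2 b3 b4 b5
  rw [lower, b1, b2, Pi.smul_apply, hG, b3, Pi.sub_apply, semi, b4, semi, b5]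
  simp only [hq, ofRealSymbol, smul_eq_mul, Complex.ofReal_inv]
  ring

/-- The product rule for the semigroup acting on a curve. -/
theorem hasDerivWithinAt_semi_curve (hm : 0 ≤ m) (hpm : p ≤ m) {S : Set ℝ} (hS : S ⊆ Ici 0)
    {Y : ℝ → L2} {y' : L2} {t : ℝ} (ht : t ∈ S)
    (hY : HasDerivWithinAt (fun t => lower m (Y t)) y' S t) :
    HasDerivWithinAt (fun t => lower m (semi k t (Y t)))
      (mulOp (dispSymbol k m) (semi k t (Y t)) + semi k t y') S t := by
  have ht0 := hS ht
  have h1 := (hasDerivWithinAt_iff_tendsto_slope.1 ((hasDerivWithinAt_semi hk hm hpm (Y t) ht0).mono hS))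
  rw [hasDerivWithinAt_iff_tendsto_slope] at hY ⊢
  have h2 := tendsto_semi hk (l := nhdsWithin t (S \ {t})) (τ := fun t => t) (τ₀ := t)
    (Filter.tendsto_id.mono_left nhdsWithin_le_nhds)
    (eventually_nhdsWithin_of_forall fun x hx => hS hx.1) ht0 hY
  refine (h1.add h2).congr' (eventually_nhdsWithin_of_forall fun t' ht' => ?_)
  have ht0' := hS ht'.1
  simp only [slope, vsub_eq_sub]
  have e : ∀ (c : ℝ) (F : L2), semi k t' (c • F) = c • semi k t' F := fun c F =>
    mulOp_real_smul _ c F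
  rw [e, ← smul_add, map_sub, lower_semi hk ht0' hm, lower_semi hk ht0' hm, lower_semi hk ht0 hm]
  congr 1; abel

end semi

/-! ### Commutators -/

section commutator
variable {p M m r : ℝ} {k : ℝ → ℂ} (hk : IsAdmissibleSymbol p M k) (hpm : p ≤ m) (hm : 1 ≤ m)
  (hr : 3 / 2 < r)

/-- The commutator of the dispersion and the Burgers nonlinearity, from `H^s` to `H^o`. -/
abbrev commBil (k : ℝ → ℂ) (s o : ℝ) : L2 → L2 → L2 := bil (atLevel (commKernel k) s s o)

/-- A bound for the kernel of the commutator. -/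
def commConst (r m M : ℝ) : ℝ := 2 * M * 2 ^ (r + m + 1) * bilConst (r - 1)

/-- A bound for the remainder of the commutator with the dispersive semigroup. -/
def remConst (r m M : ℝ) : ℝ := 2 * (2 * M ^ 2 * (2 ^ m + 1)) * 2 ^ (r + 1) * bilConst (r - 1)

include hk hpm hm hr

/-- The output space H^{r+m} matters: the corrector is a multiple of this commutator, and K, which
costs m derivatives, is applied to it in the local error estimate. -/
theorem adm_comm : Adm (r - 1) (atLevel (commKernel k) (r + 3 * m) (r + 3 * m) (r + m))
    (2 * M * 2 ^ (r + m + 1)) :=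
  adm_atLevel (measurable_commKernel hk) (norm_commKernel_le hk hpm hm)
    (by have := hk.M_nonneg; positivity) (by linarith) (Or.inl ⟨by linarith, by linarith⟩)
    (Or.inr ⟨by linarith, by linarith⟩)

theorem adm_comm' : Adm (r - 1) (atLevel (commKernel k) (r + 3 * m) (r + 3 * m) r)
    (2 * M * 2 ^ (r + 1)) :=
  adm_atLevel (measurable_commKernel hk) (norm_commKernel_le hk hpm hm)
    (by have := hk.M_nonneg; positivity) (by linarith) (Or.inl ⟨by linarith, by linarith⟩)
    (Or.inr ⟨by linarith, by linarith⟩)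

/-- One argument is needed only in H^{r+2m}, where the curves move by O(t) in time t. With
`adm_comm_right` this bounds the change of the commutator along a flow. -/
theorem adm_comm_left : Adm (r - 1) (atLevel (commKernel k) (r + 2 * m) (r + 3 * m) r)
    (2 * M * 2 ^ (r + 1)) :=
  adm_atLevel (measurable_commKernel hk) (norm_commKernel_le hk hpm hm)
    (by have := hk.M_nonneg; positivity) (by linarith) (Or.inl ⟨by linarith, by linarith⟩)
    (Or.inr ⟨by linarith, by linarith⟩)

theorem adm_comm_right : Adm (r - 1) (atLevel (commKernel k) (r + 3 * m) (r + 2 * m) r)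
    (2 * M * 2 ^ (r + 1)) :=
  adm_atLevel (measurable_commKernel hk) (norm_commKernel_le hk hpm hm)
    (by have := hk.M_nonneg; positivity) (by linarith) (Or.inl ⟨by linarith, by linarith⟩)
    (Or.inr ⟨by linarith, by linarith⟩)

theorem adm_flowComm_sub {t : ℝ} (ht : 0 ≤ t) : Adm (r - 1)
    (atLevel (fun x y => flowCommKernel k t x y - t * commKernel k x y) (r + 3 * m) (r + 3 * m) r)
    (2 * (2 * M ^ 2 * (2 ^ m + 1) * t ^ 2) * 2 ^ (r + 1)) :=
  adm_atLevel_symm (κ := fun x y => flowCommKernel k t x y - t * commKernel k x y)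
    ((measurable_flowCommKernel hk t).sub
    (measurable_const.mul (measurable_commKernel hk)))
    (norm_flowCommKernel_sub_le hk hpm hm ht)
    (by positivity) (by linarith) (Or.inl ⟨by linarith, by linarith⟩)
    (Or.inr ⟨by linarith, by linarith⟩)

theorem norm_commBil_le (F : L2) :
    ‖commBil k (r + 3 * m) (r + m) F F‖ ≤ commConst r m M * ‖F‖ * ‖F‖ :=
  (adm_comm hk hpm hm hr).norm_bil_le (by linarith) F F

omit hpm hm hr in
theorem commConst_nonneg : 0 ≤ commConst r m M := by
  have := bilConst_nonneg (r - 1)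
  have := hk.M_nonneg
  unfold commConst; positivity

omit hk hpm hm hr in
theorem remConst_nonneg (r m M : ℝ) : 0 ≤ remConst r m M := by
  have := bilConst_nonneg (r - 1)
  unfold remConst; positivity

theorem lower_commBil (F : L2) : lower m (commBil k (r + 3 * m) (r + m) F F) =
    commBil k (r + 3 * m) r F F := by
  rw [commBil, lower_bil (adm_comm hk hpm hm hr) (by linarith) (by linarith), add_sub_cancel_right]

theorem norm_commBil_sub_le {F G : L2} {D : ℝ} (hF : ‖F‖ ≤ D) (hG : ‖G‖ ≤ D) :
    ‖commBil k (r + 3 * m) r F F - commBil k (r + 3 * m) r G G‖ ≤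
      2 * commConst r m M * D * ‖lower m (F - G)‖ := by
  have ha : 1 / 2 < r - 1 := by linarith
  have hm0 : 0 ≤ m := by linarith
  have h := adm_comm' hk hpm hm hr
  have e : commBil k (r + 3 * m) r F F - commBil k (r + 3 * m) r G G =
      bil (atLevel (commKernel k) (r + 2 * m) (r + 3 * m) r) (lower m (F - G)) F +
        bil (atLevel (commKernel k) (r + 3 * m) (r + 2 * m) r) G (lower m (F - G)) := by
    rw [bil_lower_left hm0, bil_lower_right hm0, show r + 2 * m + m = r + 3 * m by ring,
      commBil, h.bil_sub_left ha, h.bil_sub_right ha]; abel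
  have hb := bilConst_nonneg (r - 1)
  have hM := hk.M_nonneg
  have hD : 0 ≤ D := (norm_nonneg _).trans hF
  have h2 : (2 : ℝ) ^ (r + 1) ≤ 2 ^ (r + m + 1) :=
    Real.rpow_le_rpow_of_exponent_le (by norm_num) (by linarith)
  rw [e]
  calc _ ≤ 2 * M * 2 ^ (r + 1) * bilConst (r - 1) * ‖lower m (F - G)‖ * ‖F‖ +
        2 * M * 2 ^ (r + 1) * bilConst (r - 1) * ‖G‖ * ‖lower m (F - G)‖ :=
        (norm_add_le _ _).trans (add_le_add ((adm_comm_left hk hpm hm hr).norm_bil_le ha _ _)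
          ((adm_comm_right hk hpm hm hr).norm_bil_le ha _ _))
    _ ≤ 2 * M * 2 ^ (r + m + 1) * bilConst (r - 1) * ‖lower m (F - G)‖ * D +
        2 * M * 2 ^ (r + m + 1) * bilConst (r - 1) * D * ‖lower m (F - G)‖ := by gcongr
    _ = _ := by rw [commConst]; ring

/-- The commutator of the dispersive semigroup and the Burgers nonlinearity. -/
theorem exists_semi_burgersBil {t : ℝ} (ht : 0 ≤ t) (F : L2) :
    ∃ E : L2, ‖E‖ ≤ remConst r m M * t ^ 2 * ‖F‖ * ‖F‖ ∧
      semi k t (burgersBil (r + 3 * m) r F F) =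
        burgersBil (r + 3 * m) r (semi k t F) (semi k t F) +
          t • commBil k (r + 3 * m) r F F + E := by
  have ha : 1 / 2 < r - 1 := by linarith
  set s := r + 3 * m with hs
  have hS := bddSymbol_semi hk ht
  have aB : Adm (r - 1) (atLevel burgersKernel s s r) (2 ^ (r + 1)) :=
    adm_burgersBil (by linarith) (by linarith) (by linarith)
  have aC := adm_comm' hk hpm hm hr
  have aE := adm_flowComm_sub hk hpm hm hr ht
  refine ⟨bil (atLevel (fun x y => flowCommKernel k t x y - t * commKernel k x y) s s r) F F,
    (aE.norm_bil_le ha F F).trans_eq (by rw [remConst]; ring), ?_⟩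
  have hSc : Measurable fun q : ℝ × ℝ => semiSymbol k t (q.1 + q.2) :=
    hS.meas.comp (measurable_fst.add measurable_snd)
  have aS1 : Adm (r - 1) (fun x y => semiSymbol k t (x + y) * atLevel burgersKernel s s r x y)
      (1 * 2 ^ (r + 1)) :=
    aB.of_le (hSc.mul aB.meas) (fun x y => by
      rw [norm_mul]; gcongr; exact hS.bound _) zero_le_one
  have aS2 : Adm (r - 1) (fun x y => atLevel burgersKernel s s r x y *
      (semiSymbol k t x * semiSymbol k t y)) (1 * 2 ^ (r + 1)) :=
    aB.of_le (aB.meas.mul ((hS.meas.comp measurable_fst).mul (hS.meas.comp measurable_snd)))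
      (fun x y => by
        rw [norm_mul, norm_mul, mul_comm]
        gcongr
        exact mul_le_one₀ (hS.bound x) (norm_nonneg _) (hS.bound y)) zero_le_one
  have aD := aS1.sub aS2
  set κ : ℝ → ℝ → ℂ := fun x y => semiSymbol k t (x + y) * atLevel burgersKernel s s r x y -
    atLevel burgersKernel s s r x y * (semiSymbol k t x * semiSymbol k t y) with hκ
  have e1 : semi k t (burgersBil s r F F) - burgersBil s r (semi k t F) (semi k t F) =
      bil κ F F := by
    rw [semi, burgersBil, aB.mulOp_bil ha hS, bil_mulOp _ hS hS, sub_eq_iff_eq_add,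
      ← aD.bil_kernel_add aS2 ha]
    simp only [hκ, sub_add_cancel]
  have aH : Adm (r - 1) (fun x y => (1 / 2 : ℂ) * κ x y) (1 / 2 * (1 * 2 ^ (r + 1) + 1 * 2 ^ (r + 1))) :=
    aD.of_le (measurable_const.mul aD.meas) (fun x y => by rw [norm_mul]; norm_num) (by norm_num)
  -- Both arguments are F, so the kernel may be symmetrized. The factor -iy becomes -(i/2)(x+y), the
  -- form to which the hypothesis on the symbol applies.
  have e2 : bil κ F F = bil (fun x y => (1 / 2 : ℂ) * κ x y + (1 / 2 : ℂ) * κ y x) F F := by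
    rw [aH.bil_kernel_add aH.swap ha, ← bil_swap (fun x y => (1 / 2 : ℂ) * κ x y),
      aD.bil_kernel_smul ha, ← add_smul]
    norm_num
  have aC' : Adm (r - 1) (fun x y => (t : ℂ) * atLevel (commKernel k) s s r x y)
      (t * (2 * M * 2 ^ (r + 1))) :=
    aC.of_le (measurable_const.mul aC.meas) (fun x y => by
      rw [norm_mul, Complex.norm_real, Real.norm_of_nonneg ht]) ht
  rw [add_assoc, ← sub_eq_iff_eq_add', e1, e2, real_smul_eq, ← aC.bil_kernel_smul ha,
    ← aC'.bil_kernel_add aE ha]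
  congr 1
  funext x y
  simp only [hκ, atLevel, levelWeight, burgersKernel, flowCommKernel, semiSymbol, mul_add,
    Complex.exp_add, add_comm y x]
  push_cast
  ring

end commutator

/-- `U` is a curve of real-valued functions in `H^s`, solving the full equation in `H^{s-m}`. -/
structure IsFullCurve (k : ℝ → ℂ) (s m a b : ℝ) (U : ℝ → L2) : Prop where
  cont : ContinuousOn U (Icc a b)
  herm : ∀ t ∈ Icc a b, IsHerm (U t)
  deriv : ∀ t ∈ Icc a b, HasDerivWithinAt (fun t => lower m (U t))
    (mulOp (dispSymbol k m) (U t) + burgersBil s (s - m) (U t) (U t)) (Icc a b) t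

theorem norm_sub_le_of_hasDerivWithinAt {y y' : ℝ → L2} {a b C : ℝ}
    (hy : ∀ t ∈ Icc a b, HasDerivWithinAt y (y' t) (Icc a b) t)
    (hC : ∀ t ∈ Icc a b, ‖y' t‖ ≤ C) {t : ℝ} (ht : t ∈ Icc a b) : ‖y t - y a‖ ≤ C * (t - a) :=
  norm_image_sub_le_of_norm_deriv_le_segment' hy (fun t ht => hC t (Ico_subset_Icc_self ht)) t ht

/-! ### Local errors of the composed flows -/

section local_error
variable {p M m r : ℝ} {k : ℝ → ℂ} (hk : IsAdmissibleSymbol p M k) (hpm : p ≤ m) (hm : 1 ≤ m)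
  (hr : 3 / 2 < r)
include hk hpm hm hr

omit hk hpm in
theorem norm_lower_sub_start_le {h D : ℝ} {Y : ℝ → L2} (hY : IsBurgersCurve (r + 3 * m) m 0 h Y)
    (hD : ∀ t ∈ Icc 0 h, ‖Y t‖ ≤ D) {t : ℝ} (ht : t ∈ Icc 0 h) :
    ‖lower m (Y t - Y 0)‖ ≤ 2 ^ (r + 2 * m + 1) * bilConst (r - 1) * D * D * t := by
  have hb := bilConst_nonneg (r - 1)
  have aB : Adm (r - 1) (atLevel burgersKernel (r + 3 * m) (r + 3 * m) (r + 3 * m - m))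
      (2 ^ (r + 3 * m - m + 1)) :=
    adm_burgersBil (by linarith) (by linarith) (by linarith)
  have h1 := norm_sub_le_of_hasDerivWithinAt hY.deriv (fun t ht => by
    have h2 := hD t ht
    have hD0 := (norm_nonneg _).trans h2
    refine (aB.norm_bil_le (by linarith) _ _).trans (?_ : _ ≤
      2 ^ (r + 2 * m + 1) * bilConst (r - 1) * D * D)
    rw [show r + 3 * m - m + 1 = r + 2 * m + 1 by ring]
    gcongr) ht
  rwa [← map_sub, sub_zero] at h1

/-- The constant in the estimates of local errors. -/
def localConst (r m M D : ℝ) : ℝ :=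
  1 + (M + 1) * (1 + commConst r m M * D * D) + remConst r m M * D * D +
    2 * commConst r m M * D * (2 ^ (r + 2 * m + 1) * bilConst (r - 1) * D * D)

omit hpm hm hr in
theorem one_le_localConst {D : ℝ} (hD : 0 ≤ D) : 1 ≤ localConst r m M D := by
  have := bilConst_nonneg (r - 1)
  have hM := hk.M_nonneg
  have h1 := commConst_nonneg (r := r) (m := m) hk
  have h2 := remConst_nonneg r m M
  have h3 : 0 ≤ (M + 1) * (1 + commConst r m M * D * D) + remConst r m M * D * D +
    2 * commConst r m M * D * (2 ^ (r + 2 * m + 1) * bilConst (r - 1) * D * D) := by positivity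
  unfold localConst; linarith

/-- The error of the composition of the Burgers flow and the dispersive semigroup. -/
theorem norm_semi_flow_sub_le {h D : ℝ} {Y U : ℝ → L2} (hY : IsBurgersCurve (r + 3 * m) m 0 h Y)
    (hU : IsFullCurve k (r + 3 * m) m 0 h U) (hD : ∀ t ∈ Icc 0 h, ‖Y t‖ ≤ D)
    (hDU : ∀ t ∈ Icc 0 h, ‖U t‖ ≤ D) (g₀ : L2) {t : ℝ} (ht : t ∈ Icc 0 h) :
    ‖lower (3 * m) (semi k t (Y t) - U t) - lower m g₀ -
        (t ^ 2 / 2) • commBil k (r + 3 * m) r (Y 0) (Y 0)‖ ≤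
      Real.exp (stabConst r M D * t) * (‖lower (3 * m) (Y 0 - U 0) - lower m g₀‖ +
        stabConst r M D * (localConst r m M D * (t ^ 2 + ‖g₀‖)) * t) := by
  have ht0 := ht.1
  have h0 : (0 : ℝ) ∈ Icc 0 h := ⟨le_rfl, ht.1.trans ht.2⟩
  have hD0 : 0 ≤ D := (norm_nonneg _).trans (hD 0 h0)
  have hM := hk.M_nonneg
  have hc := commConst_nonneg (r := r) (m := m) hk
  have he := remConst_nonneg r m M
  have hb := bilConst_nonneg (r - 1)
  have hm0 : 0 ≤ m := by linarith
  have h2m : 0 ≤ 2 * m := by linarith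
  have hdisp := bddSymbol_dispSymbol hk hpm
  set s := r + 3 * m with hs
  set A := 2 ^ (r + 2 * m + 1) * bilConst (r - 1) * D * D with hA
  have hA0 : 0 ≤ A := by positivity
  set G := commBil k s (r + m) (Y 0) (Y 0) with hG
  have hGn : ‖G‖ ≤ commConst r m M * D * D := by
    have h1 := hD 0 h0
    refine (norm_commBil_le hk hpm hm hr _).trans ?_
    gcongr
  have hGl : lower m G = commBil k s r (Y 0) (Y 0) := lower_commBil hk hpm hm hr _
  have hsub : Icc 0 t ⊆ Icc 0 h := Icc_subset_Icc le_rfl ht.2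
  have low3 : ∀ F : L2, lower (2 * m) (lower m F) = lower (3 * m) F := fun F => by
    rw [lower_lower h2m hm0]; congr 1; ring_nf
  have low3' : ∀ F : L2, lower m (lower (2 * m) F) = lower (3 * m) F := fun F => by
    rw [lower_lower hm0 h2m]; congr 1; ring_nf
  have lowB : ∀ F : L2, lower (2 * m) (burgersBil s (s - m) F F) = burgersBil s r F F := fun F =>
    lower_burgersBil (r := r) hr (by linarith) (by linarith) (by linarith) h2m (by rw [hs]; ring) _ _
  have liftB : ∀ F : L2, burgersBil (r + m) r (lower (2 * m) F) (lower (2 * m) F) =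
      burgersBil s r F F := fun F => burgersBil_lower h2m (by rw [hs]; ring) _ _
  choose! E hE1 hE2 using fun τ (hτ : 0 ≤ τ) F => exists_semi_burgersBil hk hpm hm hr
    (t := τ) hτ F
  -- The forcing τG integrates to τ²G/2, the expected leading error. The summand g₀ is a leading
  -- error inherited from the preceding half step, which must be carried along without being
  -- estimated.
  set j : ℝ → L2 := fun τ => g₀ + (τ ^ 2 / 2) • G with hj
  have hjn : ∀ τ ∈ Ioo 0 t, ‖j τ‖ ≤ (1 + commConst r m M * D * D) * (t ^ 2 + ‖g₀‖) := fun τ hτ => by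
    have h1 : τ ^ 2 / 2 ≤ t ^ 2 := by have := hτ.1; have := hτ.2; nlinarith
    calc ‖j τ‖ ≤ ‖g₀‖ + ‖(τ ^ 2 / 2) • G‖ := norm_add_le _ _
      _ = ‖g₀‖ + (τ ^ 2 / 2) * ‖G‖ := by rw [norm_smul, Real.norm_of_nonneg (by positivity)]
      _ ≤ ‖g₀‖ + t ^ 2 * (commConst r m M * D * D) := by gcongr
      _ ≤ _ := by
        have : 0 ≤ t ^ 2 + commConst r m M * D * D * ‖g₀‖ := by positivity
        linarith
  have hS0 : 0 ≤ localConst r m M D * (t ^ 2 + ‖g₀‖) := by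
    have := one_le_localConst (m := m) (r := r) hk hD0; positivity
  have hst := stability hr hm hpm hk hS0 hD0 (a := 0) (b := t)
    (f := fun τ => lower (2 * m) (semi k τ (Y τ))) (g := fun τ => lower (2 * m) (U τ)) (j := j)
    -- What the corrector does not remove: K applied to j, the second-order remainder of the
    -- semigroup, and the change of the commutator since time 0. Each is O(t² + ‖g₀‖), and
    -- integration in time gains the third power of t when g₀ = O(t²).
    (ρ := fun τ => mulOp (dispSymbol k m) (j τ) + (E τ (Y τ) +
      τ • (commBil k s r (Y τ) (Y τ) - commBil k s r (Y 0) (Y 0))))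
    (fun τ hτ => (norm_lower_le h2m _).trans ((norm_semi_le hk hτ.1 _).trans (hD τ (hsub hτ))))
    (fun τ hτ => (norm_lower_le h2m _).trans (hDU τ (hsub hτ)))
    (fun τ hτ => (hU.herm τ (hsub hτ)).lower h2m)
    (fun τ hτ => (hjn τ hτ).trans (by
      have : 0 ≤ (1 + M * (1 + commConst r m M * D * D) + remConst r m M * D * D +
        2 * commConst r m M * D * A) * (t ^ 2 + ‖g₀‖) := by positivity
      rw [localConst, ← hA]; linarith)) (fun τ hτ => by
      have hτ0 := hτ.1.le
      have hτt := hτ.2.le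
      have hτ' := hsub (Ioo_subset_Icc_self hτ)
      have hYτ := hD τ hτ'
      have a1 : ‖mulOp (dispSymbol k m) (j τ)‖ ≤
          M * ((1 + commConst r m M * D * D) * (t ^ 2 + ‖g₀‖)) :=
        (norm_mulOp_le hdisp _).trans (by gcongr; exact hjn τ hτ)
      have a2 : ‖E τ (Y τ)‖ ≤ remConst r m M * t ^ 2 * D * D :=
        (hE1 τ hτ0 (Y τ)).trans (by gcongr)
      have a3 : ‖τ • (commBil k s r (Y τ) (Y τ) - commBil k s r (Y 0) (Y 0))‖ ≤
          t * (2 * commConst r m M * D * (A * t)) := by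
        rw [norm_smul, Real.norm_of_nonneg hτ0]
        have b1 := norm_commBil_sub_le hk hpm hm hr hYτ (hD 0 h0)
        have b2 := norm_lower_sub_start_le hm hr hY hD hτ'
        have b3 : ‖lower m (Y τ - Y 0)‖ ≤ A * t :=
          b2.trans (mul_le_mul_of_nonneg_left hτt hA0)
        refine mul_le_mul hτt (b1.trans ?_) (norm_nonneg _) ht0
        gcongr
      refine (norm_add_le _ _).trans ((add_le_add a1 ((norm_add_le _ _).trans
        (add_le_add a2 a3))).trans ?_)
      have : 0 ≤ (2 + commConst r m M * D * D) * (t ^ 2 + ‖g₀‖) +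
        (remConst r m M * D * D + 2 * commConst r m M * D * A) * ‖g₀‖ := by positivity
      rw [localConst, ← hA]; linarith) (by
      have h1 : ContinuousOn (fun τ => semi k τ (Y τ)) (Icc 0 t) :=
        continuousOn_semi hk continuousOn_id (fun x hx => hx.1) (hY.cont.mono hsub)
      have h2 : ContinuousOn j (Icc 0 t) := by
        rw [hj]; exact Continuous.continuousOn (by fun_prop)
      exact (lower m).continuous.comp_continuousOn
        ((((lower (2 * m)).continuous.comp_continuousOn h1).sub
          ((lower (2 * m)).continuous.comp_continuousOn (hU.cont.mono hsub))).sub h2))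
    (fun τ hτ => by
      have hτ' := hsub (Ioo_subset_Icc_self hτ)
      have nb : Icc 0 h ∈ nhds τ := Icc_mem_nhds hτ.1 (hτ.2.trans_le ht.2)
      have d1 := (hasDerivWithinAt_semi_curve hk hm0 hpm (fun x hx => hx.1) hτ'
        (hY.deriv τ hτ')).hasDerivAt nb
      have d2 := (hU.deriv τ hτ').hasDerivAt nb
      have d3 := hasDerivAt_mulOp (ofRealSymbol fun ξ => jap ξ ^ (-(2 * m))) (d1.sub d2)
      have d4 : HasDerivAt j (τ • G) τ := by
        have q : HasDerivAt (fun τ : ℝ => τ ^ 2 / 2) τ τ := by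
          have := (hasDerivAt_pow 2 τ).div_const 2
          simpa using this
        exact (q.smul_const G).const_add g₀
      have d5 := hasDerivAt_mulOp (ofRealSymbol fun ξ => jap ξ ^ (-m)) d4
      have d6 := d3.sub d5
      have e1 : ∀ F : L2, mulOp (ofRealSymbol fun ξ => jap ξ ^ (-(2 * m))) F = lower (2 * m) F :=
        fun _ => rfl
      have e2 : ∀ F : L2, mulOp (ofRealSymbol fun ξ => jap ξ ^ (-m)) F = lower m F :=
        fun _ => rfl
      simp only [e1, e2] at d6
      refine (d6.congr_of_eventuallyEq (Filter.Eventually.of_forall fun x => ?_)).congr_deriv ?_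
      · simp only [map_sub, low3', low3, Pi.sub_apply]
      · change _ = _ + (burgersBil (r + m) r _ _ - burgersBil (r + m) r _ _) + _
        have e3 : ∀ F : L2, lower (2 * m) (mulOp (dispSymbol k m) F) =
            mulOp (dispSymbol k m) (lower (2 * m) F) := fun F =>
          mulOp_comm (bddSymbol_lower h2m) hdisp F
        have e4 : lower m (τ • G) = τ • lower m G := mulOp_real_smul _ τ G
        rw [liftB, liftB, map_sub, map_add, map_add, e3, e3, lowB, lower_semi hk hτ'.1 h2m (burgersBil s (s - m) (Y τ) (Y τ)), lowB,
          hE2 τ hτ'.1, e4, hGl, map_sub, map_sub, smul_sub]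
        abel) t ⟨ht0, le_rfl⟩
  simp only [sub_zero] at hst
  have e5 : lower m (lower (2 * m) (semi k t (Y t)) - lower (2 * m) (U t) - j t) =
      lower (3 * m) (semi k t (Y t) - U t) - lower m g₀ -
        (t ^ 2 / 2) • commBil k s r (Y 0) (Y 0) := by
    have : lower m (j t) = lower m g₀ + (t ^ 2 / 2) • lower m G := by
      rw [hj, map_add]; congr 1; exact mulOp_real_smul _ _ G
    rw [map_sub, map_sub, low3', low3', this, hGl, map_sub]; abel
  have e6 : lower m (lower (2 * m) (semi k 0 (Y 0)) - lower (2 * m) (U 0) - j 0) =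
      lower (3 * m) (Y 0 - U 0) - lower m g₀ := by
    have : j 0 = g₀ := by simp [hj]
    rw [map_sub, map_sub, low3', low3', this, semi_zero, map_sub]
  rw [e5, e6] at hst
  exact hst

/-- The error of exchanging the Burgers flow and the dispersive semigroup. -/
theorem norm_semi_flow_sub_flow_semi_le {h D t : ℝ} {Y X : ℝ → L2}
    (hY : IsBurgersCurve (r + 3 * m) m 0 h Y) (hX : IsBurgersCurve (r + 3 * m) m 0 h X)
    (hD : ∀ t ∈ Icc 0 h, ‖Y t‖ ≤ D) (hDX : ∀ t ∈ Icc 0 h, ‖X t‖ ≤ D) (ht : t ∈ Icc 0 h)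
    (h0X : X 0 = semi k t (Y 0)) :
    ‖lower (3 * m) (semi k t (Y t) - X t) - t ^ 2 • commBil k (r + 3 * m) r (Y 0) (Y 0)‖ ≤
      Real.exp (stabConst r 0 D * t) * (stabConst r 0 D * (localConst r m M D * t ^ 2) * t) := by
  have ht0 := ht.1
  have h0 : (0 : ℝ) ∈ Icc 0 h := ⟨le_rfl, ht.1.trans ht.2⟩
  have hD0 : 0 ≤ D := (norm_nonneg _).trans (hD 0 h0)
  have hM := hk.M_nonneg
  have hc := commConst_nonneg (r := r) (m := m) hk
  have he := remConst_nonneg r m M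
  have hb := bilConst_nonneg (r - 1)
  have hm0 : 0 ≤ m := by linarith
  have h2m : 0 ≤ 2 * m := by linarith
  set s := r + 3 * m with hs
  set A := 2 ^ (r + 2 * m + 1) * bilConst (r - 1) * D * D with hA
  have hA0 : 0 ≤ A := by positivity
  set G := commBil k s (r + m) (Y 0) (Y 0) with hG
  have hGn : ‖G‖ ≤ commConst r m M * D * D := by
    have h1 := hD 0 h0
    refine (norm_commBil_le hk hpm hm hr _).trans ?_
    gcongr
  have hGl : lower m G = commBil k s r (Y 0) (Y 0) := lower_commBil hk hpm hm hr _
  have hsub : Icc 0 t ⊆ Icc 0 h := Icc_subset_Icc le_rfl ht.2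
  have low3' : ∀ F : L2, lower m (lower (2 * m) F) = lower (3 * m) F := fun F => by
    rw [lower_lower hm0 h2m]; congr 1; ring_nf
  have liftB : ∀ F : L2, burgersBil (r + m) r (lower (2 * m) F) (lower (2 * m) F) =
      burgersBil s r F F := fun F => burgersBil_lower h2m (by rw [hs]; ring) _ _
  obtain ⟨E, hE⟩ := Classical.axiomOfChoice fun F =>
    exists_semi_burgersBil hk hpm hm hr (t := t) ht0 F
  -- The semigroup time t is frozen and τ runs along the Burgers flow. Then e^{tK}Y(τ) solves the
  -- Burgers equation with forcing tG to leading order, whose integral is τtG. No dispersion acts in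
  -- τ, so `stability` is used with k = 0.
  set j : ℝ → L2 := fun τ => (τ * t) • G with hj
  have hS0 : 0 ≤ localConst r m M D * t ^ 2 := by
    have := one_le_localConst (m := m) (r := r) hk hD0; positivity
  have hst := stability (p := m) (M := 0) hr hm le_rfl (IsAdmissibleSymbol.zero m le_rfl) hS0 hD0
    (a := 0) (b := t)
    (f := fun τ => lower (2 * m) (semi k t (Y τ))) (g := fun τ => lower (2 * m) (X τ)) (j := j)
    (ρ := fun τ => E (Y τ) +
      t • (commBil k s r (Y τ) (Y τ) - commBil k s r (Y 0) (Y 0)))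
    (fun τ hτ => (norm_lower_le h2m _).trans ((norm_semi_le hk ht0 _).trans (hD τ (hsub hτ))))
    (fun τ hτ => (norm_lower_le h2m _).trans (hDX τ (hsub hτ)))
    (fun τ hτ => (hX.herm τ (hsub hτ)).lower h2m)
    (fun τ hτ => by
      have hτ0 := hτ.1.le
      have hτt := hτ.2.le
      rw [hj]; simp only
      rw [norm_smul, Real.norm_of_nonneg (by positivity)]
      calc τ * t * ‖G‖ ≤ t * t * (commConst r m M * D * D) := by gcongr
        _ ≤ _ := by
          have : 0 ≤ (2 + M * (1 + commConst r m M * D * D) + remConst r m M * D * D +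
            2 * commConst r m M * D * A) * t ^ 2 := by positivity
          rw [localConst, ← hA]; linarith) (fun τ hτ => by
      have hτt := hτ.2.le
      have hτ' := hsub (Ioo_subset_Icc_self hτ)
      have hYτ := hD τ hτ'
      have a2 : ‖E (Y τ)‖ ≤ remConst r m M * t ^ 2 * D * D :=
        (hE (Y τ)).1.trans (by gcongr)
      have a3 : ‖t • (commBil k s r (Y τ) (Y τ) - commBil k s r (Y 0) (Y 0))‖ ≤
          t * (2 * commConst r m M * D * (A * t)) := by
        rw [norm_smul, Real.norm_of_nonneg ht0]
        have b1 := norm_commBil_sub_le hk hpm hm hr hYτ (hD 0 h0)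
        have b2 := norm_lower_sub_start_le hm hr hY hD hτ'
        have b3 : ‖lower m (Y τ - Y 0)‖ ≤ A * t :=
          b2.trans (mul_le_mul_of_nonneg_left hτt hA0)
        refine mul_le_mul_of_nonneg_left (b1.trans ?_) ht0
        gcongr
      refine ((norm_add_le _ _).trans (add_le_add a2 a3)).trans ?_
      have : 0 ≤ (1 + (M + 1) * (1 + commConst r m M * D * D)) * t ^ 2 := by positivity
      rw [localConst, ← hA]; linarith) (by
      have h1 : ContinuousOn (fun τ => semi k t (Y τ)) (Icc 0 t) :=
        (semi k t).continuous.comp_continuousOn (hY.cont.mono hsub)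
      have h2 : ContinuousOn j (Icc 0 t) := by
        rw [hj]; exact Continuous.continuousOn (by fun_prop)
      exact (lower m).continuous.comp_continuousOn
        ((((lower (2 * m)).continuous.comp_continuousOn h1).sub
          ((lower (2 * m)).continuous.comp_continuousOn (hX.cont.mono hsub))).sub h2))
    (fun τ hτ => by
      have hτ' : τ ∈ Ioo 0 h := ⟨hτ.1, hτ.2.trans_le ht.2⟩
      have d1 := hasDerivAt_mulOp (semiSymbol k t)
        (hY.hasDerivAt_lower hr hm (by linarith : m ≤ 3 * m) hτ')
      have d2 := hX.hasDerivAt_lower hr hm (by linarith : m ≤ 3 * m) hτ'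
      have d4 : HasDerivAt j (t • G) τ := by
        have q : HasDerivAt (fun τ : ℝ => τ * t) t τ := by
          simpa using (hasDerivAt_id τ).mul_const t
        exact q.smul_const G
      have d5 := hasDerivAt_mulOp (ofRealSymbol fun ξ => jap ξ ^ (-m)) d4
      have d6 := (d1.sub d2).sub d5
      have e1 : ∀ F : L2, mulOp (semiSymbol k t) F = semi k t F := fun _ => rfl
      have e2 : ∀ F : L2, mulOp (ofRealSymbol fun ξ => jap ξ ^ (-m)) F = lower m F :=
        fun _ => rfl
      simp only [e1, e2] at d6
      refine (d6.congr_of_eventuallyEq (Filter.Eventually.of_forall fun x => ?_)).congr_deriv ?_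
      · simp only [map_sub, low3', Pi.sub_apply, lower_semi hk ht0 (by linarith : 0 ≤ 3 * m)]
      · change _ = _ + (burgersBil (r + m) r _ _ - burgersBil (r + m) r _ _) + _
        have e4 : lower m (t • G) = t • lower m G := mulOp_real_smul _ t G
        rw [liftB, liftB, mulOp_dispSymbol_zero, (hE (Y τ)).2, e4, hGl, smul_sub]
        abel) t ⟨ht0, le_rfl⟩
  simp only [sub_zero] at hst
  have e5 : lower m (lower (2 * m) (semi k t (Y t)) - lower (2 * m) (X t) - j t) =
      lower (3 * m) (semi k t (Y t) - X t) - t ^ 2 • commBil k s r (Y 0) (Y 0) := by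
    have : lower m (j t) = t ^ 2 • lower m G := by
      rw [hj, sq]; exact mulOp_real_smul _ _ G
    rw [map_sub, map_sub, low3', low3', this, hGl, map_sub]
  have e6 : lower m (lower (2 * m) (semi k t (Y 0)) - lower (2 * m) (X 0) - j 0) = 0 := by
    have : j 0 = 0 := by simp [hj]
    rw [this, h0X, sub_self, sub_zero, map_zero]
  rw [e5, e6, norm_zero, zero_add] at hst
  exact hst

end local_error

/-! ### Half steps of the splitting scheme -/

/-- `Φ w t` is the solution at the time `t ∈ [0, h]` of the Burgers equation with initial value
`w`. -/
structure IsBurgersFlow (r m B h : ℝ) (Φ : L2 → ℝ → L2) : Prop where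
  curve : ∀ w, IsHerm w → ‖lower (3 * m) w‖ ≤ B → IsBurgersCurve (r + 3 * m) m 0 h (Φ w)
  start : ∀ w, IsHerm w → ‖lower (3 * m) w‖ ≤ B → Φ w 0 = w
  tail_le : ∀ w, IsHerm w → ‖lower (3 * m) w‖ ≤ B → ∀ t ∈ Icc 0 h, ∀ R, 0 ≤ R →
    ‖tail R (Φ w t)‖ ≤ Real.exp (flowRate r (3 * m) B * t) * ‖tail R w‖

theorem exists_isBurgersFlow {r m B h : ℝ} (hr : 3 / 2 < r) (hm : 1 ≤ m) (hB : 0 < B) (hh : 0 ≤ h)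
    (hhB : Real.exp (growthConst r r * (3 * B) * h) ≤ 2) : ∃ Φ, IsBurgersFlow r m B h Φ := by
  have key : ∀ w : L2, ∃ Y : ℝ → L2, IsHerm w → ‖lower (3 * m) w‖ ≤ B →
      Y 0 = w ∧ IsBurgersCurve (r + 3 * m) m 0 h Y ∧ ∀ t ∈ Icc 0 h, ∀ R, 0 ≤ R →
      ‖tail R (Y t)‖ ≤ Real.exp (flowRate r (3 * m) B * t) * ‖tail R w‖ := by
    intro w
    by_cases hw : IsHerm w ∧ ‖lower (3 * m) w‖ ≤ B
    · obtain ⟨Y, h1⟩ := exists_burgersCurve hr hm (by linarith : m + 1 ≤ 3 * m) hB hh hhB hw.1 hw.2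
      exact ⟨Y, fun _ _ => h1⟩
    · exact ⟨fun _ => 0, fun h1 h2 => absurd ⟨h1, h2⟩ hw⟩
  choose Φ hΦ using key
  exact ⟨Φ, fun w h1 h2 => (hΦ w h1 h2).2.1, fun w h1 h2 => (hΦ w h1 h2).1,
    fun w h1 h2 => (hΦ w h1 h2).2.2⟩

/-- The composition of the Burgers flow over the time `t` and the dispersive semigroup over the
time `τ`, in the order given by `b`. -/
def halfStep (k : ℝ → ℂ) (Φ : L2 → ℝ → L2) (b : Bool) (w : L2) (t τ : ℝ) : L2 :=
  if b then semi k τ (Φ w t) else Φ (semi k τ w) t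

theorem flowRate_nonneg {r d B : ℝ} (hσ : 1 ≤ r + d) (hB : 0 ≤ B) : 0 ≤ flowRate r d B := by
  have := growthConst_nonneg (r := r) hσ
  unfold flowRate; positivity

section halfStep
variable {p M m r B h : ℝ} {k : ℝ → ℂ} (hk : IsAdmissibleSymbol p M k) (hpm : p ≤ m) (hm : 1 ≤ m)
  (hr : 3 / 2 < r) {Φ : L2 → ℝ → L2} (hΦ : IsBurgersFlow r m B h Φ) {w : L2} (hw : IsHerm w)
  (hwB : ‖lower (3 * m) w‖ ≤ B) (b : Bool)
include hm hΦ hw hwB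

omit hm in
theorem norm_flow_le {t : ℝ} (ht : t ∈ Icc 0 h) :
    ‖Φ w t‖ ≤ Real.exp (flowRate r (3 * m) B * t) * ‖w‖ := by
  simpa only [tail_zero] using hΦ.tail_le w hw hwB t ht 0 le_rfl

include hk

omit hΦ hw in
theorem norm_lower_semi_le {τ : ℝ} (hτ : 0 ≤ τ) : ‖lower (3 * m) (semi k τ w)‖ ≤ B := by
  rw [lower_semi hk hτ (by linarith)]
  exact (norm_semi_le hk hτ _).trans hwB

theorem halfStep_zero_left {τ : ℝ} (hτ : τ ∈ Icc 0 h) :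
    halfStep k Φ b w 0 τ = semi k τ w := by
  cases b
  · simp [halfStep, hΦ.start _ (hw.semi hk hτ.1) (norm_lower_semi_le hk hm hwB hτ.1)]
  · simp [halfStep, hΦ.start w hw hwB]

theorem isHerm_halfStep {t τ : ℝ} (ht : t ∈ Icc 0 h) (hτ : τ ∈ Icc 0 h) :
    IsHerm (halfStep k Φ b w t τ) := by
  cases b
  · simpa [halfStep] using (hΦ.curve _ (hw.semi hk hτ.1)
      (norm_lower_semi_le hk hm hwB hτ.1)).herm t ht
  · simpa [halfStep] using ((hΦ.curve w hw hwB).herm t ht).semi hk hτ.1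

theorem norm_halfStep_le {t τ : ℝ} (ht : t ∈ Icc 0 h) (hτ : τ ∈ Icc 0 h) :
    ‖halfStep k Φ b w t τ‖ ≤ Real.exp (flowRate r (3 * m) B * t) * ‖w‖ := by
  cases b
  · simp only [halfStep, Bool.false_eq_true, if_false]
    refine (norm_flow_le hΦ (hw.semi hk hτ.1)
      (norm_lower_semi_le hk hm hwB hτ.1) ht).trans ?_
    gcongr
    exact norm_semi_le hk hτ.1 w
  · simp only [halfStep, if_true]
    exact (norm_semi_le hk hτ.1 _).trans (norm_flow_le hΦ hw hwB ht)

include hr in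
theorem continuousOn_halfStep (hB : 0 ≤ B) :
    ContinuousOn (fun q : ℝ × ℝ => halfStep k Φ b w q.1 q.2) (Icc 0 h ×ˢ Icc 0 h) := by
  have hc := flowRate_nonneg (r := r) (d := 3 * m) (by linarith) hB
  cases b
  · simp only [halfStep, Bool.false_eq_true, if_false]
    refine continuousOn_flow hr hm (by linarith : m ≤ 3 * m)
      (D := Real.exp (flowRate r (3 * m) B * h) * ‖w‖) (c := Real.exp (flowRate r (3 * m) B * h))
      (Real.exp_pos _).le (y := fun τ => semi k τ w) (Φ := fun τ => Φ (semi k τ w))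
      ((continuousOn_semi_const hk w).mono fun x hx => hx.1)
      (fun τ hτ => hΦ.start _ (hw.semi hk hτ.1) (norm_lower_semi_le hk hm hwB hτ.1))
      (fun τ hτ => hΦ.curve _ (hw.semi hk hτ.1) (norm_lower_semi_le hk hm hwB hτ.1)) ?_ ?_
    · intro τ hτ t ht
      refine (norm_flow_le hΦ (hw.semi hk hτ.1)
        (norm_lower_semi_le hk hm hwB hτ.1) ht).trans ?_
      gcongr
      · exact ht.2
      · exact norm_semi_le hk hτ.1 w
    · intro τ hτ t ht R hR
      refine (hΦ.tail_le _ (hw.semi hk hτ.1)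
        (norm_lower_semi_le hk hm hwB hτ.1) t ht R hR).trans ?_
      gcongr
      exact ht.2
  · simp only [halfStep, if_true]
    exact continuousOn_semi hk continuousOn_snd (fun q hq => hq.2.1)
      ((hΦ.curve w hw hwB).cont.comp continuousOn_fst fun q hq => hq.1)

theorem isBurgersCurve_halfStep {τ : ℝ} (hτ : τ ∈ Icc 0 h) (hb : b = false ∨ τ = 0) :
    IsBurgersCurve (r + 3 * m) m 0 h fun t => halfStep k Φ b w t τ := by
  cases b
  · simpa [halfStep] using hΦ.curve _ (hw.semi hk hτ.1) (norm_lower_semi_le hk hm hwB hτ.1)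
  · obtain rfl : τ = 0 := by simpa using hb
    simpa [halfStep, semi_zero] using hΦ.curve w hw hwB

include hpm in
theorem hasDerivWithinAt_halfStep {t τ : ℝ} (ht : t ∈ Icc 0 h) (hτ : τ ∈ Icc 0 h)
    (hb : b = true ∨ t = 0) :
    HasDerivWithinAt (fun τ => lower m (halfStep k Φ b w t τ))
      (mulOp (dispSymbol k m) (halfStep k Φ b w t τ)) (Icc 0 h) τ := by
  have key : ∀ F : L2, HasDerivWithinAt (fun τ => lower m (semi k τ F))
      (mulOp (dispSymbol k m) (semi k τ F)) (Icc 0 h) τ := fun F =>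
    (hasDerivWithinAt_semi hk (by linarith) hpm F hτ.1).mono fun x hx => hx.1
  cases b
  · obtain rfl : t = 0 := by simpa using hb
    rw [halfStep_zero_left hk hm hΦ hw hwB false hτ]
    exact (key w).congr (fun x hx => by rw [halfStep_zero_left hk hm hΦ hw hwB false hx])
      (by rw [halfStep_zero_left hk hm hΦ hw hwB false hτ])
  · simpa only [halfStep, if_true] using key (Φ w t)

end halfStep

theorem stabConst_mono {r M D : ℝ} (hM : 0 ≤ M) : stabConst r 0 D ≤ stabConst r M D := by
  unfold stabConst; linarith

/-- The sign of the leading term of the local error. -/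
def errorSign (b : Bool) : ℝ := if b then 1 else -1

theorem abs_errorSign (b : Bool) : |errorSign b| = 1 := by cases b <;> simp [errorSign]

theorem errorSign_not (b : Bool) : errorSign (!b) = -errorSign b := by cases b <;> simp [errorSign]

/-! ### A half step against the exact solution -/

section
variable {p M m r B h D : ℝ} {k : ℝ → ℂ} (hk : IsAdmissibleSymbol p M k) (hpm : p ≤ m)
  (hm : 1 ≤ m) (hr : 3 / 2 < r) {Φ : L2 → ℝ → L2} (hΦ : IsBurgersFlow r m B h Φ) {w : L2}
  (hw : IsHerm w) (hwB : ‖lower (3 * m) w‖ ≤ B)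
  (hwD : Real.exp (flowRate r (3 * m) B * h) * ‖w‖ ≤ D) (hB : 0 ≤ B)
include hk hpm hm hr hΦ hw hwB hwD hB

/-- The local error of a half step. -/
theorem norm_halfStep_sub_le (b : Bool) {U : ℝ → L2} (hU : IsFullCurve k (r + 3 * m) m 0 h U)
    (hDU : ∀ t ∈ Icc 0 h, ‖U t‖ ≤ D) (g₀ : L2) {t : ℝ} (ht : t ∈ Icc 0 h) :
    ‖lower (3 * m) (halfStep k Φ b w t t - U t) - lower m g₀ -
        (errorSign b * t ^ 2 / 2) • commBil k (r + 3 * m) r w w‖ ≤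
      Real.exp (stabConst r M D * t) * (‖lower (3 * m) (w - U 0) - lower m g₀‖ +
        2 * (stabConst r M D * (localConst r m M D * (t ^ 2 + ‖g₀‖)) * t)) := by
  have hc := flowRate_nonneg (r := r) (d := 3 * m) (by linarith) hB
  have ht0 := ht.1
  have bound : ∀ {v : L2}, IsHerm v → ‖lower (3 * m) v‖ ≤ B → ‖v‖ ≤ ‖w‖ → ∀ t ∈ Icc 0 h,
      ‖Φ v t‖ ≤ D := fun h1 h2 h3 t ht => by
    refine (norm_flow_le hΦ h1 h2 ht).trans (le_trans ?_ hwD)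
    gcongr
    exact ht.2
  have hD0 : 0 ≤ D := (norm_nonneg _).trans (bound hw hwB le_rfl t ht)
  have hM := hk.M_nonneg
  have hK := stabConst_nonneg hr hM hD0
  have hL := one_le_localConst (m := m) (r := r) hk hD0
  have h1 := norm_semi_flow_sub_le hk hpm hm hr (hΦ.curve w hw hwB) hU (bound hw hwB le_rfl) hDU
    g₀ ht
  rw [hΦ.start w hw hwB] at h1
  have hq : 0 ≤ stabConst r M D * (localConst r m M D * (t ^ 2 + ‖g₀‖)) * t := by positivity
  have hE := Real.exp_pos (stabConst r M D * t)
  cases b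
  · have hs := norm_lower_semi_le hk hm hwB ht0
    have h2 := norm_semi_flow_sub_flow_semi_le hk hpm hm hr (hΦ.curve w hw hwB)
      (hΦ.curve _ (hw.semi hk ht0) hs) (bound hw hwB le_rfl)
      (bound (hw.semi hk ht0) hs (norm_semi_le hk ht0 w)) ht
      (by rw [hΦ.start _ (hw.semi hk ht0) hs, hΦ.start w hw hwB])
    rw [hΦ.start w hw hwB] at h2
    have h3 : Real.exp (stabConst r 0 D * t) *
        (stabConst r 0 D * (localConst r m M D * t ^ 2) * t) ≤ Real.exp (stabConst r M D * t) *
        (stabConst r M D * (localConst r m M D * (t ^ 2 + ‖g₀‖)) * t) := by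
      have hKM := stabConst_mono (r := r) (D := D) hM
      have hK0 := stabConst_nonneg hr le_rfl hD0
      have := norm_nonneg g₀
      gcongr
      linarith
    simp only [halfStep, errorSign, Bool.false_eq_true, if_false]
    -- When the semigroup acts first, the leading coefficient is t²/2 from the comparison with U
    -- minus t² from the exchange of the flows, that is -t²/2.
    have e : lower (3 * m) (Φ (semi k t w) t - U t) - lower m g₀ -
        (-1 * t ^ 2 / 2) • commBil k (r + 3 * m) r w w =
        (lower (3 * m) (semi k t (Φ w t) - U t) - lower m g₀ -
          (t ^ 2 / 2) • commBil k (r + 3 * m) r w w) -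
        (lower (3 * m) (semi k t (Φ w t) - Φ (semi k t w) t) -
          t ^ 2 • commBil k (r + 3 * m) r w w) := by
      simp only [map_sub]; module
    rw [e]
    refine (norm_sub_le _ _).trans ((add_le_add h1 (h2.trans h3)).trans_eq ?_)
    ring
  · simp only [halfStep, errorSign, if_true, one_mul]
    refine h1.trans (mul_le_mul_of_nonneg_left ?_ hE.le)
    linarith

/-- Over a half step the value moves by O(t) in H^{r+2m}. Hence the leading errors of two
consecutive half steps, which are commutators at nearby arguments, differ by one further order. -/
theorem norm_lower_halfStep_sub_start_le (b : Bool) {t : ℝ} (ht : t ∈ Icc 0 h) :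
    ‖lower m (halfStep k Φ b w t t - w)‖ ≤
      (2 ^ (r + 2 * m + 1) * bilConst (r - 1) * D * D + M * D) * t := by
  have hc := flowRate_nonneg (r := r) (d := 3 * m) (by linarith) hB
  have hm0 : 0 ≤ m := by linarith
  have ht0 := ht.1
  have hM := hk.M_nonneg
  have bound : ∀ {v : L2}, IsHerm v → ‖lower (3 * m) v‖ ≤ B → ‖v‖ ≤ ‖w‖ → ∀ t ∈ Icc 0 h,
      ‖Φ v t‖ ≤ D := fun h1 h2 h3 t ht => by
    refine (norm_flow_le hΦ h1 h2 ht).trans (le_trans ?_ hwD)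
    gcongr
    exact ht.2
  have hwD' : ‖w‖ ≤ D := by
    have h0 : (0 : ℝ) ∈ Icc 0 h := ⟨le_rfl, ht.1.trans ht.2⟩
    simpa [hΦ.start w hw hwB] using bound hw hwB le_rfl 0 h0
  have h1 : ‖lower m (semi k t w - w)‖ ≤ M * D * t := by
    have h2 := norm_sub_le_of_hasDerivWithinAt (a := 0) (b := h) (C := M * D)
      (fun t ht => (hasDerivWithinAt_semi hk hm0 hpm w ht.1).mono fun x hx => hx.1)
      (fun t ht => (norm_mulOp_le (bddSymbol_dispSymbol hk hpm) _).trans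
        (by gcongr; exact (norm_semi_le hk ht.1 w).trans hwD')) ht
    rwa [← map_sub, semi_zero, sub_zero] at h2
  cases b
  · have hs := norm_lower_semi_le hk hm hwB ht0
    have h2 := norm_lower_sub_start_le hm hr (hΦ.curve _ (hw.semi hk ht0) hs)
      (bound (hw.semi hk ht0) hs (norm_semi_le hk ht0 w)) ht
    rw [hΦ.start _ (hw.semi hk ht0) hs] at h2
    simp only [halfStep, Bool.false_eq_true, if_false]
    have e : Φ (semi k t w) t - w = (Φ (semi k t w) t - semi k t w) + (semi k t w - w) := by abel
    rw [e, map_add, add_mul]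
    exact (norm_add_le _ _).trans (add_le_add h2 h1)
  · have h2 := norm_lower_sub_start_le hm hr (hΦ.curve w hw hwB) (bound hw hwB le_rfl) ht
    rw [hΦ.start w hw hwB] at h2
    simp only [halfStep, if_true]
    have e : semi k t (Φ w t) - w = semi k t (Φ w t - w) + (semi k t w - w) := by
      rw [map_sub]; abel
    rw [e, map_add, add_mul, lower_semi hk ht0 hm0]
    exact (norm_add_le _ _).trans (add_le_add ((norm_semi_le hk ht0 _).trans h2) h1)

end

/-! ### The global error -/

/-- The constant in the error estimate over two half steps. -/
def stepConst (r m M D : ℝ) : ℝ :=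
  4 * (stabConst r M D * localConst r m M D) * (1 + commConst r m M * D * D) +
    commConst r m M * D * D +
    commConst r m M * D * (2 ^ (r + 2 * m + 1) * bilConst (r - 1) * D * D + M * D)

theorem IsFullCurve.shift {k : ℝ → ℂ} {s m a b c h : ℝ} {U : ℝ → L2} (hU : IsFullCurve k s m a b U)
    (ha : a ≤ c) (hb : c + h ≤ b) : IsFullCurve k s m 0 h fun t => U (c + t) := by
  have hmap : MapsTo (fun t => c + t) (Icc 0 h) (Icc a b) := fun t ht =>
    ⟨by linarith [ht.1], by linarith [ht.2]⟩
  refine ⟨hU.cont.comp (by fun_prop) hmap, fun t ht => hU.herm _ (hmap ht), fun t ht => ?_⟩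
  have h1 := (hU.deriv _ (hmap ht)).scomp t
    (((hasDerivAt_id t).const_add c).hasDerivWithinAt (s := Icc 0 h)) hmap
  rw [one_smul] at h1
  exact h1

/-! ### Two consecutive half steps -/

section
variable {p M m r B h D : ℝ} {k : ℝ → ℂ} (hk : IsAdmissibleSymbol p M k) (hpm : p ≤ m)
  (hm : 1 ≤ m) (hr : 3 / 2 < r)
include hk hm hr

omit hm in
theorem stepConst_nonneg (hD : 0 ≤ D) : 0 ≤ stepConst r m M D := by
  have hM := hk.M_nonneg
  have hK := stabConst_nonneg hr hM hD
  have hL := one_le_localConst (m := m) (r := r) hk hD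
  have hC := commConst_nonneg (m := m) (r := r) hk
  have hb := bilConst_nonneg (r - 1)
  unfold stepConst; positivity

include hpm

theorem norm_commBil_le' {w : L2} (hw : ‖w‖ ≤ D) :
    ‖commBil k (r + 3 * m) (r + m) w w‖ ≤ commConst r m M * D * D ∧
      ‖commBil k (r + 3 * m) r w w‖ ≤ commConst r m M * D * D := by
  have hC := commConst_nonneg (m := m) (r := r) hk
  have hD := (norm_nonneg _).trans hw
  have h1 : ‖commBil k (r + 3 * m) (r + m) w w‖ ≤ commConst r m M * D * D :=
    (norm_commBil_le hk hpm hm hr w).trans (by gcongr)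
  refine ⟨h1, ?_⟩
  rw [← lower_commBil hk hpm hm hr]
  exact (norm_lower_le (by linarith) _).trans h1

variable {Φ : L2 → ℝ → L2} (hΦ : IsBurgersFlow r m B h Φ) {w : L2} (hw : IsHerm w)
  (hwB : ‖lower (3 * m) w‖ ≤ B) (hwD : Real.exp (flowRate r (3 * m) B * h) * ‖w‖ ≤ D)
  (hB : 0 ≤ B) (h0 : 0 ≤ h) (h1 : h ≤ 1) (b : Bool)
include hΦ hw hwB hwD hB h0

omit hpm hm hr hΦ hw hwB hk in
theorem norm_le_of_exp_mul_le (hσ : 1 ≤ r + 3 * m) : ‖w‖ ≤ D := by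
  have hc := flowRate_nonneg (r := r) (d := 3 * m) hσ hB
  refine le_trans (le_mul_of_one_le_left (norm_nonneg _) ?_) hwD
  exact Real.one_le_exp (by positivity)

include h1

/-- A single half step cancels nothing and is only accurate to O(h²). This is enough at intermediate
times, where such an error enters once and is not accumulated. -/
theorem norm_first_step_le {U : ℝ → L2} (hU : IsFullCurve k (r + 3 * m) m 0 h U)
    (hDU : ∀ t ∈ Icc 0 h, ‖U t‖ ≤ D) {t : ℝ} (ht : t ∈ Icc 0 h) :
    ‖lower (3 * m) (halfStep k Φ b w t t - U t)‖ ≤ Real.exp (stabConst r M D * (2 * h)) *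
      (‖lower (3 * m) (w - U 0)‖ + stepConst r m M D * h ^ 2) := by
  have hD := norm_le_of_exp_mul_le hwD hB h0 (by linarith)
  have hD0 := (norm_nonneg _).trans hD
  have hM := hk.M_nonneg
  have hK := stabConst_nonneg hr hM hD0
  have hL := one_le_localConst (m := m) (r := r) hk hD0
  have hC := commConst_nonneg (m := m) (r := r) hk
  have hb := bilConst_nonneg (r - 1)
  have ht0 := ht.1
  have hth := ht.2
  have a1 := norm_halfStep_sub_le hk hpm hm hr hΦ hw hwB hwD hB b hU hDU 0 ht
  rw [map_zero, sub_zero, sub_zero, norm_zero, add_zero] at a1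
  have a2 := (norm_commBil_le' hk hpm hm hr hD).2
  set K := stabConst r M D
  set L := localConst r m M D
  set e := ‖lower (3 * m) (w - U 0)‖
  have he : 0 ≤ e := norm_nonneg _
  set X := lower (3 * m) (halfStep k Φ b w t t - U t)
  set G := commBil k (r + 3 * m) r w w
  have a3 : ‖(errorSign b * t ^ 2 / 2) • G‖ ≤ h ^ 2 * (commConst r m M * D * D) := by
    rw [norm_smul, Real.norm_eq_abs, abs_div, abs_mul, abs_errorSign, one_mul, abs_two,
      abs_of_nonneg (by positivity : 0 ≤ t ^ 2)]
    have : t ^ 2 / 2 ≤ h ^ 2 := by nlinarith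
    gcongr
  have a4 : ‖X‖ ≤ ‖X - (errorSign b * t ^ 2 / 2) • G‖ + ‖(errorSign b * t ^ 2 / 2) • G‖ := by
    have := norm_add_le (X - (errorSign b * t ^ 2 / 2) • G) ((errorSign b * t ^ 2 / 2) • G)
    rwa [sub_add_cancel] at this
  have a5 : Real.exp (K * t) ≤ Real.exp (K * (2 * h)) := Real.exp_le_exp.2 (by gcongr; linarith)
  have a6 : 1 ≤ Real.exp (K * (2 * h)) := Real.one_le_exp (by positivity)
  have a7 : t ^ 2 * t ≤ h ^ 2 * 1 := by gcongr; exact hth.trans h1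
  have hx : 0 ≤ commConst r m M * D * D := by positivity
  calc ‖X‖ ≤ Real.exp (K * t) * (e + 2 * (K * (L * t ^ 2) * t)) +
        h ^ 2 * (commConst r m M * D * D) := a4.trans (add_le_add a1 a3)
    _ = Real.exp (K * t) * (e + 2 * (K * L) * (t ^ 2 * t)) +
        1 * (h ^ 2 * (commConst r m M * D * D)) := by ring
    _ ≤ Real.exp (K * (2 * h)) * (e + 2 * (K * L) * (h ^ 2 * 1)) +
        Real.exp (K * (2 * h)) * (h ^ 2 * (commConst r m M * D * D)) := by gcongr
    _ = Real.exp (K * (2 * h)) * (e + (2 * (K * L) + commConst r m M * D * D) * h ^ 2) := by ring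
    _ ≤ _ := by
      gcongr
      have : 0 ≤ 2 * (K * L) + 4 * (K * L) * (commConst r m M * D * D) +
        commConst r m M * D * (2 ^ (r + 2 * m + 1) * bilConst (r - 1) * D * D + M * D) := by
        positivity
      unfold stepConst; linarith

/-- The leading error of the first half step is fed into the second as g₀, so it is propagated as a
known term. At the final time it meets a term of opposite sign, and only the difference of two
commutators remains. At intermediate times the terms do not match and the bound is O(h²). -/
theorem norm_second_step_le {U V : ℝ → L2} (hU : IsFullCurve k (r + 3 * m) m 0 h U)
    (hV : IsFullCurve k (r + 3 * m) m 0 h V) (hDU : ∀ t ∈ Icc 0 h, ‖U t‖ ≤ D)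
    (hDV : ∀ t ∈ Icc 0 h, ‖V t‖ ≤ D) (hUV : V 0 = U h)
    (hw' : IsHerm (halfStep k Φ b w h h)) (hwB' : ‖lower (3 * m) (halfStep k Φ b w h h)‖ ≤ B)
    (hwD' : Real.exp (flowRate r (3 * m) B * h) * ‖halfStep k Φ b w h h‖ ≤ D) :
    (∀ t ∈ Icc 0 h, ‖lower (3 * m) (halfStep k Φ (!b) (halfStep k Φ b w h h) t t - V t)‖ ≤
      Real.exp (stabConst r M D * (2 * h)) *
        (‖lower (3 * m) (w - U 0)‖ + stepConst r m M D * h ^ 2)) ∧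
    ‖lower (3 * m) (halfStep k Φ (!b) (halfStep k Φ b w h h) h h - V h)‖ ≤
      Real.exp (stabConst r M D * (2 * h)) *
        (‖lower (3 * m) (w - U 0)‖ + stepConst r m M D * h ^ 3) := by
  have hhh : h ∈ Icc 0 h := ⟨h0, le_rfl⟩
  have hD := norm_le_of_exp_mul_le hwD hB h0 (by linarith)
  have hD' := norm_le_of_exp_mul_le hwD' hB h0 (by linarith)
  have hD0 := (norm_nonneg _).trans hD
  have hM := hk.M_nonneg
  have hK := stabConst_nonneg hr hM hD0
  have hL := one_le_localConst (m := m) (r := r) hk hD0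
  have hC := commConst_nonneg (m := m) (r := r) hk
  have hb := bilConst_nonneg (r - 1)
  have a1 := norm_halfStep_sub_le hk hpm hm hr hΦ hw hwB hwD hB b hU hDU 0 hhh
  rw [map_zero, sub_zero, sub_zero, norm_zero, add_zero] at a1
  have a0 := norm_lower_halfStep_sub_start_le hk hpm hm hr hΦ hw hwB hwD hB b hhh
  set w' := halfStep k Φ b w h h with hw'def
  set g₀ := (errorSign b * h ^ 2 / 2) • commBil k (r + 3 * m) (r + m) w w with hg
  have hgl : lower m g₀ = (errorSign b * h ^ 2 / 2) • commBil k (r + 3 * m) r w w := by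
    rw [hg, ← lower_commBil hk hpm hm hr]
    exact mulOp_real_smul _ _ _
  have habs : ∀ x : ℝ, |errorSign b * x ^ 2 / 2| = x ^ 2 / 2 := fun x => by
    rw [abs_div, abs_mul, abs_errorSign, one_mul, abs_two, abs_of_nonneg (by positivity)]
  have a2 := norm_commBil_le' hk hpm hm hr hD
  have a2' := norm_commBil_le' hk hpm hm hr hD'
  have hx : 0 ≤ commConst r m M * D * D := by positivity
  have hgn : ‖g₀‖ ≤ h ^ 2 / 2 * (commConst r m M * D * D) := by
    rw [hg, norm_smul, Real.norm_eq_abs, habs]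
    gcongr
    exact a2.1
  have a3 := fun {t : ℝ} (ht : t ∈ Icc 0 h) =>
    norm_halfStep_sub_le hk hpm hm hr hΦ hw' hwB' hwD' hB (!b) hV hDV g₀ ht
  have a4 := norm_commBil_sub_le hk hpm hm hr hD' hD
  rw [hUV, hgl, errorSign_not] at a3
  set K := stabConst r M D
  set L := localConst r m M D
  set cc := commConst r m M
  set e := ‖lower (3 * m) (w - U 0)‖
  have he : 0 ≤ e := norm_nonneg _
  set A := 2 ^ (r + 2 * m + 1) * bilConst (r - 1) * D * D + M * D with hA
  have hA0 : 0 ≤ A := by positivity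
  set G := commBil k (r + 3 * m) r w w
  set G' := commBil k (r + 3 * m) r w' w'
  have hst : stepConst r m M D = 4 * (K * L) * (1 + cc * D * D) + cc * D * D + cc * D * A := rfl
  have hKL : 0 ≤ K * L := by positivity
  have main : ∀ t ∈ Icc 0 h, ‖lower (3 * m) (halfStep k Φ (!b) w' t t - V t) -
      (errorSign b * h ^ 2 / 2) • G - (-errorSign b * t ^ 2 / 2) • G'‖ ≤
      Real.exp (K * (2 * h)) * (e + 4 * (K * L) * (1 + cc * D * D) * h ^ 3) := by
    intro t ht
    have ht0 := ht.1
    have hth := ht.2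
    have b1 : t ^ 2 + ‖g₀‖ ≤ h ^ 2 * (1 + cc * D * D) := by
      have : t ^ 2 ≤ h ^ 2 := by gcongr
      have : 0 ≤ h ^ 2 * (cc * D * D) := by positivity
      linarith
    have hE : 0 < Real.exp (K * h) := Real.exp_pos _
    have hE1 : 1 ≤ Real.exp (K * h) := Real.one_le_exp (by positivity)
    have b2 : Real.exp (K * t) ≤ Real.exp (K * h) := Real.exp_le_exp.2 (by gcongr)
    have b4 : Real.exp (K * (2 * h)) = Real.exp (K * h) * Real.exp (K * h) := by
      rw [← Real.exp_add]; ring_nf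
    calc _ ≤ _ := a3 ht
      _ ≤ Real.exp (K * h) * (Real.exp (K * h) * (e + 2 * (K * (L * h ^ 2) * h)) +
          2 * (K * (L * (h ^ 2 * (1 + cc * D * D))) * h)) := by
          have := norm_nonneg g₀
          gcongr
      _ ≤ Real.exp (K * h) * (Real.exp (K * h) * (e + 2 * (K * (L * h ^ 2) * h)) +
          Real.exp (K * h) * (2 * (K * (L * (h ^ 2 * (1 + cc * D * D))) * h))) := by
          exact mul_le_mul_of_nonneg_left (add_le_add le_rfl
            (le_mul_of_one_le_left (by positivity) hE1)) hE.le
      _ = Real.exp (K * (2 * h)) * (e + (2 * (K * L) + 2 * (K * L) * (1 + cc * D * D)) * h ^ 3) := by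
          rw [b4]; ring
      _ ≤ _ := by
          gcongr
          have : 0 ≤ 2 * (K * L) * (cc * D * D) := by positivity
          linarith
  have hE1 : 1 ≤ Real.exp (K * (2 * h)) := Real.one_le_exp (by positivity)
  refine ⟨fun t ht => ?_, ?_⟩
  · have ht0 := ht.1
    have hth := ht.2
    have c1 : ‖(errorSign b * h ^ 2 / 2) • G‖ ≤ h ^ 2 / 2 * (cc * D * D) := by
      rw [norm_smul, Real.norm_eq_abs, habs]
      gcongr
      exact a2.2
    have c2 : ‖(-errorSign b * t ^ 2 / 2) • G'‖ ≤ h ^ 2 / 2 * (cc * D * D) := by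
      rw [norm_smul, Real.norm_eq_abs, neg_mul, neg_div, abs_neg, habs]
      gcongr
      exact a2'.2
    have c3 := norm_add_le (lower (3 * m) (halfStep k Φ (!b) w' t t - V t) -
      (errorSign b * h ^ 2 / 2) • G - (-errorSign b * t ^ 2 / 2) • G')
      ((errorSign b * h ^ 2 / 2) • G + (-errorSign b * t ^ 2 / 2) • G')
    have c4 := norm_add_le ((errorSign b * h ^ 2 / 2) • G) ((-errorSign b * t ^ 2 / 2) • G')
    rw [sub_sub, sub_add_cancel] at c3
    have c5 := main t ht
    rw [sub_sub] at c5
    calc _ ≤ Real.exp (K * (2 * h)) * (e + 4 * (K * L) * (1 + cc * D * D) * h ^ 3) +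
          h ^ 2 * (cc * D * D) := by linarith
      _ ≤ Real.exp (K * (2 * h)) * (e + 4 * (K * L) * (1 + cc * D * D) * h ^ 2) +
          Real.exp (K * (2 * h)) * (h ^ 2 * (cc * D * D)) := by
          have : h ^ 3 ≤ h ^ 2 := pow_le_pow_of_le_one h0 h1 (by norm_num)
          exact add_le_add (by gcongr) (le_mul_of_one_le_left (by positivity) hE1)
      _ = Real.exp (K * (2 * h)) * (e + (4 * (K * L) * (1 + cc * D * D) + cc * D * D) * h ^ 2) := by
          ring
      _ ≤ _ := by
          rw [hst]
          exact mul_le_mul_of_nonneg_left (add_le_add le_rfl (mul_le_mul_of_nonneg_right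
            (by linarith [(by positivity : 0 ≤ cc * D * A)]) (by positivity))) (by positivity)
  · have c5 := main h hhh
    -- The cancellation: at t = h the coefficients are opposite, and G' - G is O(h).
    have c6 : (errorSign b * h ^ 2 / 2) • G + (-errorSign b * h ^ 2 / 2) • G' =
        (-(errorSign b * h ^ 2 / 2)) • (G' - G) := by module
    have c7 : ‖(-(errorSign b * h ^ 2 / 2)) • (G' - G)‖ ≤ cc * D * A * h ^ 3 := by
      rw [norm_smul, Real.norm_eq_abs, abs_neg, habs]
      calc _ ≤ h ^ 2 / 2 * (2 * cc * D * (A * h)) := by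
            gcongr
            exact a4.trans (by gcongr)
        _ = _ := by ring
    have c3 := norm_add_le (lower (3 * m) (halfStep k Φ (!b) w' h h - V h) -
      (errorSign b * h ^ 2 / 2) • G - (-errorSign b * h ^ 2 / 2) • G')
      ((errorSign b * h ^ 2 / 2) • G + (-errorSign b * h ^ 2 / 2) • G')
    rw [sub_sub, sub_add_cancel, c6] at c3
    rw [sub_sub, c6] at c5
    calc _ ≤ Real.exp (K * (2 * h)) * (e + 4 * (K * L) * (1 + cc * D * D) * h ^ 3) +
          1 * (cc * D * A * h ^ 3) := by linarith
      _ ≤ Real.exp (K * (2 * h)) * (e + 4 * (K * L) * (1 + cc * D * D) * h ^ 3) +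
          Real.exp (K * (2 * h)) * (cc * D * A * h ^ 3) := by gcongr
      _ = Real.exp (K * (2 * h)) * (e + (4 * (K * L) * (1 + cc * D * D) + cc * D * A) * h ^ 3) := by
          ring
      _ ≤ _ := by
          rw [hst]
          exact mul_le_mul_of_nonneg_left (add_le_add le_rfl (mul_le_mul_of_nonneg_right
            (by linarith) (by positivity))) (by positivity)

end

/-- The values of the splitting scheme after each half step. -/
def schemeValue (k : ℝ → ℂ) (Φ : L2 → ℝ → L2) (b : ℕ → Bool) (h : ℝ) (w : L2) : ℕ → L2
  | 0 => w
  | j + 1 => halfStep k Φ (b j) (schemeValue k Φ b h w j) h h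

/-- Bootstrap over pairs of half steps. The H^r error is at most Ch² ≤ 1, so the H^r norm stays
below B = C₀ + 1. This fixes the growth rate c of the H^s norm, which stays below D = e^{cT}C₀, and
D in turn determines the constants of the error estimate. The order of choice is B, c, D, C, and
finally h₀. -/
theorem exists_scheme_error {p M m r T C₀ : ℝ} (hpm : p ≤ m) (hm : 1 ≤ m) (hr : 3 / 2 < r)
    (hT : 0 < T) (hC₀ : 0 < C₀) (hM : 0 ≤ M) :
    ∃ h₀ : ℝ, 0 < h₀ ∧ ∃ C : ℝ, 0 < C ∧ ∀ k, IsAdmissibleSymbol p M k → ∀ h, 0 < h → h ≤ h₀ →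
      ∃ Φ, IsBurgersFlow r m (C₀ + 1) h Φ ∧ ∀ b : ℕ → Bool, (∀ j, b (j + 1) = !b j) →
      ∀ U : ℝ → L2, IsFullCurve k (r + 3 * m) m 0 T U → (∀ t ∈ Icc 0 T, ‖U t‖ ≤ C₀) →
      ∀ n : ℕ, 2 * n * h ≤ T → ∀ j < 2 * n,
        IsHerm (schemeValue k Φ b h (U 0) j) ∧
        ‖lower (3 * m) (schemeValue k Φ b h (U 0) j)‖ ≤ C₀ + 1 ∧
        ∀ t ∈ Icc 0 h, ‖lower (3 * m) (halfStep k Φ (b j) (schemeValue k Φ b h (U 0) j) t t -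
          U (j * h + t))‖ ≤ C * h ^ 2 := by
  set B := C₀ + 1 with hBdef
  have hB : 0 < B := by positivity
  set c := flowRate r (3 * m) B with hc
  have hc0 : 0 ≤ c := flowRate_nonneg (by linarith) hB.le
  set D := Real.exp (c * T) * C₀ with hD
  have hD0 : 0 ≤ D := by positivity
  set K := stabConst r M D with hK
  have hK0 : 0 ≤ K := stabConst_nonneg hr hM hD0
  have hQ0 : 0 ≤ stepConst r m M D :=
    stepConst_nonneg (IsAdmissibleSymbol.zero p hM) hr hD0
  set Q := stepConst r m M D with hQ
  set C := Real.exp (K * T) * (Q * T + Q) + 1 with hCdef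
  have hC1 : 1 ≤ C := by
    have : 0 ≤ Real.exp (K * T) * (Q * T + Q) := by positivity
    linarith
  set ρ := growthConst r r * (3 * B) with hρ
  have hρ0 : 0 ≤ ρ := by
    have := growthConst_nonneg (r := r) (σ := r) (by linarith)
    positivity
  have hl2 : 0 < Real.log 2 := Real.log_pos (by norm_num)
  -- With C ≥ 1, the bound h ≤ 1/C gives both h ≤ 1 and Ch² ≤ 1. The second entry guarantees a
  -- Burgers lifespan of at least h for data of H^r size B.
  refine ⟨min (1 / C) (Real.log 2 / (ρ + 1)), by positivity, C, by positivity, ?_⟩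
  intro k hk h h0 hh
  have hhC : h ≤ 1 / C := hh.trans (min_le_left _ _)
  have hh1 : h ≤ 1 := hhC.trans (by rw [div_le_one (by positivity)]; exact hC1)
  have hCh : C * h ^ 2 ≤ 1 := by
    rw [le_div_iff₀ (by positivity)] at hhC
    nlinarith
  have hexp : Real.exp (ρ * h) ≤ 2 := by
    have h1 : h ≤ Real.log 2 / (ρ + 1) := hh.trans (min_le_right _ _)
    rw [le_div_iff₀ (by positivity)] at h1
    rw [← Real.exp_log (by norm_num : (0 : ℝ) < 2)]
    exact Real.exp_le_exp.2 (by linarith)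
  obtain ⟨Φ, hΦ⟩ := exists_isBurgersFlow (r := r) (m := m) hr hm hB h0.le hexp
  refine ⟨Φ, hΦ, fun b hb U hU hUC n hn => ?_⟩
  set x := schemeValue k Φ b h (U 0) with hx
  have hx1 : ∀ j, x (j + 1) = halfStep k Φ (b j) (x j) h h := fun j => rfl
  have hhh : h ∈ Icc 0 h := ⟨h0.le, le_rfl⟩
  have hCD : C₀ ≤ D := le_mul_of_one_le_left hC₀.le (Real.one_le_exp (by positivity))
  have hnT : ∀ j : ℕ, j < 2 * n → (j : ℝ) * h + h ≤ T := fun j hj => by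
    have : ((j : ℝ) + 1) ≤ 2 * n := by exact_mod_cast hj
    nlinarith
  have shift : ∀ j : ℕ, j < 2 * n → IsFullCurve k (r + 3 * m) m 0 h fun t => U (j * h + t) :=
    fun j hj => hU.shift (by positivity) (hnT j hj)
  have shiftD : ∀ j : ℕ, j < 2 * n → ∀ t ∈ Icc 0 h, ‖U (j * h + t)‖ ≤ D := fun j hj t ht =>
    (hUC _ ⟨by have := ht.1; positivity, by linarith [ht.2, hnT j hj]⟩).trans hCD
  -- the bounds over one step
  have small : ∀ {F V : L2}, ‖V‖ ≤ C₀ → ‖lower (3 * m) (F - V)‖ ≤ C * h ^ 2 →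
      ‖lower (3 * m) F‖ ≤ B := fun {F V} h1 h2 => by
    have e : lower (3 * m) F = lower (3 * m) V + lower (3 * m) (F - V) := by rw [map_sub]; abel
    rw [e]
    refine (norm_add_le _ _).trans (add_le_add ?_ (h2.trans hCh))
    exact (norm_lower_le (by linarith) _).trans h1
  have growth : ∀ j : ℕ, j < 2 * n → ‖x j‖ ≤ Real.exp (c * (j * h)) * C₀ →
      Real.exp (c * h) * ‖x j‖ ≤ Real.exp (c * ((j + 1 : ℕ) * h)) * C₀ ∧
      Real.exp (c * h) * ‖x j‖ ≤ D := fun j hj h1 => by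
    have h2 : Real.exp (c * h) * ‖x j‖ ≤ Real.exp (c * ((j + 1 : ℕ) * h)) * C₀ := by
      calc _ ≤ Real.exp (c * h) * (Real.exp (c * (j * h)) * C₀) := by gcongr
        _ = _ := by rw [← mul_assoc, ← Real.exp_add]; push_cast; ring_nf
    refine ⟨h2, h2.trans ?_⟩
    rw [hD]
    gcongr
    have := hnT j hj
    push_cast; linarith
  -- Discrete Grönwall: after l pairs, l local errors Qh³ have each been amplified by at most
  -- e^{2Khl}. As lh ≤ T, this is O(h²).
  set Err : ℕ → ℝ := fun l => Real.exp (K * (l * (2 * h))) * (Q * h ^ 3 * l) with hErr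
  have errLe : ∀ l : ℕ, l < n → Real.exp (K * (2 * h)) * (Err l + Q * h ^ 2) ≤ C * h ^ 2 := by
    intro l hl
    have q1 : ((l : ℝ) + 1) * (2 * h) ≤ T := by
      have : ((l : ℝ) + 1) ≤ n := by exact_mod_cast hl
      nlinarith
    have q2 : (l : ℝ) * h ≤ T := by nlinarith [(by positivity : (0 : ℝ) ≤ l * h)]
    have hE : 1 ≤ Real.exp (K * (l * (2 * h))) := Real.one_le_exp (by positivity)
    calc _ ≤ Real.exp (K * (2 * h)) * (Err l + Real.exp (K * (l * (2 * h))) * (Q * h ^ 2)) := by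
          exact mul_le_mul_of_nonneg_left (add_le_add le_rfl
            (le_mul_of_one_le_left (by positivity) hE)) (by positivity)
      _ = Real.exp (K * ((l + 1) * (2 * h))) * (Q * (l * h) + Q) * h ^ 2 := by
          have : Real.exp (K * ((l + 1) * (2 * h))) =
              Real.exp (K * (2 * h)) * Real.exp (K * (l * (2 * h))) := by
            rw [← Real.exp_add]; ring_nf
          rw [this]; simp only [hErr]; ring
      _ ≤ Real.exp (K * T) * (Q * T + Q) * h ^ 2 := by gcongr
      _ ≤ _ := by gcongr; linarith
  have pair : ∀ l : ℕ, l < n → (IsHerm (x (2 * l)) ∧ ‖x (2 * l)‖ ≤ Real.exp (c * ((2 * l : ℕ) * h)) * C₀ ∧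
      ‖lower (3 * m) (x (2 * l))‖ ≤ B ∧ ‖lower (3 * m) (x (2 * l) - U ((2 * l : ℕ) * h))‖ ≤ Err l) →
      (∀ t ∈ Icc 0 h, ‖lower (3 * m) (halfStep k Φ (b (2 * l)) (x (2 * l)) t t -
          U ((2 * l : ℕ) * h + t))‖ ≤ C * h ^ 2) ∧
      (IsHerm (x (2 * l + 1)) ∧ ‖lower (3 * m) (x (2 * l + 1))‖ ≤ B ∧
        (∀ t ∈ Icc 0 h, ‖lower (3 * m) (halfStep k Φ (b (2 * l + 1)) (x (2 * l + 1)) t t -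
          U ((2 * l + 1 : ℕ) * h + t))‖ ≤ C * h ^ 2)) ∧
      (IsHerm (x (2 * (l + 1))) ∧
        ‖x (2 * (l + 1))‖ ≤ Real.exp (c * ((2 * (l + 1) : ℕ) * h)) * C₀ ∧
        ‖lower (3 * m) (x (2 * (l + 1)))‖ ≤ B ∧
        ‖lower (3 * m) (x (2 * (l + 1)) - U ((2 * (l + 1) : ℕ) * h))‖ ≤ Err (l + 1)) := by
    rintro l hl ⟨i1, i2, i3, i4⟩
    have hj1 : 2 * l < 2 * n := by omega
    have hj2 : 2 * l + 1 < 2 * n := by omega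
    obtain ⟨g1, g2⟩ := growth (2 * l) hj1 i2
    have f1 := fun {t : ℝ} (ht : t ∈ Icc 0 h) =>
      norm_first_step_le hk hpm hm hr hΦ i1 i3 g2 hB.le h0.le hh1 (b (2 * l))
      (shift _ hj1) (shiftD _ hj1) ht
    simp only [add_zero] at f1
    have f2 : ∀ t ∈ Icc 0 h, ‖lower (3 * m) (halfStep k Φ (b (2 * l)) (x (2 * l)) t t -
          U ((2 * l : ℕ) * h + t))‖ ≤ C * h ^ 2 := fun t ht =>
      (f1 ht).trans (le_trans (by gcongr) (errLe l hl))
    have k1 : IsHerm (x (2 * l + 1)) := isHerm_halfStep hk hm hΦ i1 i3 _ hhh hhh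
    have k2 : ‖x (2 * l + 1)‖ ≤ Real.exp (c * ((2 * l + 1 : ℕ) * h)) * C₀ :=
      (norm_halfStep_le hk hm hΦ i1 i3 _ hhh hhh).trans g1
    have k3 : ‖lower (3 * m) (x (2 * l + 1))‖ ≤ B := by
      refine small (V := U ((2 * l : ℕ) * h + h)) (hUC _ ⟨by positivity, hnT _ hj1⟩) ?_
      exact f2 h hhh
    obtain ⟨g3, g4⟩ := growth (2 * l + 1) hj2 k2
    have eU : U ((2 * l + 1 : ℕ) * h + 0) = U ((2 * l : ℕ) * h + h) := by
      congr 1; push_cast; ring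
    have f3 := norm_second_step_le hk hpm hm hr hΦ i1 i3 g2 hB.le h0.le hh1 (b (2 * l))
      (shift _ hj1) (shift _ hj2) (shiftD _ hj1) (shiftD _ hj2) eU k1 k3 g4
    rw [← hb (2 * l)] at f3
    simp only [add_zero] at f3
    obtain ⟨f4, f5⟩ := f3
    have f6 : ∀ t ∈ Icc 0 h, ‖lower (3 * m) (halfStep k Φ (b (2 * l + 1)) (x (2 * l + 1)) t t -
          U ((2 * l + 1 : ℕ) * h + t))‖ ≤ C * h ^ 2 := fun t ht =>
      (f4 t ht).trans (le_trans (by gcongr) (errLe l hl))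
    have eU' : U ((2 * l + 1 : ℕ) * h + h) = U ((2 * (l + 1) : ℕ) * h) := by
      congr 1; push_cast; ring
    refine ⟨f2, ⟨k1, k3, f6⟩, isHerm_halfStep hk hm hΦ k1 k3 _ hhh hhh,
      (norm_halfStep_le hk hm hΦ k1 k3 _ hhh hhh).trans g3, ?_, ?_⟩
    · refine small (V := U ((2 * l + 1 : ℕ) * h + h)) (hUC _ ⟨by positivity, hnT _ hj2⟩) ?_
      exact f6 h hhh
    · rw [← eU']
      refine f5.trans ?_
      have e1 : Err (l + 1) = Real.exp (K * (2 * h)) *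
          (Real.exp (K * (l * (2 * h))) * (Q * h ^ 3 * (l + 1))) := by
        have : Real.exp (K * ((l + 1 : ℕ) * (2 * h))) =
            Real.exp (K * (2 * h)) * Real.exp (K * (l * (2 * h))) := by
          rw [← Real.exp_add]; push_cast; ring_nf
        simp only [hErr, this]; push_cast; ring
      rw [e1]
      have hE : 1 ≤ Real.exp (K * (l * (2 * h))) := Real.one_le_exp (by positivity)
      refine mul_le_mul_of_nonneg_left ?_ (Real.exp_pos _).le
      calc _ ≤ Err l + Real.exp (K * (l * (2 * h))) * (Q * h ^ 3) :=
            add_le_add i4 (le_mul_of_one_le_left (by positivity) hE)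
        _ = _ := by simp only [hErr]; ring
  have inv : ∀ l : ℕ, l ≤ n → (IsHerm (x (2 * l)) ∧ ‖x (2 * l)‖ ≤ Real.exp (c * ((2 * l : ℕ) * h)) * C₀ ∧
      ‖lower (3 * m) (x (2 * l))‖ ≤ B ∧ ‖lower (3 * m) (x (2 * l) - U ((2 * l : ℕ) * h))‖ ≤ Err l) := by
    intro l
    induction l with
    | zero =>
      intro _
      have h0T : (0 : ℝ) ∈ Icc 0 T := ⟨le_rfl, hT.le⟩
      have hx0 : x (2 * 0) = U 0 := rfl
      refine ⟨hU.herm 0 h0T, ?_, ?_, ?_⟩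
      · rw [hx0]; simpa using hUC 0 h0T
      · rw [hx0]
        exact (norm_lower_le (by linarith) _).trans ((hUC 0 h0T).trans (by linarith))
      · rw [hx0]; simp [hErr]
    | succ l ih => intro hl; exact (pair l (by omega) (ih (by omega))).2.2
  intro j hj
  rcases Nat.even_or_odd' j with ⟨l, rfl | rfl⟩
  · have hl : l < n := by omega
    have i := inv l hl.le
    exact ⟨i.1, i.2.2.1, (pair l hl i).1⟩
  · have hl : l < n := by omega
    have i := pair l hl (inv l hl.le)
    exact i.2.1

/-! ### The Fourier transform of products -/

/-- On integrable functions, the inverse Fourier transform on `L²` is given by the integral. -/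
theorem coeFn_fourierInv {u : L2} (hu : Integrable u) :
    (𝓕⁻ u : L2) =ᵐ[volume] 𝓕⁻ (u : ℝ → ℂ) := by
  have hcont : Continuous (𝓕⁻ (u : ℝ → ℂ)) :=
    VectorFourier.fourierIntegral_continuous Real.continuous_fourierChar
      (by exact continuous_inner.neg) hu
  -- Both functions are tested against smooth compactly supported g. On the L² side the transform
  -- moves to the test function through tempered distributions, on the integral side through Fubini.
  refine ae_eq_of_integral_contDiff_smul_eq
    ((Lp.memLp _).locallyIntegrable (by norm_num)) hcont.locallyIntegrable fun g hg hgs => ?_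
  have hG : HasCompactSupport fun x => (g x : ℂ) := hgs.comp_left (g := Complex.ofReal) rfl
  set G := hG.toSchwartzMap (Complex.ofRealCLM.contDiff.comp hg) with hGdef
  have hGe : ∀ x, G x = (g x : ℂ) := fun x => rfl
  have h1 := DFunLike.congr_fun (Lp.fourierInv_toTemperedDistribution_eq u) G
  rw [TemperedDistribution.fourierInv_apply, Lp.toTemperedDistribution_apply,
    Lp.toTemperedDistribution_apply] at h1
  have h2 := VectorFourier.integral_fourierIntegral_smul_eq_flip (e := Real.fourierChar)
    (L := -innerₗ ℝ) (μ := volume) (ν := volume) (f := G) (g := u) Real.continuous_fourierChar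
    (by exact continuous_inner.neg) G.integrable hu
  have h3 : ∀ x, 𝓕⁻ G x = VectorFourier.fourierIntegral Real.fourierChar volume (-innerₗ ℝ) G x :=
    fun x => by rw [SchwartzMap.fourierInv_coe]; rfl
  have h4 : ∀ x, VectorFourier.fourierIntegral Real.fourierChar volume
      (LinearMap.flip (-innerₗ ℝ)) u x = 𝓕⁻ (u : ℝ → ℂ) x := fun x => by
    simp [VectorFourier.fourierIntegral, Real.fourierInv_eq, mul_comm]
  simp only [h4, ← h3] at h2
  rw [h2] at h1
  simpa [hGe] using h1.symm

theorem fourierInv_convolution {u v : ℝ → ℂ} (hu : Integrable u) (hv : Integrable v) (x : ℝ) :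
    𝓕⁻ (bilInt (fun _ _ => 1) u v) x = 𝓕⁻ u x * 𝓕⁻ v x := by
  have h : bilInt (fun _ _ => 1) u v =
      convolution v u (ContinuousLinearMap.mul ℂ ℂ) volume := by
    funext ξ
    simp only [bilInt, convolution, one_mul, ContinuousLinearMap.mul_apply']
    exact integral_congr_ae (Filter.Eventually.of_forall fun η => mul_comm _ _)
  rw [h]
  simp only [Real.fourierInv_eq_fourier_neg]
  rw [Real.fourier_mul_convolution_eq hv hu, mul_comm]

theorem exists_subseq_tendsto_ae {f g h : ℕ → L2} {f₀ g₀ h₀ : L2}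
    (hf : Filter.Tendsto f Filter.atTop (nhds f₀)) (hg : Filter.Tendsto g Filter.atTop (nhds g₀))
    (hh : Filter.Tendsto h Filter.atTop (nhds h₀)) :
    ∃ ns : ℕ → ℕ, ∀ᵐ x, Filter.Tendsto (fun i => f (ns i) x) Filter.atTop (nhds (f₀ x)) ∧
      Filter.Tendsto (fun i => g (ns i) x) Filter.atTop (nhds (g₀ x)) ∧
      Filter.Tendsto (fun i => h (ns i) x) Filter.atTop (nhds (h₀ x)) := by
  obtain ⟨a, ha, ha'⟩ := (tendstoInMeasure_of_tendsto_Lp hf).exists_seq_tendsto_ae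
  obtain ⟨b, hb, hb'⟩ :=
    (tendstoInMeasure_of_tendsto_Lp (hg.comp ha.tendsto_atTop)).exists_seq_tendsto_ae
  obtain ⟨c, hc, hc'⟩ := (tendstoInMeasure_of_tendsto_Lp
    (hh.comp (ha.tendsto_atTop.comp hb.tendsto_atTop))).exists_seq_tendsto_ae
  refine ⟨fun i => a (b (c i)), ?_⟩
  filter_upwards [ha', hb', hc'] with x h1 h2 h3
  exact ⟨h1.comp (hb.tendsto_atTop.comp hc.tendsto_atTop), h2.comp hc.tendsto_atTop, h3⟩

theorem tendsto_lowPass (F : L2) :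
    Filter.Tendsto (fun n => lowPass n F) Filter.atTop (nhds F) := by
  have h := tendsto_mulOp (l := Filter.atTop) (m := fun n => ofRealSymbol (cutoff n))
    (m₀ := fun _ => 1) (C := 1) (Filter.Eventually.of_forall fun n => bddSymbol_cutoff n)
    bddSymbol_one (fun ξ => ?_) F
  · rwa [mulOp_one] at h
  · refine tendsto_const_nhds.congr' ?_
    filter_upwards [Filter.eventually_ge_atTop ⌈jap ξ⌉₊] with n hn
    simp [ofRealSymbol, cutoff, if_pos ((Nat.le_ceil _).trans (Nat.cast_le.2 hn))]

/-- The support is bounded, where L² is contained in L¹. Low-pass functions are thus the dense class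
on which the inverse transform is an honest integral. -/
theorem integrable_mulOp_lowPass {m : ℝ → ℂ} {C : ℝ} (hm : BddSymbol m C) (n : ℕ) (F : L2) :
    Integrable (mulOp m (lowPass n F)) := by
  have hsub : {ξ : ℝ | jap ξ ≤ n} ⊆ Metric.closedBall 0 n := fun ξ hξ => by
    rw [mem_closedBall_zero_iff, Real.norm_eq_abs]
    have h1 := abs_le_jap ξ
    rw [abs_mul, abs_of_pos (by positivity : 0 < 2 * Real.pi)] at h1
    have h2 : (1 : ℝ) ≤ 2 * Real.pi := by linarith [Real.pi_gt_three]
    have h3 : jap ξ ≤ n := hξ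
    nlinarith [abs_nonneg ξ]
  have hmeas : MeasurableSet {ξ : ℝ | jap ξ ≤ n} := measurableSet_le measurable_jap measurable_const
  have h1 : Integrable ({ξ : ℝ | jap ξ ≤ n}.indicator (mulOp m F)) := by
    rw [integrable_indicator_iff hmeas]
    have : IsFiniteMeasure (volume.restrict {ξ : ℝ | jap ξ ≤ n}) :=
      ⟨by rw [Measure.restrict_apply_univ]
          exact (measure_mono hsub).trans_lt (isCompact_closedBall _ _).measure_lt_top⟩
    exact ((Lp.memLp (mulOp m F)).restrict _).integrable (by norm_num)
  refine h1.congr ?_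
  filter_upwards [coeFn_mulOp hm F, coeFn_mulOp hm (lowPass n F),
    coeFn_mulOp (bddSymbol_cutoff n) F] with ξ e1 e2 e3
  rw [e2, lowPass, e3]
  by_cases h : jap ξ ≤ n
  · simp [indicator, cutoff, h, e1, ofRealSymbol]
  · simp [indicator, cutoff, h, ofRealSymbol]

theorem adm_jap_left {a : ℝ} : Adm a (fun x _ => ((jap x ^ (-a) : ℝ) : ℂ)) 1 where
  meas := by
    simp only [Function.uncurry_def]
    fun_prop
  bound x y := by
    rw [Complex.norm_real, Real.norm_of_nonneg (jap_rpow_pos x _).le, one_mul]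
    linarith [(jap_rpow_pos y (-a)).le]

/-- The Fourier transform of a product is a convolution. -/
theorem fourierInv_bil {a : ℝ} (ha : 1 / 2 < a) (F G : L2) :
    ∀ᵐ x, (𝓕⁻ (bil (fun x _ => ((jap x ^ (-a) : ℝ) : ℂ)) F G) : L2) x =
      (𝓕⁻ (lower a F) : L2) x * (𝓕⁻ G : L2) x := by
  have ha0 : 0 ≤ a := by linarith
  have hadm := adm_jap_left (a := a)
  have key : ∀ n : ℕ, ∀ᵐ x,
      (𝓕⁻ (bil (fun x _ => ((jap x ^ (-a) : ℝ) : ℂ)) (lowPass n F) (lowPass n G)) : L2) x =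
      (𝓕⁻ (lower a (lowPass n F)) : L2) x * (𝓕⁻ (lowPass n G) : L2) x := fun n => by
    have hu : Integrable (lower a (lowPass n F)) :=
      integrable_mulOp_lowPass (bddSymbol_lower ha0) n F
    have hv : Integrable (lowPass n G) := by
      have := integrable_mulOp_lowPass bddSymbol_one n G
      rwa [mulOp_one] at this
    have e : bil (fun x _ => ((jap x ^ (-a) : ℝ) : ℂ)) (lowPass n F) (lowPass n G) =ᵐ[volume]
        bilInt (fun _ _ => 1) (lower a (lowPass n F)) (lowPass n G) := by
      refine (hadm.coeFn_bil ha _ _).trans (Filter.Eventually.of_forall fun ξ => ?_)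
      refine Eq.trans ?_ (congrFun (bilInt_congr (fun _ _ => 1)
        (coeFn_mulOp (bddSymbol_lower ha0) (lowPass n F)) Filter.EventuallyEq.rfl) ξ).symm
      refine integral_congr_ae (Filter.Eventually.of_forall fun η => ?_)
      simp only [ofRealSymbol]; ring
    have hI : Integrable (bil (fun x _ => ((jap x ^ (-a) : ℝ) : ℂ)) (lowPass n F)
        (lowPass n G)) := by
      have h := hv.integrable_convolution (ContinuousLinearMap.mul ℂ ℂ) hu
      refine h.congr (Filter.EventuallyEq.symm (e.trans (Filter.Eventually.of_forall fun ξ => ?_)))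
      simp only [bilInt, convolution, one_mul, ContinuousLinearMap.mul_apply']
      exact integral_congr_ae (Filter.Eventually.of_forall fun η => mul_comm _ _)
    filter_upwards [coeFn_fourierInv hu, coeFn_fourierInv hv, coeFn_fourierInv hI] with x h1 h2 h3
    rw [h1, h2, h3, ← fourierInv_convolution hu hv, Real.fourierInv_eq, Real.fourierInv_eq]
    exact integral_congr_ae (e.mono fun ξ hξ => by simp only [hξ])
  have hF := tendsto_lowPass F
  have hG := tendsto_lowPass G
  have hinv : Continuous fun u : L2 => (𝓕⁻ u : L2) := ContinuousFourierInv.continuous_fourierInv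
  -- The product of two L² functions need not be in L², so the identity is passed to the limit
  -- pointwise along a common almost everywhere convergent subsequence.
  obtain ⟨ns, hns⟩ := exists_subseq_tendsto_ae
    (hinv.continuousAt.tendsto.comp
      ((hadm.isBoundedBilinearMap ha).continuous.continuousAt.tendsto.comp (hF.prodMk_nhds hG)))
    (hinv.continuousAt.tendsto.comp ((lower a).continuous.continuousAt.tendsto.comp hF))
    (hinv.continuousAt.tendsto.comp hG)
  filter_upwards [hns, ae_all_iff.2 key] with x ⟨h1, h2, h3⟩ hx
  refine tendsto_nhds_unique h1 ((h2.mul h3).congr fun i => ?_)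
  exact (hx (ns i)).symm

theorem fourierInv_conjRefl (G : L2) :
    ∀ᵐ x, (𝓕⁻ (conjRefl G) : L2) x = (starRingEnd ℂ) ((𝓕⁻ G : L2) x) := by
  have key : ∀ n : ℕ, ∀ᵐ x, (𝓕⁻ (conjRefl (lowPass n G)) : L2) x =
      (starRingEnd ℂ) ((𝓕⁻ (lowPass n G) : L2) x) := fun n => by
    have hv : Integrable (lowPass n G) := by
      have := integrable_mulOp_lowPass bddSymbol_one n G
      rwa [mulOp_one] at this
    have hc : Integrable (conjRefl (lowPass n G)) :=
      (Complex.conjLIE.integrable_comp_iff.2 hv.comp_neg).congr (coeFn_conjRefl _).symm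
    filter_upwards [coeFn_fourierInv hv, coeFn_fourierInv hc] with x h1 h2
    rw [h1, h2, Real.fourierInv_eq', Real.fourierInv_eq', ← integral_conj,
      ← integral_neg_eq_self (fun v => (starRingEnd ℂ) _)]
    refine integral_congr_ae ?_
    filter_upwards [coeFn_conjRefl (lowPass n G)] with ξ hξ
    rw [hξ]
    simp [← Complex.exp_conj, map_ofNat]
  have hG := tendsto_lowPass G
  have hinv : Continuous fun u : L2 => (𝓕⁻ u : L2) := ContinuousFourierInv.continuous_fourierInv
  have hc : Continuous conjRefl := conjReflL.continuous
  obtain ⟨ns, hns⟩ := exists_subseq_tendsto_ae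
    (hinv.continuousAt.tendsto.comp (hc.continuousAt.tendsto.comp hG))
    (hinv.continuousAt.tendsto.comp hG) hG
  filter_upwards [hns, ae_all_iff.2 key] with x ⟨h1, h2, _⟩ hx
  refine tendsto_nhds_unique h1
    (((Complex.continuous_conj.tendsto _).comp h2).congr fun i => ?_)
  exact (hx (ns i)).symm

theorem isRealValued_fourierInv_iff (G : L2) : IsRealValued (𝓕⁻ G) ↔ IsHerm G := by
  rw [isHerm_iff]
  constructor
  · intro h
    have h1 : (𝓕⁻ (conjRefl G) : L2) = 𝓕⁻ G := by
      refine Lp.ext ?_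
      filter_upwards [h, fourierInv_conjRefl G] with x h1 h2
      rw [h2]; exact Complex.conj_eq_iff_im.2 h1
    exact (Lp.fourierTransformₗᵢ ℝ ℂ).symm.injective h1
  · intro h
    have h1 := fourierInv_conjRefl G
    rw [h] at h1
    filter_upwards [h1] with x hx
    exact Complex.conj_eq_iff_im.1 hx.symm

/-! ### The equations on the Fourier side -/

theorem isFourierMultiplier_iff {m m' : ℝ → ℂ} {C : ℝ} (h : BddSymbol m' C) {s : ℝ} (hs : 0 ≤ s)
    (hm : ∀ ξ, m' ξ = m (2 * Real.pi * ξ) * ((jap ξ ^ (-s) : ℝ) : ℂ)) (Y g : L2) :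
    IsFourierMultiplier m (𝓕⁻ (lower s Y)) g ↔ g = 𝓕⁻ (mulOp m' Y) := by
  have e : ∀ᵐ ξ, m (2 * Real.pi * ξ) * (𝓕 (𝓕⁻ (lower s Y) : L2) : L2) ξ = mulOp m' Y ξ := by
    rw [FourierInvPair.fourier_fourierInv_eq]
    filter_upwards [coeFn_mulOp h Y, coeFn_mulOp (bddSymbol_lower hs) Y] with ξ h1 h2
    rw [h1, lower, h2, hm]
    simp only [ofRealSymbol]; ring
  constructor
  · intro hg
    have h1 : (𝓕 g : L2) = mulOp m' Y := by
      refine Lp.ext ?_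
      filter_upwards [hg, e] with ξ h1 h2
      rw [h1, h2]
    rw [← h1, FourierPair.fourierInv_fourier_eq]
  · rintro rfl
    rw [IsFourierMultiplier, FourierInvPair.fourier_fourierInv_eq]
    filter_upwards [e] with ξ h1
    rw [← h1]

theorem dispersion_iff {p M s : ℝ} {k : ℝ → ℂ} (hk : IsAdmissibleSymbol p M k) (hps : p ≤ s)
    (hs : 0 ≤ s) (Y g : L2) :
    dispersion k (𝓕⁻ (lower s Y)) g ↔ g = 𝓕⁻ (mulOp (dispSymbol k s) Y) :=
  isFourierMultiplier_iff (bddSymbol_dispSymbol hk hps) hs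
    (fun ξ => by simp only [dispSymbol, freqSymbol]; ring) Y g

/-- The condition s ≥ 1 makes the derivative an element of L². The product with the derivative is
then the inverse transform of a convolution by `fourierInv_bil`, whose kernel is the Burgers kernel
at output level 0. -/
theorem burgers_iff {s : ℝ} (hs : 1 ≤ s) (Y g : L2) :
    burgers (𝓕⁻ (lower s Y)) g ↔ g = 𝓕⁻ (burgersBil s 0 Y Y) := by
  have hs0 : 0 ≤ s := by linarith
  set dS : ℝ → ℂ := fun ξ => Complex.I * ((2 * Real.pi * ξ : ℝ) : ℂ) * ((jap ξ ^ (-s) : ℝ) : ℂ)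
    with hdS
  have hd : BddSymbol dS 1 := by
    refine ⟨by fun_prop, fun ξ => ?_⟩
    rw [hdS]
    rw [norm_mul, norm_mul, Complex.norm_I, one_mul, Complex.norm_real, Complex.norm_real,
      Real.norm_eq_abs, Real.norm_of_nonneg (jap_rpow_pos ξ _).le, Real.rpow_neg (jap_pos ξ).le,
      ← div_eq_mul_inv, div_le_one (jap_rpow_pos ξ _)]
    refine (abs_le_jap ξ).trans ?_
    conv_lhs => rw [← Real.rpow_one (jap ξ)]
    exact jap_rpow_mono hs ξ
  have hadm := adm_jap_left (a := s)
  have e : burgersBil s 0 Y Y = -bil (fun x _ => ((jap x ^ (-s) : ℝ) : ℂ)) Y (mulOp dS Y) := by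
    rw [← neg_one_smul ℂ, ← hadm.bil_kernel_smul (by linarith), bil_mulOp_right _ hd]
    refine congrArg (fun κ => bil κ Y Y) (funext fun x => funext fun y => ?_)
    simp only [atLevel, levelWeight, burgersKernel, hdS, Real.rpow_zero]
    push_cast; ring
  have hfx := fun fx => isFourierMultiplier_iff (m := fun ξ => Complex.I * ξ) hd hs0
    (fun ξ => rfl) Y fx
  have hprod := fourierInv_bil (a := s) (by linarith) Y (mulOp dS Y)
  have hneg : (𝓕⁻ (burgersBil s 0 Y Y) : L2) =
      -𝓕⁻ (bil (fun x _ => ((jap x ^ (-s) : ℝ) : ℂ)) Y (mulOp dS Y)) := by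
    rw [e]; exact (Lp.fourierTransformₗᵢ ℝ ℂ).symm.map_neg _
  have hae : ∀ᵐ x, (𝓕⁻ (burgersBil s 0 Y Y) : L2) x =
      -((𝓕⁻ (lower s Y) : L2) x * (𝓕⁻ (mulOp dS Y) : L2) x) := by
    rw [hneg]
    filter_upwards [hprod, Lp.coeFn_neg
      (𝓕⁻ (bil (fun x _ => ((jap x ^ (-s) : ℝ) : ℂ)) Y (mulOp dS Y)) : L2)] with x h1 h2
    rw [h2, Pi.neg_apply, h1]
  constructor
  · rintro ⟨fx, h1, h2⟩
    rw [hfx] at h1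
    subst h1
    refine Lp.ext ?_
    filter_upwards [h2, hae] with x h3 h4
    rw [h3, h4]
  · rintro rfl
    exact ⟨_, (hfx _).2 rfl, hae⟩

/-! ### The splitting problem on the Fourier side -/

theorem mulOp_dispSymbol_add {p M m d : ℝ} {k : ℝ → ℂ} (hk : IsAdmissibleSymbol p M k)
    (hpm : p ≤ m) (hd : 0 ≤ d) (F : L2) :
    mulOp (dispSymbol k (d + m)) F = lower d (mulOp (dispSymbol k m) F) := by
  rw [lower, mulOp_mulOp (bddSymbol_lower hd) (bddSymbol_dispSymbol hk hpm)]
  congr 2; funext ξ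
  simp only [ofRealSymbol, dispSymbol]
  rw [← mul_assoc, ← Complex.ofReal_mul, ← Real.rpow_add (jap_pos ξ)]
  congr 3; ring

/-- The `j`-th time interval. -/
def cell (h : ℝ) (j : ℕ) : Set ℝ := Icc (j * h) (j * h + h)

/-- The domain of the splitting solution: the squares along the diagonal. -/
def stairs (h : ℝ) (n : ℕ) : Set (ℝ × ℝ) :=
  {q | q = (0, 0) ∨ ∃ j < n, q.1 ∈ cell h j ∧ q.2 ∈ cell h j}

/-- The points of the domain at which the Burgers equation holds, in the first variable. The
`j`-th square starts with the Burgers equation if `b j` is true, with the dispersive equation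
otherwise. -/
def burgersStairs (b : ℕ → Bool) (h : ℝ) (n : ℕ) : Set (ℝ × ℝ) :=
  {q | ∃ j < n, q.1 ∈ Ioc (j * h) (j * h + h) ∧ q.2 ∈ cell h j ∧ (b j = false ∨ q.2 = j * h)}

/-- The points of the domain at which the dispersive equation holds, in the second variable. -/
def dispersiveStairs (b : ℕ → Bool) (h : ℝ) (n : ℕ) : Set (ℝ × ℝ) :=
  {q | ∃ j < n, q.2 ∈ Ioc (j * h) (j * h + h) ∧ q.1 ∈ cell h j ∧ (b j = true ∨ q.1 = j * h)}

/-- `W` is the weighted Fourier transform of a solution of the splitting problem. -/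
structure IsStairsCurve (k : ℝ → ℂ) (s : ℝ) (b : ℕ → Bool) (h : ℝ) (n : ℕ) (U₀ : L2)
    (W : ℝ × ℝ → L2) : Prop where
  cont : ContinuousOn W (stairs h n)
  herm : ∀ q ∈ stairs h n, IsHerm (W q)
  init : W (0, 0) = U₀
  burgers : ∀ t τ : ℝ, (t, τ) ∈ burgersStairs b h n →
    HasDerivWithinAt (fun r => lower s (W (r, τ))) (burgersBil s 0 (W (t, τ)) (W (t, τ)))
      {r | (r, τ) ∈ stairs h n} t
  dispersive : ∀ t τ : ℝ, (t, τ) ∈ dispersiveStairs b h n →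
    HasDerivWithinAt (fun r => lower s (W (t, r))) (mulOp (dispSymbol k s) (W (t, τ)))
      {r | (t, r) ∈ stairs h n} τ

/-! ### Geometry of the squares along the diagonal -/

section
variable {h : ℝ} {n : ℕ}

theorem left_mem_cell (h0 : 0 ≤ h) (j : ℕ) : (j * h : ℝ) ∈ cell h j := ⟨le_rfl, by linarith⟩

theorem right_mem_cell (h0 : 0 ≤ h) (j : ℕ) : (j * h + h : ℝ) ∈ cell h j := ⟨by linarith, le_rfl⟩

theorem sub_mem_of_mem_cell {j : ℕ} {t : ℝ} (ht : t ∈ cell h j) : t - j * h ∈ Icc 0 h :=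
  ⟨by linarith [ht.1], by linarith [ht.2]⟩

theorem eq_of_mem_cell (h0 : 0 < h) {i j : ℕ} (hij : i < j) {t : ℝ} (hi : t ∈ cell h i)
    (hj : t ∈ cell h j) : j = i + 1 ∧ t = j * h := by
  have h1 : (j : ℝ) * h ≤ (i + 1) * h := by linarith [hi.2, hj.1]
  have h2 : j = i + 1 := by
    have : (j : ℝ) ≤ i + 1 := le_of_mul_le_mul_right h1 h0
    have : j ≤ i + 1 := by exact_mod_cast this
    omega
  refine ⟨h2, le_antisymm ?_ hj.1⟩
  rw [h2]; push_cast; linarith [hi.2]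

theorem isClosed_cell (h : ℝ) (j : ℕ) : IsClosed (cell h j) := isClosed_Icc

theorem hasDerivWithinAt_biUnion {f : ℝ → L2} {d : L2} {S : ℕ → Set ℝ} {t : ℝ} (n : ℕ)
    (hS : ∀ i < n, HasDerivWithinAt f d (S i) t) :
    HasDerivWithinAt f d {r | ∃ i < n, r ∈ S i} t := by
  induction n with
  | zero =>
    refine HasFDerivWithinAt.of_notMem_closure ?_
    simp
  | succ n ih =>
    refine ((ih fun i hi => hS i (by omega)).union (hS n (by omega))).mono ?_
    rintro r ⟨i, hi, hr⟩
    rcases Nat.lt_succ_iff_lt_or_eq.1 hi with h' | rfl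
    · exact Or.inl ⟨i, h', hr⟩
    · exact Or.inr hr

/-- A slice of the domain is a finite union of closed intervals, possibly with the point 0. Pieces
that do not contain t impose no condition, since t is outside their closure. -/
theorem hasDerivWithinAt_stairs {f : ℝ → L2} {d : L2} {t τ : ℝ} (ht : t ≠ 0)
    (hf : ∀ i < n, t ∈ cell h i → τ ∈ cell h i → HasDerivWithinAt f d (cell h i) t) :
    HasDerivWithinAt f d {r | (r, τ) ∈ stairs h n} t := by
  have h1 : HasDerivWithinAt f d {r | ∃ i < n, r ∈ {r | r ∈ cell h i ∧ τ ∈ cell h i}} t := by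
    refine hasDerivWithinAt_biUnion n fun i hi => ?_
    by_cases hm : t ∈ cell h i ∧ τ ∈ cell h i
    · exact (hf i hi hm.1 hm.2).mono fun r hr => hr.1
    · refine HasFDerivWithinAt.of_notMem_closure fun hc => hm ?_
      have hcl : IsClosed {r | r ∈ cell h i ∧ τ ∈ cell h i} :=
        (isClosed_cell h i).and isClosed_const
      rwa [hcl.closure_eq] at hc
  have h2 : HasDerivWithinAt f d {0} t := by
    refine HasFDerivWithinAt.of_notMem_closure ?_
    simpa using ht
  refine (h2.union h1).mono ?_
  rintro r (hr | ⟨i, hi, h3, h4⟩)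
  · left; exact (Prod.mk.inj hr).1
  · right; exact ⟨i, hi, h3, h4⟩

theorem stairs_swap {t τ : ℝ} : (t, τ) ∈ stairs h n ↔ (τ, t) ∈ stairs h n := by
  simp only [stairs, mem_ofPred_eq, Prod.mk.injEq]
  constructor <;> rintro (⟨h1, h2⟩ | ⟨j, hj, h1, h2⟩)
  exacts [Or.inl ⟨h2, h1⟩, Or.inr ⟨j, hj, h2, h1⟩, Or.inl ⟨h2, h1⟩, Or.inr ⟨j, hj, h2, h1⟩]

theorem mem_stairs {j : ℕ} (hj : j < n) {t τ : ℝ} (ht : t ∈ cell h j) (hτ : τ ∈ cell h j) :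
    (t, τ) ∈ stairs h n := Or.inr ⟨j, hj, ht, hτ⟩

end

/-! ### Existence for the splitting problem -/

section existence
variable {p M m r B h : ℝ} {k : ℝ → ℂ} {n : ℕ} {b : ℕ → Bool} {U₀ : L2}
  {Φ : L2 → ℝ → L2}

/-- The splitting solution on the `j`-th square. -/
def cellValue (k : ℝ → ℂ) (Φ : L2 → ℝ → L2) (b : ℕ → Bool) (h : ℝ) (U₀ : L2) (j : ℕ)
    (q : ℝ × ℝ) : L2 :=
  halfStep k Φ (b j) (schemeValue k Φ b h U₀ j) (q.1 - j * h) (q.2 - j * h)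

open Classical in
/-- The splitting solution. -/
def stairsValue (k : ℝ → ℂ) (Φ : L2 → ℝ → L2) (b : ℕ → Bool) (h : ℝ) (U₀ : L2) (n : ℕ)
    (q : ℝ × ℝ) : L2 :=
  if hq : ∃ j < n, q.1 ∈ cell h j ∧ q.2 ∈ cell h j then cellValue k Φ b h U₀ hq.choose q else U₀

variable (hk : IsAdmissibleSymbol p M k) (hpm : p ≤ m) (hm : 1 ≤ m) (hr : 3 / 2 < r)
  (hΦ : IsBurgersFlow r m B h Φ) (h0 : 0 < h) (hB : 0 ≤ B)
  (hx : ∀ j < n, IsHerm (schemeValue k Φ b h U₀ j) ∧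
    ‖lower (3 * m) (schemeValue k Φ b h U₀ j)‖ ≤ B)
include hk hm hΦ h0 hx

theorem cellValue_corner {j : ℕ} (hj : j < n) :
    cellValue k Φ b h U₀ j (j * h, j * h) = schemeValue k Φ b h U₀ j := by
  simp only [cellValue, sub_self]
  rw [halfStep_zero_left hk hm hΦ (hx j hj).1 (hx j hj).2 (b j) ⟨le_rfl, h0.le⟩, semi_zero]

/-- Two distinct squares can meet only in the corner shared by neighbours. There the later square
starts from the final value of the earlier one. -/
theorem cellValue_eq_of_lt {i j : ℕ} (hij : i < j) (hj : j < n) {q : ℝ × ℝ}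
    (hi1 : q.1 ∈ cell h i) (hi2 : q.2 ∈ cell h i) (hj1 : q.1 ∈ cell h j) (hj2 : q.2 ∈ cell h j) :
    cellValue k Φ b h U₀ i q = cellValue k Φ b h U₀ j q := by
  obtain ⟨rfl, h1⟩ := eq_of_mem_cell h0 hij hi1 hj1
  obtain ⟨-, h2⟩ := eq_of_mem_cell h0 hij hi2 hj2
  have hq : q = (((i + 1 : ℕ) : ℝ) * h, ((i + 1 : ℕ) : ℝ) * h) := Prod.ext h1 h2
  rw [hq, cellValue_corner hk hm hΦ h0 hx hj]
  have e : ((i + 1 : ℕ) : ℝ) * h - i * h = h := by push_cast; ring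
  simp only [cellValue, e]
  rfl

theorem stairsValue_eq {j : ℕ} (hj : j < n) {q : ℝ × ℝ} (h1 : q.1 ∈ cell h j)
    (h2 : q.2 ∈ cell h j) : stairsValue k Φ b h U₀ n q = cellValue k Φ b h U₀ j q := by
  have hq : ∃ j < n, q.1 ∈ cell h j ∧ q.2 ∈ cell h j := ⟨j, hj, h1, h2⟩
  rw [stairsValue, dif_pos hq]
  obtain ⟨hi, hi1, hi2⟩ := hq.choose_spec
  rcases lt_trichotomy hq.choose j with h3 | h3 | h3
  · exact cellValue_eq_of_lt hk hm hΦ h0 hx h3 hj hi1 hi2 h1 h2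
  · rw [h3]
  · exact (cellValue_eq_of_lt hk hm hΦ h0 hx h3 hi h1 h2 hi1 hi2).symm

theorem stairsValue_zero : stairsValue k Φ b h U₀ n (0, 0) = U₀ := by
  rcases Nat.eq_zero_or_pos n with rfl | hn
  · rw [stairsValue, dif_neg]
    rintro ⟨j, hj, -⟩
    omega
  · have hc := left_mem_cell h0.le 0
    have h1 := cellValue_corner hk hm hΦ h0 hx hn
    simp only [Nat.cast_zero, zero_mul] at hc h1
    rw [stairsValue_eq hk hm hΦ h0 hx hn hc hc, h1]
    rfl

include hr hpm hB

theorem isStairsCurve_stairsValue (hU₀ : IsHerm U₀) :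
    IsStairsCurve k (r + 3 * m) b h n U₀ (stairsValue k Φ b h U₀ n) := by
  have hs : 0 ≤ r + 3 * m := by linarith
  have hval := fun {j : ℕ} (hj : j < n) {q : ℝ × ℝ} => stairsValue_eq hk hm hΦ h0 hx hj (q := q)
  have hsm : r + 3 * m = (r + 3 * m - m) + m := by ring
  have low : ∀ F : L2, lower (r + 3 * m - m) (lower m F) = lower (r + 3 * m) F := fun F => by
    rw [lower_lower (by linarith) (by linarith), sub_add_cancel]
  refine ⟨?_, ?_, stairsValue_zero hk hm hΦ h0 hx, ?_, ?_⟩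
  · have hc : ∀ j : Fin n, ContinuousOn (stairsValue k Φ b h U₀ n) (cell h j ×ˢ cell h j) := by
      intro j
      have h1 : ContinuousOn (cellValue k Φ b h U₀ j) (cell h j ×ˢ cell h j) :=
        (continuousOn_halfStep hk hm hr hΦ (hx j j.2).1 (hx j j.2).2 (b j) hB).comp
          (f := fun q : ℝ × ℝ => (q.1 - j * h, q.2 - j * h)) (by fun_prop)
          fun q hq => ⟨sub_mem_of_mem_cell hq.1, sub_mem_of_mem_cell hq.2⟩
      exact h1.congr fun q hq => hval j.2 hq.1 hq.2
    have hU := (locallyFinite_of_finite fun j : Fin n => cell h j ×ˢ cell h j).continuousOn_iUnion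
      (fun j => (isClosed_cell h j).prod (isClosed_cell h j)) hc
    rcases Nat.eq_zero_or_pos n with rfl | hn
    · refine (continuousOn_singleton _ (0, 0)).mono ?_
      rintro q (hq | ⟨j, hj, -⟩)
      exacts [hq, absurd hj (by omega)]
    · refine hU.mono ?_
      rintro q (rfl | ⟨j, hj, hq⟩)
      · have hc := left_mem_cell h0.le 0
        simp only [Nat.cast_zero, zero_mul] at hc
        exact mem_iUnion.2 ⟨⟨0, hn⟩, hc, hc⟩
      · exact mem_iUnion.2 ⟨⟨j, hj⟩, hq⟩
  · rintro q (rfl | ⟨j, hj, h1, h2⟩)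
    · rw [stairsValue_zero hk hm hΦ h0 hx]; exact hU₀
    · rw [hval hj h1 h2]
      exact isHerm_halfStep hk hm hΦ (hx j hj).1 (hx j hj).2 _ (sub_mem_of_mem_cell h1)
        (sub_mem_of_mem_cell h2)
  · rintro t τ ⟨j, hj, ht, hτ, hb⟩
    have ht0 : t ≠ 0 := by
      have : (0 : ℝ) ≤ j * h := by positivity
      exact (this.trans_lt ht.1).ne'
    have htj : t ∈ cell h j := Ioc_subset_Icc_self ht
    refine hasDerivWithinAt_stairs ht0 fun i hi hti hτi => ?_
    -- The slice may also meet a neighbouring square at t. An earlier one is excluded because t lies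
    -- strictly to the right of jh. In a later one τ is its initial value, where the Burgers
    -- equation holds in either order.
    have hbi : b i = false ∨ τ - i * h = 0 := by
      rcases lt_trichotomy i j with h3 | rfl | h3
      · exact absurd (eq_of_mem_cell h0 h3 hti htj).2 ht.1.ne'
      · simpa [sub_eq_zero] using hb
      · exact Or.inr (sub_eq_zero.2 (eq_of_mem_cell h0 h3 hτ hτi).2)
    have hc := isBurgersCurve_halfStep hk hm hΦ (hx i hi).1 (hx i hi).2 (b i)
      (sub_mem_of_mem_cell hτi) hbi
    have h1 := (hc.deriv _ (sub_mem_of_mem_cell hti)).scomp t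
      (((hasDerivAt_id t).sub_const (i * h)).hasDerivWithinAt (s := cell h i))
      fun _ => sub_mem_of_mem_cell
    rw [one_smul] at h1
    have h2 := hasDerivWithinAt_mulOp (ofRealSymbol fun ξ => jap ξ ^ (-(r + 3 * m - m))) h1
    have h3 : HasDerivWithinAt (fun r' => lower (r + 3 * m) (cellValue k Φ b h U₀ i (r', τ)))
        (burgersBil (r + 3 * m) 0 (cellValue k Φ b h U₀ i (t, τ))
          (cellValue k Φ b h U₀ i (t, τ))) (cell h i) t := by
      rw [← lower_burgersBil (r := r) (o := r + 3 * m - m) (d := r + 3 * m - m) hr (by linarith)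
        (by linarith) (by linarith) (by linarith) (by ring)]
      simp only [← low]
      exact h2
    rw [hval hi hti hτi]
    exact h3.congr (fun r' hr' => by rw [hval hi hr' hτi]) (by rw [hval hi hti hτi])
  · rintro t τ ⟨j, hj, hτ, ht, hb⟩
    have hτ0 : τ ≠ 0 := by
      have : (0 : ℝ) ≤ j * h := by positivity
      exact (this.trans_lt hτ.1).ne'
    have hτj : τ ∈ cell h j := Ioc_subset_Icc_self hτ
    simp only [stairs_swap (t := t)]
    refine hasDerivWithinAt_stairs hτ0 fun i hi hτi hti => ?_
    have hbi : b i = true ∨ t - i * h = 0 := by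
      rcases lt_trichotomy i j with h3 | rfl | h3
      · exact absurd (eq_of_mem_cell h0 h3 hτi hτj).2 hτ.1.ne'
      · simpa [sub_eq_zero] using hb
      · exact Or.inr (sub_eq_zero.2 (eq_of_mem_cell h0 h3 ht hti).2)
    have h1 := (hasDerivWithinAt_halfStep hk hpm hm hΦ (hx i hi).1 (hx i hi).2 (b i)
      (sub_mem_of_mem_cell hti) (sub_mem_of_mem_cell hτi) hbi).scomp τ
      (((hasDerivAt_id τ).sub_const (i * h)).hasDerivWithinAt (s := cell h i))
      fun _ => sub_mem_of_mem_cell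
    rw [one_smul] at h1
    have h2 := hasDerivWithinAt_mulOp (ofRealSymbol fun ξ => jap ξ ^ (-(r + 3 * m - m))) h1
    have h3 : HasDerivWithinAt (fun r' => lower (r + 3 * m) (cellValue k Φ b h U₀ i (t, r')))
        (mulOp (dispSymbol k (r + 3 * m)) (cellValue k Φ b h U₀ i (t, τ))) (cell h i) τ := by
      have e : mulOp (dispSymbol k (r + 3 * m)) (cellValue k Φ b h U₀ i (t, τ)) =
          lower (r + 3 * m - m) (mulOp (dispSymbol k m) (cellValue k Φ b h U₀ i (t, τ))) := by
        rw [← mulOp_dispSymbol_add hk hpm (by linarith), sub_add_cancel]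
      rw [e]
      simp only [← low]
      exact h2
    rw [hval hi hti hτi]
    exact h3.congr (fun r' hr' => by rw [hval hi hti hr']) (by rw [hval hi hti hτi])

end existence

/-! ### Uniqueness for the splitting problem -/

namespace IsStairsCurve
variable {p M m r h : ℝ} {k : ℝ → ℂ} {n : ℕ} {b : ℕ → Bool} {U₀ : L2} {W W' : ℝ × ℝ → L2} {s : ℝ}

theorem isBurgersCurve (hW : IsStairsCurve k s b h n U₀ W) (hm : 1 ≤ m) (hsm : r ≤ s - m)
    (hr : 3 / 2 < r) {j : ℕ} (hj : j < n) {τ : ℝ} (hτ : τ ∈ cell h j)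
    (hb : b j = false ∨ τ = j * h) :
    IsBurgersCurve s m (j * h) (j * h + h) fun t => W (t, τ) := by
  refine IsBurgersCurve.of_lower hm hsm hr
    (hW.cont.comp (by fun_prop) fun t ht => mem_stairs hj ht hτ)
    (fun t ht => hW.herm _ (mem_stairs hj ht hτ)) fun t ht => ?_
  refine (hW.burgers t τ ⟨j, hj, Ioo_subset_Ioc_self ht, hτ, hb⟩).hasDerivAt ?_
  exact Filter.mem_of_superset (Icc_mem_nhds ht.1 ht.2) fun t ht => mem_stairs hj ht hτ

/-- The difference solves a linear dissipative equation, so its L² norm cannot grow from zero. -/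
theorem eqOn_dispersive (hW : IsStairsCurve k s b h n U₀ W) (hW' : IsStairsCurve k s b h n U₀ W')
    (hk : IsAdmissibleSymbol p M k) (hps : p ≤ s) (hs : 0 ≤ s) {j : ℕ} (hj : j < n) {t : ℝ}
    (ht : t ∈ cell h j) (hb : b j = true ∨ t = j * h) (h0 : W (t, j * h) = W' (t, j * h))
    {τ : ℝ} (hτ : τ ∈ cell h j) : W (t, τ) = W' (t, τ) := by
  have hc : ∀ {V : ℝ × ℝ → L2}, IsStairsCurve k s b h n U₀ V →
      ContinuousOn (fun τ => V (t, τ)) (cell h j) := fun hV =>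
    hV.cont.comp (by fun_prop) fun τ hτ => mem_stairs hj ht hτ
  have hd : ∀ {V : ℝ × ℝ → L2}, IsStairsCurve k s b h n U₀ V → ∀ τ ∈ Ioo (j * h) (j * h + h),
      HasDerivAt (fun τ => lower s (V (t, τ))) (mulOp (dispSymbol k s) (V (t, τ))) τ :=
    fun hV τ hτ => (hV.dispersive t τ ⟨j, hj, Ioo_subset_Ioc_self hτ, ht, hb⟩).hasDerivAt
      (Filter.mem_of_superset (Icc_mem_nhds hτ.1 hτ.2) fun τ hτ => mem_stairs hj ht hτ)
  have h1 := norm_le_of_re_inner_le (y := fun τ => lower s (W (t, τ)) - lower s (W' (t, τ)))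
    (C := 0) (S := 0) le_rfl le_rfl
    (((lower s).continuous.comp_continuousOn (hc hW)).sub
      ((lower s).continuous.comp_continuousOn (hc hW')))
    (fun τ hτ => (hd hW τ hτ).sub (hd hW' τ hτ)) (fun τ hτ => by
      rw [← map_sub, ← map_sub, zero_mul, zero_mul, zero_add]
      refine re_inner_mulOp_nonpos (bddSymbol_dispSymbol hk hps) (bddSymbol_lower hs)
        (fun ξ => ?_) _
      rw [dispSymbol, Complex.re_ofReal_mul]
      have h1 := re_freqSymbol hk ξ
      have h2 := jap_rpow_pos ξ (-s)
      nlinarith [mul_nonneg h2.le h2.le]) τ hτ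
  rw [h0, sub_self, norm_zero, zero_mul, add_zero, mul_zero, norm_le_zero_iff, sub_eq_zero] at h1
  exact lower_injective hs h1

/-- Uniqueness of the solution of the splitting problem. -/
theorem eqOn (hW : IsStairsCurve k (r + 3 * m) b h n U₀ W)
    (hW' : IsStairsCurve k (r + 3 * m) b h n U₀ W') (hk : IsAdmissibleSymbol p M k) (hpm : p ≤ m)
    (hm : 1 ≤ m) (hr : 3 / 2 < r) (h0 : 0 ≤ h) : EqOn W W' (stairs h n) := by
  have burg : ∀ j < n, ∀ τ ∈ cell h j, (b j = false ∨ τ = j * h) → W (j * h, τ) = W' (j * h, τ) →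
      ∀ t ∈ cell h j, W (t, τ) = W' (t, τ) := fun j hj τ hτ hb he t ht =>
    (hW.isBurgersCurve (r := r) hm (by linarith) hr hj hτ hb).eqOn
      (hW'.isBurgersCurve (r := r) hm (by linarith) hr hj hτ hb) hr hm (by linarith) he ht
  have disp : ∀ j < n, ∀ t ∈ cell h j, (b j = true ∨ t = j * h) → W (t, j * h) = W' (t, j * h) →
      ∀ τ ∈ cell h j, W (t, τ) = W' (t, τ) := fun j hj t ht hb he τ hτ =>
    hW.eqOn_dispersive hW' hk (by linarith) (by linarith) hj ht hb he hτ
  -- From the corner one moves along an edge with the flow that acts first, and then across the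
  -- square with the other one.
  have square : ∀ j < n, W (j * h, j * h) = W' (j * h, j * h) → ∀ t ∈ cell h j, ∀ τ ∈ cell h j,
      W (t, τ) = W' (t, τ) := fun j hj he t ht τ hτ => by
    have hl := left_mem_cell h0 j
    cases hb : b j
    · exact burg j hj τ hτ (Or.inl hb) (disp j hj _ hl (Or.inr rfl) he τ hτ) t ht
    · exact disp j hj t ht (Or.inl hb) (burg j hj _ hl (Or.inr rfl) he t ht) τ hτ
  have corner : ∀ j ≤ n, W (j * h, j * h) = W' (j * h, j * h) := by
    intro j
    induction j with
    | zero => intro _; simp only [Nat.cast_zero, zero_mul]; rw [hW.init, hW'.init]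
    | succ j ih =>
      intro hj
      have hr := right_mem_cell h0 j
      have e : ((j + 1 : ℕ) : ℝ) * h = j * h + h := by push_cast; ring
      rw [e]
      exact square j (by omega) (ih (by omega)) _ hr _ hr
  rintro ⟨t, τ⟩ (hq | ⟨j, hj, ht, hτ⟩)
  · rw [hq, hW.init, hW'.init]
  · exact square j hj (corner j hj.le) t ht τ hτ

end IsStairsCurve

/-! ### Sobolev spaces and the Fourier side -/

namespace Sobolev
variable {s : ℝ}

theorem norm_toWeighted (f : Sobolev s) : ‖toWeighted f‖ = ‖f‖ := rfl

theorem isometry_toWeighted : Isometry (toWeighted (σ := s)) :=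
  AddMonoidHomClass.isometry_of_norm _ norm_toWeighted

theorem coeFn_toWeighted (f : Sobolev s) :
    toWeighted f =ᵐ[volume] weightedFourier s f.toL2 := MemLp.coeFn_toLp f.2

theorem ofReal_jap_mul_cancel (ξ : ℝ) (z : ℂ) :
    ((jap ξ ^ (-s) : ℝ) : ℂ) * (((jap ξ ^ s : ℝ) : ℂ) * z) = z := by
  rw [← mul_assoc, ← Complex.ofReal_mul, ← Real.rpow_add (jap_pos ξ), neg_add_cancel,
    Real.rpow_zero, Complex.ofReal_one, one_mul]

theorem fourier_toL2 (hs : 0 ≤ s) (f : Sobolev s) : (𝓕 f.toL2 : L2) = lower s (toWeighted f) := by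
  refine Lp.ext ?_
  filter_upwards [coeFn_mulOp (bddSymbol_lower hs) (toWeighted f), coeFn_toWeighted f]
    with ξ h1 h2
  rw [lower, h1, h2]
  exact (ofReal_jap_mul_cancel ξ _).symm

theorem toL2_eq (hs : 0 ≤ s) (f : Sobolev s) : f.toL2 = 𝓕⁻ (lower s (toWeighted f)) := by
  rw [← fourier_toL2 hs, FourierPair.fourierInv_fourier_eq]

theorem exists_toWeighted_eq (hs : 0 ≤ s) (Y : L2) : ∃ f : Sobolev s, toWeighted f = Y := by
  have h : weightedFourier s (𝓕⁻ (lower s Y)) =ᵐ[volume] Y := by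
    filter_upwards [coeFn_mulOp (bddSymbol_lower hs) Y] with ξ h1
    rw [weightedFourier, FourierInvPair.fourier_fourierInv_eq, lower, h1, ← mul_assoc]
    change ((jap ξ ^ s : ℝ) : ℂ) * ((jap ξ ^ (-s) : ℝ) : ℂ) * Y ξ = Y ξ
    rw [mul_comm ((jap ξ ^ s : ℝ) : ℂ), mul_assoc, ofReal_jap_mul_cancel]
  refine ⟨⟨𝓕⁻ (lower s Y), (memLp_congr_ae h).2 (Lp.memLp Y)⟩, Lp.ext ?_⟩
  exact (coeFn_toWeighted _).trans h

theorem isRealValued_iff (hs : 0 ≤ s) (f : Sobolev s) :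
    IsRealValued f.toL2 ↔ IsHerm (toWeighted f) := by
  rw [toL2_eq hs, isRealValued_fourierInv_iff]
  exact ⟨fun h => h.of_lower hs, fun h => h.lower hs⟩

theorem continuousOn_toWeighted_iff {X : Type*} [TopologicalSpace X] {S : Set X}
    {f : X → Sobolev s} : ContinuousOn (fun x => toWeighted (f x)) S ↔ ContinuousOn f S :=
  (isometry_toWeighted.isUniformInducing.isInducing.continuousOn_iff).symm

end Sobolev

/-- The Fourier transform as a real-linear operator. -/
def fourierR : L2 →L[ℝ] L2 :=
  LinearMap.mkContinuous
    { toFun := fun F => 𝓕 F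
      map_add' := FourierAdd.fourier_add
      map_smul' := fun c F => by
        rw [RingHom.id_apply, real_smul_eq, real_smul_eq]
        exact FourierSMul.fourier_smul (c : ℂ) F } 1
    fun F => by rw [one_mul]; exact (Lp.norm_fourier_eq F).le

/-- The inverse Fourier transform as a real-linear operator. -/
def fourierInvR : L2 →L[ℝ] L2 :=
  LinearMap.mkContinuous
    { toFun := fun F => 𝓕⁻ F
      map_add' := FourierInvAdd.fourierInv_add
      map_smul' := fun c F => by
        rw [RingHom.id_apply, real_smul_eq, real_smul_eq]
        exact FourierInvSMul.fourierInv_smul (c : ℂ) F } 1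
    fun F => by rw [one_mul]; exact ((Lp.fourierTransformₗᵢ ℝ ℂ).symm.norm_map F).le

theorem hasDerivWithinAt_fourierInv_iff {y : ℝ → L2} {y' : L2} {S : Set ℝ} {t : ℝ} :
    HasDerivWithinAt (fun r => (𝓕⁻ (y r) : L2)) (𝓕⁻ y') S t ↔ HasDerivWithinAt y y' S t := by
  constructor
  · intro h
    have h1 := fourierR.hasFDerivAt.comp_hasDerivWithinAt t h
    have e : ∀ F : L2, fourierR (𝓕⁻ F) = F := (Lp.fourierTransformₗᵢ ℝ ℂ).apply_symm_apply
    rw [e] at h1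
    exact h1.congr (fun r _ => (e _).symm) (e _).symm
  · exact fun h => fourierInvR.hasFDerivAt.comp_hasDerivWithinAt t h

theorem evolvesAt_iff {A : L2 → L2 → Prop} {s : ℝ} (hs : 0 ≤ s) {f : L2 → L2}
    (hA : ∀ Y g, A (𝓕⁻ (lower s Y)) g ↔ g = 𝓕⁻ (f Y)) {v : ℝ → Sobolev s} {S : Set ℝ} {t : ℝ} :
    EvolvesAt A (fun r => (v r).toL2) S t ↔
      HasDerivWithinAt (fun r => lower s (Sobolev.toWeighted (v r)))
        (f (Sobolev.toWeighted (v t))) S t := by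
  simp only [EvolvesAt, Sobolev.toL2_eq hs, hA]
  constructor
  · rintro ⟨g, rfl, h⟩
    exact hasDerivWithinAt_fourierInv_iff.1 h
  · exact fun h => ⟨_, rfl, hasDerivWithinAt_fourierInv_iff.2 h⟩

theorem fullOperator_iff {p M s : ℝ} {k : ℝ → ℂ} (hk : IsAdmissibleSymbol p M k) (hps : p ≤ s)
    (hs : 1 ≤ s) (Y g : L2) : fullOperator k (𝓕⁻ (lower s Y)) g ↔
      g = 𝓕⁻ (mulOp (dispSymbol k s) Y + burgersBil s 0 Y Y) := by
  have hadd : (𝓕⁻ (mulOp (dispSymbol k s) Y + burgersBil s 0 Y Y) : L2) =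
      𝓕⁻ (mulOp (dispSymbol k s) Y) + 𝓕⁻ (burgersBil s 0 Y Y) := FourierInvAdd.fourierInv_add _ _
  simp only [fullOperator, dispersion_iff hk hps (by linarith), burgers_iff hs, hadd]
  constructor
  · rintro ⟨a, b, rfl, rfl, rfl⟩; rfl
  · rintro rfl; exact ⟨_, _, rfl, rfl, rfl⟩

/-- The equation is given with an L² derivative. Its right-hand side is continuous with values in
H^{s-m}, so the derivative exists in that space as well. -/
theorem IsSolution.isFullCurve {p M m r T : ℝ} {k : ℝ → ℂ} (hk : IsAdmissibleSymbol p M k)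
    (hpm : p ≤ m) (hm : 1 ≤ m) (hr : 3 / 2 < r) {u₀ : Sobolev (r + 3 * m)}
    {u : ℝ → Sobolev (r + 3 * m)} (hu : IsSolution k (r + 3 * m) T u₀ u) :
    IsFullCurve k (r + 3 * m) m 0 T fun t => Sobolev.toWeighted (u t) := by
  have hs : 0 ≤ r + 3 * m := by linarith
  have hd : 0 ≤ r + 3 * m - m := by linarith
  have hc := Sobolev.continuousOn_toWeighted_iff.2 hu.continuousOn
  have a2 : Adm (r - 1) (atLevel burgersKernel (r + 3 * m) (r + 3 * m) (r + 3 * m - m)) _ :=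
    adm_burgersBil (by linarith) (by linarith) (by linarith)
  refine ⟨hc, fun t ht => (Sobolev.isRealValued_iff hs _).1 (hu.real t ht), fun t ht => ?_⟩
  refine hasDerivWithinAt_of_mulOp (bddSymbol_lower hd)
    (fun ξ => by simpa [ofRealSymbol] using (jap_rpow_pos ξ (-(r + 3 * m - m))).ne')
    (x := fun t => lower m (Sobolev.toWeighted (u t)))
    (z := fun t => mulOp (dispSymbol k m) (Sobolev.toWeighted (u t)) +
      burgersBil (r + 3 * m) (r + 3 * m - m) (Sobolev.toWeighted (u t)) (Sobolev.toWeighted (u t)))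
    ((lower m).continuous.comp_continuousOn hc)
    (((mulOp (dispSymbol k m)).continuous.comp_continuousOn hc).add
      (a2.continuousOn_bil (by linarith) hc hc)) (fun t ht => ?_) ht
  have h1 := ((evolvesAt_iff hs (fullOperator_iff hk (by linarith) (by linarith))).1
    (hu.eqn t (Ioo_subset_Icc_self ht))).hasDerivAt (Icc_mem_nhds ht.1 ht.2)
  have e := mulOp_dispSymbol_add (d := r + 3 * m - m) hk hpm hd
  change HasDerivAt (fun t => lower (r + 3 * m - m) (lower m (Sobolev.toWeighted (u t))))
    (lower (r + 3 * m - m) (_ + _)) t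
  rw [sub_add_cancel] at e
  rw [map_add, lower_burgersBil (r := r) (o' := 0) hr (by linarith) (by linarith) (by linarith) hd
    (by ring), ← e]
  simp only [lower_lower hd (by linarith : 0 ≤ m), sub_add_cancel]
  exact h1

/-! ### The domain of the splitting problem -/

theorem stairs_eq_insert {h : ℝ} (h0 : 0 < h) (b : ℕ → Bool) (n : ℕ) :
    stairs h n = insert (0, 0) (burgersStairs b h n ∪ dispersiveStairs b h n) := by
  ext ⟨t, τ⟩
  constructor
  · rintro (hq | ⟨j, hj, ht, hτ⟩)
    · exact Or.inl hq
    · rcases ht.1.eq_or_lt with h1 | h1 <;> rcases hτ.1.eq_or_lt with h2 | h2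
      -- The lower left corner of a square belongs to neither half-open set of that square. It is
      -- the upper right corner of the previous square, or else the origin, which is why the origin
      -- is adjoined.
      · simp only at h1 h2
        rcases j with _ | i
        · left; rw [← h1, ← h2]; simp
        · have e : ((i + 1 : ℕ) : ℝ) * h = i * h + h := by push_cast; ring
          rw [e] at h1 h2
          subst h1 h2
          have hc := right_mem_cell h0.le i
          have hc' : (i * h + h : ℝ) ∈ Ioc (i * h) (i * h + h) := ⟨by linarith, le_rfl⟩
          cases hb : b i
          · exact Or.inr (Or.inl ⟨i, by omega, hc', hc, Or.inl hb⟩)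
          · exact Or.inr (Or.inr ⟨i, by omega, hc', hc, Or.inl hb⟩)
      · exact Or.inr (Or.inr ⟨j, hj, ⟨h2, hτ.2⟩, ht, Or.inr h1.symm⟩)
      · exact Or.inr (Or.inl ⟨j, hj, ⟨h1, ht.2⟩, hτ, Or.inr h2.symm⟩)
      · cases hb : b j
        · exact Or.inr (Or.inl ⟨j, hj, ⟨h1, ht.2⟩, hτ, Or.inl hb⟩)
        · exact Or.inr (Or.inr ⟨j, hj, ⟨h2, hτ.2⟩, ht, Or.inl hb⟩)
  · rintro (hq | ⟨j, hj, ht, hτ, -⟩ | ⟨j, hj, hτ, ht, -⟩)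
    · exact Or.inl hq
    · exact mem_stairs hj (Ioc_subset_Icc_self ht) hτ
    · exact mem_stairs hj ht (Ioc_subset_Icc_self hτ)

/-- Reflection in the diagonal combined with negation of b exchanges the two equations. This reduces
the problem with exchanged substeps to the original one. -/
theorem mem_dispersiveStairs_not {b : ℕ → Bool} {h : ℝ} {n : ℕ} {t τ : ℝ} :
    (τ, t) ∈ dispersiveStairs (fun j => !b j) h n ↔ (t, τ) ∈ burgersStairs b h n := by
  simp [dispersiveStairs, burgersStairs]

theorem mem_burgersStairs_not {b : ℕ → Bool} {h : ℝ} {n : ℕ} {t τ : ℝ} :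
    (τ, t) ∈ burgersStairs (fun j => !b j) h n ↔ (t, τ) ∈ dispersiveStairs b h n := by
  simp [dispersiveStairs, burgersStairs]

/-- Whether `j` is even. -/
def evenBool (j : ℕ) : Bool := decide (Even j)

theorem evenBool_succ (j : ℕ) : evenBool (j + 1) = !evenBool j := by
  simp only [evenBool, Nat.even_add_one, decide_not]

theorem evenBool_two_mul (i : ℕ) : evenBool (2 * i) = true := by simp [evenBool]

theorem exists_lt_two_mul {n : ℕ} {P : ℕ → Prop} :
    (∃ j < 2 * n, P j) ↔ ∃ i < n, P (2 * i) ∨ P (2 * i + 1) := by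
  constructor
  · rintro ⟨j, hj, hP⟩
    rcases Nat.even_or_odd' j with ⟨i, rfl | rfl⟩
    · exact ⟨i, by omega, Or.inl hP⟩
    · exact ⟨i, by omega, Or.inr hP⟩
  · rintro ⟨i, hi, hP | hP⟩
    · exact ⟨_, by omega, hP⟩
    · exact ⟨_, by omega, hP⟩

theorem exists_mem_Icc_one {n : ℕ} {P : ℕ → Prop} :
    (∃ l ∈ Icc 1 n, P l) ↔ ∃ i < n, P (i + 1) := by
  constructor
  · rintro ⟨l, ⟨h1, h2⟩, hP⟩
    exact ⟨l - 1, by omega, by rwa [Nat.sub_add_cancel h1]⟩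
  · rintro ⟨i, hi, hP⟩
    exact ⟨i + 1, ⟨by omega, by omega⟩, hP⟩

section
variable (Δt : ℝ) (i : ℕ)

theorem stairs_endpoints : ((((i + 1 : ℕ) : ℝ) - 1) * Δt = ((2 * i : ℕ) : ℝ) * (Δt / 2)) ∧
    ((((i + 1 : ℕ) : ℝ) - 1 / 2) * Δt = ((2 * i : ℕ) : ℝ) * (Δt / 2) + Δt / 2) ∧
    (((i + 1 : ℕ) : ℝ) * Δt = ((2 * i : ℕ) : ℝ) * (Δt / 2) + Δt / 2 + Δt / 2) ∧
    (((2 * i + 1 : ℕ) : ℝ) * (Δt / 2) = ((2 * i : ℕ) : ℝ) * (Δt / 2) + Δt / 2) := by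
  refine ⟨?_, ?_, ?_, ?_⟩ <;> push_cast <;> ring

end

/-- Each Strang step consists of two squares of side Δt/2. The even one starts with the
first-variable flow along its lower edge, the odd one with the second-variable flow along its left
edge. -/
theorem strangSigma₁_eq {Δt : ℝ} (h0 : 0 < Δt) (n : ℕ) :
    strangSigma₁ Δt n = burgersStairs evenBool (Δt / 2) (2 * n) := by
  ext ⟨t, τ⟩
  simp only [strangSigma₁, burgersStairs, mem_iUnion₂, exists_prop]
  rw [exists_mem_Icc_one]
  refine Iff.trans ?_ (exists_lt_two_mul (P := fun j =>
    t ∈ Ioc (j * (Δt / 2)) (j * (Δt / 2) + Δt / 2) ∧ τ ∈ cell (Δt / 2) j ∧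
      (evenBool j = false ∨ τ = j * (Δt / 2)))).symm
  refine exists_congr fun i => and_congr_right fun hi => ?_
  obtain ⟨e1, e2, e3, e4⟩ := stairs_endpoints Δt i
  rw [evenBool_succ, evenBool_two_mul, e1, e2, e3, e4]
  simp only [cell, e4, mem_union, mem_prod, mem_singleton_iff, Bool.not_true, true_or, and_true,
    Bool.true_eq_false, false_or]
  refine or_congr (and_congr_right fun _ => ⟨fun h => ?_, fun h => h.2⟩) Iff.rfl
  rw [h]
  exact ⟨⟨le_rfl, by linarith⟩, rfl⟩

theorem strangSigma₂_eq {Δt : ℝ} (h0 : 0 < Δt) (n : ℕ) :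
    strangSigma₂ Δt n = dispersiveStairs evenBool (Δt / 2) (2 * n) := by
  ext ⟨t, τ⟩
  simp only [strangSigma₂, dispersiveStairs, mem_iUnion₂, exists_prop]
  rw [exists_mem_Icc_one]
  refine Iff.trans ?_ (exists_lt_two_mul (P := fun j =>
    τ ∈ Ioc (j * (Δt / 2)) (j * (Δt / 2) + Δt / 2) ∧ t ∈ cell (Δt / 2) j ∧
      (evenBool j = true ∨ t = j * (Δt / 2)))).symm
  refine exists_congr fun i => and_congr_right fun hi => ?_
  obtain ⟨e1, e2, e3, e4⟩ := stairs_endpoints Δt i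
  rw [evenBool_succ, evenBool_two_mul, e1, e2, e3, e4]
  simp only [cell, e4, mem_union, mem_prod, mem_singleton_iff, Bool.not_true, true_or, and_true,
    Bool.false_eq_true, false_or]
  refine or_congr and_comm ⟨fun h => ?_, fun h => ⟨h.2.2, h.1⟩⟩
  rw [h.1]
  exact ⟨h.2, ⟨le_rfl, by linarith⟩, rfl⟩

theorem strangPi_eq {Δt : ℝ} (h0 : 0 < Δt) (n : ℕ) : strangPi Δt n = stairs (Δt / 2) (2 * n) := by
  rw [strangPi, strangSigma₁_eq h0, strangSigma₂_eq h0, ← stairs_eq_insert (by linarith)]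

/-! ### The two splitting problems in Sobolev spaces -/

section
variable {p M s Δt : ℝ} {k : ℝ → ℂ} {n : ℕ} {u₀ : Sobolev s} {v : ℝ × ℝ → Sobolev s}

theorem isStrangSolution_burgers_dispersion_iff (hk : IsAdmissibleSymbol p M k) (hps : p ≤ s)
    (hs : 1 ≤ s) (h0 : 0 < Δt) : IsStrangSolution burgers (dispersion k) s Δt n u₀ v ↔
      IsStairsCurve k s evenBool (Δt / 2) (2 * n) (Sobolev.toWeighted u₀)
        fun q => Sobolev.toWeighted (v q) := by
  have hs0 : 0 ≤ s := by linarith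
  have hB := fun {v : ℝ → Sobolev s} {S t} =>
    evolvesAt_iff hs0 (burgers_iff hs) (v := v) (S := S) (t := t)
  have hD := fun {v : ℝ → Sobolev s} {S t} =>
    evolvesAt_iff hs0 (dispersion_iff hk hps hs0) (v := v) (S := S) (t := t)
  constructor
  · rintro ⟨h1, h2, h3, h4, h5⟩
    simp only [strangPi_eq h0, strangSigma₁_eq h0, strangSigma₂_eq h0, hB, hD,
      Sobolev.isRealValued_iff hs0] at h1 h2 h3 h4 h5
    exact ⟨Sobolev.continuousOn_toWeighted_iff.2 h1, h2, by rw [h3], h4, h5⟩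
  · rintro ⟨h1, h2, h3, h4, h5⟩
    refine ⟨?_, ?_, Sobolev.toWeighted_injective h3, ?_, ?_⟩ <;>
    simp only [strangPi_eq h0, strangSigma₁_eq h0, strangSigma₂_eq h0, hB, hD,
      Sobolev.isRealValued_iff hs0]
    exacts [Sobolev.continuousOn_toWeighted_iff.1 h1, h2, h4, h5]

theorem isStrangSolution_dispersion_burgers_iff (hk : IsAdmissibleSymbol p M k) (hps : p ≤ s)
    (hs : 1 ≤ s) (h0 : 0 < Δt) : IsStrangSolution (dispersion k) burgers s Δt n u₀ v ↔
      IsStairsCurve k s (fun j => !evenBool j) (Δt / 2) (2 * n) (Sobolev.toWeighted u₀)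
        fun q => Sobolev.toWeighted (v q.swap) := by
  have hs0 : 0 ≤ s := by linarith
  have hB := fun {v : ℝ → Sobolev s} {S t} =>
    evolvesAt_iff hs0 (burgers_iff hs) (v := v) (S := S) (t := t)
  have hD := fun {v : ℝ → Sobolev s} {S t} =>
    evolvesAt_iff hs0 (dispersion_iff hk hps hs0) (v := v) (S := S) (t := t)
  have hsw : ∀ q : ℝ × ℝ, q ∈ stairs (Δt / 2) (2 * n) → q.swap ∈ stairs (Δt / 2) (2 * n) :=
    fun q hq => stairs_swap.1 hq
  constructor
  · rintro ⟨h1, h2, h3, h4, h5⟩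
    simp only [strangPi_eq h0, strangSigma₁_eq h0, strangSigma₂_eq h0, hB, hD,
      Sobolev.isRealValued_iff hs0] at h1 h2 h3 h4 h5
    have hc := ContinuousOn.comp (Sobolev.continuousOn_toWeighted_iff.2 h1)
      (continuous_swap (X := ℝ) (Y := ℝ)).continuousOn hsw
    refine ⟨hc, fun q hq => h2 _ (hsw q hq), by rw [Prod.swap_prod_mk, h3], fun t τ h => ?_,
      fun t τ h => ?_⟩
    · rw [show {r | (r, τ) ∈ stairs (Δt / 2) (2 * n)} =
        {r | (τ, r) ∈ stairs (Δt / 2) (2 * n)} from ext fun r => stairs_swap]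
      exact h5 τ t (mem_burgersStairs_not.1 h)
    · rw [show {r | (t, r) ∈ stairs (Δt / 2) (2 * n)} =
        {r | (r, t) ∈ stairs (Δt / 2) (2 * n)} from ext fun r => stairs_swap]
      exact h4 τ t (mem_dispersiveStairs_not.1 h)
  · rintro ⟨h1, h2, h3, h4, h5⟩
    refine ⟨?_, ?_, Sobolev.toWeighted_injective h3, fun t τ h => ?_, fun t τ h => ?_⟩
    · rw [strangPi_eq h0]
      have h6 := ContinuousOn.comp (g := fun q : ℝ × ℝ => Sobolev.toWeighted (v q.swap))
        (f := Prod.swap) h1 (continuous_swap (X := ℝ) (Y := ℝ)).continuousOn hsw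
      simp only [Function.comp_def, Prod.swap_swap] at h6
      exact Sobolev.continuousOn_toWeighted_iff.1 h6
    · rw [strangPi_eq h0]
      intro q hq
      have h6 := h2 _ (hsw q hq)
      rw [Prod.swap_swap] at h6
      exact (Sobolev.isRealValued_iff hs0 _).2 h6
    · rw [strangSigma₁_eq h0] at h
      refine (hD (v := fun r => v (r, τ))).2 ?_
      rw [strangPi_eq h0, show {r | (r, τ) ∈ stairs (Δt / 2) (2 * n)} =
        {r | (τ, r) ∈ stairs (Δt / 2) (2 * n)} from ext fun r => stairs_swap]
      exact h5 τ t (mem_dispersiveStairs_not.2 h)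
    · rw [strangSigma₂_eq h0] at h
      refine (hB (v := fun r => v (t, r))).2 ?_
      rw [strangPi_eq h0, show {r | (t, r) ∈ stairs (Δt / 2) (2 * n)} =
        {r | (r, t) ∈ stairs (Δt / 2) (2 * n)} from ext fun r => stairs_swap]
      exact h4 τ t (mem_burgersStairs_not.2 h)

end

theorem exists_mem_cell {h : ℝ} (n : ℕ) {t : ℝ} (ht : t ∈ Icc 0 (n * h)) :
    t = 0 ∨ ∃ j < n, t ∈ cell h j := by
  induction n with
  | zero => left; simpa using ht
  | succ n ih =>
    rcases le_total t (n * h) with h1 | h1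
    · rcases ih ⟨ht.1, h1⟩ with h2 | ⟨j, hj, h2⟩
      exacts [Or.inl h2, Or.inr ⟨j, by omega, h2⟩]
    · refine Or.inr ⟨n, by omega, h1, ht.2.trans (le_of_eq ?_)⟩
      push_cast; ring

theorem exists_isStairsCurve {p M m r T C₀ : ℝ} (hpm : p ≤ m) (hm : 1 ≤ m) (hr : 3 / 2 < r)
    (hT : 0 < T) (hC₀ : 0 < C₀) (hM : 0 ≤ M) :
    ∃ h₀ : ℝ, 0 < h₀ ∧ ∃ C : ℝ, 0 < C ∧ ∀ k, IsAdmissibleSymbol p M k → ∀ h, 0 < h → h ≤ h₀ →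
      ∀ b : ℕ → Bool, (∀ j, b (j + 1) = !b j) →
      ∀ U : ℝ → L2, IsFullCurve k (r + 3 * m) m 0 T U → (∀ t ∈ Icc 0 T, ‖U t‖ ≤ C₀) →
      ∀ n : ℕ, 2 * n * h ≤ T → ∃ W, IsStairsCurve k (r + 3 * m) b h (2 * n) (U 0) W ∧
        ∀ t ∈ Icc 0 (2 * n * h), ‖lower (3 * m) (W (t, t) - U t)‖ ≤ C * h ^ 2 := by
  obtain ⟨h₀, hh₀, C, hC, H⟩ := exists_scheme_error (p := p) hpm hm hr hT hC₀ hM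
  refine ⟨h₀, hh₀, C, hC, fun k hk h h0 hh b hb U hU hUC n hn => ?_⟩
  obtain ⟨Φ, hΦ, H⟩ := H k hk h h0 hh
  have H := H b hb U hU hUC n hn
  have hx := fun j hj => And.intro (H j hj).1 (H j hj).2.1
  have hW := isStairsCurve_stairsValue hk hpm hm hr hΦ h0 (by linarith) hx
    (hU.herm 0 ⟨le_rfl, hT.le⟩)
  refine ⟨_, hW, fun t ht => ?_⟩
  rcases exists_mem_cell (h := h) (2 * n) (by exact_mod_cast ht) with rfl | ⟨j, hj, htj⟩
  · rw [hW.init, sub_self, map_zero, norm_zero]; positivity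
  · rw [stairsValue_eq hk hm hΦ h0 hx hj htj htj]
    have := (H j hj).2.2 _ (sub_mem_of_mem_cell htj)
    rwa [add_sub_cancel] at this

theorem Sobolev.exists_sub_eq {σ d : ℝ} (hσ : 0 ≤ σ) (hd : 0 ≤ d) (hσd : 0 ≤ σ - d)
    (f g : Sobolev σ) : ∃ e : Sobolev (σ - d), e.toL2 = f.toL2 - g.toL2 ∧
      ‖e‖ = ‖lower d (toWeighted f - toWeighted g)‖ := by
  obtain ⟨e, he⟩ := exists_toWeighted_eq hσd (lower d (toWeighted f - toWeighted g))
  refine ⟨e, ?_, by rw [← norm_toWeighted, he]⟩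
  rw [toL2_eq hσd, toL2_eq hσ f, toL2_eq hσ g, he, lower_lower hσd hd, sub_add_cancel, map_sub]
  exact (Lp.fourierTransformₗᵢ ℝ ℂ).symm.map_sub _ _

theorem exists_strang_solution {p M m r T C₀ : ℝ} (hpm : p ≤ m) (hm : 1 ≤ m) (hr : 3 / 2 < r)
    (hT : 0 < T) (hC₀ : 0 < C₀) (hM : 0 ≤ M) :
    ∃ Δt₀ : ℝ, 0 < Δt₀ ∧ ∃ C : ℝ, 0 < C ∧
      ∀ k : ℝ → ℂ, IsAdmissibleSymbol p M k →
      ∀ (u₀ : Sobolev (r + 3 * m)) (u : ℝ → Sobolev (r + 3 * m)), IsSolution k (r + 3 * m) T u₀ u →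
      (∀ t ∈ Icc 0 T, ‖u t‖ ≤ C₀) → ∀ Δt : ℝ, 0 < Δt → Δt ≤ Δt₀ →
      ∀ A : (L2 → L2 → Prop) × (L2 → L2 → Prop),
      A = (burgers, dispersion k) ∨ A = (dispersion k, burgers) →
        ∃ v : ℝ × ℝ → Sobolev (r + 3 * m),
          IsStrangSolution A.1 A.2 (r + 3 * m) Δt (numSteps Δt T) u₀ v ∧
          (∀ w : ℝ × ℝ → Sobolev (r + 3 * m),
            IsStrangSolution A.1 A.2 (r + 3 * m) Δt (numSteps Δt T) u₀ w →
            EqOn w v (strangPi Δt (numSteps Δt T))) ∧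
          ∀ t ∈ Icc 0 ((numSteps Δt T : ℝ) * Δt),
            ∃ d : Sobolev (r + 3 * m - 3 * m),
              d.toL2 = (v (t, t)).toL2 - (u t).toL2 ∧ ‖d‖ ≤ C * Δt ^ 2 := by
  obtain ⟨h₀, hh₀, C, hC, H⟩ := exists_isStairsCurve (p := p) hpm hm hr hT hC₀ hM
  -- The half step is h = Δt/2, so the threshold doubles. The constant may be kept because (Δt/2)² ≤
  -- Δt².
  refine ⟨2 * h₀, by positivity, C, hC, fun k hk u₀ u hu hub Δt h0 hΔ A hA => ?_⟩
  have hs1 : 1 ≤ r + 3 * m := by linarith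
  have hs0 : 0 ≤ r + 3 * m := by linarith
  have hps : p ≤ r + 3 * m := by linarith
  set N := numSteps Δt T
  have hN : (N : ℝ) * Δt ≤ T := (isGreatest_numSteps h0 hT).1
  have hU := hu.isFullCurve hk hpm hm hr
  have hU0 : Sobolev.toWeighted (u 0) = Sobolev.toWeighted u₀ := by rw [hu.init]
  have H := fun b hb => H k hk (Δt / 2) (by positivity) (by linarith) b hb _ hU
    (fun t ht => (Sobolev.norm_toWeighted (u t)).le.trans (hub t ht)) N (by linarith)
  have err : ∀ {v : ℝ × ℝ → Sobolev (r + 3 * m)} {W : ℝ × ℝ → L2},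
      (∀ t, Sobolev.toWeighted (v (t, t)) = W (t, t)) →
      (∀ t ∈ Icc 0 (2 * N * (Δt / 2)),
        ‖lower (3 * m) (W (t, t) - Sobolev.toWeighted (u t))‖ ≤ C * (Δt / 2) ^ 2) →
      ∀ t ∈ Icc 0 ((N : ℝ) * Δt), ∃ d : Sobolev (r + 3 * m - 3 * m),
        d.toL2 = (v (t, t)).toL2 - (u t).toL2 ∧ ‖d‖ ≤ C * Δt ^ 2 := fun {v W} hvW hW t ht => by
    obtain ⟨d, hd1, hd2⟩ := Sobolev.exists_sub_eq hs0 (by linarith : 0 ≤ 3 * m) (by linarith)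
      (v (t, t)) (u t)
    refine ⟨d, hd1, ?_⟩
    rw [hd2, hvW]
    refine (hW t ⟨ht.1, by linarith [ht.2]⟩).trans (mul_le_mul_of_nonneg_left ?_ hC.le)
    gcongr
    linarith
  rcases hA with rfl | rfl
  · have hiff := fun v => isStrangSolution_burgers_dispersion_iff (n := N) (u₀ := u₀) (v := v)
      hk hps hs1 h0
    obtain ⟨W, hW, hWe⟩ := H evenBool evenBool_succ
    choose v hv using fun q => Sobolev.exists_toWeighted_eq hs0 (W q)
    rw [hU0] at hW
    have hsol := (hiff v).2 (by simp only [hv]; exact hW)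
    refine ⟨v, hsol, fun w hw q hq => ?_, err (fun t => hv _) hWe⟩
    rw [strangPi_eq h0] at hq
    exact Sobolev.toWeighted_injective
      (((hiff w).1 hw).eqOn ((hiff v).1 hsol) hk hpm hm hr (by linarith) hq)
  · have hiff := fun v => isStrangSolution_dispersion_burgers_iff (n := N) (u₀ := u₀) (v := v)
      hk hps hs1 h0
    obtain ⟨W, hW, hWe⟩ := H (fun j => !evenBool j) fun j => by rw [evenBool_succ]
    -- The solution with exchanged substeps is the reflection of the one with opposite parity, and
    -- on the diagonal the two coincide.
    choose v hv using fun q : ℝ × ℝ => Sobolev.exists_toWeighted_eq hs0 (W q.swap)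
    rw [hU0] at hW
    have hsol := (hiff v).2 (by simp only [hv, Prod.swap_swap]; exact hW)
    refine ⟨v, hsol, fun w hw q hq => ?_, err (fun t => hv _) hWe⟩
    rw [strangPi_eq h0] at hq
    have := ((hiff w).1 hw).eqOn ((hiff v).1 hsol) hk hpm hm hr (by linarith) (stairs_swap.1 hq)
    exact Sobolev.toWeighted_injective this

end Splitting

end

open Splitting in
theorem theorem1p3 (p M s T C₀ : ℝ) (hp : 0 ≤ p) (hT : 0 < T)
    (hs : 3 / 2 + 3 * max 1 p < s) (hC₀ : 0 < C₀) :
    ∃ Δt₀ : ℝ, 0 < Δt₀ ∧ ∃ C : ℝ, 0 < C ∧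
      ∀ k : ℝ → ℂ, IsAdmissibleSymbol p M k →
      ∀ (u₀ : Sobolev s) (u : ℝ → Sobolev s), IsSolution k s T u₀ u →
      (∀ t ∈ Set.Icc 0 T, ‖u t‖ ≤ C₀) →
      ∀ Δt : ℝ, 0 < Δt → Δt ≤ Δt₀ →
        (∃ v : ℝ × ℝ → Sobolev s,
          IsStrangSolution burgers (dispersion k) s Δt (numSteps Δt T) u₀ v ∧
          (∀ w : ℝ × ℝ → Sobolev s,
            IsStrangSolution burgers (dispersion k) s Δt (numSteps Δt T) u₀ w →
            Set.EqOn w v (strangPi Δt (numSteps Δt T))) ∧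
          ∀ t ∈ Set.Icc 0 ((numSteps Δt T : ℝ) * Δt),
            ∃ d : Sobolev (s - 3 * max 1 p),
              d.toL2 = (v (t, t)).toL2 - (u t).toL2 ∧ ‖d‖ ≤ C * Δt ^ 2) ∧
        (∃ v : ℝ × ℝ → Sobolev s,
          IsStrangSolution (dispersion k) burgers s Δt (numSteps Δt T) u₀ v ∧
          (∀ w : ℝ × ℝ → Sobolev s,
            IsStrangSolution (dispersion k) burgers s Δt (numSteps Δt T) u₀ w →
            Set.EqOn w v (strangPi Δt (numSteps Δt T))) ∧
          ∀ t ∈ Set.Icc 0 ((numSteps Δt T : ℝ) * Δt),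
            ∃ d : Sobolev (s - 3 * max 1 p),
              d.toL2 = (v (t, t)).toL2 - (u t).toL2 ∧ ‖d‖ ≤ C * Δt ^ 2) := by
  by_cases hM : 0 ≤ M
  · obtain ⟨r, rfl⟩ : ∃ r, s = r + 3 * max 1 p := ⟨s - 3 * max 1 p, by ring⟩
    obtain ⟨Δt₀, hΔt₀, C, hC, H⟩ := exists_strang_solution (p := p) (le_max_right 1 p)
      (le_max_left 1 p) (by linarith : 3 / 2 < r) hT hC₀ hM
    exact ⟨Δt₀, hΔt₀, C, hC, fun k hk u₀ u hu hub Δt h0 hΔ =>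
      ⟨H k hk u₀ u hu hub Δt h0 hΔ _ (Or.inl rfl), H k hk u₀ u hu hub Δt h0 hΔ _ (Or.inr rfl)⟩⟩
  -- For M < 0 there are no admissible symbols, so the constants are arbitrary.
  · exact ⟨1, one_pos, 1, one_pos, fun k hk => absurd hk.M_nonneg hM⟩
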